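/- **Setting.** An RBG (Regular Boardgames) description $(\mathcal R,\mathcal S)$ consists of generalized rules $\mathcal R=(\mathit{Players},\mathit{Pieces},\mathit{Variables},\mathit{Rules})$ and a game instance $\mathcal S=(\mathit{Board},\mathit{Bounds},\mathit{InitialState})$. The sets are finite, $\mathit{Players}\subseteq\mathit{Variables}$, one player is the keeper, and $\mathit{Board}=(\mathit{Vertices},\mathit{Dirs},\delta)$ with $\delta:\mathit{Vertices}\times\mathit{Dirs}\to\mathit{Vertices}\cup\{\bot\}$. A semi-state is $S=(\mathit{player},P,V,s)$ with a current player, $P:\mathit{Vertices}\to\mathit{Pieces}$, $V:\mathit{Variables}\to\mathbb N$ and a current position $s\in\mathit{Vertices}$; $\mathit{InitialState}$ is a semi-state with $V\le\mathit{Bounds}$. The actions are: shift $\mathit{dir}$ (move to $\delta(s,\mathit{dir})$, valid if it is not $\bot$); on $X\subseteq\mathit{Pieces}$ (valid if $P(s)\in X$); off $[x]$ (set $P(s)=x$, always valid); assignment $[\$v=e]$ (valid if the value of the arithmetic expression $e$ is defined and in $\{0,\dots,\mathit{Bounds}(v)\}$); comparison $\{\$e_1\otimes e_2\}$ (valid if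 both values are defined and the relation holds); switch $\to p$ (set the current player, always valid); and patterns $\{?M\}$, $\{!M\}$, where $M$ is a regular expression over actions without switches (patterns may be nested): $\{?M\}$ is valid for $S$ iff some word of $L(M)$ is a valid sequence for $S$, $\{!M\}$ is its negation, and patterns do not change $S$. Arithmetic expressions are built from integers, variables and pieces (a piece $x$ has the value $|\{v: P(v)=x\}|$) by $+,-,\cdot$ and integer division; division by zero is undefined. A sequence of actions is valid for $S$ if each action is valid when it is applied; $S\cdot u$ is the result. Offs, assignments and switches are called modifiers. $\mathit{Rules}$ is a regular expression over actions. Regular expressions are built from letters by concatenation, sum and star. The pattern depth is the maximal nesting depth of patterns in $\mathit{Rules}$ ($0$ if there are none). Let $\hat E$ be $E$ with its action occurrences numbered $1,2,\dots$ from left to right; let $L(\hat E)_0=L(\hat E)$ and, for $i\ge1$, let $L(\hat E)_i$ be the set of all $w$ with $u\,a_i\,w\in L(\hat E)$ for some $u$ and some action $a$. A game state $S_r$ is a semi-state $S$ with a rules index $r$. An indexed action $a_i$ is legal for $S_r$ if $a$ is valid for $S$ and $a_i$ is a prefix of a word of $L(\widehat{\mathit{Rules}})_r$; it yields $(S\cdot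 a)_i$. This extends to sequences. A game state is reachable if some legal sequence leads from $\mathit{InitialState}_0$ to it. A legal move of $S_r$ is the sequence of pairs (index of a modifier, position where it is applied), for all modifiers in a legal sequence for $S_r$ that contains exactly one switch, at its end. For a language $L$ of action sequences, $\mathrm{app}(S,L)$ is the smallest family of sets that contains all words $u\in\mathrm{pref}(L)$ valid for $S$, and all $uv$ with $u\in\mathrm{pref}(L)$ valid for $S$, $u\{?M\}$ or $u\{!M\}$ in $\mathrm{pref}(L)$, and $v\in\mathrm{app}(S\cdot u,L(M))$. The description is $k$-straight if every switch-free factor of a word of $\mathrm{app}(\mathit{InitialState},L(\mathit{Rules}))$ contains at most $k$ modifiers. $|\mathcal R|$ and $|\mathcal S|$ are the numbers of tokens of straightforward text representations (a name, a number, an operator or a tag of an action is one token; $\mathcal R$ lists the names of the players, variables and pieces and the expression $\mathit{Rules}$; $\mathcal S$ lists the edges of the board, the bounds and the initial semi-state). The model of computation is a random access machine with unit-cost instructions, with recursive procedures, and with output written word by word. Arithmetic is performed in constant time, but only on integers of absolute value at most $W$. Space counts the memory cells (including the cells of the input) and the pending calls, but not the output. **Theorem.** There are a program and a constant $C$ such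 that the following holds for all $k\ge1$ and $d\ge0$, every $k$-straight RBG description $(\mathcal R,\mathcal S)$ with pattern depth at most $d$, and every reachable game state $I_r$. On the input consisting of the texts of $\mathcal R$, $\mathcal S$ and $I_r$, the program halts and outputs all legal moves of $I_r$, each exactly once, in at most $$C\cdot(|\mathcal R|\cdot|\mathcal S|)^{k+1}\cdot|\mathcal S|^{d}\ \text{ steps and at most }\ C\cdot k\cdot|\mathcal R|\cdot|\mathcal S|\ \text{ space.}$$ Here $W=C\cdot(k\,|\mathcal R|\,|\mathcal S|+A+B)$, where $A$ is the largest absolute value of an input token and $B$ is the largest magnitude of an arithmetic expression in the rules. The magnitude $\|e\|$, which bounds the values of $e$ and its subexpressions, is given by $\|z\|=|z|$ for integers, $\|v\|=\mathit{Bounds}(v)$ for variables, $\|x\|=|\mathit{Vertices}|$ for pieces, $\|e\cdot f\|=(\|e\|+1)(\|f\|+1)$, and $\|e\|+\|f\|$ for the other operations. -/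

import Mathlib

/-! ## Regular expressions (no symbols for the empty word and the empty language) -/

namespace RBG

inductive Regex (α : Type) : Type
  | act (a : α)
  | sum (E F : Regex α)
  | cat (E F : Regex α)
  | star (E : Regex α)

namespace Regex

variable {α : Type}

/-- The language `L(E)`. -/
def lang : Regex α → Language α
  | act a => {[a]}
  | sum E F => E.lang + F.lang
  | cat E F => E.lang * F.lang
  | star E => KStar.kstar E.lang

/-- The number of occurrences of letters. -/
def count : Regex α → ℕ
  | act _ => 1
  | sum E F => E.count + F.count
  | cat E F => E.count + F.count
  | star E => E.count

/-- The letters are numbered from left to right, the first one gets the number `n + 1`. -/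
def number : ℕ → Regex α → Regex (ℕ × α)
  | n, act a => act (n + 1, a)
  | n, sum E F => sum (E.number n) (F.number (n + E.count))
  | n, cat E F => cat (E.number n) (F.number (n + E.count))
  | n, star E => star (E.number n)

/-- The expression `Ê`, whose letters are numbered `1, 2, …`. -/
def hat (E : Regex α) : Regex (ℕ × α) := E.number 0

end Regex

/-- The language of all prefixes of words of `L`. -/
def pref {α : Type} (L : Language α) : Language α := {u | ∃ v, u ++ v ∈ L}

/-! ## Names, expressions, actions -/

/-- The cardinalities of the finite sets of names; the elements of a set of `n` names are the
elements of `Fin n`. Every player is also a variable (his score); there are `extraVars` further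
variables. -/
structure Sig where
  players : ℕ
  extraVars : ℕ
  pieces : ℕ
  vertices : ℕ
  dirs : ℕ

namespace Sig

abbrev Player (σ : Sig) : Type := Fin σ.players
abbrev Var (σ : Sig) : Type := Fin (σ.players + σ.extraVars)
abbrev Piece (σ : Sig) : Type := Fin σ.pieces
abbrev Vertex (σ : Sig) : Type := Fin σ.vertices
abbrev Dir (σ : Sig) : Type := Fin σ.dirs

end Sig

/-- The binary arithmetic operations. -/
inductive ArithOp
  | add | sub | mul | div

/-- Integer division rounds towards zero. -/
def ArithOp.eval : ArithOp → ℤ → ℤ → ℤ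
  | add, x, y => x + y
  | sub, x, y => x - y
  | mul, x, y => x * y
  | div, x, y => x.tdiv y

/-- The relational operators. -/
inductive RelOp
  | lt | le | eq | ne | gt | ge

def RelOp.Holds : RelOp → ℤ → ℤ → Prop
  | lt, x, y => x < y
  | le, x, y => x ≤ y
  | eq, x, y => x = y
  | ne, x, y => x ≠ y
  | gt, x, y => x > y
  | ge, x, y => x ≥ y

/-- Arithmetic expressions. -/
inductive AExpr (σ : Sig) : Type
  | lit (z : ℤ)
  | var (v : σ.Var)
  | piece (x : σ.Piece)
  | bin (o : ArithOp) (e f : AExpr σ)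

/-- Actions. The action `check M` is the pattern `{? M}`, and `checkNot M` is `{! M}`. -/
inductive Action (σ : Sig) : Type
  | shift (dir : σ.Dir)
  | on (X : Finset σ.Piece)
  | off (x : σ.Piece)
  | assign (v : σ.Var) (e : AExpr σ)
  | compare (o : RelOp) (e f : AExpr σ)
  | switch (p : σ.Player)
  | check (M : Regex (Action σ))
  | checkNot (M : Regex (Action σ))

variable {σ : Sig}

def Action.IsSwitch : Action σ → Prop
  | .switch _ => True
  | _ => False

/-- Offs, assignments and switches are the modifiers. -/
def Action.isModifier : Action σ → Bool
  | .off _ => true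
  | .assign _ _ => true
  | .switch _ => true
  | _ => false

/- Well-formedness: pattern expressions contain no switches (at any nesting depth). The flag says
whether switches are allowed. -/
mutual

def Action.WF : Action σ → Bool → Prop
  | .switch _, sw => sw = true
  | .check M, _ => exprWF M false
  | .checkNot M, _ => exprWF M false
  | .shift _, _ => True
  | .on _, _ => True
  | .off _, _ => True
  | .assign _ _, _ => True
  | .compare _ _ _, _ => True

def exprWF : Regex (Action σ) → Bool → Prop
  | .act a, sw => a.WF sw
  | .sum E F, sw => exprWF E sw ∧ exprWF F sw
  | .cat E F, sw => exprWF E sw ∧ exprWF F sw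
  | .star E, sw => exprWF E sw

end

/- The pattern depth of an expression: the maximal nesting depth of its patterns, which is `0` when
there are no patterns. -/
mutual

def Action.depth : Action σ → ℕ
  | .check M => exprDepth M + 1
  | .checkNot M => exprDepth M + 1
  | .shift _ => 0
  | .on _ => 0
  | .off _ => 0
  | .assign _ _ => 0
  | .compare _ _ _ => 0
  | .switch _ => 0

def exprDepth : Regex (Action σ) → ℕ
  | .act a => a.depth
  | .sum E F => max (exprDepth E) (exprDepth F)
  | .cat E F => max (exprDepth E) (exprDepth F)
  | .star E => exprDepth E

end

/-! ## Semi-states and descriptions -/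

/-- A semi-state `(player, P, V, s)`. -/
structure SemiState (σ : Sig) where
  player : σ.Player
  pieceAt : σ.Vertex → σ.Piece
  value : σ.Var → ℕ
  pos : σ.Vertex

/-- The generalized rules `𝓡 = (Players, Pieces, Variables, Rules)`; one of the players is the
keeper. -/
structure GenRules (σ : Sig) where
  keeper : σ.Player
  rules : Regex (Action σ)
  wf : exprWF rules true

/-- A game instance `𝓢 = (Board, Bounds, InitialState)`. -/
structure Inst (σ : Sig) where
  next : σ.Vertex → σ.Dir → Option σ.Vertex
  bound : σ.Var → ℕ
  init : SemiState σ
  init_le : ∀ v, init.value v ≤ bound v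

/-- The value of an arithmetic expression; it is undefined if a divisor is zero. -/
def AExpr.eval (S : SemiState σ) : AExpr σ → Option ℤ
  | .lit z => some z
  | .var v => some (S.value v)
  | .piece x => some ((Finset.univ.filter fun v => S.pieceAt v = x).card)
  | .bin o e f =>
    match e.eval S, f.eval S, o with
    | some _, some 0, .div => none
    | some x, some y, o => some (o.eval x y)
    | _, _, _ => none

namespace Inst

/-- The semi-state `S · a` (meaningful if `a` is valid for `S`). -/
def apply (B : Inst σ) (S : SemiState σ) : Action σ → SemiState σ
  | .shift dir => { S with pos := (B.next S.pos dir).getD S.pos }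
  | .off x => { S with pieceAt := Function.update S.pieceAt S.pos x }
  | .assign v e => { S with value := Function.update S.value v ((e.eval S).getD 0).toNat }
  | .switch p => { S with player := p }
  | .on _ => S
  | .compare _ _ _ => S
  | .check _ => S
  | .checkNot _ => S

/- `Valid a S`: the action `a` is valid for `S`. `Runs E S T`: some valid sequence of actions
from `L(E)` leads from `S` to `T`, see `runs_iff`; the two clauses for patterns are restated
through words in `valid_check` and `valid_checkNot`. -/
mutual

def Valid (B : Inst σ) : Action σ → SemiState σ → Prop
  | .shift dir, S => B.next S.pos dir ≠ none
  | .on X, S => S.pieceAt S.pos ∈ X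
  | .off _, _ => True
  | .assign v e, S => ∃ z, e.eval S = some z ∧ 0 ≤ z ∧ z ≤ B.bound v
  | .compare o e f, S => ∃ x y, e.eval S = some x ∧ f.eval S = some y ∧ o.Holds x y
  | .switch _, _ => True
  | .check M, S => ∃ T, Runs B M S T
  | .checkNot M, S => ¬ ∃ T, Runs B M S T

def Runs (B : Inst σ) : Regex (Action σ) → SemiState σ → SemiState σ → Prop
  | .act a, S, T => Valid B a S ∧ T = B.apply S a
  | .sum E F, S, T => Runs B E S T ∨ Runs B F S T
  | .cat E F, S, T => ∃ U, Runs B E S U ∧ Runs B F U T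
  | .star E, S, T => Relation.ReflTransGen (fun U U' => Runs B E U U') S T

end

/-- A sequence of actions is valid for `S` if every action is valid when it is applied. -/
def ValidSeq (B : Inst σ) : SemiState σ → List (Action σ) → Prop
  | _, [] => True
  | S, a :: w => B.Valid a S ∧ B.ValidSeq (B.apply S a) w

/-- The semi-state `S · a₁ · … · aₙ`. -/
def applySeq (B : Inst σ) : SemiState σ → List (Action σ) → SemiState σ
  | S, [] => S
  | S, a :: w => B.applySeq (B.apply S a) w

theorem validSeq_append (B : Inst σ) (u v : List (Action σ)) (S : SemiState σ) :
    B.ValidSeq S (u ++ v) ↔ B.ValidSeq S u ∧ B.ValidSeq (B.applySeq S u) v := by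
  induction u generalizing S with
  | nil => simp [ValidSeq, applySeq]
  | cons a u ih => simp [ValidSeq, applySeq, ih, and_assoc]

theorem applySeq_append (B : Inst σ) (u v : List (Action σ)) (S : SemiState σ) :
    B.applySeq S (u ++ v) = B.applySeq (B.applySeq S u) v := by
  induction u generalizing S with
  | nil => simp [applySeq]
  | cons a u ih => simp [applySeq, ih]

theorem runs_iff (B : Inst σ) (E : Regex (Action σ)) (S T : SemiState σ) :
    B.Runs E S T ↔ ∃ w ∈ E.lang, B.ValidSeq S w ∧ B.applySeq S w = T := by
  induction E generalizing S T with
  | act a =>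
    simp only [Runs, Regex.lang]
    constructor
    · rintro ⟨h, rfl⟩
      exact ⟨[a], rfl, ⟨h, trivial⟩, rfl⟩
    · rintro ⟨w, hw, h1, h2⟩
      obtain rfl : w = [a] := hw
      exact ⟨h1.1, h2.symm⟩
  | sum E F ihE ihF =>
    simp only [Runs, Regex.lang, ihE, ihF, Language.mem_add]
    constructor
    · rintro (⟨w, hw, h⟩ | ⟨w, hw, h⟩)
      · exact ⟨w, Or.inl hw, h⟩
      · exact ⟨w, Or.inr hw, h⟩
    · rintro ⟨w, hw | hw, h⟩
      · exact Or.inl ⟨w, hw, h⟩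
      · exact Or.inr ⟨w, hw, h⟩
  | cat E F ihE ihF =>
    simp only [Runs, Regex.lang, ihE, ihF, Language.mem_mul]
    constructor
    · rintro ⟨U, ⟨u, hu, h1, rfl⟩, ⟨v, hv, h2, rfl⟩⟩
      exact ⟨u ++ v, ⟨u, hu, v, hv, rfl⟩, (validSeq_append ..).2 ⟨h1, h2⟩, applySeq_append ..⟩
    · rintro ⟨_, ⟨u, hu, v, hv, rfl⟩, h, rfl⟩
      rw [validSeq_append] at h
      exact ⟨_, ⟨u, hu, h.1, rfl⟩, ⟨v, hv, h.2, (applySeq_append ..).symm⟩⟩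
  | star E ih =>
    simp only [Runs, Regex.lang, Language.mem_kstar]
    constructor
    · intro h
      induction h using Relation.ReflTransGen.head_induction_on with
      | refl => exact ⟨[], ⟨[], rfl, by simp⟩, trivial, rfl⟩
      | head h1 _ h2 =>
        obtain ⟨u, hu, hv, rfl⟩ := (ih _ _).1 h1
        obtain ⟨_, ⟨L, rfl, hL⟩, hv2, rfl⟩ := h2
        refine ⟨u ++ L.flatten, ⟨u :: L, by simp, ?_⟩, (validSeq_append ..).2 ⟨hv, hv2⟩,
          applySeq_append ..⟩
        intro y hy
        rcases List.mem_cons.1 hy with rfl | hy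
        · exact hu
        · exact hL y hy
    · rintro ⟨_, ⟨L, rfl, hL⟩, h, rfl⟩
      induction L generalizing S with
      | nil => exact Relation.ReflTransGen.refl
      | cons u L ihL =>
        rw [List.flatten_cons, validSeq_append] at h
        rw [List.flatten_cons, applySeq_append]
        refine Relation.ReflTransGen.head ((ih _ _).2 ⟨u, hL u (by simp), h.1, rfl⟩) ?_
        exact ihL _ (fun y hy => hL y (by simp [hy])) h.2

theorem valid_check (B : Inst σ) (M : Regex (Action σ)) (S : SemiState σ) :
    B.Valid (.check M) S ↔ ∃ w ∈ M.lang, B.ValidSeq S w := by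
  simp only [Valid, runs_iff]
  constructor
  · rintro ⟨_, w, hw, h, _⟩
    exact ⟨w, hw, h⟩
  · rintro ⟨w, hw, h⟩
    exact ⟨_, w, hw, h, rfl⟩

theorem valid_checkNot (B : Inst σ) (M : Regex (Action σ)) (S : SemiState σ) :
    B.Valid (.checkNot M) S ↔ ¬ ∃ w ∈ M.lang, B.ValidSeq S w := by
  rw [← valid_check]
  simp only [Valid]

/-- The application language `app(S, L)`. -/
inductive App (B : Inst σ) : SemiState σ → Language (Action σ) → List (Action σ) → Prop
  | base {S : SemiState σ} {L : Language (Action σ)} {u : List (Action σ)} :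
      u ∈ pref L → B.ValidSeq S u → App B S L u
  | enter {S : SemiState σ} {L : Language (Action σ)} {u v : List (Action σ)}
      {M : Regex (Action σ)} :
      u ∈ pref L → B.ValidSeq S u →
      (u ++ [.check M] ∈ pref L ∨ u ++ [.checkNot M] ∈ pref L) →
      App B (B.applySeq S u) M.lang v → App B S L (u ++ v)

end Inst

/-- The set of all factors of the words of `L` that contain no switch. -/
def mseq (L : Language (Action σ)) : Language (Action σ) :=
  {f | ∃ w ∈ L, f <:+: w ∧ ∀ a ∈ f, ¬ a.IsSwitch}

/-- The straightness of `L` (the maximal number of modifiers in a word) is at most `k`. -/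
def StraightnessLE (L : Language (Action σ)) (k : ℕ) : Prop :=
  ∀ w ∈ L, w.countP Action.isModifier ≤ k

/-- The description `(𝓡, 𝓢)` is `k`-straight. -/
def IsStraight (R : GenRules σ) (B : Inst σ) (k : ℕ) : Prop :=
  StraightnessLE (mseq {w | B.App B.init R.rules.lang w}) k

/-! ## Game states and moves -/

/-- A game state: a semi-state with a rules index. -/
structure GameState (σ : Sig) where
  semi : SemiState σ
  index : ℕ

/-- The derivative `L(Ê)_r`: all continuations after the action with number `r` has been applied as
the last one; `L(Ê)_0 = L(Ê)`. -/
def derivative (E : Regex (Action σ)) (r : ℕ) : Language (ℕ × Action σ) :=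
  {w | (r = 0 ∧ w ∈ E.hat.lang) ∨ ∃ u a, u ++ (r, a) :: w ∈ E.hat.lang}

/-- `LegalSeq R B g w h`: the sequence `w` of indexed actions is legal for the game state `g`
and yields the game state `h`. -/
inductive LegalSeq (R : GenRules σ) (B : Inst σ) :
    GameState σ → List (ℕ × Action σ) → GameState σ → Prop
  | nil {g : GameState σ} : LegalSeq R B g [] g
  | cons {g h : GameState σ} {i : ℕ} {a : Action σ} {w : List (ℕ × Action σ)} :
      B.Valid a g.semi → [(i, a)] ∈ pref (derivative R.rules g.index) →
      LegalSeq R B ⟨B.apply g.semi a, i⟩ w h → LegalSeq R B g ((i, a) :: w) h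

/-- The game state `g` is reachable from the initial one. -/
def Reachable (R : GenRules σ) (B : Inst σ) (g : GameState σ) : Prop :=
  ∃ w, LegalSeq R B ⟨B.init, 0⟩ w g

/-- A move sequence has exactly one switch, at its end. -/
def IsMoveSeq (w : List (ℕ × Action σ)) : Prop :=
  ∃ u i p, w = u ++ [(i, Action.switch p)] ∧ ∀ b ∈ u, ¬ b.2.IsSwitch

/-- A move: the indices of the modifiers with the positions where they are applied. -/
abbrev Move (σ : Sig) : Type := List (ℕ × σ.Vertex)

/-- The move that is defined by a sequence of indexed actions applied to `S`. -/
def moveOf (B : Inst σ) : SemiState σ → List (ℕ × Action σ) → Move σ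
  | _, [] => []
  | S, (i, a) :: w => (if a.isModifier then [(i, S.pos)] else []) ++ moveOf B (B.apply S a) w

/-- `m` is a legal move for the game state `g`. -/
def LegalMove (R : GenRules σ) (B : Inst σ) (g : GameState σ) (m : Move σ) : Prop :=
  ∃ w h, IsMoveSeq w ∧ LegalSeq R B g w h ∧ moveOf B g.semi w = m

/-! ## Text representations

A text is a list of tokens, and a token is an integer. Expressions are written in prefix notation. -/

def ArithOp.code : ArithOp → ℤ
  | add => 3
  | sub => 4
  | mul => 5
  | div => 6

def RelOp.code : RelOp → ℤ
  | lt => 0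
  | le => 1
  | eq => 2
  | ne => 3
  | gt => 4
  | ge => 5

def AExpr.text : AExpr σ → List ℤ
  | .lit z => [0, z]
  | .var v => [1, (v : ℕ)]
  | .piece x => [2, (x : ℕ)]
  | .bin o e f => o.code :: (e.text ++ f.text)

mutual

def Action.text : Action σ → List ℤ
  | .shift dir => [((dir : ℕ) : ℤ)]
  | .on X => -4 :: (X.card : ℤ) :: (X.sort (· ≤ ·)).map (fun x => ((x : ℕ) : ℤ))
  | .off x => [-5, ((x : ℕ) : ℤ)]
  | .assign v e => -6 :: ((v : ℕ) : ℤ) :: e.text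
  | .compare o e f => -7 :: o.code :: (e.text ++ f.text)
  | .switch p => [-8, ((p : ℕ) : ℤ)]
  | .check M => -9 :: exprText M
  | .checkNot M => -10 :: exprText M

def exprText : Regex (Action σ) → List ℤ
  | .act a => a.text
  | .sum E F => -1 :: (exprText E ++ exprText F)
  | .cat E F => -2 :: (exprText E ++ exprText F)
  | .star E => -3 :: exprText E

end

/-- The list of the values of a function on `Fin n`. -/
def tableText {n : ℕ} (f : Fin n → ℕ) : List ℤ := (List.ofFn f).map (fun m => (m : ℤ))

/-- Player, position, piece of every vertex, value of every variable. -/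
def SemiState.text (S : SemiState σ) : List ℤ :=
  ((S.player : ℕ) : ℤ) :: ((S.pos : ℕ) : ℤ) ::
    (tableText (fun v => (S.pieceAt v : ℕ)) ++ tableText S.value)

/-- The text of `𝓡`: the declarations of the players, of the other variables and of the pieces
(number of names, then the list of all names), and the rules. -/
def GenRules.text (R : GenRules σ) : List ℤ :=
  ((σ.players : ℤ) :: tableText (fun p : σ.Player => (p : ℕ))) ++ [((R.keeper : ℕ) : ℤ)] ++
  ((σ.extraVars : ℤ) :: tableText (fun v : Fin σ.extraVars => σ.players + (v : ℕ))) ++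
  ((σ.pieces : ℤ) :: tableText (fun x : σ.Piece => (x : ℕ))) ++
  exprText R.rules

/-- The outgoing edges of `v`: their number, then for each of them its label and its end. -/
def Inst.edgesText (B : Inst σ) (v : σ.Vertex) : List ℤ :=
  let l : List (List ℤ) := (List.finRange σ.dirs).filterMap fun dir =>
    (B.next v dir).map fun v' => [((dir : ℕ) : ℤ), ((v' : ℕ) : ℤ)]
  (l.length : ℤ) :: l.flatten

/-- The text of `𝓢`: the board (number of vertices, then the outgoing edges of every vertex), the
bounds of all variables, the initial semi-state. -/
def Inst.text (B : Inst σ) : List ℤ :=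
  ((σ.vertices : ℤ) :: (List.finRange σ.vertices).flatMap B.edgesText) ++
  tableText B.bound ++ B.init.text

/-- The length `|𝓡|`. -/
def GenRules.length (R : GenRules σ) : ℕ := R.text.length

/-- The length `|𝓢|`. -/
def Inst.length (B : Inst σ) : ℕ := B.text.length

def GameState.text (g : GameState σ) : List ℤ := (g.index : ℤ) :: g.semi.text

/-- The input of the problem of finding all legal moves. -/
def inputText (R : GenRules σ) (B : Inst σ) (g : GameState σ) : List ℤ :=
  R.text ++ B.text ++ g.text

/-- The text of a list of moves; every move ends with the token `-1`. -/
def movesText (ms : List (Move σ)) : List ℤ :=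
  ms.flatMap fun m => m.flatMap (fun b => [(b.1 : ℤ), ((b.2 : ℕ) : ℤ)]) ++ [-1]

/-! ## The size of the numbers that occur -/

/-- The largest absolute value of an entry. -/
def maxAbs (l : List ℤ) : ℕ := (l.map Int.natAbs).foldr max 0

/-- A bound on the absolute values of `e` and all its subexpressions when the variables respect
their bounds. -/
def AExpr.magnitude (B : Inst σ) : AExpr σ → ℕ
  | .lit z => z.natAbs
  | .var v => B.bound v
  | .piece _ => σ.vertices
  | .bin .mul e f => (e.magnitude B + 1) * (f.magnitude B + 1)
  | .bin _ e f => e.magnitude B + f.magnitude B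

mutual

def Action.magnitude (B : Inst σ) : Action σ → ℕ
  | .assign _ e => e.magnitude B
  | .compare _ e f => max (e.magnitude B) (f.magnitude B)
  | .check M => exprMagnitude B M
  | .checkNot M => exprMagnitude B M
  | .shift _ => 0
  | .on _ => 0
  | .off _ => 0
  | .switch _ => 0

def exprMagnitude (B : Inst σ) : Regex (Action σ) → ℕ
  | .act a => a.magnitude B
  | .sum E F => max (exprMagnitude B E) (exprMagnitude B F)
  | .cat E F => max (exprMagnitude B E) (exprMagnitude B F)
  | .star E => exprMagnitude B E

end

/-! ## Random access machines

Structured programs over finitely many integer registers (those that the program mentions), a memory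
with addresses `0, 1, 2, …`, and a write-only output. -/

/-- Commands; `x`, `y`, `z` are registers. -/
inductive Cmd
  /-- `x := c` -/
  | const (x : ℕ) (c : ℤ)
  /-- `x := y o z` -/
  | arith (o : ArithOp) (x y z : ℕ)
  /-- `x := memory[y]` -/
  | load (x y : ℕ)
  /-- `memory[x] := y` -/
  | store (x y : ℕ)
  /-- append the content of `x` to the output -/
  | write (x : ℕ)
  | seq (c₁ c₂ : Cmd)
  /-- `if x > 0 then c₁ else c₂` -/
  | ite (x : ℕ) (c₁ c₂ : Cmd)
  /-- `while x > 0 do c` -/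
  | loop (x : ℕ) (c : Cmd)
  /-- call the procedure with number `f` (recursion is allowed; all registers are global) -/
  | call (f : ℕ)

/-- A program is a finite list of procedures; procedure `0` is the main one. -/
abbrev Program : Type := List Cmd

structure Store where
  reg : ℕ → ℤ
  mem : ℕ → ℤ
  out : List ℤ

/-- `Exec P W c s t m s'`: in the program `P`, with words that hold the integers of absolute value
at most `W`, the command `c` started in `s` terminates in `s'`, and takes `t` steps and `m` memory
cells. Every elementary command, test and call is one step. A memory access to the address `a` needs
`a + 1` cells, and each pending call takes one further cell. There is no execution that computes or
loads a larger number or accesses a negative address. -/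
inductive Exec (P : Program) (W : ℕ) : Cmd → Store → ℕ → ℕ → Store → Prop
  | const {x : ℕ} {c : ℤ} {s : Store} :
      |c| ≤ W →
      Exec P W (.const x c) s 1 0 { s with reg := Function.update s.reg x c }
  | arith {o : ArithOp} {x y z : ℕ} {s : Store} :
      |o.eval (s.reg y) (s.reg z)| ≤ W →
      Exec P W (.arith o x y z) s 1 0
        { s with reg := Function.update s.reg x (o.eval (s.reg y) (s.reg z)) }
  | load {x y a : ℕ} {s : Store} :
      s.reg y = a → |s.mem a| ≤ W →
      Exec P W (.load x y) s 1 (a + 1) { s with reg := Function.update s.reg x (s.mem a) }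
  | store {x y a : ℕ} {s : Store} :
      s.reg x = a →
      Exec P W (.store x y) s 1 (a + 1) { s with mem := Function.update s.mem a (s.reg y) }
  | write {x : ℕ} {s : Store} :
      Exec P W (.write x) s 1 0 { s with out := s.out ++ [s.reg x] }
  | seq {c₁ c₂ : Cmd} {s s' s'' : Store} {t₁ m₁ t₂ m₂ : ℕ} :
      Exec P W c₁ s t₁ m₁ s' → Exec P W c₂ s' t₂ m₂ s'' →
      Exec P W (.seq c₁ c₂) s (t₁ + t₂) (max m₁ m₂) s''
  | ite_true {x : ℕ} {c₁ c₂ : Cmd} {s s' : Store} {t m : ℕ} :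
      0 < s.reg x → Exec P W c₁ s t m s' → Exec P W (.ite x c₁ c₂) s (t + 1) m s'
  | ite_false {x : ℕ} {c₁ c₂ : Cmd} {s s' : Store} {t m : ℕ} :
      ¬ 0 < s.reg x → Exec P W c₂ s t m s' → Exec P W (.ite x c₁ c₂) s (t + 1) m s'
  | loop_true {x : ℕ} {c : Cmd} {s s' s'' : Store} {t₁ m₁ t₂ m₂ : ℕ} :
      0 < s.reg x → Exec P W c s t₁ m₁ s' → Exec P W (.loop x c) s' t₂ m₂ s'' →
      Exec P W (.loop x c) s (t₁ + t₂ + 1) (max m₁ m₂) s''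
  | loop_false {x : ℕ} {c : Cmd} {s : Store} :
      ¬ 0 < s.reg x → Exec P W (.loop x c) s 1 0 s
  | call {f : ℕ} {c : Cmd} {s s' : Store} {t m : ℕ} :
      P[f]? = some c → Exec P W c s t m s' → Exec P W (.call f) s (t + 1) (m + 1) s'

/-- Initially, the registers are zero, and the memory holds the input, followed by zeros. -/
def initStore (input : List ℤ) : Store where
  reg := fun _ => 0
  mem := fun a => input.getD a 0
  out := []

/-- The program `P` halts on the input with the output, in `t` steps and `m` memory cells. -/
def Computes (P : Program) (W : ℕ) (input output : List ℤ) (t m : ℕ) : Prop :=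
  ∃ s', Exec P W (.call 0) (initStore input) t m s' ∧ s'.out = output

end RBG

-- Why the theorem holds. Between two modifiers an action can change nothing but the current
-- position. As long as no modifier is applied, the search is therefore in one of few
-- configurations: a node of the expression (an occurrence of a subexpression, which determines what
-- has to be matched behind it) and a vertex. A depth first search with a table of visited pairs
-- finds every modifier that can be applied next. At a modifier the program records its number and
-- position, applies it, searches on from its continuation with a fresh table, and undoes it. At a
-- switch it writes the recorded list. A pattern is decided by the same search, with a flag for
-- acceptance.
--
-- No move is written twice, although no move is stored: the first entry (number, position) of a
-- move determines the node and the vertex at which it is found (`EmitsAt.unique`), and no pair is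
-- entered twice with the same table.
--
-- Correctness. Regular expressions are read by a machine whose stack holds the expressions still to
-- be matched (`MRun`). As no expression denotes the empty language, every stack can be emptied, so
-- prefixes of words are the same as runs, and legal moves are exactly the moves of runs from the
-- stack behind the rules index (`After.legalMove_iff`). Every stack that occurs is empty or belongs
-- to a node (`IsNodeStack.step`). The structure `Searched` is the invariant of the search: each
-- pair visited since the beginning has all its successors visited at the end. For an empty initial
-- table the visited set is closed under steps, hence contains everything reachable; this gives
-- `Searched.moves_iff` and `Searched.accepts_iff`.
--
-- Straightness enters through `Budget`. The application language continues inside patterns, so the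
-- modifiers that the search applies, inside nested patterns too, form a factor of one of its words,
-- and at most `k` of them can be active at the same time.
--
-- Time. A visited pair pays `U` times the number of its own tokens times (the length of the list of
-- edges, plus one); summed over all pairs this is at most `U` times |R||S|. The unit `U` depends on
-- the number `j` of modifiers still possible and on the pattern depth `d` (`allowance`): a search
-- behind a modifier costs about |R||S| smaller units, and a search in a pattern with `m` tokens
-- about `m`|S| units of the smaller depth. Hence the powers of |R||S| and of |S|. A modifier pays
-- at least four units while two suffice for the main part of the next search, so the unit may lose
-- a factor two less than |R||S| from level to level. This yields the factor `2 ^ (K - j)`, which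
-- pays for writing moves with `K - j` entries; at the top it is `1`.
--
-- Space. Each active modifier has its own table with a cell for every text address and vertex. A
-- pair takes at most ten cells of the stacks when it gets marked, so the room needed is ten times
-- the number of unvisited pairs. Patterns need nothing more: their nodes use the cells of the
-- current table at the addresses inside the pattern, where the surrounding expression has no nodes,
-- and for the same reason their pairs fit into the room of the unvisited ones (`card_add_le`).
--
-- The program. Continuations are kept as cells containing an address, because the address of the
-- second factor of a concatenation is unknown while the first one is parsed. With `N` the length of
-- the input, the tables begin at multiples of `N`: 1 continuation cell of a node, 2 second operand
-- or end of a pattern, 3 number of a letter, 4 continuation cell of the letter with a given number,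
-- 5 edges of a vertex, 6 number of pieces of a kind. The cell `7 * N` holds zero, the address that
-- stands for acceptance, and the next cell the address of the rules. The program is written in a
-- small language with expressions and an exact clock; `HExec.exec` transfers its executions to the
-- machine, and the lemmas `go_…` are obtained by symbolic execution.

set_option linter.constructorNameAsVariable false
set_option linter.unusedSimpArgs false

namespace RBG

/-! ## A structured language with expressions, compiled to random access machines -/

/-- The names of the registers of the structured language. -/
inductive Reg
  | q | c | i | p | s | found | vb | mv | sp | t | a | b | x | y | e | er | v | n | N | L | PA | VA | BD

/-- States of the structured language, with a clock. -/
structure St where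
  (q c i p s found vb mv sp t a b x y e er v n N L PA VA BD : ℤ)
  mem : ℤ → ℤ
  out : List ℤ
  time : ℕ

/-- The number of a register. -/
def Reg.toNat : Reg → ℕ
  | q => 0
  | c => 1
  | i => 2
  | p => 3
  | s => 4
  | found => 5
  | vb => 6
  | mv => 7
  | sp => 8
  | t => 9
  | a => 10
  | b => 11
  | x => 12
  | y => 13
  | e => 14
  | er => 15
  | v => 16
  | n => 17
  | N => 18
  | L => 19
  | PA => 20
  | VA => 21
  | BD => 22

/-- The content of a register. -/
def St.get (s : St) : Reg → ℤ
  | .q => s.q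
  | .c => s.c
  | .i => s.i
  | .p => s.p
  | .s => s.s
  | .found => s.found
  | .vb => s.vb
  | .mv => s.mv
  | .sp => s.sp
  | .t => s.t
  | .a => s.a
  | .b => s.b
  | .x => s.x
  | .y => s.y
  | .e => s.e
  | .er => s.er
  | .v => s.v
  | .n => s.n
  | .N => s.N
  | .L => s.L
  | .PA => s.PA
  | .VA => s.VA
  | .BD => s.BD

/-- Assignment to a register. -/
def St.set (s : St) : Reg → ℤ → St
  | .q, v => { s with q := v }
  | .c, v => { s with c := v }
  | .i, v => { s with i := v }
  | .p, v => { s with p := v }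
  | .s, v => { s with s := v }
  | .found, v => { s with found := v }
  | .vb, v => { s with vb := v }
  | .mv, v => { s with mv := v }
  | .sp, v => { s with sp := v }
  | .t, v => { s with t := v }
  | .a, v => { s with a := v }
  | .b, v => { s with b := v }
  | .x, v => { s with x := v }
  | .y, v => { s with y := v }
  | .e, v => { s with e := v }
  | .er, v => { s with er := v }
  | .v, v => { s with v := v }
  | .n, v => { s with n := v }
  | .N, v => { s with N := v }
  | .L, v => { s with L := v }
  | .PA, v => { s with PA := v }
  | .VA, v => { s with VA := v }
  | .BD, v => { s with BD := v }

theorem Reg.toNat_lt (r : Reg) : r.toNat < 23 := by cases r <;> decide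

theorem St.get_set (s : St) (r r' : Reg) (v : ℤ) :
    (s.set r v).get r' = if r'.toNat = r.toNat then v else s.get r' := by
  cases r <;> cases r' <;> rfl

theorem St.mem_set (s : St) (r : Reg) (v : ℤ) : (s.set r v).mem = s.mem := by cases r <;> rfl

theorem St.out_set (s : St) (r : Reg) (v : ℤ) : (s.set r v).out = s.out := by cases r <;> rfl

theorem St.time_set (s : St) (r : Reg) (v : ℤ) : (s.set r v).time = s.time := by cases r <;> rfl
/-- The clock advances. -/
def St.tick (s : St) (t : ℕ) : St := { s with time := s.time + t }

/-- Expressions; the value of `lt e f` is `1` if `e < f` and `0` otherwise. -/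
inductive HExp
  | const (c : ℤ)
  | reg (r : Reg)
  | bin (o : ArithOp) (e f : HExp)
  | ld (e : HExp)
  | lt (e f : HExp)

namespace HExp

instance : Add HExp := ⟨bin .add⟩
instance : Sub HExp := ⟨bin .sub⟩
instance : Mul HExp := ⟨bin .mul⟩

def val (s : St) : HExp → ℤ
  | const c => c
  | reg r => s.get r
  | bin o e f => o.eval (e.val s) (f.val s)
  | ld e => s.mem (e.val s)
  | lt e f => if e.val s < f.val s then 1 else 0

def cost : HExp → ℕ
  | const _ => 1
  | reg _ => 1
  | bin _ e f => e.cost + (f.cost + 1)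
  | ld e => e.cost + 1
  | lt e f => e.cost + (f.cost + 3)

/-- The evaluation of an expression needs only numbers up to `W` and `M` memory cells. -/
def ok (W : ℤ) (M : ℤ) (s : St) : HExp → Prop
  -- All constants of the program lie in this range, so `16 ≤ W` is enough for them.
  | const c => -16 ≤ c ∧ c ≤ 16
  | reg _ => True
  | bin o e f => e.ok W M s ∧ f.ok W M s ∧
      -W ≤ o.eval (e.val s) (f.val s) ∧ o.eval (e.val s) (f.val s) ≤ W
  | ld e => e.ok W M s ∧ 0 ≤ e.val s ∧ e.val s < M
  | lt e f => e.ok W M s ∧ f.ok W M s ∧ -W ≤ f.val s - e.val s ∧ f.val s - e.val s ≤ W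

/-- The code that puts the value of the expression into the register `t` and uses only registers
from `t` on. -/
def compile : HExp → ℕ → Cmd
  | const c, t => .const t c
  -- The machine has no instruction for copying. Register 39 is never written and stays zero, so
  -- adding it copies.
  | reg r, t => .arith .add t r.toNat 39
  | bin o e f, t => .seq (e.compile t) (.seq (f.compile (t + 1)) (.arith o t t (t + 1)))
  | ld e, t => .seq (e.compile t) (.load t t)
  | lt e f, t => .seq (e.compile t) (.seq (f.compile (t + 1)) (.seq (.arith .sub t (t + 1) t)
      (.ite t (.const t 1) (.const t 0))))

end HExp

/-- Commands of the structured language. -/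
inductive HCmd
  | skip
  | set (x : Reg) (e : HExp)
  | store (a e : HExp)
  | write (e : HExp)
  | seq (c₁ c₂ : HCmd)
  | ite (e : HExp) (c₁ c₂ : HCmd)
  | loop (e : HExp) (c : HCmd)
  | call (f : ℕ)

namespace HCmd

def compile : HCmd → Cmd
  | skip => .const 40 0
  | set x e => .seq (e.compile 40) (.arith .add x.toNat 40 39)
  | store a e => .seq (a.compile 40) (.seq (e.compile 41) (.store 40 41))
  | write e => .seq (e.compile 40) (.write 40)
  | seq c₁ c₂ => .seq c₁.compile c₂.compile
  | ite e c₁ c₂ => .seq (e.compile 40) (.ite 40 c₁.compile c₂.compile)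
  -- The machine tests a register only, so the condition is evaluated before the loop and again at
  -- the end of each round.
  | loop e c => .seq (e.compile 40) (.loop 40 (.seq c.compile (e.compile 40)))
  | call f => .call f

end HCmd

/-- Big-step semantics: with numbers up to `W` and `M` memory cells the command leads from one
state to the other. -/
inductive HExec (P : List HCmd) (W : ℤ) : ℤ → HCmd → St → St → Prop
  | skip {M : ℤ} {s : St} : HExec P W M .skip s (s.tick 1)
  | set {M : ℤ} {x : Reg} {e : HExp} {s : St} :
      e.ok W M s → HExec P W M (.set x e) s ((s.set x (e.val s)).tick (e.cost + 1))
  | store {M : ℤ} {a e : HExp} {s : St} :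
      a.ok W M s → e.ok W M s → 0 ≤ a.val s → a.val s < M →
      HExec P W M (.store a e) s
        { s with
          mem := Function.update s.mem (a.val s) (e.val s), time := s.time + (a.cost + e.cost + 1) }
  | write {M : ℤ} {e : HExp} {s : St} :
      e.ok W M s →
      HExec P W M (.write e) s { s with out := s.out ++ [e.val s], time := s.time + (e.cost + 1) }
  | seq {M : ℤ} {c₁ c₂ : HCmd} {s s' s'' : St} :
      HExec P W M c₁ s s' → HExec P W M c₂ s' s'' → HExec P W M (.seq c₁ c₂) s s''
  | ite_true {M : ℤ} {e : HExp} {c₁ c₂ : HCmd} {s s' : St} :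
      e.ok W M s → 0 < e.val s → HExec P W M c₁ (s.tick (e.cost + 1)) s' →
      HExec P W M (.ite e c₁ c₂) s s'
  | ite_false {M : ℤ} {e : HExp} {c₁ c₂ : HCmd} {s s' : St} :
      e.ok W M s → ¬ 0 < e.val s → HExec P W M c₂ (s.tick (e.cost + 1)) s' →
      HExec P W M (.ite e c₁ c₂) s s'
  | loop_true {M : ℤ} {e : HExp} {c : HCmd} {s s' s'' : St} :
      e.ok W M s → 0 < e.val s → HExec P W M c (s.tick (e.cost + 1)) s' →
      HExec P W M (.loop e c) s' s'' → HExec P W M (.loop e c) s s''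
  | loop_false {M : ℤ} {e : HExp} {c : HCmd} {s : St} :
      e.ok W M s → ¬ 0 < e.val s → HExec P W M (.loop e c) s (s.tick (e.cost + 1))
  | call {M : ℤ} {f : ℕ} {c : HCmd} {s s' : St} :
      P[f]? = some c → 1 ≤ M → HExec P W (M - 1) c (s.tick 1) s' → HExec P W M (.call f) s s'

/-- The store of the machine represents the state, and all numbers are small. -/
structure Represents (W : ℤ) (s : St) (σ : Store) : Prop where
  reg : ∀ r : Reg, σ.reg r.toNat = s.get r
  zero : σ.reg 39 = 0
  mem : ∀ a : ℕ, σ.mem a = s.mem a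
  out : σ.out = s.out
  reg_le : ∀ r : Reg, |s.get r| ≤ W
  mem_le : ∀ a : ℕ, |s.mem a| ≤ W

/-- The named registers have numbers below 23, and the zero register is 39, so scratch work from
register 40 on is invisible to the state. -/
theorem Represents.of_temps {W : ℤ} {s : St} {σ σ' : Store} (h : Represents W s σ)
    (hr : ∀ r < 40, σ'.reg r = σ.reg r) (hm : σ'.mem = σ.mem) (ho : σ'.out = σ.out) :
    Represents W s σ' where
  reg r := by rw [hr _ (r.toNat_lt.trans (by decide)), h.reg]
  zero := by rw [hr _ (by decide), h.zero]
  mem a := by rw [hm, h.mem]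
  out := by rw [ho, h.out]
  reg_le := h.reg_le
  mem_le := h.mem_le

theorem Represents.tick {W : ℤ} {s : St} {σ : Store} (h : Represents W s σ) (t : ℕ) :
    Represents W (s.tick t) σ :=
  ⟨fun r => by rw [h.reg]; cases r <;> rfl, h.zero, h.mem, h.out,
    fun r => by have := h.reg_le r; cases r <;> exact this, h.mem_le⟩

/-- The registers from `t` on serve as an evaluation stack: the second operand is evaluated one
register higher and leaves the value of the first intact. The bound on the value keeps all registers
within the word size. -/
theorem HExp.exec_compile {P : Program} {W : ℕ} (hW : 16 ≤ W) {M : ℤ} {s : St} (e : HExp)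
    (t : ℕ) (ht : 40 ≤ t) (σ : Store) (hs : Represents W s σ) (hok : e.ok W M s) (hM : 0 ≤ M) :
    ∃ (m : ℕ) (σ' : Store), Exec P W (e.compile t) σ e.cost m σ' ∧ (m : ℤ) ≤ M ∧
      σ'.reg t = e.val s ∧ (∀ r < t, σ'.reg r = σ.reg r) ∧ σ'.mem = σ.mem ∧ σ'.out = σ.out ∧
      |e.val s| ≤ W := by
  induction e generalizing t σ with
  | const c =>
    simp only [ok] at hok
    have hc : |c| ≤ W := by rw [abs_le]; omega
    exact ⟨0, _, .const hc, by simpa, by simp [val],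
      fun r hr => Function.update_of_ne (by omega) _ _, rfl, rfl, hc⟩
  | reg r =>
    have hr := hs.reg_le r
    refine ⟨0, _, .arith (o := .add) (y := r.toNat) (z := 39) ?_, by simpa, ?_,
      fun r hr => Function.update_of_ne (by omega) _ _, rfl, rfl, hr⟩
    · simpa [ArithOp.eval, hs.reg, hs.zero] using hr
    · simp [ArithOp.eval, hs.reg, hs.zero, val]
  | bin o e f ihe ihf =>
    obtain ⟨he, hf, h1, h2⟩ := hok
    obtain ⟨m₁, σ₁, x₁, a₁, b₁, c₁, d₁, e₁, f₁⟩ := ihe t ht σ hs he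
    have hs₁ := hs.of_temps (fun r hr => c₁ r (by omega)) d₁ e₁
    obtain ⟨m₂, σ₂, x₂, a₂, b₂, c₂, d₂, e₂, f₂⟩ := ihf (t + 1) (by omega) σ₁ hs₁ hf
    have hv : o.eval (σ₂.reg t) (σ₂.reg (t + 1)) = (HExp.bin o e f).val s := by
      rw [c₂ t (by omega), b₁, b₂, val]
    have hvW : |(HExp.bin o e f).val s| ≤ W := abs_le.2 ⟨h1, h2⟩
    refine ⟨max m₁ (max m₂ 0), _, .seq x₁ (.seq x₂ (.arith (by rw [hv]; exact hvW))), by omega,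
      ?_, fun r hr => ?_, d₂.trans d₁, e₂.trans e₁, hvW⟩
    · simp [hv]
    · rw [← c₁ r hr, ← c₂ r (by omega)]
      exact Function.update_of_ne (by omega) _ _
  | ld e ihe =>
    obtain ⟨he, h1, h2⟩ := hok
    obtain ⟨m₁, σ₁, x₁, a₁, b₁, c₁, d₁, e₁, f₁⟩ := ihe t ht σ hs he
    obtain ⟨a, ha⟩ := Int.eq_ofNat_of_zero_le h1
    have hv : σ₁.mem a = (HExp.ld e).val s := by rw [d₁, hs.mem, val, ha]
    have hvW : |(HExp.ld e).val s| ≤ W := by rw [← hv, d₁, hs.mem]; exact hs.mem_le a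
    refine ⟨max m₁ (a + 1), _, .seq x₁ (.load (a := a) (by rw [b₁, ha]) (by rwa [hv])),
      by omega, ?_, fun r hr => ?_, d₁, e₁, hvW⟩
    · simp [hv]
    · rw [← c₁ r hr]
      exact Function.update_of_ne (by omega) _ _
  | lt e f ihe ihf =>
    obtain ⟨he, hf, h1, h2⟩ := hok
    obtain ⟨m₁, σ₁, x₁, a₁, b₁, c₁, d₁, e₁, f₁⟩ := ihe t ht σ hs he
    have hs₁ := hs.of_temps (fun r hr => c₁ r (by omega)) d₁ e₁
    obtain ⟨m₂, σ₂, x₂, a₂, b₂, c₂, d₂, e₂, f₂⟩ := ihf (t + 1) (by omega) σ₁ hs₁ hf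
    have hv : ArithOp.sub.eval (σ₂.reg (t + 1)) (σ₂.reg t) = f.val s - e.val s := by
      rw [c₂ t (by omega), b₁, b₂]; rfl
    have hle : |ArithOp.sub.eval (σ₂.reg (t + 1)) (σ₂.reg t)| ≤ W := by
      rw [hv]; exact abs_le.2 ⟨h1, h2⟩
    have hfr : ∀ z : ℤ, ∀ r < t, Function.update (Function.update σ₂.reg t
        (ArithOp.sub.eval (σ₂.reg (t + 1)) (σ₂.reg t))) t z r = σ.reg r := by
      intro z r hr
      rw [← c₁ r hr, ← c₂ r (by omega), Function.update_of_ne (by omega),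
        Function.update_of_ne (by omega)]
    by_cases hlt : e.val s < f.val s
    · refine ⟨max m₁ (max m₂ (max 0 0)), _, .seq x₁ (.seq x₂ (.seq (.arith hle)
        (.ite_true ?_ (.const (c := 1) ?_)))), by omega, ?_, hfr 1, d₂.trans d₁, e₂.trans e₁, ?_⟩
      · simp only [Function.update_self, hv]; omega
      · simp; omega
      · simp [val, hlt]
      · simp [val, hlt]; omega
    · refine ⟨max m₁ (max m₂ (max 0 0)), _, .seq x₁ (.seq x₂ (.seq (.arith hle)
        (.ite_false ?_ (.const (c := 0) ?_)))), by omega, ?_, hfr 0, d₂.trans d₁, e₂.trans e₁, ?_⟩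
      · simp only [Function.update_self, hv]; omega
      · simp
      · simp [val, hlt]
      · simp [val, hlt]

/-- The simulation that reduces everything to the structured language. The clock counts machine
steps exactly. The space bound is preserved because `M` drops by one with each pending call, which
is what such a call costs the machine. -/
theorem HExec.exec {P : List HCmd} {W : ℕ} (hW : 16 ≤ W) {M : ℤ} {c : HCmd} {s s' : St}
    (h : HExec P W M c s s') (σ : Store) (hs : Represents W s σ) (hM : 0 ≤ M) :
    ∃ (t m : ℕ) (σ' : Store), Exec (P.map HCmd.compile) W c.compile σ t m σ' ∧
      Represents W s' σ' ∧ (m : ℤ) ≤ M ∧ s'.time = s.time + t := by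
  induction h generalizing σ with
  | skip =>
    exact ⟨1, 0, _, .const (by simp), (hs.tick 1).of_temps
      (fun r hr => Function.update_of_ne (by omega) _ _) rfl rfl, by simpa, rfl⟩
  | @set M x e s hok =>
    obtain ⟨m₁, σ₁, x₁, a₁, b₁, c₁, d₁, e₁, f₁⟩ :=
      e.exec_compile (P := P.map HCmd.compile) hW 40 le_rfl σ hs hok hM
    have h1 := hs.of_temps c₁ d₁ e₁
    refine ⟨_, _, _, .seq x₁ (.arith (o := .add) ?_), ?_, ?_, ?_⟩
    · simpa [ArithOp.eval, b₁, h1.zero] using f₁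
    · refine Represents.tick ⟨fun r => ?_, ?_, fun a => ?_, ?_, fun r => ?_, fun a => ?_⟩ _
      · simp only [Function.update_apply, St.get_set, b₁, h1.zero, h1.reg, ArithOp.eval, add_zero]
      · have := x.toNat_lt
        dsimp only
        rw [Function.update_of_ne (by omega), h1.zero]
      · rw [St.mem_set]; exact h1.mem a
      · rw [St.out_set]; exact h1.out
      · rw [St.get_set]; split_ifs
        · exact f₁
        · exact h1.reg_le r
      · rw [St.mem_set]; exact h1.mem_le a
    · omega
    · simp [St.tick, St.time_set]
  | @store M a e s hoka hoke h0 hlt =>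
    obtain ⟨m₁, σ₁, x₁, a₁, b₁, c₁, d₁, e₁, f₁⟩ :=
      a.exec_compile (P := P.map HCmd.compile) hW 40 le_rfl σ hs hoka hM
    have h1 := hs.of_temps c₁ d₁ e₁
    obtain ⟨m₂, σ₂, x₂, a₂, b₂, c₂, d₂, e₂, f₂⟩ :=
      e.exec_compile (P := P.map HCmd.compile) hW 41 (by omega) σ₁ h1 hoke hM
    have h2 := h1.of_temps (fun r hr => c₂ r (by omega)) d₂ e₂
    obtain ⟨k, hk⟩ := Int.eq_ofNat_of_zero_le h0
    refine ⟨_, _, _, .seq x₁ (.seq x₂ (.store (a := k) ?_)), ?_, ?_, ?_⟩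
    · rw [c₂ 40 (by omega), b₁, hk]
    · refine ⟨fun r => ?_, h2.zero, fun a => ?_, h2.out, fun r => ?_, fun a => ?_⟩
      · rw [h2.reg]; cases r <;> rfl
      · simp only [Function.update_apply, hk, h2.mem, b₂]
        norm_cast
      · have := h2.reg_le r
        cases r <;> exact this
      · simp only [Function.update_apply]
        split_ifs
        · exact f₂
        · exact h2.mem_le a
    · omega
    · simp; omega
  | @write M e s hok =>
    obtain ⟨m₁, σ₁, x₁, a₁, b₁, c₁, d₁, e₁, f₁⟩ :=
      e.exec_compile (P := P.map HCmd.compile) hW 40 le_rfl σ hs hok hM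
    have h1 := hs.of_temps c₁ d₁ e₁
    refine ⟨_, _, _, .seq x₁ .write, ?_, by omega, rfl⟩
    refine ⟨fun r => ?_, h1.zero, h1.mem, ?_, fun r => ?_, h1.mem_le⟩
    · rw [h1.reg]; cases r <;> rfl
    · simp [h1.out, b₁]
    · have := h1.reg_le r
      cases r <;> exact this
  | seq _ _ ih₁ ih₂ =>
    obtain ⟨t₁, m₁, σ₁, x₁, r₁, a₁, b₁⟩ := ih₁ σ hs hM
    obtain ⟨t₂, m₂, σ₂, x₂, r₂, a₂, b₂⟩ := ih₂ σ₁ r₁ hM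
    exact ⟨_, _, _, .seq x₁ x₂, r₂, by omega, by omega⟩
  | @ite_true M e _ _ s _ hok hp _ ih =>
    obtain ⟨m₁, σ₁, x₁, a₁, b₁, c₁, d₁, e₁, f₁⟩ :=
      e.exec_compile (P := P.map HCmd.compile) hW 40 le_rfl σ hs hok hM
    obtain ⟨t₂, m₂, σ₂, x₂, r₂, a₂, b₂⟩ := ih σ₁ ((hs.of_temps c₁ d₁ e₁).tick _) hM
    refine ⟨_, _, _, .seq x₁ (.ite_true (by rwa [b₁]) x₂), r₂, by omega, ?_⟩
    simp [St.tick] at b₂; omega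
  | @ite_false M e _ _ s _ hok hp _ ih =>
    obtain ⟨m₁, σ₁, x₁, a₁, b₁, c₁, d₁, e₁, f₁⟩ :=
      e.exec_compile (P := P.map HCmd.compile) hW 40 le_rfl σ hs hok hM
    obtain ⟨t₂, m₂, σ₂, x₂, r₂, a₂, b₂⟩ := ih σ₁ ((hs.of_temps c₁ d₁ e₁).tick _) hM
    refine ⟨_, _, _, .seq x₁ (.ite_false (by rwa [b₁]) x₂), r₂, by omega, ?_⟩
    simp [St.tick] at b₂; omega
  | @loop_true M e _ s _ _ hok hp _ _ ih₁ ih₂ =>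
    obtain ⟨m₁, σ₁, x₁, a₁, b₁, c₁, d₁, e₁, f₁⟩ :=
      e.exec_compile (P := P.map HCmd.compile) hW 40 le_rfl σ hs hok hM
    obtain ⟨t₂, m₂, σ₂, x₂, r₂, a₂, b₂⟩ := ih₁ σ₁ ((hs.of_temps c₁ d₁ e₁).tick _) hM
    obtain ⟨t₃, m₃, σ₃, x₃, r₃, a₃, b₃⟩ := ih₂ σ₂ r₂ hM
    -- The execution of the remaining loop begins with evaluating the condition. That part becomes
    -- the end of the present round.
    cases x₃ with
    | @seq _ _ _ σ₄ _ t₄ m₄ t₅ m₅ x₄ x₅ =>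
      refine ⟨_, _, _, .seq x₁ (.loop_true (by rwa [b₁]) (.seq x₂ x₄) x₅), r₃, by omega, ?_⟩
      simp [St.tick] at b₂; omega
  | @loop_false M e _ s hok hp =>
    obtain ⟨m₁, σ₁, x₁, a₁, b₁, c₁, d₁, e₁, f₁⟩ :=
      e.exec_compile (P := P.map HCmd.compile) hW 40 le_rfl σ hs hok hM
    exact ⟨_, _, _, .seq x₁ (.loop_false (by rwa [b₁])), (hs.of_temps c₁ d₁ e₁).tick _,
      by omega, rfl⟩
  | @call M f c s s' hf h1 _ ih =>
    obtain ⟨t₁, m₁, σ₁, x₁, r₁, a₁, b₁⟩ := ih σ (hs.tick 1) (by omega)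
    refine ⟨_, _, _, .call (by simp [hf]) x₁, r₁, by push_cast; omega, ?_⟩
    simp [St.tick] at b₁; omega

/-- The command started in `s` terminates in a state with the property `Q`. -/
def Run (P : List HCmd) (W M : ℤ) (c : HCmd) (s : St) (Q : St → Prop) : Prop :=
  ∃ s', HExec P W M c s s' ∧ Q s'

/-- A sequence of commands. -/
def HCmd.block : List HCmd → HCmd
  | [] => .skip
  | [c] => c
  | c :: d :: l => .seq c (block (d :: l))

-- Rules for symbolic execution of the structured language

section Run

variable {P : List HCmd} {W M : ℤ} {s : St} {Q Q' : St → Prop}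

theorem Run.mono {c : HCmd} (h : Run P W M c s Q) (hQ : ∀ s', Q s' → Q' s') :
    Run P W M c s Q' :=
  h.imp fun _ h => ⟨h.1, hQ _ h.2⟩

theorem run_skip : Run P W M .skip s Q ↔ Q (s.tick 1) := by
  constructor
  · rintro ⟨s', ⟨⟩, h⟩; exact h
  · exact fun h => ⟨_, .skip, h⟩

theorem run_set {x : Reg} {e : HExp} :
    Run P W M (.set x e) s Q ↔ e.ok W M s ∧ Q ((s.set x (e.val s)).tick (e.cost + 1)) := by
  constructor
  · rintro ⟨s', ⟨⟩, h⟩; exact ⟨by assumption, h⟩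
  · exact fun h => ⟨_, .set h.1, h.2⟩

theorem run_store {a e : HExp} :
    Run P W M (.store a e) s Q ↔ a.ok W M s ∧ e.ok W M s ∧ 0 ≤ a.val s ∧ a.val s < M ∧
      Q { s with
        mem := Function.update s.mem (a.val s) (e.val s), time := s.time + (a.cost + e.cost + 1) } := by
  constructor
  · rintro ⟨s', ⟨⟩, h⟩; exact ⟨by assumption, by assumption, by assumption, by assumption, h⟩
  · exact fun h => ⟨_, .store h.1 h.2.1 h.2.2.1 h.2.2.2.1, h.2.2.2.2⟩

theorem run_write {e : HExp} :
    Run P W M (.write e) s Q ↔ e.ok W M s ∧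
      Q { s with out := s.out ++ [e.val s], time := s.time + (e.cost + 1) } := by
  constructor
  · rintro ⟨s', ⟨⟩, h⟩; exact ⟨by assumption, h⟩
  · exact fun h => ⟨_, .write h.1, h.2⟩

theorem run_seq {c₁ c₂ : HCmd} :
    Run P W M (.seq c₁ c₂) s Q ↔ Run P W M c₁ s fun s' => Run P W M c₂ s' Q := by
  constructor
  · rintro ⟨s', h, hQ⟩
    cases h with
    | seq h₁ h₂ => exact ⟨_, h₁, _, h₂, hQ⟩
  · rintro ⟨_, h₁, _, h₂, hQ⟩; exact ⟨_, .seq h₁ h₂, hQ⟩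

theorem run_ite {e : HExp} {c₁ c₂ : HCmd} :
    Run P W M (.ite e c₁ c₂) s Q ↔ e.ok W M s ∧
      if 0 < e.val s then Run P W M c₁ (s.tick (e.cost + 1)) Q
      else Run P W M c₂ (s.tick (e.cost + 1)) Q := by
  constructor
  · rintro ⟨s', h, hQ⟩
    cases h with
    | ite_true h₁ h₂ h₃ => exact ⟨h₁, by rw [if_pos h₂]; exact ⟨_, h₃, hQ⟩⟩
    | ite_false h₁ h₂ h₃ => exact ⟨h₁, by rw [if_neg h₂]; exact ⟨_, h₃, hQ⟩⟩
  · rintro ⟨h₁, h₂⟩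
    split_ifs at h₂ with h
    · obtain ⟨_, h₃, hQ⟩ := h₂; exact ⟨_, .ite_true h₁ h h₃, hQ⟩
    · obtain ⟨_, h₃, hQ⟩ := h₂; exact ⟨_, .ite_false h₁ h h₃, hQ⟩

theorem run_loop {e : HExp} {c : HCmd} :
    Run P W M (.loop e c) s Q ↔ e.ok W M s ∧
      if 0 < e.val s then
        Run P W M c (s.tick (e.cost + 1)) fun s' => Run P W M (.loop e c) s' Q
      else Q (s.tick (e.cost + 1)) := by
  constructor
  · rintro ⟨s', h, hQ⟩
    cases h with
    | loop_true h₁ h₂ h₃ h₄ => exact ⟨h₁, by rw [if_pos h₂]; exact ⟨_, h₃, _, h₄, hQ⟩⟩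
    | loop_false h₁ h₂ => exact ⟨h₁, by rwa [if_neg h₂]⟩
  · rintro ⟨h₁, h₂⟩
    split_ifs at h₂ with h
    · obtain ⟨_, h₃, _, h₄, hQ⟩ := h₂; exact ⟨_, .loop_true h₁ h h₃ h₄, hQ⟩
    · exact ⟨_, .loop_false h₁ h, h₂⟩

theorem Run.call {f : ℕ} {c : HCmd} (hf : P[f]? = some c) (hM : 1 ≤ M)
    (h : Run P W (M - 1) c (s.tick 1) Q) : Run P W M (.call f) s Q := by
  obtain ⟨_, h, hQ⟩ := h
  exact ⟨_, .call hf hM h, hQ⟩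

theorem run_block_singleton {c : HCmd} : Run P W M (.block [c]) s Q ↔ Run P W M c s Q := Iff.rfl

theorem run_block_cons {c d : HCmd} {l : List HCmd} :
    Run P W M (.block (c :: d :: l)) s Q ↔
      Run P W M c s fun s' => Run P W M (.block (d :: l)) s' Q := run_seq

end Run

section Expressions

variable {W M : ℤ} {s : St} (e f : HExp)

theorem HExp.val_add : (e + f).val s = e.val s + f.val s := rfl
theorem HExp.val_sub : (e - f).val s = e.val s - f.val s := rfl
theorem HExp.val_mul : (e * f).val s = e.val s * f.val s := rfl
theorem HExp.cost_add : (e + f).cost = e.cost + (f.cost + 1) := rfl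
theorem HExp.cost_sub : (e - f).cost = e.cost + (f.cost + 1) := rfl
theorem HExp.cost_mul : (e * f).cost = e.cost + (f.cost + 1) := rfl

theorem HExp.ok_add : (e + f).ok W M s ↔ e.ok W M s ∧ f.ok W M s ∧
    -W ≤ e.val s + f.val s ∧ e.val s + f.val s ≤ W := Iff.rfl
theorem HExp.ok_sub : (e - f).ok W M s ↔ e.ok W M s ∧ f.ok W M s ∧
    -W ≤ e.val s - f.val s ∧ e.val s - f.val s ≤ W := Iff.rfl
theorem HExp.ok_mul : (e * f).ok W M s ↔ e.ok W M s ∧ f.ok W M s ∧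
    -W ≤ e.val s * f.val s ∧ e.val s * f.val s ≤ W := Iff.rfl

end Expressions

end RBG

namespace RBG

/-! ## The program -/

namespace Code

abbrev r : Reg → HExp := .reg
abbrev k : ℤ → HExp := .const
abbrev ld : HExp → HExp := .ld
abbrev lt : HExp → HExp → HExp := .lt

/-- The value is `1` if the two values are equal and `0` otherwise. -/
abbrev eqv (e f : HExp) : HExp := k 1 - lt e f - lt f e

/-- The address of the entry `e` of the table with number `j`. -/
abbrev tab (j : ℤ) (e : HExp) : HExp := k j * r .N + e

/-- A case distinction by the tag in the register `t`, which is `0` or greater for the first command,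
and decreases by one from command to command. -/
def cases : ℤ → List HCmd → HCmd → HCmd
  | _, [], d => d
  | j, c :: l, d => .ite (lt (k j) (r .t)) c (cases (j - 1) l d)

/-- Move `q` behind the arithmetic expression. -/
def skipExpr : HCmd := .block [
  .set .t (ld (r .q)),
  .ite (lt (k 2) (r .t))
    (.block [.set .q (r .q + k 1), .call 1, .call 1])
    (.set .q (r .q + k 2))]

/-- Move `q` behind the regular expression. -/
def skipRegex : HCmd := .block [
  .set .t (ld (r .q)),
  cases (-1) [
    .set .q (r .q + k 1),
    .block [.set .q (r .q + k 1), .call 2, .call 2],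
    .block [.set .q (r .q + k 1), .call 2, .call 2],
    .block [.set .q (r .q + k 1), .call 2],
    .set .q (r .q + k 2 + ld (r .q + k 1)),
    .set .q (r .q + k 2),
    .block [.set .q (r .q + k 2), .call 1],
    .block [.set .q (r .q + k 2), .call 1, .call 1],
    .set .q (r .q + k 2)]
    (.block [.set .q (r .q + k 1), .call 2])]

/-- Number a letter with continuation cell `c`. -/
def letter : HCmd := .block [
  .set .i (r .i + k 1),
  .store (tab 3 (r .q)) (r .i),
  .store (tab 4 (r .i)) (r .c)]

/-- Only when the first operand has been parsed is the beginning of the second known. The address of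
the operator waits on the stack meanwhile, and the continuation of the second operand, which is that
of the whole expression, is read again from table 1. -/
def parseSecond : HCmd := .block [
  .set .sp (r .sp - k 1),
  .set .p (ld (r .sp)),
  .store (tab 2 (r .p)) (r .q),
  .set .c (ld (tab 1 (r .p))),
  .call 3]

def parseSum : HCmd := .block [
  .store (r .sp) (r .q),
  .set .sp (r .sp + k 1),
  .set .q (r .q + k 1),
  .call 3,
  parseSecond]

/-- The first factor gets as continuation cell the entry of table 2 for the operator, although this
entry is filled only later, by `parseSecond`. -/
def parseCat : HCmd := .block [
  .store (r .sp) (r .q),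
  .set .sp (r .sp + k 1),
  .set .c (tab 2 (r .q)),
  .set .q (r .q + k 1),
  .call 3,
  parseSecond]

/-- Behind the body of a star comes the star itself, so its entry of table 2 is its own address. -/
def parseStar : HCmd := .block [
  .store (tab 2 (r .q)) (r .q),
  .set .c (tab 2 (r .q)),
  .set .q (r .q + k 1),
  .call 3]

/-- Reaching the end of a pattern is acceptance, hence the cell `7 * N`. The letters inside get
provisional numbers: afterwards `i` is reset to the number of the pattern itself, since the
numbering of the surrounding expression does not count them. -/
def parseCheck : HCmd := .block [
  letter,
  .store (r .sp) (r .q),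
  .set .sp (r .sp + k 1),
  .set .c (k 7 * r .N),
  .set .q (r .q + k 1),
  .call 3,
  .set .sp (r .sp - k 1),
  .set .p (ld (r .sp)),
  .store (tab 2 (r .p)) (r .q),
  .set .i (ld (tab 3 (r .p)))]

/-- Fill the tables for the regular expression at `q`, whose continuation cell is `c`. -/
def parse : HCmd := .block [
  .store (tab 1 (r .q)) (r .c),
  .set .t (ld (r .q)),
  cases (-1) [
    .block [letter, .set .q (r .q + k 1)],
    parseSum,
    parseCat,
    parseStar,
    .block [letter, .set .q (r .q + k 2 + ld (r .q + k 1))],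
    .block [letter, .set .q (r .q + k 2)],
    .block [letter, .set .q (r .q + k 2), .call 1],
    .block [letter, .set .q (r .q + k 2), .call 1, .call 1],
    .block [letter, .set .q (r .q + k 2)]]
    parseCheck]

/-- After a division by zero the evaluation continues with the value that the machine delivers, and
`er` remembers that the result is void. -/
def evalOp : HCmd :=
  .ite (lt (r .t) (k 4)) (.set .v (r .x + r .v)) <|
  .ite (lt (r .t) (k 5)) (.set .v (r .x - r .v)) <|
  .ite (lt (r .t) (k 6)) (.set .v (r .x * r .v)) <|
  .block [.ite (eqv (r .v) (k 0)) (.set .er (k 1)) .skip, .set .v (.bin .div (r .x) (r .v))]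

/-- Evaluate the arithmetic expression at `q`; `er` becomes `1` if it is undefined. -/
def eval : HCmd := .block [
  .set .t (ld (r .q)),
  .ite (lt (k 2) (r .t))
    (.block [
      .store (r .sp) (r .t),
      .set .sp (r .sp + k 1),
      .set .q (r .q + k 1),
      .call 4,
      .store (r .sp) (r .v),
      .set .sp (r .sp + k 1),
      .call 4,
      .set .sp (r .sp - k 2),
      .set .x (ld (r .sp + k 1)),
      .set .t (ld (r .sp)),
      evalOp])
    (.block [
      .set .v (ld (r .q + k 1)),
      .ite (lt (r .t) (k 1)) .skip <|
        .ite (lt (r .t) (k 2)) (.set .v (ld (r .VA + r .v))) (.set .v (ld (tab 6 (r .v)))),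
      .set .q (r .q + k 2)])]

/-- Visit the continuation of `p`. -/
def goOn : HCmd := .block [.set .p (ld (ld (tab 1 (r .p)))), .call 5]

def findEdge : HCmd := .loop (r .y) <| .block [
  .ite (eqv (ld (r .e)) (r .t)) (.set .x (ld (r .e + k 1))) .skip,
  .set .e (r .e + k 2),
  .set .y (r .y - k 1)]

def visitShift : HCmd := .block [
  .set .e (ld (tab 5 (r .s))),
  .set .y (ld (r .e)),
  .set .e (r .e + k 1),
  -- Vertices are numbered from 0, so -1 means that no edge has been found.
  .set .x (k (-1)),
  findEdge,
  .ite (lt (k (-1)) (r .x)) (.block [.set .s (r .x), goOn]) .skip]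

def saveNode : HCmd := .block [
  .store (r .sp) (r .p),
  .store (r .sp + k 1) (r .s),
  .set .sp (r .sp + k 2)]

def restoreNode : HCmd := .block [
  .set .sp (r .sp - k 2),
  .set .p (ld (r .sp)),
  .set .s (ld (r .sp + k 1))]

def visitSum : HCmd := .block [
  saveNode,
  .set .p (r .p + k 1),
  .call 5,
  restoreNode,
  .set .p (ld (tab 2 (r .p))),
  .call 5]

def visitCat : HCmd := .block [.set .p (r .p + k 1), .call 5]

def visitStar : HCmd := .block [
  saveNode,
  .set .p (r .p + k 1),
  .call 5,
  restoreNode,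
  goOn]

def findPiece : HCmd := .loop (r .c) <| .block [
  .ite (eqv (ld (r .e)) (r .x)) (.set .y (k 1)) .skip,
  .set .e (r .e + k 1),
  .set .c (r .c - k 1)]

def visitOn : HCmd := .block [
  .set .c (ld (r .p + k 1)),
  .set .x (ld (r .PA + r .s)),
  .set .e (r .p + k 2),
  .set .y (k 0),
  findPiece,
  .ite (r .y) goOn .skip]

/-- The piece `x` at the position `s` is replaced by `y`. -/
def setPiece (x y : Reg) : HCmd := .block [
  .store (tab 6 (r x)) (ld (tab 6 (r x)) - k 1),
  .store (tab 6 (r y)) (ld (tab 6 (r y)) + k 1),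
  .store (r .PA + r .s) (r y)]

/-- Position, old piece and node are saved because undoing the action needs them: the search does
not preserve `s` and `p`. The new piece is read again from the text. -/
def visitOff : HCmd := .block [
  .set .x (ld (r .PA + r .s)),
  .set .y (ld (r .p + k 1)),
  .store (r .sp) (r .s),
  .store (r .sp + k 1) (r .x),
  .store (r .sp + k 2) (r .p),
  .set .sp (r .sp + k 3),
  setPiece .x .y,
  .call 8,
  .set .sp (r .sp - k 3),
  .set .s (ld (r .sp)),
  .set .x (ld (r .sp + k 1)),
  .set .p (ld (r .sp + k 2)),
  .set .y (ld (r .p + k 1)),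
  setPiece .y .x]

def doAssign : HCmd := .block [
  .set .x (ld (r .VA + r .y)),
  .store (r .sp) (r .y),
  .store (r .sp + k 1) (r .x),
  .set .sp (r .sp + k 2),
  .store (r .VA + r .y) (r .v),
  .call 8,
  .set .sp (r .sp - k 2),
  .set .y (ld (r .sp)),
  .set .x (ld (r .sp + k 1)),
  .store (r .VA + r .y) (r .x)]

def visitAssign : HCmd := .block [
  .set .q (r .p + k 2),
  .set .er (k 0),
  .call 4,
  .set .y (ld (r .p + k 1)),
  .ite (r .er) .skip <| .ite (lt (r .v) (k 0)) .skip <|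
    .ite (lt (ld (r .BD + r .y)) (r .v)) .skip doAssign]

/-- Put the truth value of the comparison with code `t` of `x` and `v` into `y`. -/
def relation : HCmd :=
  .ite (lt (r .t) (k 1)) (.set .y (lt (r .x) (r .v))) <|
  .ite (lt (r .t) (k 2)) (.set .y (k 1 - lt (r .v) (r .x))) <|
  .ite (lt (r .t) (k 3)) (.set .y (eqv (r .x) (r .v))) <|
  .ite (lt (r .t) (k 4)) (.set .y (k 1 - eqv (r .x) (r .v))) <|
  .ite (lt (r .t) (k 5)) (.set .y (lt (r .v) (r .x))) (.set .y (k 1 - lt (r .x) (r .v)))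

def visitCompare : HCmd := .block [
  .set .q (r .p + k 2),
  .set .er (k 0),
  .call 4,
  .store (r .sp) (r .v),
  .set .sp (r .sp + k 1),
  .call 4,
  .set .sp (r .sp - k 1),
  .set .x (ld (r .sp)),
  .set .t (ld (r .p + k 1)),
  relation,
  .ite (r .er) .skip (.ite (r .y) goOn .skip)]

/-- A switch ends a move: the recorded modifiers are written, then the switch itself, then the end
mark. It is never applied, so nothing has to be undone. -/
def visitSwitch : HCmd := .block [
  .set .x (r .mv),
  .call 6,
  .write (ld (tab 3 (r .p))),
  .write (r .s),
  .write (k (-1))]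

/-- Decide whether the pattern at `p` has a valid sequence. -/
def match_ : HCmd := .block [
  .store (r .sp) (r .p),
  .store (r .sp + k 1) (r .s),
  .store (r .sp + k 2) (r .found),
  .set .sp (r .sp + k 3),
  -- The part of the current table that belongs to the text of the pattern. It is cleared at every
  -- evaluation, because earlier evaluations of the same pattern have left marks there.
  .set .a (r .vb + (r .p + k 1) * r .n),
  .set .b (r .vb + ld (tab 2 (r .p)) * r .n),
  .call 7,
  .set .found (k 0),
  .set .p (r .p + k 1),
  .call 5,
  .set .sp (r .sp - k 3),
  .set .p (ld (r .sp)),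
  .set .s (ld (r .sp + k 1)),
  .set .x (r .found),
  .set .found (ld (r .sp + k 2))]

def visitCheck : HCmd := .block [match_, .ite (r .x) goOn .skip]

def visitCheckNot : HCmd := .block [match_, .ite (r .x) .skip goOn]

def visitNode : HCmd := .block [
  .store (r .a) (k 1),
  .set .t (ld (r .p)),
  cases (-1) [visitShift, visitSum, visitCat, visitStar, visitOn, visitOff, visitAssign,
    visitCompare, visitSwitch, visitCheck] visitCheckNot]

/-- Depth first search from the node at `p` and the position `s`. -/
def visit : HCmd :=
  -- No node has the address 0; it stands for the end of the expression.
  .ite (r .p)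
    (.block [
      .set .a (r .vb + (r .p * r .n + r .s)),
      .ite (ld (r .a)) .skip visitNode])
    (.set .found (k 1))

/-- Write the modifiers that are recorded in the linked list `x`, the last one first. -/
def print : HCmd :=
  .ite (r .x)
    (.block [
      .store (r .sp) (r .x),
      .set .sp (r .sp + k 1),
      .set .x (ld (r .x + k 2)),
      .call 6,
      .set .sp (r .sp - k 1),
      .set .x (ld (r .sp)),
      .write (ld (r .x)),
      .write (ld (r .x + k 1))])
    .skip

/-- Clear the cells from `a` to `b - 1`. -/
def clear : HCmd := .loop (lt (r .a) (r .b)) <| .block [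
  .store (r .a) (k 0),
  .set .a (r .a + k 1)]

/-- Record the modifier at `p` and search on with a new table of visited nodes. -/
def descend : HCmd := .block [
  .store (r .sp) (ld (tab 3 (r .p))),
  .store (r .sp + k 1) (r .s),
  .store (r .sp + k 2) (r .mv),
  .store (r .sp + k 3) (r .vb),
  -- The record consists of four cells: number, position, previous record, previous table. The new
  -- table begins directly behind it.
  .set .mv (r .sp),
  .set .vb (r .sp + k 4),
  .set .a (r .vb),
  .set .b (r .vb + r .L * r .n),
  .set .sp (r .b),
  .call 7,
  goOn,
  .set .sp (r .mv),
  .set .vb (ld (r .sp + k 3)),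
  .set .mv (ld (r .sp + k 2))]

/-- Move `q` behind the edges of the next `x` vertices. -/
def skipEdges : HCmd := .loop (r .x) <| .block [
  .set .q (r .q + k 1 + k 2 * ld (r .q)),
  .set .x (r .x - k 1)]

def tableEdges : HCmd := .loop (lt (r .x) (r .n)) <| .block [
  .store (tab 5 (r .x)) (r .q),
  .set .q (r .q + k 1 + k 2 * ld (r .q)),
  .set .x (r .x + k 1)]

def countPieces : HCmd := .loop (lt (r .x) (r .n)) <| .block [
  .set .y (ld (r .PA + r .x)),
  .store (tab 6 (r .y)) (ld (tab 6 (r .y)) + k 1),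
  .set .x (r .x + k 1)]

/-- The input contains no addresses, so the places of its parts are found by passing over it once.
The number of variables, players included, is collected in `y`. -/
def readHeader : HCmd := .block [
  .set .y (ld (k 0)),
  .set .q (r .y + k 2),
  .set .x (ld (r .q)),
  .set .y (r .y + r .x),
  .set .q (r .q + r .x + k 1),
  .set .x (ld (r .q)),
  .set .q (r .q + r .x + k 1),
  .set .b (r .q),
  .call 2,
  .set .L (r .q),
  .set .n (ld (r .q)),
  .set .q (r .q + k 1),
  .set .x (r .n),
  skipEdges,
  .set .BD (r .q),
  -- Passed over are the bounds, the player, position, pieces and values of the initial semi-state,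
  -- and the index, player and position of the game state: two lists of variables, one of vertices
  -- and five single tokens.
  .set .PA (r .q + r .y + r .y + r .n + k 5),
  .set .VA (r .PA + r .n),
  .set .N (r .VA + r .y)]

def fillTables : HCmd := .block [
  .set .q (r .L + k 1),
  .set .x (k 0),
  tableEdges,
  .set .x (k 0),
  countPieces,
  -- The rules index 0 gets a cell containing the address of the rules, as if a letter with number 0
  -- preceded them.
  .store (k 7 * r .N + k 1) (r .b),
  .store (k 4 * r .N) (k 7 * r .N + k 1),
  .set .sp (k 7 * r .N + k 2),
  .set .q (r .b),
  .set .c (k 7 * r .N),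
  .call 3]

def search : HCmd := .block [
  -- Index, player and position of the game state directly precede its pieces. The index selects a
  -- continuation cell, and the cell holds the node where the search begins.
  .set .p (ld (ld (tab 4 (ld (r .PA - k 3))))),
  .set .s (ld (r .PA - k 1)),
  .set .vb (r .sp),
  .set .a (r .sp),
  .set .b (r .sp + r .L * r .n),
  .set .sp (r .b),
  .call 7,
  .call 5]

def main : HCmd := .block [readHeader, fillTables, search]

/-- The procedures of the program. -/
def procedures : List HCmd :=
  [main, skipExpr, skipRegex, parse, eval, visit, print, clear, descend]

end Code

end RBG

namespace RBG

/-! ## Regular expressions as stack machines -/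

section Machine

variable {β : Type}

/-- A step of the machine whose stack holds the expressions to be matched one after the other, not
reading a letter. -/
inductive MStep : List (Regex β) → List (Regex β) → Prop
  | sumL {E F : Regex β} {k : List (Regex β)} : MStep (.sum E F :: k) (E :: k)
  | sumR {E F : Regex β} {k : List (Regex β)} : MStep (.sum E F :: k) (F :: k)
  | cat {E F : Regex β} {k : List (Regex β)} : MStep (.cat E F :: k) (E :: F :: k)
  | starEnd {E : Regex β} {k : List (Regex β)} : MStep (.star E :: k) k
  | starGo {E : Regex β} {k : List (Regex β)} : MStep (.star E :: k) (E :: .star E :: k)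

/-- Runs of the machine that read a word. -/
inductive MRun : List (Regex β) → List β → List (Regex β) → Prop
  | refl {k : List (Regex β)} : MRun k [] k
  | step {k k' k'' : List (Regex β)} {w : List β} : MStep k k' → MRun k' w k'' → MRun k w k''
  | act {x : β} {k k' : List (Regex β)} {w : List β} :
      MRun k w k' → MRun (.act x :: k) (x :: w) k'

theorem MRun.trans {k k' k'' : List (Regex β)} {u v : List β} (h : MRun k u k')
    (h' : MRun k' v k'') : MRun k (u ++ v) k'' := by
  induction h with
  | refl => exact h'
  | step h₁ _ ih => exact .step h₁ (ih h')
  | act _ ih => exact .act (ih h')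

theorem MRun.split {k k'' : List (Regex β)} {w : List β} (h : MRun k w k'') :
    ∀ u v, w = u ++ v → ∃ k', MRun k u k' ∧ MRun k' v k'' := by
  induction h with
  | refl =>
    rintro u v h
    obtain ⟨rfl, rfl⟩ : u = [] ∧ v = [] := by simpa using h.symm
    exact ⟨_, .refl, .refl⟩
  | step h₁ _ ih =>
    rintro u v h
    obtain ⟨k', h₂, h₃⟩ := ih u v h
    exact ⟨k', .step h₁ h₂, h₃⟩
  | @act x k k' w h₁ ih =>
    rintro u v h
    cases u with
    | nil => subst h; exact ⟨_, .refl, .act h₁⟩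
    | cons y u =>
      obtain ⟨rfl, rfl⟩ : x = y ∧ w = u ++ v := by simpa using h
      obtain ⟨k', h₂, h₃⟩ := ih u v rfl
      exact ⟨k', .act h₂, h₃⟩

/-- The words that are matched by a stack. -/
def stackLang : List (Regex β) → Language β
  | [] => 1
  | E :: k => E.lang * stackLang k

theorem MStep.stackLang_le {k k' : List (Regex β)} (h : MStep k k') :
    ∀ w ∈ stackLang k', w ∈ stackLang k := by
  intro w hw
  cases h with
  | sumL => simp only [stackLang, Regex.lang, add_mul, Language.mem_add] at hw ⊢; exact .inl hw
  | sumR => simp only [stackLang, Regex.lang, add_mul, Language.mem_add] at hw ⊢; exact .inr hw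
  | cat => simpa only [stackLang, Regex.lang, mul_assoc] using hw
  | starEnd =>
    simp only [stackLang, Regex.lang]
    exact Language.mem_mul.2 ⟨[], Language.nil_mem_kstar _, w, hw, rfl⟩
  | @starGo E k =>
    simp only [stackLang, Regex.lang, ← mul_assoc] at hw ⊢
    have : E.lang * KStar.kstar E.lang ≤ KStar.kstar E.lang := mul_kstar_le_kstar
    exact mul_le_mul_left this _ hw

theorem MRun.append_mem {k k' : List (Regex β)} {u : List β} (h : MRun k u k') :
    ∀ v ∈ stackLang k', u ++ v ∈ stackLang k := by
  induction h with
  | refl => exact fun v hv => hv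
  | step h₁ _ ih => exact fun v hv => h₁.stackLang_le _ (ih v hv)
  | @act x k k' w _ ih =>
    exact fun v hv => Language.mem_mul.2 ⟨[x], rfl, w ++ v, ih v hv, rfl⟩

theorem mRun_of_mem {E : Regex β} {w : List β} (hw : w ∈ E.lang) (k : List (Regex β)) :
    MRun (E :: k) w k := by
  induction E generalizing w k with
  | act x => obtain rfl : w = [x] := hw; exact .act .refl
  | sum E F ihE ihF =>
    rcases hw with hw | hw
    · exact .step .sumL (ihE hw k)
    · exact .step .sumR (ihF hw k)
  | cat E F ihE ihF =>
    obtain ⟨u, hu, v, hv, rfl⟩ := Language.mem_mul.1 hw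
    exact .step .cat ((ihE hu _).trans (ihF hv k))
  | star E ih =>
    obtain ⟨l, rfl, hl⟩ := Language.mem_kstar.1 hw
    clear hw
    induction l with
    | nil => exact .step .starEnd .refl
    | cons u l ihl =>
      exact .step .starGo ((ih (hl u (by simp)) _).trans (ihl fun y hy => hl y (by simp [hy])))

theorem mem_stackLang_iff {k : List (Regex β)} {w : List β} : w ∈ stackLang k ↔ MRun k w [] := by
  constructor
  · intro hw
    induction k generalizing w with
    | nil => obtain rfl : w = [] := hw; exact .refl
    | cons E k ih =>
      obtain ⟨u, hu, v, hv, rfl⟩ := Language.mem_mul.1 hw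
      exact (mRun_of_mem hu k).trans (ih hv)
  · intro h
    simpa using h.append_mem [] rfl

theorem mem_lang_iff {E : Regex β} {w : List β} : w ∈ E.lang ↔ MRun [E] w [] := by
  rw [← mem_stackLang_iff]; simp [stackLang]

/-- Depends on the absence of a symbol for the empty language. Hence the stack machine has no dead
ends. -/
theorem Regex.exists_mem_lang (E : Regex β) : ∃ w, w ∈ E.lang := by
  induction E with
  | act x => exact ⟨[x], rfl⟩
  | sum E F ihE _ => exact ihE.imp fun w hw => Or.inl hw
  | cat E F ihE ihF =>
    obtain ⟨⟨u, hu⟩, ⟨v, hv⟩⟩ := ihE, ihF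
    exact ⟨u ++ v, Language.mem_mul.2 ⟨u, hu, v, hv, rfl⟩⟩
  | star E _ => exact ⟨[], Language.nil_mem_kstar _⟩

theorem exists_mRun_nil (k : List (Regex β)) : ∃ w, MRun k w [] := by
  induction k with
  | nil => exact ⟨[], .refl⟩
  | cons E k ih =>
    obtain ⟨u, hu⟩ := E.exists_mem_lang
    obtain ⟨v, hv⟩ := ih
    exact ⟨u ++ v, (mRun_of_mem hu k).trans hv⟩

theorem Regex.map_lang_number {α : Type} (E : Regex α) (n : ℕ) :
    Language.map Prod.snd (E.number n).lang = E.lang := by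
  induction E generalizing n with
  | act a => exact Set.image_singleton
  | sum E F ihE ihF => simp [Regex.number, Regex.lang, ihE, ihF]
  | cat E F ihE ihF => simp [Regex.number, Regex.lang, ihE, ihF]
  | star E ih => simp [Regex.number, Regex.lang, ih, Language.map_kstar]

end Machine

/-! ## Runs of the game -/

section Game

variable {σ : Sig}

/-- A stack of numbered expressions. -/
abbrev Stack (σ : Sig) : Type := List (Regex (ℕ × Action σ))

/-- The action sequences that are matched by a stack. -/
def actionLang (k : Stack σ) : Language (Action σ) := {u | ∃ w, MRun k w [] ∧ w.map Prod.snd = u}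

/-- Any partial run can be completed, as every stack can be emptied. Thus runs may be used wherever
prefixes of words are required. -/
theorem mem_pref_actionLang {k : Stack σ} {u : List (Action σ)} :
    u ∈ pref (actionLang k) ↔ ∃ w k', MRun k w k' ∧ w.map Prod.snd = u := by
  constructor
  · rintro ⟨v, w, hw, h⟩
    obtain ⟨w₁, w₂, rfl, h₁, h₂⟩ := List.map_eq_append_iff.1 h
    obtain ⟨k', h₃, _⟩ := hw.split _ _ rfl
    exact ⟨w₁, k', h₃, h₁⟩
  · rintro ⟨w, k', hw, rfl⟩
    obtain ⟨v, hv⟩ := exists_mRun_nil k'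
    exact ⟨v.map Prod.snd, w ++ v, hw.trans hv, by simp⟩

/-- The offset `n` plays no role for the actions, so the provisional numbers of letters in patterns
do no harm. -/
theorem actionLang_number (M : Regex (Action σ)) (n : ℕ) :
    actionLang [M.number n] = M.lang := by
  rw [← M.map_lang_number n]
  ext u
  simp only [← mem_lang_iff, actionLang]
  rfl

/-- The stack matches a valid sequence without switches. -/
def Accepts (B : Inst σ) (k : Stack σ) (S : SemiState σ) : Prop :=
  ∃ w, MRun k w [] ∧ (∀ b ∈ w, ¬ b.2.IsSwitch) ∧ B.ValidSeq S (w.map Prod.snd)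

/-- The moves that are defined by valid sequences matched by the stack. -/
def MoveFrom (B : Inst σ) (k : Stack σ) (S : SemiState σ) (m : Move σ) : Prop :=
  ∃ w k', MRun k w k' ∧ IsMoveSeq w ∧ B.ValidSeq S (w.map Prod.snd) ∧ moveOf B S w = m

/-- The next move sequences consist of at most `j` modifiers, and a switch. -/
def Budget (B : Inst σ) (k : Stack σ) (S : SemiState σ) (j : ℕ) : Prop :=
  ∀ f, B.App S (actionLang k) f → (∀ a ∈ f, ¬ a.IsSwitch) → f.countP Action.isModifier ≤ j

/-- A step of the game that is not a modifier. -/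
inductive EStep (B : Inst σ) : Stack σ × SemiState σ → Stack σ × SemiState σ → Prop
  | step {k k' : Stack σ} {S : SemiState σ} : MStep k k' → EStep B (k, S) (k', S)
  | act {i : ℕ} {a : Action σ} {k : Stack σ} {S : SemiState σ} :
      a.isModifier = false → B.Valid a S → EStep B (.act (i, a) :: k, S) (k, B.apply S a)

/-- A modifier is the next action, and it leads to acceptance. -/
def AcceptsAt (B : Inst σ) (k : Stack σ) (S : SemiState σ) : Prop :=
  ∃ i a k', k = .act (i, a) :: k' ∧ a.isModifier = true ∧ ¬ a.IsSwitch ∧ B.Valid a S ∧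
    Accepts B k' (B.apply S a)

/-- A modifier is the next action, and `m` is a move that begins with it. -/
def EmitsAt (B : Inst σ) (k : Stack σ) (S : SemiState σ) (m : Move σ) : Prop :=
  ∃ i a k' m', k = .act (i, a) :: k' ∧ a.isModifier = true ∧ B.Valid a S ∧ m = (i, S.pos) :: m' ∧
    (a.IsSwitch ∧ m' = [] ∨ ¬ a.IsSwitch ∧ MoveFrom B k' (B.apply S a) m')

variable {B : Inst σ}

theorem not_isSwitch_of_isModifier {a : Action σ} (h : a.isModifier = false) : ¬ a.IsSwitch := by
  cases a <;> simp_all [Action.isModifier, Action.IsSwitch]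

theorem EStep.accepts {c c' : Stack σ × SemiState σ} (h : EStep B c c')
    (h' : Accepts B c'.1 c'.2) : Accepts B c.1 c.2 := by
  obtain ⟨w, h₁, h₂, h₃⟩ := h'
  cases h with
  | step hs => exact ⟨w, .step hs h₁, h₂, h₃⟩
  | @act i a k S ha hv =>
    refine ⟨(i, a) :: w, .act h₁, ?_, hv, h₃⟩
    rintro b hb
    rcases List.mem_cons.1 hb with rfl | hb
    · exact not_isSwitch_of_isModifier ha
    · exact h₂ b hb

theorem isMoveSeq_cons {b : ℕ × Action σ} {w : List (ℕ × Action σ)} (hb : ¬ b.2.IsSwitch) :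
    IsMoveSeq (b :: w) ↔ IsMoveSeq w := by
  constructor
  · rintro ⟨u, i, p, h, hu⟩
    cases u with
    | nil =>
      obtain ⟨rfl, _⟩ : b = (i, .switch p) ∧ w = [] := by simpa using h
      exact absurd trivial hb
    | cons c u =>
      obtain ⟨rfl, rfl⟩ : b = c ∧ w = u ++ [(i, .switch p)] := by simpa using h
      exact ⟨u, i, p, rfl, fun d hd => hu d (by simp [hd])⟩
  · rintro ⟨u, i, p, rfl, hu⟩
    refine ⟨b :: u, i, p, rfl, ?_⟩
    rintro d hd
    rcases List.mem_cons.1 hd with rfl | hd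
    · exact hb
    · exact hu d hd

theorem isMoveSeq_switch {i : ℕ} {a : Action σ} {w : List (ℕ × Action σ)} (ha : a.IsSwitch) :
    IsMoveSeq ((i, a) :: w) ↔ w = [] := by
  constructor
  · rintro ⟨u, i', p, h, hu⟩
    cases u with
    | nil => simpa using (List.cons.inj h).2
    | cons c u =>
      obtain ⟨rfl, _⟩ := List.cons.inj h
      exact absurd ha (hu (i, a) (by simp))
  · rintro rfl
    cases a <;> simp only [Action.IsSwitch] at ha
    exact ⟨[], i, _, rfl, by simp⟩

theorem EStep.moveFrom {c c' : Stack σ × SemiState σ} (h : EStep B c c') {m : Move σ}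
    (h' : MoveFrom B c'.1 c'.2 m) : MoveFrom B c.1 c.2 m := by
  obtain ⟨w, k', h₁, h₂, h₃, h₄⟩ := h'
  cases h with
  | step hs => exact ⟨w, k', .step hs h₁, h₂, h₃, h₄⟩
  | @act i a k S ha hv =>
    exact ⟨(i, a) :: w, k', .act h₁, (isMoveSeq_cons (not_isSwitch_of_isModifier ha)).2 h₂,
      ⟨hv, h₃⟩, by simpa [moveOf, ha] using h₄⟩

theorem AcceptsAt.accepts {k : Stack σ} {S : SemiState σ} (h : AcceptsAt B k S) :
    Accepts B k S := by
  obtain ⟨i, a, k', rfl, _, h₂, h₃, w, h₄, h₅, h₆⟩ := h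
  refine ⟨(i, a) :: w, .act h₄, ?_, h₃, h₆⟩
  rintro b hb
  rcases List.mem_cons.1 hb with rfl | hb
  · exact h₂
  · exact h₅ b hb

theorem EmitsAt.moveFrom {k : Stack σ} {S : SemiState σ} {m : Move σ} (h : EmitsAt B k S m) :
    MoveFrom B k S m := by
  obtain ⟨i, a, k', m', rfl, h₁, h₂, rfl, ⟨h₃, rfl⟩ | ⟨h₃, w, k'', h₄, h₅, h₆, h₇⟩⟩ := h
  · exact ⟨[(i, a)], k', .act .refl, (isMoveSeq_switch h₃).2 rfl, ⟨h₂, trivial⟩, by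
      simp [moveOf, h₁]⟩
  · exact ⟨(i, a) :: w, k'', .act h₄, (isMoveSeq_cons h₃).2 h₅, ⟨h₂, h₆⟩, by
      simp [moveOf, h₁, h₇]⟩

/-- Acceptance, in terms of the configurations that are reached without modifiers. -/
theorem accepts_iff {c : Stack σ × SemiState σ} :
    Accepts B c.1 c.2 ↔ ∃ c', Relation.ReflTransGen (EStep B) c c' ∧
      (c'.1 = [] ∨ AcceptsAt B c'.1 c'.2) := by
  constructor
  · obtain ⟨k, S⟩ := c
    rintro ⟨w, h₁ : MRun k w [], h₂, h₃⟩
    generalize hk : ([] : Stack σ) = k' at h₁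
    induction h₁ generalizing S with
    | @refl k => exact ⟨(k, S), .refl, .inl rfl⟩
    | step hs _ ih =>
      obtain ⟨c', h₄, h₅⟩ := ih S h₂ h₃ hk
      exact ⟨c', .head (.step hs) h₄, h₅⟩
    | @act x k k' w h ih =>
      obtain ⟨i, a⟩ := x
      subst hk
      have h₂' : ∀ b ∈ w, ¬ b.2.IsSwitch := fun b hb => h₂ b (by simp [hb])
      cases ha : a.isModifier with
      | false =>
        obtain ⟨c', h₄, h₅⟩ := ih _ h₂' h₃.2 rfl
        exact ⟨c', .head (.act ha h₃.1) h₄, h₅⟩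
      | true =>
        exact ⟨_, .refl, .inr ⟨i, a, k, rfl, ha, h₂ (i, a) (by simp), h₃.1, w, h, h₂', h₃.2⟩⟩
  · rintro ⟨c', h₁, h₂⟩
    have h₃ : Accepts B c'.1 c'.2 := by
      rcases h₂ with h₂ | h₂
      · exact ⟨[], h₂ ▸ .refl, by simp, trivial⟩
      · exact h₂.accepts
    clear h₂
    induction h₁ using Relation.ReflTransGen.head_induction_on with
    | refl => exact h₃
    | head h _ ih => exact h.accepts ih

/-- The moves, in terms of the configurations that are reached without modifiers. -/
theorem moveFrom_iff {c : Stack σ × SemiState σ} {m : Move σ} :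
    MoveFrom B c.1 c.2 m ↔ ∃ c', Relation.ReflTransGen (EStep B) c c' ∧ EmitsAt B c'.1 c'.2 m := by
  constructor
  · obtain ⟨k, S⟩ := c
    rintro ⟨w, k', h₁ : MRun k w k', h₂, h₃, h₄⟩
    induction h₁ generalizing S with
    | refl => obtain ⟨u, i, p, h, _⟩ := h₂; simp at h
    | step hs _ ih =>
      obtain ⟨c', h₄, h₅⟩ := ih S h₂ h₃ h₄
      exact ⟨c', .head (.step hs) h₄, h₅⟩
    | @act x k k' w h ih =>
      obtain ⟨i, a⟩ := x
      cases ha : a.isModifier with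
      | false =>
        obtain ⟨c', h₄, h₅⟩ := ih (B.apply S a)
          ((isMoveSeq_cons (not_isSwitch_of_isModifier ha)).1 h₂) h₃.2
          (by simpa [moveOf, ha] using h₄)
        exact ⟨c', .head (.act ha h₃.1) h₄, h₅⟩
      | true =>
        refine ⟨_, .refl, i, a, k, moveOf B (B.apply S a) w, rfl, ha, h₃.1,
          by simpa [moveOf, ha] using h₄.symm, ?_⟩
        by_cases hs : a.IsSwitch
        · obtain rfl := (isMoveSeq_switch hs).1 h₂
          exact .inl ⟨hs, rfl⟩
        · exact .inr ⟨hs, w, k', h, (isMoveSeq_cons hs).1 h₂, h₃.2, rfl⟩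
  · rintro ⟨c', h₁, h₂⟩
    have h₃ := h₂.moveFrom
    clear h₂
    induction h₁ using Relation.ReflTransGen.head_induction_on with
    | refl => exact h₃
    | head h _ ih => exact h.moveFrom ih

theorem App.mono {S : SemiState σ} {L L' : Language (Action σ)} (hL : ∀ u ∈ L, u ∈ L')
    {v : List (Action σ)} (h : B.App S L v) : B.App S L' v := by
  have hp : ∀ u ∈ pref L, u ∈ pref L' := fun u ⟨v, hv⟩ => ⟨v, hL _ hv⟩
  cases h with
  | base h₁ h₂ => exact .base (hp _ h₁) h₂
  | enter h₁ h₂ h₃ h₄ => exact .enter (hp _ h₁) h₂ (h₃.imp (hp _) (hp _)) h₄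

theorem App.cons {S : SemiState σ} {L L' : Language (Action σ)} {a : Action σ}
    (hL : ∀ u ∈ L, a :: u ∈ L') (ha : B.Valid a S) {v : List (Action σ)}
    (h : B.App (B.apply S a) L v) : B.App S L' (a :: v) := by
  have hp : ∀ u ∈ pref L, a :: u ∈ pref L' := fun u ⟨v, hv⟩ => ⟨v, hL _ hv⟩
  cases h with
  | base h₁ h₂ => exact .base (hp _ h₁) ⟨ha, h₂⟩
  | @enter _ _ u v M h₁ h₂ h₃ h₄ =>
    exact .enter (u := a :: u) (hp _ h₁) ⟨ha, h₂⟩ (h₃.imp (hp _) (hp _)) h₄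

theorem Budget.step {k k' : Stack σ} {S : SemiState σ} {j : ℕ} (h : Budget B k S j)
    (hs : MStep k k') : Budget B k' S j :=
  fun f hf => h f (App.mono (L := actionLang k') (by rintro _ ⟨w, hw, h⟩; exact ⟨w, .step hs hw, h⟩) hf)

theorem Budget.act {i : ℕ} {a : Action σ} {k : Stack σ} {S : SemiState σ} {j : ℕ}
    (h : Budget B (.act (i, a) :: k) S j) (ha : a.isModifier = false) (hv : B.Valid a S) :
    Budget B k (B.apply S a) j := by
  intro f hf hs
  have := h (a :: f) (App.cons (L := actionLang k) (by rintro u ⟨w, hw, h⟩; exact ⟨(i, a) :: w, .act hw, by simp [h]⟩) hv hf) (by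
    simpa using ⟨not_isSwitch_of_isModifier ha, hs⟩)
  simpa [ha] using this

theorem EStep.budget {c c' : Stack σ × SemiState σ} (h : EStep B c c') {j : ℕ}
    (hb : Budget B c.1 c.2 j) : Budget B c'.1 c'.2 j := by
  cases h with
  | step hs => exact hb.step hs
  | act ha hv => exact hb.act ha hv

/-- Prefixing the modifier to a word of the application language behind it gives a word of the
application language in front of it, with one modifier more. -/
theorem Budget.modifier {i : ℕ} {a : Action σ} {k : Stack σ} {S : SemiState σ} {j : ℕ}
    (h : Budget B (.act (i, a) :: k) S j) (ha : a.isModifier = true) (hs : ¬ a.IsSwitch)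
    (hv : B.Valid a S) : ∃ j', j = j' + 1 ∧ Budget B k (B.apply S a) j' := by
  have key : ∀ f, B.App (B.apply S a) (actionLang k) f → (∀ a ∈ f, ¬ a.IsSwitch) →
      f.countP Action.isModifier + 1 ≤ j := by
    intro f hf hs'
    have := h (a :: f) (App.cons (L := actionLang k) (by rintro u ⟨w, hw, h⟩; exact ⟨(i, a) :: w, .act hw, by simp [h]⟩) hv hf)
      (by simpa using ⟨hs, hs'⟩)
    simpa [ha] using this
  -- The empty word behind the modifier shows that `j` is positive.
  have h0 := key [] (.base (mem_pref_actionLang.2 ⟨[], k, .refl, rfl⟩) trivial) (by simp)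
  exact ⟨j - 1, by simp at h0; omega, fun f hf hs' => by have := key f hf hs'; omega⟩

/-- Here the constructor `enter` of the application language is used: the attempts made inside a
pattern count towards the same budget. -/
theorem Budget.pattern {i : ℕ} {a : Action σ} {M : Regex (Action σ)} {k : Stack σ}
    {S : SemiState σ} {j : ℕ} (h : Budget B (.act (i, a) :: k) S j)
    (ha : a = .check M ∨ a = .checkNot M) (n : ℕ) : Budget B [M.number n] S j := by
  intro f hf hs
  rw [actionLang_number] at hf
  have hp : [a] ∈ pref (actionLang (.act (i, a) :: k)) :=
    mem_pref_actionLang.2 ⟨[(i, a)], k, .act .refl, rfl⟩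
  refine h f (Inst.App.enter (u := []) (M := M)
    (mem_pref_actionLang.2 ⟨[], _, .refl, rfl⟩) trivial ?_ hf) hs
  rcases ha with rfl | rfl
  · exact .inl hp
  · exact .inr hp

mutual

theorem Action.switchFree_of_wf (a : Action σ) (h : a.WF false) : ¬ a.IsSwitch := by
  cases a <;> simp_all [Action.WF, Action.IsSwitch]

theorem exprWF.switchFree (M : Regex (Action σ)) (h : exprWF M false) {w : List (Action σ)}
    (hw : w ∈ M.lang) : ∀ a ∈ w, ¬ a.IsSwitch := by
  induction M generalizing w with
  | act a =>
    obtain rfl : w = [a] := hw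
    simpa using Action.switchFree_of_wf a h
  | sum E F ihE ihF =>
    rcases hw with hw | hw
    · exact ihE h.1 hw
    · exact ihF h.2 hw
  | cat E F ihE ihF =>
    obtain ⟨u, hu, v, hv, rfl⟩ := Language.mem_mul.1 hw
    intro a ha
    rcases List.mem_append.1 ha with ha | ha
    · exact ihE h.1 hu a ha
    · exact ihF h.2 hv a ha
  | star E ih =>
    obtain ⟨l, rfl, hl⟩ := Language.mem_kstar.1 hw
    intro a ha
    obtain ⟨u, hu, ha⟩ := List.mem_flatten.1 ha
    exact ih h (hl u hu) a ha

end

/-- Even an incomplete run is covered, since it extends to a word of the language. -/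
theorem switchFree_of_mRun {M : Regex (Action σ)} {n : ℕ} (h : exprWF M false)
    {w : List (ℕ × Action σ)} {k' : Stack σ} (hw : MRun [M.number n] w k') :
    ∀ b ∈ w, ¬ b.2.IsSwitch := by
  obtain ⟨v, hv⟩ := exists_mRun_nil k'
  have h₁ : (w ++ v).map Prod.snd ∈ M.lang := by
    rw [← actionLang_number M n]; exact ⟨_, hw.trans hv, rfl⟩
  intro b hb
  exact exprWF.switchFree M h h₁ b.2 (List.mem_map.2 ⟨b, by simp [hb], rfl⟩)

theorem valid_check_iff_accepts {M : Regex (Action σ)} (n : ℕ) (h : exprWF M false)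
    {S : SemiState σ} : B.Valid (.check M) S ↔ Accepts B [M.number n] S := by
  rw [Inst.valid_check, ← actionLang_number M n]
  constructor
  · rintro ⟨_, ⟨w, hw, rfl⟩, hv⟩
    exact ⟨w, hw, switchFree_of_mRun h hw, hv⟩
  · rintro ⟨w, hw, _, hv⟩
    exact ⟨_, ⟨w, hw, rfl⟩, hv⟩

theorem valid_checkNot_iff_accepts {M : Regex (Action σ)} (n : ℕ) (h : exprWF M false)
    {S : SemiState σ} : B.Valid (.checkNot M) S ↔ ¬ Accepts B [M.number n] S := by
  rw [← valid_check_iff_accepts n h]; simp only [Inst.Valid]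

/-- Guarantees that the search in a pattern writes nothing. -/
theorem not_moveFrom_of_switchFree {M : Regex (Action σ)} {n : ℕ} (h : exprWF M false)
    {S : SemiState σ} {m : Move σ} : ¬ MoveFrom B [M.number n] S m := by
  rintro ⟨w, k', h₁, ⟨u, i, p, rfl, _⟩, _⟩
  exact switchFree_of_mRun h h₁ (i, .switch p) (by simp) trivial

/-- All variables respect their bounds. -/
def SemiState.Bounded (B : Inst σ) (S : SemiState σ) : Prop := ∀ v, S.value v ≤ B.bound v

theorem SemiState.Bounded.apply {S : SemiState σ} (h : S.Bounded B) {a : Action σ}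
    (ha : B.Valid a S) : (B.apply S a).Bounded B := by
  cases a with
  | assign v e =>
    intro u
    obtain ⟨z, h₁, h₂, h₃⟩ := ha
    simp only [Inst.apply, h₁, Option.getD_some, Function.update_apply]
    split_ifs with hu
    · subst hu; omega
    · exact h u
  | _ => exact h

end Game

end RBG

namespace RBG

/-! ## The nodes of an expression and their addresses in the text -/

variable {σ : Sig}

/-- Numbered regular expressions. -/
abbrev NRegex (σ : Sig) : Type := Regex (ℕ × Action σ)

/-- The length of the text of an expression. -/
def exprLen (E : Regex (Action σ)) : ℤ := (exprText E).length

/-- The length of the text of a numbered expression. -/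
def nlen : NRegex σ → ℤ
  | .act x => x.2.text.length
  | .sum E F => 1 + nlen E + nlen F
  | .cat E F => 1 + nlen E + nlen F
  | .star E => 1 + nlen E

/-- The text of a numbered expression. -/
def ntext : NRegex σ → List ℤ
  | .act x => x.2.text
  | .sum E F => -1 :: (ntext E ++ ntext F)
  | .cat E F => -2 :: (ntext E ++ ntext F)
  | .star E => -3 :: ntext E

theorem length_ntext (H : NRegex σ) : ((ntext H).length : ℤ) = nlen H := by
  induction H with
  | act x => rfl
  | sum E F ihE ihF => simp [ntext, nlen, ← ihE, ← ihF]; ring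
  | cat E F ihE ihF => simp [ntext, nlen, ← ihE, ← ihF]; ring
  | star E ih => simp [ntext, nlen, ← ih]; ring

theorem ntext_number (E : Regex (Action σ)) (n : ℕ) : ntext (E.number n) = exprText E := by
  induction E generalizing n with
  | act a => rfl
  | sum E F ihE ihF => simp [ntext, Regex.number, exprText, ihE, ihF]
  | cat E F ihE ihF => simp [ntext, Regex.number, exprText, ihE, ihF]
  | star E ih => simp [ntext, Regex.number, exprText, ih]

theorem nlen_number (E : Regex (Action σ)) (n : ℕ) : nlen (E.number n) = exprLen E := by
  rw [← length_ntext, ntext_number]; rfl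

theorem Action.one_le_length_text (a : Action σ) : 1 ≤ a.text.length := by
  cases a <;> simp [Action.text]

theorem one_le_nlen (H : NRegex σ) : 1 ≤ nlen H := by
  induction H with
  | act x => have := x.2.one_le_length_text; simp only [nlen]; omega
  | sum E F ihE ihF => simp only [nlen]; omega
  | cat E F ihE ihF => simp only [nlen]; omega
  | star E ih => simp only [nlen]; omega

/-- The memory holds the list from the address `p` on. -/
def HasText (mem : ℤ → ℤ) : ℤ → List ℤ → Prop
  | _, [] => True
  | p, x :: l => mem p = x ∧ HasText mem (p + 1) l

theorem hasText_append {mem : ℤ → ℤ} {p : ℤ} {l l' : List ℤ} :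
    HasText mem p (l ++ l') ↔ HasText mem p l ∧ HasText mem (p + l.length) l' := by
  induction l generalizing p with
  | nil => simp [HasText]
  | cons x l ih =>
    have : p + 1 + (l.length : ℤ) = p + ((l.length + 1 : ℕ) : ℤ) := by push_cast; ring
    simp [HasText, ih, and_assoc, this]

theorem HasText.congr {mem mem' : ℤ → ℤ} {p : ℤ} {l : List ℤ} (h : HasText mem p l)
    (hm : ∀ a, p ≤ a → a < p + l.length → mem' a = mem a) : HasText mem' p l := by
  induction l generalizing p with
  | nil => trivial
  | cons x l ih =>
    simp only [List.length_cons, Nat.cast_add, Nat.cast_one] at hm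
    exact ⟨(hm p le_rfl (by omega)).trans h.1,
      ih h.2 fun a h1 h2 => hm a (by omega) (by omega)⟩

/-- A node: an occurrence of an expression, with its address, the stack of the expressions that
follow, and the cell that holds the address where they begin. -/
structure Node (σ : Sig) where
  addr : ℤ
  expr : NRegex σ
  cont : Stack σ
  cell : ℤ

/-- The stack to be matched from the node on. -/
def Node.stack (z : Node σ) : Stack σ := z.expr :: z.cont

/-- The nodes of an expression at the address `p` that is followed by the stack `k` with the cell
`c`, outside patterns. -/
def NodeAt (N : ℤ) : NRegex σ → ℤ → Stack σ → ℤ → Node σ → Prop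
  | .act x, p, k, c, z => z = ⟨p, .act x, k, c⟩
  | .sum E F, p, k, c, z => z = ⟨p, .sum E F, k, c⟩ ∨ NodeAt N E (p + 1) k c z ∨
      NodeAt N F (p + 1 + nlen E) k c z
  | .cat E F, p, k, c, z => z = ⟨p, .cat E F, k, c⟩ ∨ NodeAt N E (p + 1) (F :: k) (2 * N + p) z ∨
      NodeAt N F (p + 1 + nlen E) k c z
  | .star E, p, k, c, z => z = ⟨p, .star E, k, c⟩ ∨
      NodeAt N E (p + 1) (.star E :: k) (2 * N + p) z

theorem NodeAt.root (N : ℤ) (H : NRegex σ) (p : ℤ) (k : Stack σ) (c : ℤ) :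
    NodeAt N H p k c ⟨p, H, k, c⟩ := by
  cases H <;> simp [NodeAt]

theorem NodeAt.trans {N : ℤ} {H : NRegex σ} {p c : ℤ} {k : Stack σ} {z z' : Node σ}
    (h : NodeAt N H p k c z) (h' : NodeAt N z.expr z.addr z.cont z.cell z') :
    NodeAt N H p k c z' := by
  induction H generalizing p k c with
  | act x => obtain rfl := h; exact h'
  | sum E F ihE ihF =>
    rcases h with rfl | h | h
    · exact h'
    · exact .inr (.inl (ihE h))
    · exact .inr (.inr (ihF h))
  | cat E F ihE ihF =>
    rcases h with rfl | h | h
    · exact h'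
    · exact .inr (.inl (ihE h))
    · exact .inr (.inr (ihF h))
  | star E ih =>
    rcases h with rfl | h
    · exact h'
    · exact .inr (ih h)

theorem NodeAt.range {N : ℤ} {H : NRegex σ} {p c : ℤ} {k : Stack σ} {z : Node σ}
    (h : NodeAt N H p k c z) : p ≤ z.addr ∧ z.addr + nlen z.expr ≤ p + nlen H := by
  induction H generalizing p k c with
  | act x => obtain rfl := h; exact ⟨le_rfl, le_rfl⟩
  | sum E F ihE ihF =>
    have hE := one_le_nlen E
    have hF := one_le_nlen F
    rcases h with rfl | h | h
    · exact ⟨le_rfl, le_rfl⟩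
    · have := ihE h; simp only [nlen]; omega
    · have := ihF h; simp only [nlen]; omega
  | cat E F ihE ihF =>
    have hE := one_le_nlen E
    have hF := one_le_nlen F
    rcases h with rfl | h | h
    · exact ⟨le_rfl, le_rfl⟩
    · have := ihE h; simp only [nlen]; omega
    · have := ihF h; simp only [nlen]; omega
  | star E ih =>
    rcases h with rfl | h
    · exact ⟨le_rfl, le_rfl⟩
    · have := ih h; simp only [nlen]; omega

theorem NodeAt.lt {N : ℤ} {H : NRegex σ} {p c : ℤ} {k : Stack σ} {z : Node σ}
    (h : NodeAt N H p k c z) : p ≤ z.addr ∧ z.addr < p + nlen H := by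
  have := h.range
  have := one_le_nlen z.expr
  omega

/-- Operands occupy disjoint intervals of the text behind their operator. So addresses can serve as
keys in the table of visited nodes. -/
theorem NodeAt.unique {N : ℤ} {H : NRegex σ} {p c : ℤ} {k : Stack σ} {z z' : Node σ}
    (h : NodeAt N H p k c z) (h' : NodeAt N H p k c z') (hz : z.addr = z'.addr) : z = z' := by
  induction H generalizing p k c with
  | act x => exact (show z = _ from h).trans (show z' = _ from h').symm
  | sum E F ihE ihF =>
    rcases h with rfl | h | h <;> rcases h' with rfl | h' | h'
    · rfl
    all_goals try exact ihE h h'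
    all_goals try exact ihF h h'
    all_goals
      exfalso
      try have := h.lt
      try have := h'.lt
      have := one_le_nlen E
      try dsimp only at *
      omega
  | cat E F ihE ihF =>
    rcases h with rfl | h | h <;> rcases h' with rfl | h' | h'
    · rfl
    all_goals try exact ihE h h'
    all_goals try exact ihF h h'
    all_goals
      exfalso
      try have := h.lt
      try have := h'.lt
      have := one_le_nlen E
      try dsimp only at *
      omega
  | star E ih =>
    rcases h with rfl | h <;> rcases h' with rfl | h'
    · rfl
    all_goals try exact ih h h'
    all_goals
      exfalso
      try have := h.lt
      try have := h'.lt
      try dsimp only at *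
      omega

/-- No node lies inside the text of a letter. -/
theorem NodeAt.not_inside {N : ℤ} {H : NRegex σ} {p c : ℤ} {k : Stack σ} {z z' : Node σ}
    {x : ℕ × Action σ} (h : NodeAt N H p k c z) (hx : z.expr = .act x)
    (h' : NodeAt N H p k c z') : z'.addr ≤ z.addr ∨ z.addr + nlen z.expr ≤ z'.addr := by
  induction H generalizing p k c with
  | act x => obtain rfl := h; obtain rfl := h'; exact .inl le_rfl
  | sum E F ihE ihF =>
    rcases h with rfl | h | h <;> rcases h' with rfl | h' | h'
    any_goals simp at hx
    all_goals try exact ihE h h'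
    all_goals try exact ihF h h'
    all_goals
      have h₁ := h.range
      try have h₂ := h'.range
      have := one_le_nlen z.expr
      try have := one_le_nlen z'.expr
      have := one_le_nlen E
      try dsimp only at *
      omega
  | cat E F ihE ihF =>
    rcases h with rfl | h | h <;> rcases h' with rfl | h' | h'
    any_goals simp at hx
    all_goals try exact ihE h h'
    all_goals try exact ihF h h'
    all_goals
      have h₁ := h.range
      try have h₂ := h'.range
      have := one_le_nlen z.expr
      try have := one_le_nlen z'.expr
      have := one_le_nlen E
      try dsimp only at *
      omega
  | star E ih =>
    rcases h with rfl | h <;> rcases h' with rfl | h'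
    any_goals simp at hx
    all_goals try exact ih h h'
    all_goals
      have h₁ := h.range
      try dsimp only at *
      omega

theorem NodeAt.hasText {N : ℤ} {H : NRegex σ} {p c : ℤ} {k : Stack σ} {z : Node σ}
    (h : NodeAt N H p k c z) {mem : ℤ → ℤ} (ht : HasText mem p (ntext H)) :
    HasText mem z.addr (ntext z.expr) := by
  induction H generalizing p k c with
  | act x => obtain rfl := h; exact ht
  | sum E F ihE ihF =>
    rcases h with rfl | h | h
    · exact ht
    · exact ihE h (hasText_append.1 ht.2).1
    · exact ihF h (by simpa [length_ntext] using (hasText_append.1 ht.2).2)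
  | cat E F ihE ihF =>
    rcases h with rfl | h | h
    · exact ht
    · exact ihE h (hasText_append.1 ht.2).1
    · exact ihF h (by simpa [length_ntext] using (hasText_append.1 ht.2).2)
  | star E ih =>
    rcases h with rfl | h
    · exact ht
    · exact ih h ht.2

theorem NodeAt.reach {N : ℤ} {H : NRegex σ} {p c : ℤ} {k : Stack σ} {z : Node σ}
    (h : NodeAt N H p k c z) : ∃ u, MRun (H :: k) u z.stack := by
  induction H generalizing p k c with
  | act x => obtain rfl := h; exact ⟨[], .refl⟩
  | sum E F ihE ihF =>
    rcases h with rfl | h | h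
    · exact ⟨[], .refl⟩
    · exact (ihE h).imp fun u hu => .step .sumL hu
    · exact (ihF h).imp fun u hu => .step .sumR hu
  | cat E F ihE ihF =>
    rcases h with rfl | h | h
    · exact ⟨[], .refl⟩
    · exact (ihE h).imp fun u hu => .step .cat hu
    · obtain ⟨u, hu⟩ := ihF h
      obtain ⟨v, hv⟩ := E.exists_mem_lang
      exact ⟨v ++ u, .step .cat ((mRun_of_mem hv _).trans hu)⟩
  | star E ih =>
    rcases h with rfl | h
    · exact ⟨[], .refl⟩
    · exact (ih h).imp fun u hu => .step .starGo hu

theorem NodeAt.index_range {N : ℤ} {E : Regex (Action σ)} {n : ℕ} {p c : ℤ} {k : Stack σ}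
    {z : Node σ} (h : NodeAt N (E.number n) p k c z) {x : ℕ × Action σ} (hx : z.expr = .act x) :
    n < x.1 ∧ x.1 ≤ n + E.count := by
  induction E generalizing n p k c with
  | act a => obtain rfl := h; obtain rfl := Regex.act.inj hx; simp [Regex.count]
  | sum E F ihE ihF =>
    rcases h with rfl | h | h
    · simp at hx
    · have := ihE h; simp only [Regex.count]; omega
    · have := ihF h; simp only [Regex.count]; omega
  | cat E F ihE ihF =>
    rcases h with rfl | h | h
    · simp at hx
    · have := ihE h; simp only [Regex.count]; omega
    · have := ihF h; simp only [Regex.count]; omega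
  | star E ih =>
    rcases h with rfl | h
    · simp at hx
    · exact ih h

/-- Operands get disjoint ranges of numbers. This makes the continuation behind a rules index well
defined, and it keeps the moves found at different nodes apart. -/
theorem NodeAt.unique_index {N : ℤ} {E : Regex (Action σ)} {n : ℕ} {p c : ℤ} {k : Stack σ}
    {z z' : Node σ} (h : NodeAt N (E.number n) p k c z) (h' : NodeAt N (E.number n) p k c z')
    {x x' : ℕ × Action σ} (hx : z.expr = .act x) (hx' : z'.expr = .act x') (hi : x.1 = x'.1) :
    z = z' := by
  induction E generalizing n p k c with
  | act a => exact (show z = _ from h).trans (show z' = _ from h').symm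
  | sum E F ihE ihF =>
    rcases h with rfl | h | h <;> rcases h' with rfl | h' | h'
    any_goals simp at hx
    any_goals simp at hx'
    all_goals try exact ihE h h'
    all_goals try exact ihF h h'
    all_goals
      have := h.index_range hx
      have := h'.index_range hx'
      omega
  | cat E F ihE ihF =>
    rcases h with rfl | h | h <;> rcases h' with rfl | h' | h'
    any_goals simp at hx
    any_goals simp at hx'
    all_goals try exact ihE h h'
    all_goals try exact ihF h h'
    all_goals
      have := h.index_range hx
      have := h'.index_range hx'
      omega
  | star E ih =>
    rcases h with rfl | h <;> rcases h' with rfl | h'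
    any_goals simp at hx
    any_goals simp at hx'
    exact ih h h'

mutual

/-- The tables are filled for the pattern of an action at the address `p` with the number `i`. -/
def Action.Laid (mem : ℤ → ℤ) (N : ℤ) : Action σ → ℤ → ℕ → Prop
  | .check M, p, i => mem (2 * N + p) = p + 1 + (exprText M).length ∧
      exprLaid mem N M (p + 1) (7 * N) i
  | .checkNot M, p, i => mem (2 * N + p) = p + 1 + (exprText M).length ∧
      exprLaid mem N M (p + 1) (7 * N) i
  | .shift _, _, _ => True
  | .on _, _, _ => True
  | .off _, _, _ => True
  | .assign _ _, _, _ => True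
  | .compare _ _ _, _, _ => True
  | .switch _, _, _ => True

/-- The tables are filled for the expression at the address `p` with the continuation cell `c`,
where `n` letters have been numbered before. -/
def exprLaid (mem : ℤ → ℤ) (N : ℤ) : Regex (Action σ) → ℤ → ℤ → ℕ → Prop
  | .act a, p, c, n => mem (N + p) = c ∧ mem (3 * N + p) = n + 1 ∧ a.Laid mem N p (n + 1)
  | .sum E F, p, c, n => mem (N + p) = c ∧ mem (2 * N + p) = p + 1 + (exprText E).length ∧
      exprLaid mem N E (p + 1) c n ∧
      exprLaid mem N F (p + 1 + (exprText E).length) c (n + E.count)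
  | .cat E F, p, c, n => mem (N + p) = c ∧ mem (2 * N + p) = p + 1 + (exprText E).length ∧
      exprLaid mem N E (p + 1) (2 * N + p) n ∧
      exprLaid mem N F (p + 1 + (exprText E).length) c (n + E.count)
  | .star E, p, c, n => mem (N + p) = c ∧ mem (2 * N + p) = p ∧
      exprLaid mem N E (p + 1) (2 * N + p) n

end

/-- The table entries of a node. -/
def Node.Ok (mem : ℤ → ℤ) (N : ℤ) (z : Node σ) : Prop :=
  mem (N + z.addr) = z.cell ∧
    match z.expr with
    | .act x => mem (3 * N + z.addr) = x.1 ∧ x.2.Laid mem N z.addr x.1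
    | .sum E _ => mem (2 * N + z.addr) = z.addr + 1 + nlen E
    | .cat E _ => mem (2 * N + z.addr) = z.addr + 1 + nlen E
    | .star _ => mem (2 * N + z.addr) = z.addr

theorem NodeAt.ok {N : ℤ} {E : Regex (Action σ)} {n : ℕ} {p c : ℤ} {k : Stack σ} {z : Node σ}
    (h : NodeAt N (E.number n) p k c z) {mem : ℤ → ℤ} (hl : exprLaid mem N E p c n) :
    z.Ok mem N := by
  induction E generalizing n p k c with
  | act a => obtain rfl := h; exact ⟨hl.1, by simpa using hl.2.1, hl.2.2⟩
  | sum E F ihE ihF =>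
    obtain ⟨h₁, h₂, h₃, h₄⟩ := hl
    rcases h with rfl | h | h
    · refine ⟨h₁, ?_⟩
      change mem (2 * N + p) = p + 1 + nlen (E.number n)
      rw [h₂, nlen_number]; rfl
    · exact ihE h h₃
    · rw [nlen_number] at h; exact ihF h h₄
  | cat E F ihE ihF =>
    obtain ⟨h₁, h₂, h₃, h₄⟩ := hl
    rcases h with rfl | h | h
    · refine ⟨h₁, ?_⟩
      change mem (2 * N + p) = p + 1 + nlen (E.number n)
      rw [h₂, nlen_number]; rfl
    · exact ihE h h₃
    · rw [nlen_number] at h; exact ihF h h₄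
  | star E ih =>
    obtain ⟨h₁, h₂, h₃⟩ := hl
    rcases h with rfl | h
    · exact ⟨h₁, h₂⟩
    · exact ih h h₃

/-- What follows a node is what follows the whole expression, or a node. -/
theorem NodeAt.next {N : ℤ} {H : NRegex σ} {p c : ℤ} {k : Stack σ} {z : Node σ}
    (h : NodeAt N H p k c z) : z.cont = k ∧ z.cell = c ∨
      ∃ z', NodeAt N H p k c z' ∧ z.cont = z'.stack ∧
        ∀ mem, (∀ y, NodeAt N H p k c y → y.Ok mem N) → mem z.cell = z'.addr := by
  induction H generalizing p k c with
  | act x => obtain rfl := h; exact .inl ⟨rfl, rfl⟩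
  | sum E F ihE ihF =>
    rcases h with rfl | h | h
    · exact .inl ⟨rfl, rfl⟩
    · rcases ihE h with h₁ | ⟨z', h₁, h₂, h₃⟩
      · exact .inl h₁
      · exact .inr ⟨z', .inr (.inl h₁), h₂, fun m hm => h₃ m fun y hy => hm y (.inr (.inl hy))⟩
    · rcases ihF h with h₁ | ⟨z', h₁, h₂, h₃⟩
      · exact .inl h₁
      · exact .inr ⟨z', .inr (.inr h₁), h₂, fun m hm => h₃ m fun y hy => hm y (.inr (.inr hy))⟩
  | cat E F ihE ihF =>
    rcases h with rfl | h | h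
    · exact .inl ⟨rfl, rfl⟩
    · rcases ihE h with h₁ | ⟨z', h₁, h₂, h₃⟩
      · refine .inr ⟨⟨p + 1 + nlen E, F, k, c⟩, .inr (.inr (.root ..)), h₁.1, fun m hm => ?_⟩
        rw [h₁.2]
        exact (hm _ (.root ..)).2
      · exact .inr ⟨z', .inr (.inl h₁), h₂, fun m hm => h₃ m fun y hy => hm y (.inr (.inl hy))⟩
    · rcases ihF h with h₁ | ⟨z', h₁, h₂, h₃⟩
      · exact .inl h₁
      · exact .inr ⟨z', .inr (.inr h₁), h₂, fun m hm => h₃ m fun y hy => hm y (.inr (.inr hy))⟩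
  | star E ih =>
    rcases h with rfl | h
    · exact .inl ⟨rfl, rfl⟩
    · rcases ih h with h₁ | ⟨z', h₁, h₂, h₃⟩
      · refine .inr ⟨⟨p, .star E, k, c⟩, .root .., h₁.1, fun m hm => ?_⟩
        rw [h₁.2]
        exact (hm _ (.root ..)).2
      · exact .inr ⟨z', .inr h₁, h₂, fun m hm => h₃ m fun y hy => hm y (.inr hy)⟩

/-- The number of tokens of the text at `q` that belong to a node at `q` only. -/
def headAt : NRegex σ → ℤ → ℤ → ℕ
  | .act x, p, q => if q = p then x.2.text.length else 0
  | .sum E F, p, q => (if q = p then 1 else 0) + headAt E (p + 1) q + headAt F (p + 1 + nlen E) q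
  | .cat E F, p, q => (if q = p then 1 else 0) + headAt E (p + 1) q + headAt F (p + 1 + nlen E) q
  | .star E, p, q => (if q = p then 1 else 0) + headAt E (p + 1) q

/-- The number of tokens that belong to the root only. -/
def headLen : NRegex σ → ℕ
  | .act x => x.2.text.length
  | _ => 1

theorem NodeAt.headLen_le {N : ℤ} {H : NRegex σ} {p c : ℤ} {k : Stack σ} {z : Node σ}
    (h : NodeAt N H p k c z) : headLen z.expr ≤ headAt H p z.addr := by
  induction H generalizing p k c with
  | act x => obtain rfl := h; simp [headLen, headAt]
  | sum E F ihE ihF =>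
    rcases h with rfl | h | h
    · simp only [headLen, headAt, if_pos]; omega
    · have := ihE h; simp only [headAt]; omega
    · have := ihF h; simp only [headAt]; omega
  | cat E F ihE ihF =>
    rcases h with rfl | h | h
    · simp only [headLen, headAt, if_pos]; omega
    · have := ihE h; simp only [headAt]; omega
    · have := ihF h; simp only [headAt]; omega
  | star E ih =>
    rcases h with rfl | h
    · simp only [headLen, headAt, if_pos]; omega
    · have := ih h; simp only [headAt]; omega

/-- Every token belongs to one node: an operator to its own node, all tokens of a letter (including
the text of a pattern) to the letter. So a search that pays for each node by its own tokens pays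
once for the whole text. -/
theorem sum_headAt_le (H : NRegex σ) (p : ℤ) (F : Finset ℤ) :
    ((∑ q ∈ F, headAt H p q : ℕ) : ℤ) ≤ nlen H := by
  have key : ∀ p n, (∑ q ∈ F, if q = p then n else 0 : ℕ) ≤ n := by
    intro p n
    rw [Finset.sum_ite_eq']
    split_ifs <;> simp
  induction H generalizing p with
  | act x =>
    have := key p x.2.text.length
    simp only [headAt, nlen]
    exact_mod_cast this
  | sum E F ihE ihF =>
    have := key p 1
    have := ihE (p + 1)
    have := ihF (p + 1 + nlen E)
    simp only [headAt, Finset.sum_add_distrib, nlen]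
    omega
  | cat E F ihE ihF =>
    have := key p 1
    have := ihE (p + 1)
    have := ihF (p + 1 + nlen E)
    simp only [headAt, Finset.sum_add_distrib, nlen]
    omega
  | star E ih =>
    have := key p 1
    have := ih (p + 1)
    simp only [headAt, Finset.sum_add_distrib, nlen]
    omega

/-! ## The language after a letter -/

section After

variable {β : Type}

theorem MRun.head {k k' : List (Regex β)} {x : β} {w : List β} (h : MRun k (x :: w) k') :
    ∃ k₁, MRun k [] (.act x :: k₁) ∧ MRun k₁ w k' := by
  generalize hv : x :: w = v at h
  induction h with
  | refl => simp at hv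
  | step hs _ ih =>
    obtain ⟨k₁, h₁, h₂⟩ := ih hv
    exact ⟨k₁, .step hs h₁, h₂⟩
  | act h =>
    obtain ⟨rfl, rfl⟩ := List.cons.inj hv
    exact ⟨_, .refl, h⟩

/-- The stack is that of a node, or empty. -/
def IsNodeStack (N : ℤ) (H : NRegex σ) (p c : ℤ) (k : Stack σ) : Prop :=
  k = [] ∨ ∃ z, NodeAt N H p [] c z ∧ k = z.stack

theorem NodeAt.isNodeStack_cont {N : ℤ} {H : NRegex σ} {p c : ℤ} {z : Node σ}
    (h : NodeAt N H p [] c z) : IsNodeStack N H p c z.cont := by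
  rcases h.next with h₁ | ⟨z', h₁, h₂, _⟩
  · exact .inl h₁.1
  · exact .inr ⟨z', h₁, h₂⟩

/-- The reason why the search space is finite: stacks do not grow without bound, because behind the
body of a star there is the same star with the same rest. -/
theorem IsNodeStack.step {N : ℤ} {H : NRegex σ} {p c : ℤ} {k k' : Stack σ}
    (h : IsNodeStack N H p c k) (hs : MStep k k') : IsNodeStack N H p c k' := by
  rcases h with rfl | ⟨⟨q, E, k₀, d⟩, hz, rfl⟩
  · cases hs
  · have h₁ := fun z' (h : NodeAt N E q k₀ d z') => hz.trans (z' := z') h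
    cases hs with
    | @sumL A B => exact .inr ⟨_, h₁ ⟨q + 1, A, k₀, d⟩ (.inr (.inl (.root ..))), rfl⟩
    | @sumR A B => exact .inr ⟨_, h₁ ⟨q + 1 + nlen A, B, k₀, d⟩ (.inr (.inr (.root ..))), rfl⟩
    | @cat A B => exact .inr ⟨_, h₁ ⟨q + 1, A, B :: k₀, 2 * N + q⟩ (.inr (.inl (.root ..))), rfl⟩
    | starEnd => exact hz.isNodeStack_cont
    | @starGo A => exact .inr ⟨_, h₁ ⟨q + 1, A, .star A :: k₀, 2 * N + q⟩ (.inr (.root ..)), rfl⟩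

theorem IsNodeStack.run {N : ℤ} {H : NRegex σ} {p c : ℤ} {k k' : Stack σ}
    {w : List (ℕ × Action σ)} (h : IsNodeStack N H p c k) (hw : MRun k w k') :
    IsNodeStack N H p c k' := by
  induction hw with
  | refl => exact h
  | step hs _ ih => exact ih (h.step hs)
  | act _ ih =>
    apply ih
    rcases h with h | ⟨z, hz, h⟩
    · simp at h
    · obtain ⟨_, rfl⟩ := List.cons.inj h
      exact hz.isNodeStack_cont

/-- The stack `k` with cell `c` is what follows the letter with number `r` (or the whole expression,
if `r` is zero). -/
def After (N : ℤ) (E : Regex (Action σ)) (p : ℤ) (r : ℕ) (k : Stack σ) (c : ℤ) : Prop :=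
  (r = 0 ∧ k = [E.hat] ∧ c = 7 * N + 1) ∨
    ∃ z a, NodeAt N E.hat p [] (7 * N) z ∧ z.expr = .act (r, a) ∧ k = z.cont ∧ c = z.cell

theorem After.isNodeStack {N : ℤ} {E : Regex (Action σ)} {p c : ℤ} {r : ℕ} {k : Stack σ}
    (h : After N E p r k c) : IsNodeStack N E.hat p (7 * N) k := by
  rcases h with ⟨rfl, rfl, rfl⟩ | ⟨z, a, h, _, rfl, rfl⟩
  · exact .inr ⟨_, .root .., rfl⟩
  · exact h.isNodeStack_cont

/-- When the letter with number `r` has just been read, the stack must be the one behind the only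
node with that number, no matter what was read before. Conversely every node can be reached. -/
theorem After.mem_derivative {N : ℤ} {E : Regex (Action σ)} {p c : ℤ} {r : ℕ} {k : Stack σ}
    (h : After N E p r k c) {w : List (ℕ × Action σ)} : w ∈ derivative E r ↔ MRun k w [] := by
  have key : ∀ u a, MRun [E.hat] (u ++ (r, a) :: w) [] → ∃ z, NodeAt N E.hat p [] (7 * N) z ∧
      z.expr = .act (r, a) ∧ MRun z.cont w [] := by
    intro u a hu
    obtain ⟨k₁, h₁, h₂⟩ := hu.split _ _ rfl
    obtain ⟨k₂, h₃, h₄⟩ := h₂.head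
    have h₅ : IsNodeStack N E.hat p (7 * N) (.act (r, a) :: k₂) :=
      IsNodeStack.run (.inr ⟨_, .root .., rfl⟩) (h₁.trans h₃)
    rcases h₅ with h₅ | ⟨z, hz, h₅⟩
    · simp at h₅
    · obtain ⟨h₆, rfl⟩ := List.cons.inj h₅
      exact ⟨z, hz, h₆.symm, h₄⟩
  change (r = 0 ∧ w ∈ E.hat.lang) ∨ (∃ u a, u ++ (r, a) :: w ∈ E.hat.lang) ↔ _
  simp only [mem_lang_iff]
  rcases h with ⟨rfl, rfl, rfl⟩ | ⟨z, a, h, hz, rfl, rfl⟩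
  · constructor
    · rintro (h | ⟨u, a, h⟩)
      · exact h.2
      · obtain ⟨z, hz, h₁, _⟩ := key u a h
        -- Numbers begin with 1, so no letter has the number 0.
        have := hz.index_range h₁
        simp at this
    · exact fun h => .inl ⟨rfl, h⟩
  · constructor
    · rintro (h₁ | ⟨u, b, h₁⟩)
      · have := h.index_range hz
        simp [h₁.1] at this
      · obtain ⟨z', hz', h₂, h₃⟩ := key u b h₁
        obtain rfl := h.unique_index hz' hz h₂ rfl
        exact h₃
    · intro h₁
      obtain ⟨u, hu⟩ := h.reach
      refine .inr ⟨u, a, hu.trans ?_⟩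
      rw [Node.stack, hz]
      exact .act h₁

/-- The definition of legality forgets the stack after each action and keeps only the index. Nothing
is lost, because the index determines the stack. -/
theorem LegalSeq.after {N : ℤ} {R : GenRules σ} {B : Inst σ} {p : ℤ} {g h : GameState σ}
    {w : List (ℕ × Action σ)} (hw : LegalSeq R B g w h) {k : Stack σ} {c : ℤ}
    (hk : After N R.rules p g.index k c) :
    ∃ k' c', After N R.rules p h.index k' c' ∧ MRun k w k' ∧
      B.ValidSeq g.semi (w.map Prod.snd) ∧ h.semi = B.applySeq g.semi (w.map Prod.snd) := by
  induction hw generalizing k c with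
  | nil => exact ⟨k, c, hk, .refl, trivial, rfl⟩
  | @cons g h i a w hv hp _ ih =>
    obtain ⟨v, hv'⟩ := hp
    rw [hk.mem_derivative] at hv'
    obtain ⟨k₁, h₁, h₂⟩ := hv'.head
    rcases hk.isNodeStack.run h₁ with h₃ | ⟨z, hz, h₃⟩
    · simp at h₃
    · obtain ⟨h₄, rfl⟩ := List.cons.inj h₃
      obtain ⟨k', c', h₅, h₆, h₇, h₈⟩ := ih (.inr ⟨z, a, hz, h₄.symm, rfl, rfl⟩)
      exact ⟨k', c', h₅, h₁.trans (.act h₆), ⟨hv, h₇⟩, h₈⟩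

theorem After.legalSeq {N : ℤ} {R : GenRules σ} {B : Inst σ} {p : ℤ} {g : GameState σ}
    {w : List (ℕ × Action σ)} {k k' : Stack σ} {c : ℤ} (hk : After N R.rules p g.index k c)
    (hw : MRun k w k') (hv : B.ValidSeq g.semi (w.map Prod.snd)) : ∃ h, LegalSeq R B g w h := by
  induction w generalizing g k c with
  | nil => exact ⟨g, .nil⟩
  | cons x w ih =>
    obtain ⟨i, a⟩ := x
    obtain ⟨k₁, h₁, h₂⟩ := hw.head
    rcases hk.isNodeStack.run h₁ with h₃ | ⟨z, hz, h₃⟩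
    · simp at h₃
    · obtain ⟨h₄, rfl⟩ := List.cons.inj h₃
      obtain ⟨h, hh⟩ := ih (g := ⟨B.apply g.semi a, i⟩) (.inr ⟨z, a, hz, h₄.symm, rfl, rfl⟩) h₂ hv.2
      -- The rest is completed to a full word, so that the letter is a prefix of a word of the
      -- derivative.
      obtain ⟨v, h₅⟩ := exists_mRun_nil z.cont
      exact ⟨h, .cons hv.1 ⟨v, hk.mem_derivative.2 (h₁.trans (.act h₅))⟩ hh⟩

theorem After.legalMove_iff {N : ℤ} {R : GenRules σ} {B : Inst σ} {p : ℤ} {g : GameState σ}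
    {k : Stack σ} {c : ℤ} (hk : After N R.rules p g.index k c) {m : Move σ} :
    LegalMove R B g m ↔ MoveFrom B k g.semi m := by
  constructor
  · rintro ⟨w, h, h₁, h₂, h₃⟩
    obtain ⟨k', _, _, h₄, h₅, _⟩ := h₂.after hk
    exact ⟨w, k', h₄, h₁, h₅, h₃⟩
  · rintro ⟨w, k', h₁, h₂, h₃, h₄⟩
    obtain ⟨h, hh⟩ := hk.legalSeq h₁ h₃
    exact ⟨w, h, h₂, hh, h₄⟩

theorem App.append {B : Inst σ} {S : SemiState σ} {L L' : Language (Action σ)}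
    {w : List (Action σ)} (hL : ∀ u ∈ L, w ++ u ∈ L') (hw : B.ValidSeq S w) {v : List (Action σ)}
    (h : B.App (B.applySeq S w) L v) : B.App S L' (w ++ v) := by
  have hp : ∀ u ∈ pref L, w ++ u ∈ pref L' := fun u ⟨v, hv⟩ => ⟨v, by simpa using hL _ hv⟩
  cases h with
  | base h₁ h₂ => exact .base (hp _ h₁) ((B.validSeq_append ..).2 ⟨hw, h₂⟩)
  | @enter _ _ u v M h₁ h₂ h₃ h₄ =>
    rw [← List.append_assoc]
    refine .enter (hp _ h₁) ((B.validSeq_append ..).2 ⟨hw, h₂⟩) (M := M) ?_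
      (by rwa [B.applySeq_append])
    simp only [List.append_assoc]
    exact h₃.imp (hp _) (hp _)

theorem SemiState.Bounded.applySeq {B : Inst σ} {S : SemiState σ} (h : S.Bounded B)
    {w : List (Action σ)} (hw : B.ValidSeq S w) : (B.applySeq S w).Bounded B := by
  induction w generalizing S with
  | nil => exact h
  | cons a w ih => exact ih (h.apply hw.1) hw.2

/-- Straightness is a condition on words that start in the initial state. Prefixing the play that
leads to `g` to an attempt from `g` turns it into a condition on `g`. -/
theorem Reachable.after {N : ℤ} {R : GenRules σ} {B : Inst σ} {p : ℤ} {g : GameState σ}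
    (hg : Reachable R B g) {j : ℕ} (hj : IsStraight R B j) :
    ∃ k c, After N R.rules p g.index k c ∧ Budget B k g.semi j ∧ g.semi.Bounded B := by
  obtain ⟨w, hw⟩ := hg
  have h0 : After N R.rules p 0 [R.rules.hat] (7 * N + 1) := .inl ⟨rfl, rfl, rfl⟩
  obtain ⟨k, c, h₁, h₂, h₃, h₄⟩ := hw.after h0
  refine ⟨k, c, h₁, ?_, ?_⟩
  · intro f hf hs
    rw [h₄] at hf
    have h₅ : B.App B.init R.rules.lang (w.map Prod.snd ++ f) := by
      refine App.append ?_ h₃ hf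
      rw [← actionLang_number R.rules 0]
      rintro _ ⟨v, hv, rfl⟩
      exact ⟨w ++ v, h₂.trans hv, by simp⟩
    -- Only the suffix `f` has to be free of switches; the play before it may contain some.
    exact hj f ⟨_, h₅, ⟨w.map Prod.snd, [], by simp⟩, hs⟩
  · rw [h₄]
    exact SemiState.Bounded.applySeq B.init_le h₃

end After

end RBG

namespace RBG

/-! ## Symbolic execution -/

/-- The memory after the value `v` has been stored at the address `a`. -/
def upd (mem : ℤ → ℤ) (a v : ℤ) : ℤ → ℤ := Function.update mem a v

theorem upd_self (mem : ℤ → ℤ) (a v : ℤ) : upd mem a v a = v := Function.update_self ..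

theorem upd_of_ne {mem : ℤ → ℤ} {a v x : ℤ} (h : x ≠ a) : upd mem a v x = mem x :=
  Function.update_of_ne h ..

theorem upd_apply (mem : ℤ → ℤ) (a v x : ℤ) : upd mem a v x = if x = a then v else mem x :=
  Function.update_apply ..

/-- Bundled for `simp only`: together with the three bundles below it turns a statement about a
straight piece of program into its arithmetical side conditions and a statement about the final
state. Calls and loops are left over. -/
theorem run_rules (P : List HCmd) (W M : ℤ) (s : St) (Q : St → Prop) :
    (Run P W M .skip s Q ↔ Q (s.tick 1)) ∧
    (∀ x e, Run P W M (.set x e) s Q ↔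
      e.ok W M s ∧ Q ((s.set x (e.val s)).tick (e.cost + 1))) ∧
    (∀ a e, Run P W M (.store a e) s Q ↔
      a.ok W M s ∧ e.ok W M s ∧ 0 ≤ a.val s ∧ a.val s < M ∧ Q { s with
        mem := upd s.mem (a.val s) (e.val s),
        time := s.time + (a.cost + e.cost + 1) }) ∧
    (∀ e, Run P W M (.write e) s Q ↔ e.ok W M s ∧
      Q { s with out := s.out ++ [e.val s], time := s.time + (e.cost + 1) }) ∧
    (∀ e c₁ c₂, Run P W M (.ite e c₁ c₂) s Q ↔ e.ok W M s ∧
      if 0 < e.val s then Run P W M c₁ (s.tick (e.cost + 1)) Q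
      else Run P W M c₂ (s.tick (e.cost + 1)) Q) ∧
    (∀ c, Run P W M (.block [c]) s Q ↔ Run P W M c s Q) ∧
    (∀ c d l, Run P W M (.block (c :: d :: l)) s Q ↔
      Run P W M c s fun s' => Run P W M (.block (d :: l)) s' Q) :=
  ⟨run_skip, fun _ _ => run_set, fun _ _ => run_store, fun _ => run_write, fun _ _ _ => run_ite,
    fun _ => run_block_singleton, fun _ _ _ => run_block_cons⟩

theorem val_rules (s : St) :
    (∀ c, (HExp.const c).val s = c) ∧ (∀ r, (HExp.reg r).val s = s.get r) ∧
    (∀ e, (HExp.ld e).val s = s.mem (e.val s)) ∧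
    (∀ e f, (HExp.lt e f).val s = if e.val s < f.val s then 1 else 0) ∧
    (∀ e f : HExp, (e + f).val s = e.val s + f.val s) ∧
    (∀ e f : HExp, (e - f).val s = e.val s - f.val s) ∧
    (∀ e f : HExp, (e * f).val s = e.val s * f.val s) ∧
    (∀ e f : HExp, (HExp.bin .div e f).val s = (e.val s).tdiv (f.val s)) :=
  ⟨fun _ => rfl, fun _ => rfl, fun _ => rfl, fun _ _ => rfl, fun _ _ => rfl, fun _ _ => rfl,
    fun _ _ => rfl, fun _ _ => rfl⟩

theorem cost_rules :
    (∀ c, (HExp.const c).cost = 1) ∧ (∀ r, (HExp.reg r).cost = 1) ∧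
    (∀ e, (HExp.ld e).cost = e.cost + 1) ∧
    (∀ e f, (HExp.lt e f).cost = e.cost + (f.cost + 3)) ∧
    (∀ e f : HExp, (e + f).cost = e.cost + (f.cost + 1)) ∧
    (∀ e f : HExp, (e - f).cost = e.cost + (f.cost + 1)) ∧
    (∀ e f : HExp, (e * f).cost = e.cost + (f.cost + 1)) ∧
    (∀ e f : HExp, (HExp.bin .div e f).cost = e.cost + (f.cost + 1)) :=
  ⟨fun _ => rfl, fun _ => rfl, fun _ => rfl, fun _ _ => rfl, fun _ _ => rfl, fun _ _ => rfl,
    fun _ _ => rfl, fun _ _ => rfl⟩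

theorem ok_rules (W M : ℤ) (s : St) :
    (∀ c, (HExp.const c).ok W M s ↔ -16 ≤ c ∧ c ≤ 16) ∧ (∀ r, (HExp.reg r).ok W M s ↔ True) ∧
    (∀ e, (HExp.ld e).ok W M s ↔ e.ok W M s ∧ 0 ≤ e.val s ∧ e.val s < M) ∧
    (∀ e f, (HExp.lt e f).ok W M s ↔ e.ok W M s ∧ f.ok W M s ∧
        -W ≤ f.val s - e.val s ∧ f.val s - e.val s ≤ W) ∧
    (∀ e f : HExp, (e + f).ok W M s ↔ e.ok W M s ∧ f.ok W M s ∧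
        -W ≤ e.val s + f.val s ∧ e.val s + f.val s ≤ W) ∧
    (∀ e f : HExp, (e - f).ok W M s ↔ e.ok W M s ∧ f.ok W M s ∧
        -W ≤ e.val s - f.val s ∧ e.val s - f.val s ≤ W) ∧
    (∀ e f : HExp, (e * f).ok W M s ↔ e.ok W M s ∧ f.ok W M s ∧
        -W ≤ e.val s * f.val s ∧ e.val s * f.val s ≤ W) ∧
    (∀ e f : HExp, (HExp.bin .div e f).ok W M s ↔ e.ok W M s ∧ f.ok W M s ∧
        -W ≤ (e.val s).tdiv (f.val s) ∧ (e.val s).tdiv (f.val s) ≤ W) :=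
  ⟨fun _ => Iff.rfl, fun _ => Iff.rfl, fun _ => Iff.rfl, fun _ _ => Iff.rfl, fun _ _ => Iff.rfl,
    fun _ _ => Iff.rfl, fun _ _ => Iff.rfl, fun _ _ => Iff.rfl⟩

theorem test_rules : ((0 : ℤ) < 0 ↔ False) ∧ ((0 : ℤ) < 1 ↔ True) := by simp

/-- Reduction of a property of a state to a property that does not depend on the clock. -/
theorem St.transfer {Q : St → Prop} {s : St} {f : ℕ → St} {T : ℕ}
    (hQ : ∀ τ, τ ≤ T → Q (f τ)) (hT : s.time ≤ T) (h : s = f s.time) : Q s := by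
  rw [h]; exact hQ _ hT

variable {σ : Sig}

/-- The program, started in the given state, reaches a state with the property `Q`. -/
abbrev Go (W M : ℤ) (c : HCmd) (s : St) (Q : St → Prop) : Prop := Run Code.procedures W M c s Q

/-- The length of the text of an arithmetic expression. -/
def alen (e : AExpr σ) : ℕ := e.text.length

theorem alen_bin (o : ArithOp) (e f : AExpr σ) : alen (.bin o e f) = 1 + alen e + alen f := by
  simp [alen, AExpr.text]; omega

theorem one_le_alen (e : AExpr σ) : 1 ≤ alen e := by cases e <;> simp [alen, AExpr.text]

theorem zero_lt_ite (p : Prop) [Decidable p] : (0 < if p then (1 : ℤ) else 0) ↔ p := by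
  split_ifs with h <;> simp [h]

theorem go_skipExpr_leaf {W M c x : ℤ} {s : St} {Q : St → Prop} (hc : 0 ≤ c) (hc' : c ≤ 2)
    (h0 : 0 ≤ s.q) (ht : HasText s.mem s.q [c, x]) (hM : s.q + 2 * (2 : ℕ) + 2 ≤ M)
    (hW : s.q + (2 : ℕ) + 16 ≤ W)
    (hQ : ∀ t τ, τ ≤ s.time + 20 * 2 → Q { s with q := s.q + (2 : ℕ), t := t, time := τ }) :
    Go W M (.call 1) s Q := by
  have h1 := ht.1
  have hlt : ¬ 2 < c := by omega
  refine Run.call rfl (by omega) ?_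
  simp only [Code.skipExpr, run_rules, val_rules, cost_rules, ok_rules, St.set, St.get, St.tick,
    zero_lt_ite, true_and, h1, hlt, if_false]
  exact ⟨by omega, by omega, by omega, hQ _ _ (by omega)⟩

theorem go_skipExpr {W : ℤ} (e : AExpr σ) {M : ℤ} {s : St} {Q : St → Prop} (h0 : 0 ≤ s.q)
    (ht : HasText s.mem s.q e.text) (hM : s.q + 2 * alen e + 2 ≤ M) (hW : s.q + alen e + 16 ≤ W)
    (hQ : ∀ t τ, τ ≤ s.time + 20 * alen e →
      Q { s with q := s.q + alen e, t := t, time := τ }) :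
    Go W M (.call 1) s Q := by
  induction e generalizing M s Q with
  | bin o e f ihe ihf =>
    rw [AExpr.text] at ht
    have h1 := ht.1
    have h2 := hasText_append.1 ht.2
    rw [alen_bin] at hM hW hQ
    have := one_le_alen e
    have := one_le_alen f
    have ho : 3 ≤ o.code ∧ o.code ≤ 6 := by cases o <;> simp [ArithOp.code]
    have hlt : 2 < o.code := by omega
    refine Run.call rfl (by omega) ?_
    simp only [Code.skipExpr, run_rules, val_rules, cost_rules, ok_rules, St.set, St.get, St.tick,
      zero_lt_ite, true_and, h1, hlt, if_true]
    refine ⟨by omega, by omega, by omega, ?_⟩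
    refine ihe ?_ h2.1 ?_ ?_ fun t τ hτ => ihf ?_ h2.2 ?_ ?_ fun t' τ' hτ' => ?_
    iterate 6 dsimp only; omega
    dsimp only at hτ hτ' ⊢
    convert hQ t' τ' (by omega) using 2
    push_cast; ring
  | _ => exact go_skipExpr_leaf (by norm_num) (by norm_num) h0 ht hM hW hQ

theorem Action.text_on (X : Finset σ.Piece) : (Action.on X).text =
    -4 :: (X.card : ℤ) :: (X.sort (· ≤ ·)).map fun x : σ.Piece => ((x : ℕ) : ℤ) := by
  have : ∀ l : List σ.Piece, (l.flatMap fun x : σ.Piece => [(x : ℕ)]) =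
      l.map fun x : σ.Piece => (x : ℕ) := by
    intro l; induction l <;> simp_all
  simp [Action.text, this]

theorem exprText_ne_nil (E : Regex (Action σ)) : 1 ≤ (exprText E).length := by
  have := one_le_nlen (E.number 0)
  rw [nlen_number, exprLen] at this
  omega

/-- The induction is on the length of the text: the expression inside a pattern is not a subterm
that structural induction on `Regex` reaches. -/
theorem go_skipRegex {W : ℤ} (l : ℕ) (E : Regex (Action σ)) (hl : (exprText E).length ≤ l)
    {M : ℤ} {s : St} {Q : St → Prop} (h0 : 0 ≤ s.q) (ht : HasText s.mem s.q (exprText E))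
    (hM : s.q + 2 * (exprText E).length + 2 ≤ M) (hW : s.q + (exprText E).length + 16 ≤ W)
    (hA : ∀ x ∈ exprText E, x + 16 ≤ W)
    (hQ : ∀ t τ, τ ≤ s.time + 100 * (exprText E).length →
      Q { s with q := s.q + (exprText E).length, t := t, time := τ }) :
    Go W M (.call 2) s Q := by
  induction l generalizing E M s Q with
  | zero => have := exprText_ne_nil E; omega
  | succ l ih =>
  refine Run.call rfl (by omega) ?_
  simp only [Code.skipRegex, Code.cases, run_rules, val_rules, cost_rules, ok_rules, St.set, St.get,
    St.tick, zero_lt_ite, true_and]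
  cases E with
  | sum E F =>
    rw [exprText] at hl ht hM hW hA hQ
    simp only [List.length_cons, List.length_append, Nat.cast_add, Nat.cast_one] at hl hM hW hQ
    have := exprText_ne_nil E
    have := exprText_ne_nil F
    have h1 := ht.1
    have h2 := hasText_append.1 ht.2
    simp only [h1, Int.reduceNeg, Int.reduceSub, Int.reduceLT, if_true, if_false]
    refine ⟨by omega, by omega, by omega, by omega, ?_⟩
    refine ih E (by omega) ?_ h2.1 ?_ ?_ (fun x hx => hA x (by simp [hx])) fun t τ hτ =>
      ih F (by omega) ?_ h2.2 ?_ ?_ (fun x hx => hA x (by simp [hx])) fun t' τ' hτ' => ?_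
    iterate 6 dsimp only; omega
    dsimp only at hτ hτ' ⊢
    convert hQ t' τ' (by omega) using 2
    ring
  | cat E F =>
    rw [exprText] at hl ht hM hW hA hQ
    simp only [List.length_cons, List.length_append, Nat.cast_add, Nat.cast_one] at hl hM hW hQ
    have := exprText_ne_nil E
    have := exprText_ne_nil F
    have h1 := ht.1
    have h2 := hasText_append.1 ht.2
    simp only [h1, Int.reduceNeg, Int.reduceSub, Int.reduceLT, if_true, if_false]
    refine ⟨by omega, by omega, by omega, by omega, by omega, ?_⟩
    refine ih E (by omega) ?_ h2.1 ?_ ?_ (fun x hx => hA x (by simp [hx])) fun t τ hτ =>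
      ih F (by omega) ?_ h2.2 ?_ ?_ (fun x hx => hA x (by simp [hx])) fun t' τ' hτ' => ?_
    iterate 6 dsimp only; omega
    dsimp only at hτ hτ' ⊢
    convert hQ t' τ' (by omega) using 2
    ring
  | star E =>
    rw [exprText] at hl ht hM hW hA hQ
    simp only [List.length_cons, List.length_append, Nat.cast_add, Nat.cast_one] at hl hM hW hQ
    have := exprText_ne_nil E
    have h1 := ht.1
    simp only [h1, Int.reduceNeg, Int.reduceSub, Int.reduceLT, if_true, if_false]
    refine ⟨by omega, by omega, by omega, by omega, by omega, by omega, ?_⟩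
    refine ih E (by omega) ?_ ht.2 ?_ ?_ (fun x hx => hA x (by simp [hx])) fun t' τ' hτ' => ?_
    iterate 3 dsimp only; omega
    dsimp only at hτ' ⊢
    convert hQ t' τ' (by omega) using 2
    ring
  | act a =>
    rw [exprText] at hl ht hM hW hA hQ
    cases a with
    | shift dir =>
      have h1 := ht.1
      have h2 : ¬ ((dir : ℕ) : ℤ) ≤ -1 := by omega
      have h3 := hA dir (by simp [Action.text])
      simp only [Action.text, List.length_cons, List.length_nil, Nat.cast_add,
        Nat.cast_one] at hl hM hW hQ
      simp only [h1, not_le.1 h2, if_true]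
      exact ⟨by omega, by omega, by omega, hQ _ _ (by omega)⟩
    | on X =>
      rw [Action.text_on] at ht hl hM hW hQ
      have h1 := ht.1
      have h2 := ht.2.1
      simp only [List.length_cons, List.length_map, Finset.length_sort, Nat.cast_add,
        Nat.cast_one] at hl hM hW hQ
      simp only [h1, h2, Int.reduceNeg, Int.reduceSub, Int.reduceLT, if_true, if_false]
      refine ⟨by omega, by omega, by omega, by omega, by omega, by omega, by omega, ?_⟩
      convert hQ _ _ ?_ using 2
      · ring
      · omega
    | off x =>
      have h1 := ht.1
      simp only [Action.text, List.length_cons, List.length_nil, Nat.cast_add,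
        Nat.cast_one] at hl hM hW hQ
      simp only [h1, Int.reduceNeg, Int.reduceSub, Int.reduceLT, if_true, if_false]
      exact ⟨by omega, by omega, by omega, by omega, by omega, by omega, by omega, by omega,
        hQ _ _ (by omega)⟩
    | switch x =>
      have h1 := ht.1
      simp only [Action.text, List.length_cons, List.length_nil, Nat.cast_add,
        Nat.cast_one] at hl hM hW hQ
      simp only [h1, Int.reduceNeg, Int.reduceSub, Int.reduceLT, if_true, if_false]
      exact ⟨by omega, by omega, by omega, by omega, by omega, by omega, by omega, by omega,
        by omega, by omega, by omega, hQ _ _ (by omega)⟩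
    | assign v e =>
      have h1 := ht.1
      have h2 := ht.2.2
      simp only [Action.text, List.length_cons, Nat.cast_add, Nat.cast_one] at hl hM hW hQ
      simp only [h1, Int.reduceNeg, Int.reduceSub, Int.reduceLT, if_true, if_false]
      refine ⟨by omega, by omega, by omega, by omega, by omega, by omega, by omega, by omega,
        by omega, ?_⟩
      refine go_skipExpr e ?_ (by simpa [add_assoc] using h2) ?_ ?_ fun t' τ' hτ' => ?_
      iterate 3 dsimp only [alen]; omega
      dsimp only [alen] at hτ' ⊢
      convert hQ t' τ' (by omega) using 2
      ring
    | compare o e f =>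
      have h1 := ht.1
      have h2 := hasText_append.1 ht.2.2
      simp only [Action.text, List.length_cons, List.length_append, Nat.cast_add,
        Nat.cast_one] at hl hM hW hQ
      simp only [h1, Int.reduceNeg, Int.reduceSub, Int.reduceLT, if_true, if_false]
      refine ⟨by omega, by omega, by omega, by omega, by omega, by omega, by omega, by omega,
        by omega, by omega, ?_⟩
      refine go_skipExpr e ?_ (by simpa [add_assoc] using h2.1) ?_ ?_ fun t τ hτ =>
        go_skipExpr f ?_ (by simpa [add_assoc, alen] using h2.2) ?_ ?_ fun t' τ' hτ' => ?_
      iterate 6 dsimp only [alen]; omega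
      dsimp only [alen] at hτ hτ' ⊢
      convert hQ t' τ' (by omega) using 2
      ring
    | check M =>
      have := exprText_ne_nil M
      have h1 := ht.1
      simp only [Action.text, List.length_cons, Nat.cast_add, Nat.cast_one] at hl hM hW hQ hA
      simp only [h1, Int.reduceNeg, Int.reduceSub, Int.reduceLT, if_true, if_false]
      refine ⟨by omega, by omega, by omega, by omega, by omega, by omega, by omega, by omega,
        by omega, by omega, by omega, ?_⟩
      refine ih M (by omega) ?_ ht.2 ?_ ?_ (fun x hx => hA x (by simp [hx])) fun t' τ' hτ' => ?_
      iterate 3 dsimp only; omega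
      dsimp only at hτ' ⊢
      convert hQ t' τ' (by omega) using 2
      ring
    | checkNot M =>
      have := exprText_ne_nil M
      have h1 := ht.1
      simp only [Action.text, List.length_cons, Nat.cast_add, Nat.cast_one] at hl hM hW hQ hA
      simp only [h1, Int.reduceNeg, Int.reduceSub, Int.reduceLT, if_true, if_false]
      refine ⟨by omega, by omega, by omega, by omega, by omega, by omega, by omega, by omega,
        by omega, by omega, by omega, ?_⟩
      refine ih M (by omega) ?_ ht.2 ?_ ?_ (fun x hx => hA x (by simp [hx])) fun t' τ' hτ' => ?_
      iterate 3 dsimp only; omega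
      dsimp only at hτ' ⊢
      convert hQ t' τ' (by omega) using 2
      ring

end RBG

-- Clearing a table and printing a move

namespace RBG

variable {σ : Sig}

/-- The memory after the cells from `a` to `b - 1` have been cleared. -/
def cleared (mem : ℤ → ℤ) (a b : ℤ) : ℤ → ℤ := fun x => if a ≤ x ∧ x < b then 0 else mem x

theorem go_clear {W M : ℤ} {s : St} {Q : St → Prop} (h0 : 0 ≤ s.a) (hab : s.a ≤ s.b)
    (hM : s.b + 1 ≤ M) (hW : s.b + 16 ≤ W)
    (hQ : ∀ τ : ℕ, (τ : ℤ) ≤ s.time + 20 * (s.b - s.a) + 10 →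
      Q { s with a := s.b, mem := cleared s.mem s.a s.b, time := τ }) :
    Go W M (.call 7) s Q := by
  refine Run.call rfl (by omega) ?_
  have key : ∀ (l : ℕ) (s : St), s.b = s.a + l → 0 ≤ s.a → s.b + 1 ≤ M → s.b + 16 ≤ W →
      (∀ τ : ℕ, (τ : ℤ) ≤ s.time + 20 * (s.b - s.a) + 9 →
        Q { s with a := s.b, mem := cleared s.mem s.a s.b, time := τ }) →
      Go W (M - 1) Code.clear s Q := by
    intro l
    induction l with
    | zero =>
      intro s hl h0 hM hW hQ
      have hn : ¬ s.a < s.b := by omega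
      rw [Code.clear, Go, run_loop]
      simp only [val_rules, ok_rules, cost_rules, zero_lt_ite, test_rules, St.get, St.tick, hn,
        true_and, if_false]
      refine ⟨by omega, ?_⟩
      have hm : cleared s.mem s.a s.b = s.mem := by
        funext x
        simp only [cleared]
        rw [if_neg (by omega)]
      convert hQ _ ?_ using 2
      all_goals first | exact hm.symm | (push_cast; omega)
    | succ l ih =>
      intro s hl h0 hM hW hQ
      push_cast at hl
      have hn : s.a < s.b := by omega
      rw [Code.clear, Go, run_loop]
      simp only [run_rules, val_rules, ok_rules, cost_rules, zero_lt_ite, test_rules, St.get, St.set,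
        St.tick, hn, true_and, if_true]
      refine ⟨by omega, by omega, by omega, by omega, by omega, ?_⟩
      refine ih _ ?_ ?_ ?_ ?_ fun τ hτ => ?_
      iterate 4 dsimp only; omega
      dsimp only at hτ ⊢
      convert hQ τ (by push_cast at hτ; omega) using 2
      funext x
      simp only [cleared, upd_apply]
      split_ifs <;> first | rfl | omega
  refine key (s.b - s.a).toNat _ ?_ ?_ ?_ ?_ fun τ hτ => ?_
  iterate 4 simp only [St.tick]; omega
  exact hQ τ (by simp only [St.tick] at hτ; push_cast at hτ; omega)

/-- The linked list of the modifiers `l`, the last one first, lies between the addresses `g` and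
`h`. -/
def Chain (mem : ℤ → ℤ) (g h : ℤ) : ℤ → List (ℕ × σ.Vertex) → Prop
  | x, [] => x = 0
  | x, m :: l => 0 < x ∧ g ≤ x ∧ x + 3 ≤ h ∧ mem x = m.1 ∧ mem (x + 1) = (m.2 : ℕ) ∧
      Chain mem g h (mem (x + 2)) l

theorem Chain.congr {mem mem' : ℤ → ℤ} {g h h' x : ℤ} {l : List (ℕ × σ.Vertex)}
    (hc : Chain mem g h x l) (hh : h ≤ h') (hm : ∀ a, 0 ≤ a → g ≤ a → a < h → mem' a = mem a) :
    Chain mem' g h' x l := by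
  induction l generalizing x with
  | nil => exact hc
  | cons m l ih =>
    obtain ⟨h1, h0, h2, h3, h4, h5⟩ := hc
    refine ⟨h1, h0, by omega, by rw [hm _ (by omega) (by omega) (by omega), h3],
      by rw [hm _ (by omega) (by omega) (by omega), h4], ?_⟩
    rw [hm _ (by omega) (by omega) (by omega)]
    exact ih h5

/-- The tokens of a sequence of modifiers. -/
def moveTokens (m : Move σ) : List ℤ := m.flatMap fun b => [(b.1 : ℤ), ((b.2 : ℕ) : ℤ)]

/-- The list is linked from the last modifier to the first, so the recursion descends first and
writes on its way back. Its stack lies above the records, which therefore survive. -/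
theorem go_print {W M : ℤ} {s : St} {Q : St → Prop} {l : List (ℕ × σ.Vertex)}
    {g : ℤ} (hc : Chain s.mem g s.sp s.x l) (h0 : 0 ≤ s.sp) (hM : s.sp + 2 * l.length + 2 ≤ M)
    (hW : s.sp + l.length + 16 ≤ W)
    (hQ : ∀ x mem τ, (∀ a, a < s.sp → mem a = s.mem a) → τ ≤ s.time + 60 * l.length + 10 →
      Q { s with x := x, mem := mem, out := s.out ++ moveTokens l.reverse, time := τ }) :
    Go W M (.call 6) s Q := by
  induction l generalizing s M Q with
  | nil =>
    refine Run.call rfl (by omega) ?_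
    have hx : ¬ 0 < s.x := by have : s.x = 0 := hc; omega
    simp only [Code.print, run_rules, val_rules, cost_rules, ok_rules, St.set, St.get, St.tick, hx,
      if_false, true_and]
    convert hQ s.x s.mem _ (fun _ _ => rfl) ?_ using 2
    · simp [moveTokens]
    · omega
  | cons m l ih =>
    obtain ⟨h1, -, h2, h3, h4, h5⟩ := hc
    simp only [List.length_cons, Nat.cast_add, Nat.cast_one] at hM hW hQ
    refine Run.call rfl (by omega) ?_
    simp only [Code.print, run_rules, val_rules, cost_rules, ok_rules, St.set, St.get, St.tick, h1,
      if_true, true_and]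
    refine ⟨by omega, by omega, by omega, by omega, ?_⟩
    have hm : ∀ a, a < s.sp → upd s.mem s.sp s.x a = s.mem a := fun a ha =>
      upd_of_ne (by omega)
    refine ih ?_ ?_ ?_ ?_ fun x mem τ hmem hτ => ?_
    · dsimp only
      rw [hm _ (by omega)]
      exact h5.congr (by omega) fun a _ _ ha => hm a ha
    iterate 3 dsimp only; omega
    dsimp only at hmem hτ
    have e0 : mem (s.sp + 1 - 1) = s.x := by
      rw [hmem _ (by omega), add_sub_cancel_right, upd_self]
    have e1 : mem s.x = m.1 := by rw [hmem _ (by omega), hm _ (by omega), h3]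
    have e2 : mem (s.x + 1) = (m.2 : ℕ) := by rw [hmem _ (by omega), hm _ (by omega), h4]
    simp only [e0, e1, e2]
    refine ⟨by omega, by omega, by omega, by omega, ?_⟩
    convert hQ s.x mem _ (fun a ha => by rw [hmem _ (by omega), hm a ha]) ?_ using 2
    · omega
    · simp [moveTokens]
    · omega

/-! ## Arithmetic expressions -/

/-- The value of an expression, where `0` is used for the quotient of a division by zero. -/
def AExpr.total (S : SemiState σ) : AExpr σ → ℤ
  | .lit z => z
  | .var v => S.value v
  | .piece x => ((Finset.univ.filter fun v => S.pieceAt v = x).card : ℕ)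
  | .bin o e f => o.eval (e.total S) (f.total S)

/-- No division by zero occurs. -/
def AExpr.IsDef (S : SemiState σ) : AExpr σ → Bool
  | .bin .div e f => e.IsDef S && f.IsDef S && decide (f.total S ≠ 0)
  | .bin _ e f => e.IsDef S && f.IsDef S
  | _ => true

/-- Separates the value from definedness, as the program does with the registers `v` and `er`. -/
theorem AExpr.eval_eq (S : SemiState σ) (e : AExpr σ) :
    e.eval S = if e.IsDef S then some (e.total S) else none := by
  induction e with
  | bin o e f ihe ihf =>
    simp only [AExpr.eval, ihe, ihf]
    cases he : e.IsDef S <;> cases hf : f.IsDef S <;>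
      cases o <;> simp [AExpr.IsDef, AExpr.total, he, hf]
    by_cases h0 : f.total S = 0
    · simp [h0]
    · simp [h0]
  | _ => simp [AExpr.eval, AExpr.IsDef, AExpr.total]

/-- A quotient is not larger than its dividend, also for the divisor zero, where `tdiv` gives zero.
So undefined expressions do not leave the word size either. -/
theorem AExpr.abs_total_le {B : Inst σ} {S : SemiState σ} (hS : S.Bounded B) (e : AExpr σ) :
    |e.total S| ≤ e.magnitude B := by
  induction e with
  | lit z => simp [AExpr.total, AExpr.magnitude]
  | var v => simpa [AExpr.total, AExpr.magnitude] using hS v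
  | piece x =>
    simp only [AExpr.total, AExpr.magnitude, Nat.abs_cast, Nat.cast_le]
    exact (Finset.card_le_univ _).trans (by simp)
  | bin o e f ihe ihf =>
    have h1 := abs_le.1 ihe
    have h2 := abs_le.1 ihf
    cases o with
    | add => simp only [AExpr.total, AExpr.magnitude, ArithOp.eval]; rw [abs_le]; omega
    | sub => simp only [AExpr.total, AExpr.magnitude, ArithOp.eval]; rw [abs_le]; omega
    | mul =>
      simp only [AExpr.total, AExpr.magnitude, ArithOp.eval, abs_mul]
      push_cast
      exact mul_le_mul (by omega) (by omega) (abs_nonneg _) (by omega)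
    | div =>
      simp only [AExpr.total, AExpr.magnitude, ArithOp.eval]
      have : |(e.total S).tdiv (f.total S)| ≤ |e.total S| := by
        rw [Int.abs_eq_natAbs, Int.abs_eq_natAbs, Int.natAbs_tdiv]
        exact_mod_cast Nat.div_le_self _ _
      push_cast
      omega

/-- The subexpressions have at most the magnitude of the expression. -/
theorem AExpr.magnitude_bin {B : Inst σ} (o : ArithOp) (e f : AExpr σ) :
    e.magnitude B ≤ (AExpr.bin o e f).magnitude B ∧
      f.magnitude B ≤ (AExpr.bin o e f).magnitude B := by
  -- The two summands 1 in the magnitude of a product matter here: without them, a factor of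
  -- magnitude 0 would hide the size of the other one.
  cases o <;> simp only [AExpr.magnitude] <;> constructor <;> nlinarith

/-- The memory holds the values of the variables and the numbers of pieces. -/
structure ValuesAt (mem : ℤ → ℤ) (VA N h : ℤ) (S : SemiState σ) : Prop where
  var : ∀ v : σ.Var, VA + (v : ℕ) < h ∧ mem (VA + (v : ℕ)) = S.value v
  piece : ∀ x : σ.Piece, 6 * N + (x : ℕ) < h ∧
    mem (6 * N + (x : ℕ)) = ((Finset.univ.filter fun v => S.pieceAt v = x).card : ℕ)

theorem ValuesAt.congr {mem mem' : ℤ → ℤ} {VA N h h' : ℤ} {S : SemiState σ} (hv : ValuesAt mem VA N h S)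
    (hh : h ≤ h') (h1 : 0 ≤ VA) (h2 : 0 ≤ N) (hm : ∀ a, 0 ≤ a → a < h → mem' a = mem a) :
    ValuesAt mem' VA N h' S where
  var v := ⟨by have := hv.var v; omega, by
    rw [hm _ (by omega) (hv.var v).1, (hv.var v).2]⟩
  piece x := ⟨by have := hv.piece x; omega, by
    rw [hm _ (by omega) (hv.piece x).1, (hv.piece x).2]⟩

/-- The operator and the value of the first operand wait on the stack, above all data. The flag `er`
is only ever set, so one undefined subexpression makes the whole undefined. -/
theorem go_eval {W : ℤ} {B : Inst σ} {S : SemiState σ} (hS : S.Bounded B) (e : AExpr σ) {M : ℤ}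
    {s : St} {Q : St → Prop} (h0 : 0 ≤ s.q) (ht : HasText s.mem s.q e.text)
    (hq : s.q + alen e ≤ s.sp) (hv : ValuesAt s.mem s.VA s.N s.sp S) (hVA : 0 ≤ s.VA)
    (hN : 0 ≤ s.N) (hNW : 6 * s.N ≤ W)
    (hM : s.sp + 3 * alen e + 4 ≤ M) (hW : s.sp + 2 * alen e + 16 ≤ W)
    (hB : (e.magnitude B : ℤ) + 16 ≤ W)
    (hQ : ∀ t x mem τ, (∀ a, a < s.sp → mem a = s.mem a) → τ ≤ s.time + 120 * alen e →
      Q { s with q := s.q + alen e, t := t, x := x, v := e.total S,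
                 er := if e.IsDef S then s.er else 1, mem := mem, time := τ }) :
    Go W M (.call 4) s Q := by
  induction e generalizing M s Q with
  | bin o e f ihe ihf =>
    rw [AExpr.text] at ht
    have h1 := ht.1
    have h2 := hasText_append.1 ht.2
    have hmag := AExpr.magnitude_bin (B := B) o e f
    have habs := abs_le.1 (AExpr.abs_total_le hS (.bin o e f))
    rw [alen_bin] at hq hM hW hQ
    have := one_le_alen e
    have := one_le_alen f
    have ho : 3 ≤ o.code ∧ o.code ≤ 6 := by cases o <;> simp [ArithOp.code]
    have hlt : 2 < o.code := by omega
    push_cast at hq hM hW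
    refine Run.call rfl (by omega) ?_
    simp only [Code.eval, run_rules, val_rules, cost_rules, ok_rules, St.set, St.get, St.tick,
      zero_lt_ite, true_and, h1, hlt, if_true]
    refine ⟨by omega, by omega, by omega, by omega, by omega, by omega, ?_⟩
    have hm : ∀ a, a < s.sp → upd s.mem s.sp o.code a = s.mem a := fun a ha =>
      upd_of_ne (by omega)
    refine ihe ?_ (h2.1.congr fun a _ ha => hm a ?_) ?_
      (hv.congr ?_ hVA hN fun a _ ha => hm a ha) hVA hN hNW ?_ ?_ ?_ fun t x mem τ hmem hτ => ?_
    · dsimp only; omega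
    · simp only [alen] at *; omega
    all_goals try dsimp only
    iterate 5 omega
    dsimp only at hmem hτ
    have hm2 : ∀ z, ∀ a, a < s.sp → upd mem (s.sp + 1) z a = s.mem a := fun z a ha => by
      rw [upd_of_ne (by omega), hmem _ (by omega), hm a ha]
    refine ⟨by omega, by omega, by omega, ?_⟩
    refine ihf ?_ (h2.2.congr fun a _ ha => hm2 _ a ?_) ?_
      (hv.congr ?_ hVA hN fun a _ ha => hm2 _ a ha) hVA hN hNW ?_ ?_ ?_ fun t' x' mem' τ' hmem' hτ' => ?_
    · dsimp only; omega
    · simp only [alen] at *; omega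
    iterate 5 (try dsimp only); omega
    dsimp only at hmem' hτ' ⊢
    have e1 : mem' (s.sp + 1 + 1 - 2 + 1) = e.total S := by
      rw [hmem' _ (by omega), show s.sp + 1 + 1 - 2 + 1 = s.sp + 1 by ring, upd_self]
    have e2 : mem' (s.sp + 1 + 1 - 2) = o.code := by
      rw [hmem' _ (by omega), show s.sp + 1 + 1 - 2 = s.sp by ring,
        upd_of_ne (by omega), hmem _ (by omega), upd_self]
    have hfr : ∀ a, a < s.sp → mem' a = s.mem a := fun a ha => by
      rw [hmem' _ (by omega), hm2 _ a ha]
    simp only [e1, e2]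
    refine ⟨by omega, by omega, by omega, ?_⟩
    have hfin := fun τ => hQ o.code (e.total S) mem' τ hfr
    push_cast at hfin
    cases o with
    | add =>
      simp only [AExpr.total, ArithOp.eval] at habs
      simp only [Code.evalOp, run_rules, val_rules, cost_rules, ok_rules, St.set, St.get, St.tick,
        zero_lt_ite, true_and, ArithOp.code, Int.reduceLT, if_true, if_false]
      refine ⟨by omega, by omega, ?_⟩
      refine St.transfer hfin (by dsimp only; omega) ?_
      simp only [St.mk.injEq, AExpr.total, ArithOp.eval, AExpr.IsDef, true_and, and_true]
      refine ⟨by ring, by ring, rfl, ?_⟩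
      by_cases he : e.IsDef S = true <;> by_cases hf : f.IsDef S = true <;> simp [he, hf]
    | sub =>
      simp only [AExpr.total, ArithOp.eval] at habs
      simp only [Code.evalOp, run_rules, val_rules, cost_rules, ok_rules, St.set, St.get, St.tick,
        zero_lt_ite, true_and, ArithOp.code, Int.reduceLT, if_true, if_false]
      refine ⟨by omega, by omega, by omega, ?_⟩
      refine St.transfer hfin (by dsimp only; omega) ?_
      simp only [St.mk.injEq, AExpr.total, ArithOp.eval, AExpr.IsDef, true_and, and_true]
      refine ⟨by ring, by ring, rfl, ?_⟩
      by_cases he : e.IsDef S = true <;> by_cases hf : f.IsDef S = true <;> simp [he, hf]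
    | mul =>
      simp only [AExpr.total, ArithOp.eval] at habs
      simp only [Code.evalOp, run_rules, val_rules, cost_rules, ok_rules, St.set, St.get, St.tick,
        zero_lt_ite, true_and, ArithOp.code, Int.reduceLT, if_true, if_false]
      refine ⟨by omega, by omega, by omega, by omega, ?_⟩
      refine St.transfer hfin (by dsimp only; omega) ?_
      simp only [St.mk.injEq, AExpr.total, ArithOp.eval, AExpr.IsDef, true_and, and_true]
      refine ⟨by ring, by ring, rfl, ?_⟩
      by_cases he : e.IsDef S = true <;> by_cases hf : f.IsDef S = true <;> simp [he, hf]
    | div =>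
      have hpos : (0 < 1 - (if f.total S < 0 then (1 : ℤ) else 0) - (if 0 < f.total S then (1 : ℤ) else 0)) ↔
          f.total S = 0 := by split_ifs <;> omega
      have habs' := abs_le.1 (AExpr.abs_total_le hS f)
      simp only [AExpr.total, ArithOp.eval] at habs
      simp only [Code.evalOp, run_rules, val_rules, cost_rules, ok_rules, St.set, St.get, St.tick,
        zero_lt_ite, true_and, ArithOp.code, Int.reduceLT, if_true, if_false, hpos]
      refine ⟨by omega, by omega, by omega, ?_, ?_⟩
      · refine ⟨⟨by omega, by omega, ?_⟩, by omega, ?_⟩ <;> split_ifs <;> omega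
      by_cases hz : f.total S = 0
      · rw [if_pos hz]
        refine ⟨by omega, by omega, ?_⟩
        refine St.transfer hfin (by dsimp only; omega) ?_
        simp only [St.mk.injEq, AExpr.total, ArithOp.eval, AExpr.IsDef, true_and, and_true]
        refine ⟨by ring, by ring, rfl, ?_⟩
        simp [hz]
      · rw [if_neg hz]
        refine ⟨by omega, ?_⟩
        refine St.transfer hfin (by dsimp only; omega) ?_
        simp only [St.mk.injEq, AExpr.total, ArithOp.eval, AExpr.IsDef, true_and, and_true]
        refine ⟨by ring, by ring, rfl, ?_⟩
        by_cases he : e.IsDef S = true <;> by_cases hf : f.IsDef S = true <;> simp [he, hf, hz]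
  | lit z =>
    have h1 := ht.1
    have h2 := ht.2.1
    have hl : alen (σ := σ) (.lit z) = 2 := rfl
    rw [hl] at hq hM hW hQ
    refine Run.call rfl (by omega) ?_
    simp only [Code.eval, run_rules, val_rules, cost_rules, ok_rules, St.set, St.get, St.tick,
      zero_lt_ite, true_and, h1, h2, Int.reduceLT, if_false, if_true]
    refine ⟨by omega, by omega, by omega, by omega, by omega, ?_⟩
    exact hQ _ _ s.mem _ (fun _ _ => rfl) (by omega)
  | var v =>
    have h1 := ht.1
    have h2 := ht.2.1
    have hl : alen (σ := σ) (.var v) = 2 := rfl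
    rw [hl] at hq hM hW hQ
    refine Run.call rfl (by omega) ?_
    have h3 := hv.var v
    simp only [Code.eval, run_rules, val_rules, cost_rules, ok_rules, St.set, St.get, St.tick,
      zero_lt_ite, true_and, h1, h2, Int.reduceLT, if_false, if_true, h3.2]
    refine ⟨by omega, by omega, by omega, by omega, by omega, by omega, by omega, ?_⟩
    exact hQ _ _ s.mem _ (fun _ _ => rfl) (by omega)
  | piece v =>
    have h1 := ht.1
    have h2 := ht.2.1
    have hl : alen (σ := σ) (.piece v) = 2 := rfl
    rw [hl] at hq hM hW hQ
    refine Run.call rfl (by omega) ?_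
    have h3 := hv.piece v
    simp only [Code.eval, run_rules, val_rules, cost_rules, ok_rules, St.set, St.get, St.tick,
      zero_lt_ite, true_and, h1, h2, Int.reduceLT, if_false, if_true, h3.2]
    refine ⟨by omega, by omega, by omega, by omega, by omega, by omega, by omega, ?_⟩
    exact hQ _ _ s.mem _ (fun _ _ => rfl) (by omega)

end RBG

namespace RBG

variable {σ : Sig}

/-! ## Filling the tables -/

/-- The filled tables depend only on the entries for the addresses of the expression's own text.
Induction on the length again serves to get inside patterns. -/
theorem exprLaid_congr {mem mem' : ℤ → ℤ} {N : ℤ} (l : ℕ) (E : Regex (Action σ))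
    (hl : (exprText E).length ≤ l) {p c : ℤ} {n : ℕ} (h : exprLaid mem N E p c n)
    (h1 : ∀ x, p ≤ x → x < p + (exprText E).length → mem' (N + x) = mem (N + x))
    (h2 : ∀ x, p ≤ x → x < p + (exprText E).length → mem' (2 * N + x) = mem (2 * N + x))
    (h3 : ∀ x, p ≤ x → x < p + (exprText E).length → mem' (3 * N + x) = mem (3 * N + x)) :
    exprLaid mem' N E p c n := by
  induction l generalizing E p c n with
  | zero => have := exprText_ne_nil E; omega
  | succ l ih =>
    have hE := exprText_ne_nil E
    have e1 := h1 p le_rfl (by omega)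
    have e2 := h2 p le_rfl (by omega)
    have e3 := h3 p le_rfl (by omega)
    have sub : ∀ (F : Regex (Action σ)) (p' c' : ℤ) (n' : ℕ), exprLaid mem N F p' c' n' →
        (exprText F).length ≤ l → p ≤ p' →
        p' + (exprText F).length ≤ p + (exprText E).length → exprLaid mem' N F p' c' n' :=
      fun F p' c' n' hF hlF hp hp' => ih F hlF hF (fun x a b => h1 x (by omega) (by omega))
        (fun x a b => h2 x (by omega) (by omega)) (fun x a b => h3 x (by omega) (by omega))
    cases E with
    | sum E F =>
      rw [exprText, List.length_cons, List.length_append] at sub hl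
      obtain ⟨a, b, hE, hF⟩ := h
      exact ⟨e1.trans a, e2.trans b, sub E _ _ _ hE (by omega) (by omega) (by push_cast; omega),
        sub F _ _ _ hF (by omega) (by omega) (by push_cast; omega)⟩
    | cat E F =>
      rw [exprText, List.length_cons, List.length_append] at sub hl
      obtain ⟨a, b, hE, hF⟩ := h
      exact ⟨e1.trans a, e2.trans b, sub E _ _ _ hE (by omega) (by omega) (by push_cast; omega),
        sub F _ _ _ hF (by omega) (by omega) (by push_cast; omega)⟩
    | star E =>
      rw [exprText, List.length_cons] at sub hl
      obtain ⟨a, b, hE⟩ := h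
      exact ⟨e1.trans a, e2.trans b, sub E _ _ _ hE (by omega) (by omega) (by push_cast; omega)⟩
    | act a =>
      obtain ⟨ha, hb, hc⟩ := h
      refine ⟨e1.trans ha, e3.trans hb, ?_⟩
      cases a with
      | check F =>
        rw [exprText, Action.text, List.length_cons] at sub hl
        exact ⟨e2.trans hc.1, sub F _ _ _ hc.2 (by omega) (by omega) (by push_cast; omega)⟩
      | checkNot F =>
        rw [exprText, Action.text, List.length_cons] at sub hl
        exact ⟨e2.trans hc.1, sub F _ _ _ hc.2 (by omega) (by omega) (by push_cast; omega)⟩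
      | _ => trivial

theorem Regex.count_le_length (E : Regex (Action σ)) : E.count ≤ (exprText E).length := by
  induction E with
  | act a => exact a.one_le_length_text
  | sum E F ihE ihF => simp only [Regex.count, exprText, List.length_cons, List.length_append]; omega
  | cat E F ihE ihF => simp only [Regex.count, exprText, List.length_cons, List.length_append]; omega
  | star E ih => simp only [Regex.count, exprText, List.length_cons]; omega

/-- The cells below `h` that belong to the tables for the addresses from `q` to `q + l - 1` and the
numbers from `n + 1` to `n + l`. -/
def InTables (N q : ℤ) (n : ℕ) (l : ℤ) (x : ℤ) : Prop :=
  N + q ≤ x ∧ x < N + q + l ∨ 2 * N + q ≤ x ∧ x < 2 * N + q + l ∨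
    3 * N + q ≤ x ∧ x < 3 * N + q + l ∨ 4 * N + n < x ∧ x ≤ 4 * N + n + l

/-- The tables for an expression have been filled; nothing else below `h` has been changed. -/
structure Parsed (N h : ℤ) (mem mem' : ℤ → ℤ) (E : Regex (Action σ)) (q c : ℤ) (n : ℕ) : Prop where
  frame : ∀ x, x < h → ¬ InTables N q n (exprText E).length x → mem' x = mem x
  laid : exprLaid mem' N E q c n
  jump : ∀ k z x, NodeAt N (E.number n) q k c z → z.expr = .act x → mem' (4 * N + x.1) = z.cell

/-- The memory after a letter has been numbered. -/
def numbered (mem : ℤ → ℤ) (N q c : ℤ) (n : ℕ) : ℤ → ℤ :=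
  upd (upd (upd mem (N + q) c) (3 * N + q) (n + 1)) (4 * N + (n + 1)) c

theorem Parsed.letter {N h : ℤ} {mem mem' : ℤ → ℤ} {a : Action σ} {q c : ℤ} {n : ℕ}
    (hm : ∀ x, x < h → ¬ InTables N q n a.text.length x → mem' x = mem x)
    (h1 : mem' (N + q) = c) (h3 : mem' (3 * N + q) = n + 1)
    (h4 : mem' (4 * N + (n + 1)) = c) (ha : a.Laid mem' N q (n + 1)) :
    Parsed N h mem mem' (.act a) q c n where
  frame := hm
  laid := ⟨h1, h3, ha⟩
  jump := by
    rintro k z x (rfl : z = _) hx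
    obtain rfl := Regex.act.inj hx
    simpa using h4

theorem Parsed.leaf {N h : ℤ} {mem : ℤ → ℤ} {a : Action σ} {q c : ℤ} {n : ℕ} (h0 : 0 ≤ q)
    (hN : q + a.text.length ≤ N) (hn : n + a.text.length < N)
    (ha : ∀ mem, a.Laid mem N q (n + 1)) :
    Parsed N h mem (numbered mem N q c n) (.act a) q c n := by
  have := a.one_le_length_text
  refine .letter (fun x _ hx => ?_) ?_ ?_ ?_ (ha _)
  · rw [InTables] at hx
    rw [numbered, upd_of_ne (by omega), upd_of_ne (by omega), upd_of_ne (by omega)]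
  · rw [numbered, upd_of_ne (by omega), upd_of_ne (by omega), upd_self]
  · rw [numbered, upd_of_ne (by omega), upd_self]
  · rw [numbered, upd_self]

/-- The cell `h` holds `q` while the first operand is parsed, hence the frame up to `h + 1`. In
tables 1 to 3 the operands use disjoint ranges. In table 4 the ranges may overlap, as letters inside
patterns of `E` have numbers above `n + E.count`; but those entries belong to no node, and the
second operand leaves the others alone. -/
theorem Parsed.sum {N h : ℤ} {mem mem₁ mem₂ : ℤ → ℤ} {E F : Regex (Action σ)} {q c : ℤ} {n : ℕ}
    (h0 : 0 ≤ q) (hN : q + (exprText (.sum E F)).length ≤ N) (hn : n + (exprText (.sum E F)).length < N)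
    (hh : 5 * N ≤ h)
    (hE : Parsed N (h + 1) (upd (upd mem (N + q) c) h q) mem₁ E (q + 1) c n)
    (hF : Parsed N h (upd mem₁ (2 * N + q) (q + 1 + (exprText E).length)) mem₂ F
      (q + 1 + (exprText E).length) c (n + E.count)) : Parsed N h mem mem₂ (.sum E F) q c n := by
  have := E.count_le_length
  have := exprText_ne_nil E
  have := exprText_ne_nil F
  simp only [exprText, List.length_cons, List.length_append, Nat.cast_add, Nat.cast_one] at hN hn
  have f2 : ∀ x, x < h → ¬ InTables N (q + 1 + (exprText E).length) (n + E.count) (exprText F).length x →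
      x ≠ 2 * N + q → mem₂ x = mem₁ x := fun x hx hx' h' => by
    rw [hF.frame x hx hx', upd_of_ne h']
  have f1 : ∀ x, x < h → ¬ InTables N (q + 1) n (exprText E).length x →
      x ≠ N + q → mem₁ x = mem x := fun x hx hx' h' => by
    rw [hE.frame x (by omega) hx', upd_of_ne (by omega), upd_of_ne h']
  refine ⟨fun x hx hx' => ?_, ⟨?_, ?_, ?_, hF.laid⟩, ?_⟩
  · simp only [InTables, exprText, List.length_cons, List.length_append, Nat.cast_add, Nat.cast_one] at hx'
    rw [f2 x hx (by rw [InTables]; push_cast; omega) (by omega),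
      f1 x hx (by rw [InTables]; omega) (by omega)]
  · rw [f2 _ (by omega) (by rw [InTables]; push_cast; omega) (by omega),
      hE.frame _ (by omega) (by rw [InTables]; omega), upd_of_ne (by omega), upd_self]
  · rw [hF.frame _ (by omega) (by rw [InTables]; push_cast; omega), upd_self]
  · refine exprLaid_congr _ E le_rfl hE.laid ?_ ?_ ?_ <;> intro x hx hx' <;>
      exact f2 _ (by omega) (by rw [InTables]; push_cast; omega) (by omega)
  · rintro k z x hz hx
    rcases hz with rfl | hz | hz
    · simp at hx
    · have := hz.index_range hx
      rw [f2 _ (by omega) (by rw [InTables]; push_cast; omega) (by omega)]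
      exact hE.jump k z x hz hx
    · rw [nlen_number] at hz
      exact hF.jump k z x hz hx

theorem Parsed.cat {N h : ℤ} {mem mem₁ mem₂ : ℤ → ℤ} {E F : Regex (Action σ)} {q c : ℤ} {n : ℕ}
    (h0 : 0 ≤ q) (hN : q + (exprText (.cat E F)).length ≤ N) (hn : n + (exprText (.cat E F)).length < N)
    (hh : 5 * N ≤ h)
    (hE : Parsed N (h + 1) (upd (upd mem (N + q) c) h q) mem₁ E (q + 1) (2 * N + q) n)
    (hF : Parsed N h (upd mem₁ (2 * N + q) (q + 1 + (exprText E).length)) mem₂ F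
      (q + 1 + (exprText E).length) c (n + E.count)) : Parsed N h mem mem₂ (.cat E F) q c n := by
  have := E.count_le_length
  have := exprText_ne_nil E
  have := exprText_ne_nil F
  simp only [exprText, List.length_cons, List.length_append, Nat.cast_add, Nat.cast_one] at hN hn
  have f2 : ∀ x, x < h → ¬ InTables N (q + 1 + (exprText E).length) (n + E.count) (exprText F).length x →
      x ≠ 2 * N + q → mem₂ x = mem₁ x := fun x hx hx' h' => by
    rw [hF.frame x hx hx', upd_of_ne h']
  have f1 : ∀ x, x < h → ¬ InTables N (q + 1) n (exprText E).length x →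
      x ≠ N + q → mem₁ x = mem x := fun x hx hx' h' => by
    rw [hE.frame x (by omega) hx', upd_of_ne (by omega), upd_of_ne h']
  refine ⟨fun x hx hx' => ?_, ⟨?_, ?_, ?_, hF.laid⟩, ?_⟩
  · simp only [InTables, exprText, List.length_cons, List.length_append, Nat.cast_add, Nat.cast_one] at hx'
    rw [f2 x hx (by rw [InTables]; push_cast; omega) (by omega),
      f1 x hx (by rw [InTables]; omega) (by omega)]
  · rw [f2 _ (by omega) (by rw [InTables]; push_cast; omega) (by omega),
      hE.frame _ (by omega) (by rw [InTables]; omega), upd_of_ne (by omega), upd_self]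
  · rw [hF.frame _ (by omega) (by rw [InTables]; push_cast; omega), upd_self]
  · refine exprLaid_congr _ E le_rfl hE.laid ?_ ?_ ?_ <;> intro x hx hx' <;>
      exact f2 _ (by omega) (by rw [InTables]; push_cast; omega) (by omega)
  · rintro k z x hz hx
    rcases hz with rfl | hz | hz
    · simp at hx
    · have := hz.index_range hx
      rw [f2 _ (by omega) (by rw [InTables]; push_cast; omega) (by omega)]
      exact hE.jump _ z x hz hx
    · rw [nlen_number] at hz
      exact hF.jump k z x hz hx

theorem Parsed.star {N h : ℤ} {mem mem₁ : ℤ → ℤ} {E : Regex (Action σ)} {q c : ℤ} {n : ℕ}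
    (h0 : 0 ≤ q) (hN : q + (exprText (.star E)).length ≤ N) (hn : n + (exprText (.star E)).length < N)
    (hh : 5 * N ≤ h)
    (hE : Parsed N h (upd (upd mem (N + q) c) (2 * N + q) q) mem₁ E (q + 1) (2 * N + q) n) :
    Parsed N h mem mem₁ (.star E) q c n := by
  have := exprText_ne_nil E
  simp only [exprText, List.length_cons, Nat.cast_add, Nat.cast_one] at hN hn
  refine ⟨fun x hx hx' => ?_, ⟨?_, ?_, hE.laid⟩, ?_⟩
  · simp only [InTables, exprText, List.length_cons, Nat.cast_add, Nat.cast_one] at hx'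
    rw [hE.frame x hx (by rw [InTables]; omega), upd_of_ne (by omega), upd_of_ne (by omega)]
  · rw [hE.frame _ (by omega) (by rw [InTables]; omega), upd_of_ne (by omega), upd_self]
  · rw [hE.frame _ (by omega) (by rw [InTables]; omega), upd_self]
  · rintro k z x hz hx
    rcases hz with rfl | hz
    · simp at hx
    · exact hE.jump _ z x hz hx

/-- The tables for a pattern. -/
theorem Parsed.pattern {N h : ℤ} {mem mem₁ : ℤ → ℤ} {a : Action σ} {E : Regex (Action σ)} {q c : ℤ}
    {n : ℕ} (h0 : 0 ≤ q) (hl : a.text.length = 1 + (exprText E).length)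
    (ha : ∀ m, a.Laid m N q (n + 1) ↔ m (2 * N + q) = q + 1 + (exprText E).length ∧
      exprLaid m N E (q + 1) (7 * N) (n + 1))
    (hN : q + a.text.length ≤ N) (hn : n + a.text.length < N) (hh : 5 * N ≤ h)
    (hE : Parsed N (h + 1) (upd (numbered mem N q c n) h q) mem₁ E (q + 1) (7 * N) (n + 1)) :
    Parsed N h mem (upd mem₁ (2 * N + q) (q + 1 + (exprText E).length)) (.act a) q c n := by
  have := exprText_ne_nil E
  have f1 : ∀ x, x < h → ¬ InTables N (q + 1) (n + 1) (exprText E).length x →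
      mem₁ x = numbered mem N q c n x := fun x hx hx' => by
    rw [hE.frame x (by omega) hx', upd_of_ne (by omega)]
  refine .letter (fun x hx hx' => ?_) ?_ ?_ ?_ ((ha _).2 ⟨upd_self .., ?_⟩)
  · rw [InTables] at hx'
    rw [upd_of_ne (by omega), f1 x hx (by rw [InTables]; push_cast; omega), numbered,
      upd_of_ne (by omega), upd_of_ne (by omega), upd_of_ne (by omega)]
  · rw [upd_of_ne (by omega), f1 _ (by omega) (by rw [InTables]; push_cast; omega), numbered,
      upd_of_ne (by omega), upd_of_ne (by omega), upd_self]
  · rw [upd_of_ne (by omega), f1 _ (by omega) (by rw [InTables]; push_cast; omega), numbered,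
      upd_of_ne (by omega), upd_self]
  · rw [upd_of_ne (by omega), f1 _ (by omega) (by rw [InTables]; push_cast; omega), numbered, upd_self]
  · refine exprLaid_congr _ E le_rfl hE.laid ?_ ?_ ?_ <;> intro x hx hx' <;>
      exact upd_of_ne (by omega)


/-- The text behind a letter of an expression with continuation cell `c`. -/
theorem go_parse_tail {a : Action σ} {s : St} {n : ℕ} {Q : St → Prop}
    (hp : ∀ m, a.Laid m s.N s.q (n + 1)) (h0 : 0 ≤ s.q)
    (hN : s.q + a.text.length ≤ s.N) (hn : n + a.text.length < s.N)
    (hQ : ∀ t p c mem τ, Parsed s.N s.sp s.mem mem (.act a) s.q s.c n →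
      τ ≤ s.time + 200 * a.text.length →
      Q { s with q := s.q + a.text.length, i := s.i + 1, t := t, p := p, c := c, mem := mem,
                 time := τ }) (s' : St) (h' : s'.time ≤ s.time + 200 * a.text.length)
    (hs : s' = { s with
      q := s.q + a.text.length, i := s.i + 1, t := s'.t,
      mem := numbered s.mem s.N s.q s.c n, time := s'.time }) : Q s' := by
  rw [hs]
  exact hQ _ _ _ _ _ (.leaf h0 hN hn hp) h'

/-- Each case runs the program symbolically and then applies the lemma on `Parsed` for its shape.
The registers `t`, `p`, `c` end with arbitrary contents, hence the quantifiers in `hQ`. -/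
theorem go_parse {W : ℤ} (l : ℕ) (E : Regex (Action σ)) (hl : (exprText E).length ≤ l)
    {M : ℤ} {s : St} {n : ℕ} {Q : St → Prop} (h0 : 0 ≤ s.q) (ht : HasText s.mem s.q (exprText E))
    (hN : s.q + (exprText E).length ≤ s.N) (hi : s.i = n) (hn : n + (exprText E).length < s.N)
    (hsp : 7 * s.N + 2 ≤ s.sp)
    (hM : s.sp + 3 * (exprText E).length + 4 ≤ M) (hW : s.sp + (exprText E).length + 20 ≤ W)
    (hA : ∀ x ∈ exprText E, x + 16 ≤ W)
    (hQ : ∀ t p c mem τ, Parsed s.N s.sp s.mem mem E s.q s.c n →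
      τ ≤ s.time + 200 * (exprText E).length →
      Q { s with q := s.q + (exprText E).length, i := s.i + E.count, t := t, p := p, c := c,
                 mem := mem, time := τ }) :
    Go W M (.call 3) s Q := by
  induction l generalizing E M s n Q with
  | zero => have := exprText_ne_nil E; omega
  | succ l ih =>
  have hE := exprText_ne_nil E
  refine Run.call rfl (by omega) ?_
  have hmq : upd s.mem (s.N + s.q) s.c s.q = s.mem s.q := upd_of_ne (by omega)
  simp only [Code.parse, Code.cases, Code.letter, run_rules, val_rules, cost_rules, ok_rules,
    St.set, St.get, St.tick, zero_lt_ite, true_and, Code.tab, hmq, one_mul]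
  repeat refine And.intro (by omega) ?_
  cases E with
  | sum E F =>
    have hp := fun mem₁ mem₂ => Parsed.sum (N := s.N) (h := s.sp) (mem := s.mem) (mem₁ := mem₁)
      (mem₂ := mem₂) (E := E) (F := F) (q := s.q) (c := s.c) (n := n) h0 hN hn (by omega)
    rw [exprText] at hl ht hM hW hA hQ hN hn
    simp only [List.length_cons, List.length_append, Nat.cast_add, Nat.cast_one] at hl hM hW hQ hN hn
    have := exprText_ne_nil E
    have := exprText_ne_nil F
    have := E.count_le_length
    have h1 := ht.1
    have h2 := hasText_append.1 ht.2
    simp only [h1, Int.reduceNeg, Int.reduceSub, Int.reduceLT, if_true, if_false]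
    simp only [Code.parseSum, Code.parseSecond, run_rules, val_rules, cost_rules, ok_rules, St.set,
      St.get, St.tick, zero_lt_ite, true_and, Code.tab, one_mul]
    repeat refine And.intro (by omega) ?_
    refine ih E (by omega) (n := n) ?_ ?_ ?_ hi ?_ ?_ ?_ ?_
      (fun x hx => hA x (by simp [hx])) fun t p c mem₁ τ hP hτ => ?_
    · dsimp only; omega
    · refine h2.1.congr fun x _ _ => ?_
      dsimp only; rw [upd_of_ne (by omega), upd_of_ne (by omega)]
    iterate 5 dsimp only; omega
    dsimp only at hP hτ
    have e1 : mem₁ (s.sp + 1 - 1) = s.q := by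
      rw [hP.frame _ (by omega) (by rw [InTables]; omega), add_sub_cancel_right, upd_self]
    have e2 : ∀ v, upd mem₁ (2 * s.N + s.q) v (s.N + s.q) = s.c := fun v => by
      rw [upd_of_ne (by omega), hP.frame _ (by omega) (by rw [InTables]; omega),
        upd_of_ne (by omega), upd_self]
    simp only [e1, e2]
    repeat refine And.intro (by omega) ?_
    refine ih F (by omega) (n := n + E.count) ?_ ?_ ?_ ?_ ?_ ?_ ?_ ?_
      (fun x hx => hA x (by simp [hx])) fun t' p' c' mem₂ τ' hP' hτ' => ?_
    · dsimp only; omega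
    · refine h2.2.congr fun x _ _ => ?_
      dsimp only
      rw [upd_of_ne (by omega), hP.frame _ (by omega) (by rw [InTables]; omega),
        upd_of_ne (by omega), upd_of_ne (by omega)]
    iterate 6 dsimp only; omega
    dsimp only at hP' hτ'
    rw [show s.sp + 1 - 1 = s.sp by ring] at hP'
    refine St.transfer (fun τ => hQ t' p' c' mem₂ τ (hp _ _ hP hP')) (by dsimp only; omega) ?_
    simp only [St.mk.injEq, Regex.count, Nat.cast_add, true_and, and_true]
    refine ⟨by ring, by ring, by ring⟩
  | cat E F =>
    have hp := fun mem₁ mem₂ => Parsed.cat (N := s.N) (h := s.sp) (mem := s.mem) (mem₁ := mem₁)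
      (mem₂ := mem₂) (E := E) (F := F) (q := s.q) (c := s.c) (n := n) h0 hN hn (by omega)
    rw [exprText] at hl ht hM hW hA hQ hN hn
    simp only [List.length_cons, List.length_append, Nat.cast_add, Nat.cast_one] at hl hM hW hQ hN hn
    have := exprText_ne_nil E
    have := exprText_ne_nil F
    have := E.count_le_length
    have h1 := ht.1
    have h2 := hasText_append.1 ht.2
    simp only [h1, Int.reduceNeg, Int.reduceSub, Int.reduceLT, if_true, if_false]
    simp only [Code.parseCat, Code.parseSecond, run_rules, val_rules, cost_rules, ok_rules, St.set,
      St.get, St.tick, zero_lt_ite, true_and, Code.tab, one_mul]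
    repeat refine And.intro (by omega) ?_
    refine ih E (by omega) (n := n) ?_ ?_ ?_ hi ?_ ?_ ?_ ?_
      (fun x hx => hA x (by simp [hx])) fun t p c mem₁ τ hP hτ => ?_
    · dsimp only; omega
    · refine h2.1.congr fun x _ _ => ?_
      dsimp only; rw [upd_of_ne (by omega), upd_of_ne (by omega)]
    iterate 5 dsimp only; omega
    dsimp only at hP hτ
    have e1 : mem₁ (s.sp + 1 - 1) = s.q := by
      rw [hP.frame _ (by omega) (by rw [InTables]; omega), add_sub_cancel_right, upd_self]
    have e2 : ∀ v, upd mem₁ (2 * s.N + s.q) v (s.N + s.q) = s.c := fun v => by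
      rw [upd_of_ne (by omega), hP.frame _ (by omega) (by rw [InTables]; omega),
        upd_of_ne (by omega), upd_self]
    simp only [e1, e2]
    repeat refine And.intro (by omega) ?_
    refine ih F (by omega) (n := n + E.count) ?_ ?_ ?_ ?_ ?_ ?_ ?_ ?_
      (fun x hx => hA x (by simp [hx])) fun t' p' c' mem₂ τ' hP' hτ' => ?_
    · dsimp only; omega
    · refine h2.2.congr fun x _ _ => ?_
      dsimp only
      rw [upd_of_ne (by omega), hP.frame _ (by omega) (by rw [InTables]; omega),
        upd_of_ne (by omega), upd_of_ne (by omega)]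
    iterate 6 dsimp only; omega
    dsimp only at hP' hτ'
    rw [show s.sp + 1 - 1 = s.sp by ring] at hP'
    refine St.transfer (fun τ => hQ t' p' c' mem₂ τ (hp _ _ hP hP')) (by dsimp only; omega) ?_
    simp only [St.mk.injEq, Regex.count, Nat.cast_add, true_and, and_true]
    refine ⟨by ring, by ring, by ring⟩
  | star E =>
    have hp := fun mem₁ => Parsed.star (N := s.N) (h := s.sp) (mem := s.mem) (mem₁ := mem₁) (E := E)
      (q := s.q) (c := s.c) (n := n) h0 hN hn (by omega)
    rw [exprText] at hl ht hM hW hA hQ hN hn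
    simp only [List.length_cons, Nat.cast_add, Nat.cast_one] at hl hM hW hQ hN hn
    have := exprText_ne_nil E
    have h1 := ht.1
    simp only [h1, Int.reduceNeg, Int.reduceSub, Int.reduceLT, if_true, if_false]
    simp only [Code.parseStar, run_rules, val_rules, cost_rules, ok_rules, St.set, St.get, St.tick,
      zero_lt_ite, true_and, Code.tab, one_mul]
    repeat refine And.intro (by omega) ?_
    refine ih E (by omega) (n := n) ?_ ?_ ?_ hi ?_ ?_ ?_ ?_
      (fun x hx => hA x (by simp [hx])) fun t p c mem₁ τ hP hτ => ?_
    · dsimp only; omega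
    · refine ht.2.congr fun x _ _ => ?_
      dsimp only; rw [upd_of_ne (by omega), upd_of_ne (by omega)]
    iterate 5 dsimp only; omega
    dsimp only at hP hτ
    refine St.transfer (fun τ => hQ t p c mem₁ τ (hp _ hP)) (by dsimp only; omega) ?_
    simp only [St.mk.injEq, Regex.count, true_and, and_true]
    ring
  | act a =>
    have hp := go_parse_tail (a := a) (s := s) (n := n) (Q := Q)
    cases a with
    | shift dir =>
      replace hp := hp (fun _ => trivial) h0 hN hn hQ
      have h1 := ht.1
      have h2 : -1 < ((dir : ℕ) : ℤ) := by omega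
      have h3 := hA dir (by simp [exprText, Action.text])
      simp only [exprText, Action.text, List.length_cons, List.length_nil, Nat.cast_add,
        Nat.cast_one] at hl hM hW hN hn hp
      simp only [h1, h2, if_true]
      repeat refine And.intro (by omega) ?_
      refine hp _ ?_ ?_
      · dsimp only; omega
      · simp only [numbered, hi, St.mk.injEq, true_and, and_true]; ring
    | on X =>
      replace hp := hp (fun _ => trivial) h0 hN hn hQ
      rw [exprText, Action.text_on] at ht hl hM hW hN hn
      rw [Action.text_on] at hp
      have h1 := ht.1
      have h2 := ht.2.1
      simp only [List.length_cons, List.length_map, Finset.length_sort, Nat.cast_add,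
        Nat.cast_one] at hl hM hW hN hn hp
      simp only [h1, Int.reduceNeg, Int.reduceSub, Int.reduceLT, if_true, if_false]
      have e2 : ∀ v v' v'', upd (upd (upd s.mem (s.N + s.q) v) (3 * s.N + s.q) v') (4 * s.N + (s.i + 1))
          v'' (s.q + 1) = X.card := fun v v' v'' => by
        rw [upd_of_ne (by omega), upd_of_ne (by omega), upd_of_ne (by omega), h2]
      simp only [e2]
      repeat refine And.intro (by omega) ?_
      refine hp _ ?_ ?_
      · dsimp only; omega
      · simp only [numbered, hi, St.mk.injEq, true_and, and_true]; ring
    | off x =>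
      replace hp := hp (fun _ => trivial) h0 hN hn hQ
      have h1 := ht.1
      simp only [exprText, Action.text, List.length_cons, List.length_nil, Nat.cast_add,
        Nat.cast_one] at hl hM hW hN hn hp
      simp only [h1, Int.reduceNeg, Int.reduceSub, Int.reduceLT, if_true, if_false]
      repeat refine And.intro (by omega) ?_
      refine hp _ ?_ ?_
      · dsimp only; omega
      · simp only [numbered, hi, St.mk.injEq, true_and, and_true]; ring
    | switch x =>
      replace hp := hp (fun _ => trivial) h0 hN hn hQ
      have h1 := ht.1
      simp only [exprText, Action.text, List.length_cons, List.length_nil, Nat.cast_add,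
        Nat.cast_one] at hl hM hW hN hn hp
      simp only [h1, Int.reduceNeg, Int.reduceSub, Int.reduceLT, if_true, if_false]
      repeat refine And.intro (by omega) ?_
      refine hp _ ?_ ?_
      · dsimp only; omega
      · simp only [numbered, hi, St.mk.injEq, true_and, and_true]; ring
    | assign v e =>
      replace hp := hp (fun _ => trivial) h0 hN hn hQ
      have h1 := ht.1
      have h2 := ht.2.2
      simp only [exprText, Action.text, List.length_cons, Nat.cast_add, Nat.cast_one] at hl hM hW hN hn hp
      simp only [h1, Int.reduceNeg, Int.reduceSub, Int.reduceLT, if_true, if_false]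
      repeat refine And.intro (by omega) ?_
      refine go_skipExpr e ?_ ?_ ?_ ?_ fun t' τ' hτ' => ?_
      · dsimp only; omega
      · rw [add_assoc] at h2
        refine h2.congr fun x _ _ => ?_
        dsimp only
        rw [upd_of_ne (by omega), upd_of_ne (by omega), upd_of_ne (by omega)]
      iterate 2 dsimp only [alen]; omega
      dsimp only [alen] at hτ' ⊢
      refine hp _ ?_ ?_
      · dsimp only; omega
      · simp only [numbered, hi, St.mk.injEq, true_and, and_true]; ring
    | compare o e f =>
      replace hp := hp (fun _ => trivial) h0 hN hn hQ
      have h1 := ht.1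
      have h2 := ht.2.2
      rw [add_assoc] at h2
      simp only [exprText, Action.text, List.length_cons, List.length_append, Nat.cast_add,
        Nat.cast_one] at hl hM hW hN hn hp
      have h3 := hasText_append.1 (h2.congr (mem' := numbered s.mem s.N s.q s.c n) fun x _ _ => by
        simp only [List.length_append, Nat.cast_add] at *
        rw [numbered, upd_of_ne (by omega), upd_of_ne (by omega), upd_of_ne (by omega)])
      rw [numbered, ← hi] at h3
      simp only [h1, Int.reduceNeg, Int.reduceSub, Int.reduceLT, if_true, if_false]
      repeat refine And.intro (by omega) ?_
      refine go_skipExpr e ?_ h3.1 ?_ ?_ fun t τ hτ =>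
        go_skipExpr f ?_ h3.2 ?_ ?_ fun t' τ' hτ' => ?_
      iterate 6 dsimp only [alen]; omega
      dsimp only [alen] at hτ hτ' ⊢
      refine hp _ ?_ ?_
      · dsimp only; omega
      · simp only [numbered, hi, St.mk.injEq, true_and, and_true]; ring
    | check E =>
      have hp := fun mem₁ => Parsed.pattern (N := s.N) (h := s.sp) (mem := s.mem) (mem₁ := mem₁)
        (a := .check E) (E := E) (q := s.q) (c := s.c) (n := n) h0
        (by rw [Action.text, List.length_cons, add_comm]) (fun _ => Iff.rfl) hN hn (by omega)
      rw [exprText, Action.text] at hl ht hM hW hA hQ hN hn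
      simp only [List.length_cons, Nat.cast_add, Nat.cast_one] at hl hM hW hQ hN hn
      have := exprText_ne_nil E
      have h1 := ht.1
      simp only [h1, Int.reduceNeg, Int.reduceSub, Int.reduceLT, if_true, if_false]
      simp only [Code.parseCheck, Code.letter, run_rules, val_rules, cost_rules, ok_rules, St.set,
        St.get, St.tick, zero_lt_ite, true_and, Code.tab, one_mul]
      repeat refine And.intro (by omega) ?_
      refine ih E (by omega) (n := n + 1) ?_ ?_ ?_ ?_ ?_ ?_ ?_ ?_
        (fun x hx => hA x (by simp [hx])) fun t p c mem₁ τ hP hτ => ?_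
      · dsimp only; omega
      · refine ht.2.congr fun x _ _ => ?_
        dsimp only
        rw [upd_of_ne (by omega), upd_of_ne (by omega), upd_of_ne (by omega), upd_of_ne (by omega)]
      iterate 6 dsimp only; omega
      dsimp only at hP hτ
      have hnum : upd (upd (upd s.mem (s.N + s.q) s.c) (3 * s.N + s.q) (s.i + 1))
          (4 * s.N + (s.i + 1)) s.c = numbered s.mem s.N s.q s.c n := by rw [numbered, hi]
      rw [hnum] at hP
      have e1 : mem₁ (s.sp + 1 - 1) = s.q := by
        rw [hP.frame _ (by omega) (by rw [InTables]; push_cast; omega), add_sub_cancel_right, upd_self]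
      have e2 : ∀ v, upd mem₁ (2 * s.N + s.q) v (3 * s.N + s.q) = n + 1 := fun v => by
        rw [upd_of_ne (by omega), hP.frame _ (by omega) (by rw [InTables]; push_cast; omega),
          upd_of_ne (by omega), numbered, upd_of_ne (by omega), upd_self]
      simp only [e1, e2]
      repeat refine And.intro (by omega) ?_
      refine St.transfer (fun τ => hQ t s.q c _ τ (hp _ hP)) (by dsimp only; omega) ?_
      simp only [St.mk.injEq, Regex.count, Nat.cast_one, true_and, and_true]
      exact ⟨by ring, by rw [hi], by ring⟩
    | checkNot E =>
      have hp := fun mem₁ => Parsed.pattern (N := s.N) (h := s.sp) (mem := s.mem) (mem₁ := mem₁)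
        (a := .checkNot E) (E := E) (q := s.q) (c := s.c) (n := n) h0
        (by rw [Action.text, List.length_cons, add_comm]) (fun _ => Iff.rfl) hN hn (by omega)
      rw [exprText, Action.text] at hl ht hM hW hA hQ hN hn
      simp only [List.length_cons, Nat.cast_add, Nat.cast_one] at hl hM hW hQ hN hn
      have := exprText_ne_nil E
      have h1 := ht.1
      simp only [h1, Int.reduceNeg, Int.reduceSub, Int.reduceLT, if_true, if_false]
      simp only [Code.parseCheck, Code.letter, run_rules, val_rules, cost_rules, ok_rules, St.set,
        St.get, St.tick, zero_lt_ite, true_and, Code.tab, one_mul]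
      repeat refine And.intro (by omega) ?_
      refine ih E (by omega) (n := n + 1) ?_ ?_ ?_ ?_ ?_ ?_ ?_ ?_
        (fun x hx => hA x (by simp [hx])) fun t p c mem₁ τ hP hτ => ?_
      · dsimp only; omega
      · refine ht.2.congr fun x _ _ => ?_
        dsimp only
        rw [upd_of_ne (by omega), upd_of_ne (by omega), upd_of_ne (by omega), upd_of_ne (by omega)]
      iterate 6 dsimp only; omega
      dsimp only at hP hτ
      have hnum : upd (upd (upd s.mem (s.N + s.q) s.c) (3 * s.N + s.q) (s.i + 1))
          (4 * s.N + (s.i + 1)) s.c = numbered s.mem s.N s.q s.c n := by rw [numbered, hi]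
      rw [hnum] at hP
      have e1 : mem₁ (s.sp + 1 - 1) = s.q := by
        rw [hP.frame _ (by omega) (by rw [InTables]; push_cast; omega), add_sub_cancel_right, upd_self]
      have e2 : ∀ v, upd mem₁ (2 * s.N + s.q) v (3 * s.N + s.q) = n + 1 := fun v => by
        rw [upd_of_ne (by omega), hP.frame _ (by omega) (by rw [InTables]; push_cast; omega),
          upd_of_ne (by omega), numbered, upd_of_ne (by omega), upd_self]
      simp only [e1, e2]
      repeat refine And.intro (by omega) ?_
      refine St.transfer (fun τ => hQ t s.q c _ τ (hp _ hP)) (by dsimp only; omega) ?_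
      simp only [St.mk.injEq, Regex.count, Nat.cast_one, true_and, and_true]
      exact ⟨by ring, by rw [hi], by ring⟩

end RBG

namespace RBG

variable {σ : Sig}

/-! ## Depth first search -/

/-- An expression with the number of letters that come before it, and its address. -/
structure Scope (σ : Sig) where
  rex : Regex (Action σ)
  first : ℕ
  addr : ℤ

/-- The nodes of the expression. -/
def Scope.Node (X : Scope σ) (N : ℤ) (z : Node σ) : Prop :=
  NodeAt N (X.rex.number X.first) X.addr [] (7 * N) z

/-- The length of the text. -/
def Scope.len (X : Scope σ) : ℤ := (exprText X.rex).length

/-- The semi-state with another position. -/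
def SemiState.move (S : SemiState σ) (v : σ.Vertex) : SemiState σ := { S with pos := v }

/-- The configuration at a node and a position. -/
def Node.conf (z : Node σ) (S : SemiState σ) (v : σ.Vertex) : Stack σ × SemiState σ :=
  (z.stack, S.move v)

/-- The configuration is accepting and acceptance has been recorded, or it has been visited. -/
def Covered (X : Scope σ) (N : ℤ) (S : SemiState σ) (V : Finset (ℤ × σ.Vertex)) (f : ℤ)
    (c : Stack σ × SemiState σ) : Prop :=
  c.1 = [] ∧ f = 1 ∨ ∃ z v, X.Node N z ∧ c = z.conf S v ∧ (z.addr, v) ∈ V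

/-- The result of a search from `c`, which extends the set of visited nodes from `V` to `V'`. -/
structure Searched (B : Inst σ) (X : Scope σ) (N : ℤ) (S : SemiState σ)
    (V V' : Finset (ℤ × σ.Vertex)) (f f' : ℤ) (ms : List (Move σ)) (c : Stack σ × SemiState σ) :
    Prop where
  subset : V ⊆ V'
  node : ∀ x ∈ V', x ∉ V → ∃ z, X.Node N z ∧ z.addr = x.1 ∧
    Relation.ReflTransGen (EStep B) c (z.conf S x.2)
  closed : ∀ z v, X.Node N z → (z.addr, v) ∈ V' → (z.addr, v) ∉ V →
    ∀ c', EStep B (z.conf S v) c' → Covered X N S V' f' c'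
  accepts : ∀ z v, X.Node N z → (z.addr, v) ∈ V' → (z.addr, v) ∉ V →
    AcceptsAt B (z.conf S v).1 (z.conf S v).2 → f' = 1
  mono : f = 1 → f' = 1
  sound : f' = 1 → f = 1 ∨ Accepts B c.1 c.2
  bool : f = 0 ∨ f = 1 → f' = 0 ∨ f' = 1
  nodup : ms.Nodup
  moves : ∀ m, m ∈ ms ↔ ∃ z v, X.Node N z ∧ (z.addr, v) ∈ V' ∧ (z.addr, v) ∉ V ∧
    EmitsAt B (z.conf S v).1 (z.conf S v).2 m

variable {B : Inst σ} {X : Scope σ} {N : ℤ} {S : SemiState σ}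

theorem Covered.mono {V V' : Finset (ℤ × σ.Vertex)} {f f' : ℤ} {c : Stack σ × SemiState σ}
    (h : Covered X N S V f c) (hV : V ⊆ V') (hf : f = 1 → f' = 1) : Covered X N S V' f' c := by
  rcases h with ⟨h, h'⟩ | ⟨z, v, h1, h2, h3⟩
  · exact .inl ⟨h, hf h'⟩
  · exact .inr ⟨z, v, h1, h2, hV h3⟩

theorem Searched.refl {V : Finset (ℤ × σ.Vertex)} {f : ℤ} {c : Stack σ × SemiState σ} :
    Searched B X N S V V f f [] c where
  subset := subset_rfl
  node x h h' := absurd h h'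
  closed z v _ h h' := absurd h h'
  accepts z v _ h h' := absurd h h'
  mono := id
  sound := .inl
  bool := id
  nodup := .nil
  moves m := ⟨by simp, fun ⟨z, v, _, h, h', _⟩ => absurd h h'⟩

/-- A move that is emitted at a node begins with its number and the position. -/
theorem EmitsAt.unique {z z' : Node σ} {v v' : σ.Vertex} {m : Move σ} (hz : X.Node N z)
    (hz' : X.Node N z') (h : EmitsAt B (z.conf S v).1 (z.conf S v).2 m)
    (h' : EmitsAt B (z'.conf S v').1 (z'.conf S v').2 m) : z = z' ∧ v = v' := by
  obtain ⟨i, a, k, m₁, h1, _, _, rfl, _⟩ := h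
  obtain ⟨i', a', k', m₂, h1', _, _, h2', _⟩ := h'
  obtain ⟨h3, _⟩ := List.cons.inj h2'
  obtain ⟨rfl, h4⟩ := Prod.mk.inj h3
  obtain ⟨h5, _⟩ := List.cons.inj h1
  obtain ⟨h5', _⟩ := List.cons.inj h1'
  exact ⟨NodeAt.unique_index hz hz' h5 h5' rfl, h4⟩

/-- The first search cannot have left pairs open that the second one would have to close, because
only successors of pairs new since `V` are claimed to be covered; pairs still on the recursion stack
lie in `V`. The two lists of moves are disjoint, because the second search emits only at pairs
outside `V₁`. -/
theorem Searched.trans {V V₁ V₂ : Finset (ℤ × σ.Vertex)} {f f₁ f₂ : ℤ} {ms ms' : List (Move σ)}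
    {c c₁ c₂ : Stack σ × SemiState σ} (h₁ : Searched B X N S V V₁ f f₁ ms c₁)
    (h₂ : Searched B X N S V₁ V₂ f₁ f₂ ms' c₂) (hc₁ : Relation.ReflTransGen (EStep B) c c₁)
    (hc₂ : Relation.ReflTransGen (EStep B) c c₂) : Searched B X N S V V₂ f f₂ (ms ++ ms') c where
  subset := h₁.subset.trans h₂.subset
  node x hx hx' := by
    by_cases h : x ∈ V₁
    · obtain ⟨z, h3, h4, h5⟩ := h₁.node x h hx'
      exact ⟨z, h3, h4, hc₁.trans h5⟩
    · obtain ⟨z, h3, h4, h5⟩ := h₂.node x hx h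
      exact ⟨z, h3, h4, hc₂.trans h5⟩
  closed z v hz hx hx' c' hc' := by
    by_cases h : (z.addr, v) ∈ V₁
    · exact (h₁.closed z v hz h hx' c' hc').mono h₂.subset h₂.mono
    · exact h₂.closed z v hz hx h c' hc'
  accepts z v hz hx hx' ha := by
    by_cases h : (z.addr, v) ∈ V₁
    · exact h₂.mono (h₁.accepts z v hz h hx' ha)
    · exact h₂.accepts z v hz hx h ha
  mono h := h₂.mono (h₁.mono h)
  sound h := by
    have key : ∀ {c₁}, Relation.ReflTransGen (EStep B) c c₁ → Accepts B c₁.1 c₁.2 →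
        Accepts B c.1 c.2 := fun hc h => by
      obtain ⟨c', h3, h4⟩ := accepts_iff.1 h
      exact accepts_iff.2 ⟨c', hc.trans h3, h4⟩
    rcases h₂.sound h with h | h
    · exact (h₁.sound h).imp_right (key hc₁)
    · exact .inr (key hc₂ h)
  bool h := h₂.bool (h₁.bool h)
  nodup := by
    refine h₁.nodup.append h₂.nodup fun m hm hm' => ?_
    obtain ⟨z, v, hz, h3, h4, h5⟩ := (h₁.moves m).1 hm
    obtain ⟨z', v', hz', h3', h4', h5'⟩ := (h₂.moves m).1 hm'
    obtain ⟨rfl, rfl⟩ := h5.unique hz hz' h5'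
    exact h4' h3
  moves m := by
    rw [List.mem_append, h₁.moves, h₂.moves]
    constructor
    · rintro (⟨z, v, hz, h3, h4, h5⟩ | ⟨z, v, hz, h3, h4, h5⟩)
      · exact ⟨z, v, hz, h₂.subset h3, h4, h5⟩
      · exact ⟨z, v, hz, h3, fun h => h4 (h₁.subset h), h5⟩
    · rintro ⟨z, v, hz, h3, h4, h5⟩
      by_cases h : (z.addr, v) ∈ V₁
      · exact .inl ⟨z, v, hz, h, h4, h5⟩
      · exact .inr ⟨z, v, hz, h3, h, h5⟩

/-- Visiting a node. -/
theorem Searched.enter {V V' : Finset (ℤ × σ.Vertex)} {f f' : ℤ} {ms : List (Move σ)} {z : Node σ}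
    {v : σ.Vertex} (hz : X.Node N z) (hv : (z.addr, v) ∉ V)
    (h : Searched B X N S (insert (z.addr, v) V) V' f f' ms (z.conf S v))
    (hc : ∀ c', EStep B (z.conf S v) c' → Covered X N S V' f' c')
    (hm : ∀ i a k, z.stack = .act (i, a) :: k → a.isModifier = false) :
    Searched B X N S V V' f f' ms (z.conf S v) := by
  have key : ∀ z', X.Node N z' → ∀ v', (z'.addr, v') ∉ V → (z'.addr, v') ∈ insert (z.addr, v) V →
      z' = z ∧ v' = v := by
    intro z' hz' v' h1 h2
    rcases Finset.mem_insert.1 h2 with h2 | h2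
    · obtain ⟨h3, rfl⟩ := Prod.mk.inj h2
      exact ⟨NodeAt.unique hz' hz h3, rfl⟩
    · exact absurd h2 h1
  refine ⟨(Finset.subset_insert _ _).trans h.subset, fun x hx hx' => ?_,
    fun z' v' hz' hx hx' c' hc' => ?_, fun z' v' hz' hx hx' ha => ?_, h.mono, h.sound, h.bool,
    h.nodup, fun m => (h.moves m).trans ⟨?_, ?_⟩⟩
  · by_cases h' : x ∈ insert (z.addr, v) V
    · rcases Finset.mem_insert.1 h' with rfl | h'
      · exact ⟨z, hz, rfl, .refl⟩
      · exact absurd h' hx'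
    · exact h.node x hx h'
  · by_cases h' : (z'.addr, v') ∈ insert (z.addr, v) V
    · obtain ⟨rfl, rfl⟩ := key z' hz' v' hx' h'
      exact hc c' hc'
    · exact h.closed z' v' hz' hx h' c' hc'
  · by_cases h' : (z'.addr, v') ∈ insert (z.addr, v) V
    · obtain ⟨rfl, rfl⟩ := key z' hz' v' hx' h'
      obtain ⟨i, a, k, h1, h2, _⟩ := ha
      simp [hm i a k h1] at h2
    · exact h.accepts z' v' hz' hx h' ha
  · rintro ⟨z', v', hz', h1, h2, h3⟩
    exact ⟨z', v', hz', h1, fun h' => h2 (Finset.mem_insert_of_mem h'), h3⟩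
  · rintro ⟨z', v', hz', h1, h2, h3⟩
    refine ⟨z', v', hz', h1, fun h' => ?_, h3⟩
    obtain ⟨rfl, rfl⟩ := key z' hz' v' h2 h'
    obtain ⟨i, a, k, m', h4, h5, _⟩ := h3
    simp [hm i a k h4] at h5

/-- Visiting a node with a modifier. -/
theorem Searched.modifier {V : Finset (ℤ × σ.Vertex)} {f f' : ℤ} {ms : List (Move σ)} {z : Node σ}
    {v : σ.Vertex} {i : ℕ} {a : Action σ} (hz : X.Node N z) (hv : (z.addr, v) ∉ V)
    (he : z.expr = .act (i, a)) (ha : a.isModifier = true)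
    (hacc : AcceptsAt B (z.conf S v).1 (z.conf S v).2 → f' = 1) (hmono : f = 1 → f' = 1)
    (hsound : f' = 1 → f = 1 ∨ AcceptsAt B (z.conf S v).1 (z.conf S v).2)
    (hbool : f = 0 ∨ f = 1 → f' = 0 ∨ f' = 1) (hnodup : ms.Nodup)
    (hms : ∀ m, m ∈ ms ↔ EmitsAt B (z.conf S v).1 (z.conf S v).2 m) :
    Searched B X N S V (insert (z.addr, v) V) f f' ms (z.conf S v) := by
  have key : ∀ z', X.Node N z' → ∀ v', (z'.addr, v') ∉ V → (z'.addr, v') ∈ insert (z.addr, v) V →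
      z' = z ∧ v' = v := by
    intro z' hz' v' h1 h2
    rcases Finset.mem_insert.1 h2 with h2 | h2
    · obtain ⟨h3, rfl⟩ := Prod.mk.inj h2
      exact ⟨NodeAt.unique hz' hz h3, rfl⟩
    · exact absurd h2 h1
  refine ⟨Finset.subset_insert _ _, fun x hx hx' => ?_, fun z' v' hz' hx hx' c' hc' => ?_,
    fun z' v' hz' hx hx' h => ?_, hmono, fun h => (hsound h).imp_right AcceptsAt.accepts, hbool,
    hnodup, fun m => (hms m).trans ⟨fun h => ⟨z, v, hz, Finset.mem_insert_self _ _, hv, h⟩, ?_⟩⟩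
  · rcases Finset.mem_insert.1 hx with rfl | h'
    · exact ⟨z, hz, rfl, .refl⟩
    · exact absurd h' hx'
  · obtain ⟨rfl, rfl⟩ := key z' hz' v' hx' hx
    exfalso
    rw [Node.conf, Node.stack, he] at hc'
    cases hc' with
    | step hs => cases hs
    | act h _ => simp [h] at ha
  · obtain ⟨rfl, rfl⟩ := key z' hz' v' hx' hx
    exact hacc h
  · rintro ⟨z', v', hz', h1, h2, h3⟩
    obtain ⟨rfl, rfl⟩ := key z' hz' v' h2 h1
    exact h3

/-- With an empty table at the beginning no pair is exempt from `closed`, so the visited set is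
closed under steps. -/
theorem Searched.covered {V' : Finset (ℤ × σ.Vertex)} {f f' : ℤ} {ms : List (Move σ)}
    {c c' : Stack σ × SemiState σ} (h : Searched B X N S ∅ V' f f' ms c)
    (hc : Covered X N S V' f' c) (hr : Relation.ReflTransGen (EStep B) c c') :
    Covered X N S V' f' c' := by
  induction hr with
  | refl => exact hc
  | @tail b d _ hs ih =>
    rcases ih with ⟨h1, _⟩ | ⟨z, v, hz, rfl, h2⟩
    · obtain ⟨k, T⟩ := b
      obtain rfl : k = [] := h1
      cases hs with
      | step hs => cases hs
    · exact h.closed z v hz h2 (by simp) _ hs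

theorem Searched.accepts_iff {V' : Finset (ℤ × σ.Vertex)} {f f' : ℤ} {ms : List (Move σ)}
    {c : Stack σ × SemiState σ} (h : Searched B X N S ∅ V' f f' ms c)
    (hc : Covered X N S V' f' c) : f' = 1 ↔ f = 1 ∨ Accepts B c.1 c.2 := by
  refine ⟨h.sound, fun h' => h'.elim h.mono fun h' => ?_⟩
  obtain ⟨c', h1, h2⟩ := RBG.accepts_iff.1 h'
  rcases h.covered hc h1 with ⟨_, h4⟩ | ⟨z, v, hz, rfl, h5⟩
  · exact h4
  · rcases h2 with h2 | h2
    · simp [Node.conf, Node.stack] at h2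
    · exact h.accepts z v hz h5 (by simp) h2

/-- Soundness comes from the reachability of the visited pairs, completeness from their being closed
under steps. -/
theorem Searched.moves_iff {V' : Finset (ℤ × σ.Vertex)} {f f' : ℤ} {ms : List (Move σ)}
    {c : Stack σ × SemiState σ} (h : Searched B X N S ∅ V' f f' ms c)
    (hc : Covered X N S V' f' c) (m : Move σ) : m ∈ ms ↔ MoveFrom B c.1 c.2 m := by
  rw [h.moves, moveFrom_iff]
  constructor
  · rintro ⟨z, v, hz, h1, h2, h3⟩
    obtain ⟨z', hz', h4, h5⟩ := h.node _ h1 h2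
    obtain rfl := NodeAt.unique hz' hz h4
    exact ⟨_, h5, h3⟩
  · rintro ⟨c', h1, h2⟩
    rcases h.covered hc h1 with ⟨h3, _⟩ | ⟨z, v, hz, rfl, h5⟩
    · obtain ⟨i, a, k, m', h4, _⟩ := h2
      simp [h3] at h4
    · exact ⟨z, v, hz, h5, by simp, h2⟩

/-! ## The memory during the search -/

/-- The places of the data in the memory, and the part of the memory that does not change. -/
structure Image where
  (N L PA VA BD : ℤ)
  base : ℤ → ℤ

/-- The cell contains a piece, the value of a variable or a number of pieces. -/
def Image.Varying (I : Image) (σ : Sig) (a : ℤ) : Prop :=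
  I.PA ≤ a ∧ a < I.PA + σ.vertices ∨ I.VA ≤ a ∧ a < I.VA + (σ.players + σ.extraVars : ℕ) ∨
    6 * I.N ≤ a ∧ a < 6 * I.N + σ.pieces

/-- The unchanging part of the memory describes the board. -/
structure Image.Ok (I : Image) (B : Inst σ) : Prop where
  L_le : 0 ≤ I.L ∧ I.L ≤ I.BD
  BD_le : I.BD + (σ.players + σ.extraVars : ℕ) ≤ I.PA
  PA_le : I.PA + σ.vertices ≤ I.VA
  VA_le : I.VA + (σ.players + σ.extraVars : ℕ) ≤ I.N
  pieces_le : σ.pieces ≤ I.N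
  edges : ∀ v : σ.Vertex, 0 ≤ I.base (5 * I.N + (v : ℕ)) ∧
    I.base (5 * I.N + (v : ℕ)) + (B.edgesText v).length ≤ I.BD ∧
    HasText I.base (I.base (5 * I.N + (v : ℕ))) (B.edgesText v)
  bound : ∀ v : σ.Var, I.base (I.BD + (v : ℕ)) = B.bound v
  zero : I.base (7 * I.N) = 0

/-- The memory holds the unchanging part and the semi-state. -/
structure Image.Held (I : Image) (mem : ℤ → ℤ) (S : SemiState σ) : Prop where
  piece : ∀ v : σ.Vertex, mem (I.PA + (v : ℕ)) = (S.pieceAt v : ℕ)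
  value : ∀ v : σ.Var, mem (I.VA + (v : ℕ)) = S.value v
  count : ∀ x : σ.Piece, mem (6 * I.N + (x : ℕ)) = ((Finset.univ.filter fun v => S.pieceAt v = x).card : ℕ)
  base : ∀ a, 0 ≤ a → a < 7 * I.N + 2 → ¬ I.Varying σ a → mem a = I.base a

theorem Image.Held.congr {I : Image} (hI : I.Ok B) {mem mem' : ℤ → ℤ} (h : I.Held mem S)
    (hm : ∀ a, 0 ≤ a → a < 7 * I.N + 2 → mem' a = mem a) : I.Held mem' S := by
  have h1 := hI.L_le
  have h2 := hI.BD_le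
  have h3 := hI.PA_le
  have h4 := hI.VA_le
  have h5 := hI.pieces_le
  refine ⟨fun v => ?_, fun v => ?_, fun x => ?_, fun a h0 ha hv => ?_⟩
  · rw [hm _ (by omega) (by omega), h.piece]
  · rw [hm _ (by omega) (by omega), h.value]
  · rw [hm _ (by omega) (by omega), h.count]
  · rw [hm _ h0 ha, h.base a h0 ha hv]

/-- Saves tracing cells when a modifier is undone: it suffices that the memory holds the old
semi-state again. -/
theorem Image.Held.unique {I : Image} {mem mem' : ℤ → ℤ} (h : I.Held mem S) (h' : I.Held mem' S)
    (a : ℤ) (h0 : 0 ≤ a) (ha : a < 7 * I.N + 2) : mem' a = mem a := by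
  by_cases hv : I.Varying σ a
  · rcases hv with ⟨h1, h2⟩ | ⟨h1, h2⟩ | ⟨h1, h2⟩
    · have e := h.piece ⟨(a - I.PA).toNat, by omega⟩
      have e' := h'.piece ⟨(a - I.PA).toNat, by omega⟩
      rw [show I.PA + (((⟨(a - I.PA).toNat, by omega⟩ : σ.Vertex) : ℕ) : ℤ) = a by
        simp only; omega] at e e'
      rw [e, e']
    · have e := h.value ⟨(a - I.VA).toNat, by omega⟩
      have e' := h'.value ⟨(a - I.VA).toNat, by omega⟩
      rw [show I.VA + (((⟨(a - I.VA).toNat, by omega⟩ : σ.Var) : ℕ) : ℤ) = a by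
        simp only; omega] at e e'
      rw [e, e']
    · have e := h.count ⟨(a - 6 * I.N).toNat, by omega⟩
      have e' := h'.count ⟨(a - 6 * I.N).toNat, by omega⟩
      rw [show 6 * I.N + (((⟨(a - 6 * I.N).toNat, by omega⟩ : σ.Piece) : ℕ) : ℤ) = a by
        simp only; omega] at e e'
      rw [e, e']
  · rw [h.base a h0 ha hv, h'.base a h0 ha hv]

theorem Image.Held.assign {I : Image} (hI : I.Ok B) {mem : ℤ → ℤ} (h : I.Held mem S) (y : σ.Var)
    (z : ℕ) : I.Held (upd mem (I.VA + (y : ℕ)) z)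
      { S with value := Function.update S.value y z } := by
  have h1 := hI.L_le
  have h2 := hI.BD_le
  have h3 := hI.PA_le
  have h4 := hI.VA_le
  refine ⟨fun v => ?_, fun v => ?_, fun x => ?_, fun a h0 ha hv => ?_⟩
  · rw [upd_of_ne (by omega), h.piece]
  · rw [upd_apply]
    simp only [Function.update_apply]
    by_cases hy : v = y
    · subst hy; simp
    · rw [if_neg (fun e => hy (Fin.ext (by omega))), if_neg hy, h.value]
  · rw [upd_of_ne (by omega), h.count]
  · rw [upd_of_ne (fun e => hv (.inr (.inl ⟨by omega, by omega⟩))), h.base a h0 ha hv]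

/-- The two counters are updated one after the other, the second on the already changed memory `m₁`;
so the statement also holds if the new piece equals the old one. -/
theorem Image.Held.off {I : Image} (hI : I.Ok B) {mem : ℤ → ℤ} (h : I.Held mem S) (v : σ.Vertex)
    (x y : σ.Piece) (hx : S.pieceAt v = x) {m₁ : ℤ → ℤ}
    (hm : m₁ = upd mem (6 * I.N + (x : ℕ)) (mem (6 * I.N + (x : ℕ)) - 1)) :
    I.Held (upd (upd m₁ (6 * I.N + (y : ℕ)) (m₁ (6 * I.N + (y : ℕ)) + 1)) (I.PA + (v : ℕ)) (y : ℕ))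
      { S with pieceAt := Function.update S.pieceAt v y } := by
  have h1 := hI.L_le
  have h2 := hI.BD_le
  have h3 := hI.PA_le
  have h4 := hI.VA_le
  refine ⟨fun w => ?_, fun w => ?_, fun w => ?_, fun a h0 ha hv => ?_⟩
  · rw [upd_apply]
    simp only [Function.update_apply]
    by_cases hy : w = v
    · subst hy; simp
    · rw [if_neg (fun e => hy (Fin.ext (by omega))), if_neg hy, upd_of_ne (by omega), hm,
        upd_of_ne (by omega), h.piece]
  · rw [upd_of_ne (by omega), upd_of_ne (by omega), hm, upd_of_ne (by omega), h.value]
  · have e1 : ((Finset.univ.filter fun u => Function.update S.pieceAt v y u = w).card : ℤ) =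
        (Finset.univ.filter fun u => S.pieceAt u = w).card - (if x = w then 1 else 0) +
          (if y = w then 1 else 0) := by
      simp only [Finset.card_filter, Nat.cast_sum]
      rw [← Finset.add_sum_erase _ _ (Finset.mem_univ v),
        ← Finset.add_sum_erase (Finset.univ) (fun u => (((if S.pieceAt u = w then 1 else 0 : ℕ)) : ℤ))
          (Finset.mem_univ v)]
      rw [Finset.sum_congr rfl (g := fun u => (((if S.pieceAt u = w then 1 else 0 : ℕ)) : ℤ))]
      · simp only [Function.update_self, hx]
        push_cast
        ring
      · intro u hu
        rw [Function.update_of_ne (Finset.ne_of_mem_erase hu)]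
    rw [e1, ← h.count w, upd_of_ne (by omega), hm]
    simp only [upd_apply]
    have hinj : ∀ u u' : σ.Piece, 6 * I.N + ((u : ℕ) : ℤ) = 6 * I.N + ((u' : ℕ) : ℤ) ↔ u = u' :=
      fun u u' => ⟨fun e => Fin.ext (by omega), fun e => by rw [e]⟩
    simp only [hinj]
    by_cases a1 : x = w <;> by_cases a2 : y = w
    · subst a1; subst a2; simp
    · subst a1; simp [a2, Ne.symm a2, eq_comm]
    · subst a2; simp [a1, Ne.symm a1, eq_comm]
    · simp [a1, a2, Ne.symm a1, Ne.symm a2]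
  · have k1 : a ≠ I.PA + (v : ℕ) := fun e => hv (.inl ⟨by omega, by omega⟩)
    have k2 : ∀ u : σ.Piece, a ≠ 6 * I.N + (u : ℕ) := fun u e =>
      hv (.inr (.inr ⟨by omega, by omega⟩))
    rw [upd_of_ne k1, upd_of_ne (k2 y), hm, upd_of_ne (k2 x), h.base a h0 ha hv]

theorem Image.Held.valuesAt {I : Image} (hI : I.Ok B) {mem : ℤ → ℤ} (h : I.Held mem S) {a : ℤ}
    (ha : 7 * I.N ≤ a) : ValuesAt mem I.VA I.N a S := by
  have h1 := hI.L_le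
  have h2 := hI.BD_le
  have h3 := hI.PA_le
  have h4 := hI.VA_le
  have h5 := hI.pieces_le
  exact ⟨fun v => ⟨by omega, h.value v⟩, fun x => ⟨by omega, h.count x⟩⟩

end RBG

-- Specification of the search, and its accounts of time and space

namespace RBG

variable {σ : Sig}

/-- The costs of a node at a position, in units of `U`. -/
def Scope.weight (X : Scope σ) (B : Inst σ) (U : ℕ) (x : ℤ × σ.Vertex) : ℕ :=
  U * (headAt (X.rex.number X.first) X.addr x.1 * ((B.edgesText x.2).length + 1))

/-- The costs of a set of nodes. -/
def Scope.total (X : Scope σ) (B : Inst σ) (U : ℕ) (V : Finset (ℤ × σ.Vertex)) : ℕ :=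
  ∑ x ∈ V, X.weight B U x

/-- The size of the board. -/
def Inst.size (B : Inst σ) : ℕ := ∑ v, ((B.edgesText v).length + 1)

/-- The cells of the table at `vb` that belong to the expression. -/
def Scope.Cells (X : Scope σ) (vb : ℤ) (a : ℤ) : Prop :=
  vb + X.addr * σ.vertices ≤ a ∧ a < vb + (X.addr + X.len) * σ.vertices

/-- The registers with a fixed meaning and the cells below `h` outside `R` have the same contents. -/
structure Agree (R : ℤ → Prop) (h : ℤ) (s s' : St) : Prop where
  n : s'.n = s.n
  N : s'.N = s.N
  L : s'.L = s.L
  PA : s'.PA = s.PA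
  VA : s'.VA = s.VA
  BD : s'.BD = s.BD
  vb : s'.vb = s.vb
  mv : s'.mv = s.mv
  mem : ∀ a, 0 ≤ a → a < h → ¬ R a → s'.mem a = s.mem a

theorem Agree.trans {R : ℤ → Prop} {h : ℤ} {s s' s'' : St} (h₁ : Agree R h s s')
    (h₂ : Agree R h s' s'') : Agree R h s s'' :=
  ⟨h₂.n.trans h₁.n, h₂.N.trans h₁.N, h₂.L.trans h₁.L, h₂.PA.trans h₁.PA, h₂.VA.trans h₁.VA,
    h₂.BD.trans h₁.BD, h₂.vb.trans h₁.vb, h₂.mv.trans h₁.mv,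
    fun a h0 ha hR => (h₂.mem a h0 ha hR).trans (h₁.mem a h0 ha hR)⟩

theorem Agree.mono {R R' : ℤ → Prop} {h h' : ℤ} {s s' : St} (H : Agree R h s s') (hh : h' ≤ h)
    (hR : ∀ a, 0 ≤ a → a < h' → R a → R' a) : Agree R' h' s s' :=
  { H with mem := fun a h0 ha hR' => H.mem a h0 (ha.trans_le hh) fun h => hR' (hR a h0 ha h) }

/-- The visited nodes are marked in the table at `vb`. -/
def Marks (X : Scope σ) (N : ℤ) (mem : ℤ → ℤ) (vb : ℤ) (V : Finset (ℤ × σ.Vertex)) : Prop :=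
  ∀ z (v : σ.Vertex), X.Node N z →
    mem (vb + (z.addr * σ.vertices + (v : ℕ))) = if (z.addr, v) ∈ V then 1 else 0

/-- Everything that lies below the stack pointer is in order. -/
structure Ready (I : Image) (X : Scope σ) (S : SemiState σ) (V : Finset (ℤ × σ.Vertex))
    (l : List (ℕ × σ.Vertex)) (s : St) : Prop where
  n : s.n = σ.vertices
  N : s.N = I.N
  L : s.L = I.L
  PA : s.PA = I.PA
  VA : s.VA = I.VA
  BD : s.BD = I.BD
  held : I.Held s.mem S
  marks : Marks X I.N s.mem s.vb V
  nodes : ∀ x ∈ V, ∃ z, X.Node I.N z ∧ z.addr = x.1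
  chain : Chain s.mem (7 * I.N + 2) s.vb s.mv l
  vb_le : 7 * I.N + 2 ≤ s.vb
  sp_le : s.vb + I.L * σ.vertices ≤ s.sp
  found : s.found = 0 ∨ s.found = 1

/-- The unchanging part of the memory contains the expression and the tables, and the numbers are
small. -/
structure Scope.Ok (X : Scope σ) (I : Image) (B : Inst σ) (W : ℤ) : Prop where
  addr_pos : 1 ≤ X.addr
  addr_le : X.addr + X.len ≤ I.L
  text : HasText I.base X.addr (exprText X.rex)
  laid : exprLaid I.base I.N X.rex X.addr (7 * I.N) X.first
  wf : ∃ sw, exprWF X.rex sw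
  magnitude : 2 * (exprMagnitude B X.rex : ℤ) + 32 ≤ W
  bound : ∀ v, exprMagnitude B X.rex + (B.bound v : ℤ) + 32 ≤ W
  tokens : ∀ a, 0 ≤ a → a < I.BD → |I.base a| + 32 ≤ W

/-- The node or the acceptance that is to be visited. -/
def Target (X : Scope σ) (N : ℤ) (S : SemiState σ) (c : Stack σ × SemiState σ) (s : St) : Prop :=
  c.1 = [] ∧ s.p = 0 ∨ ∃ z v, X.Node N z ∧ c = z.conf S v ∧ s.p = z.addr ∧ s.s = (v : ℕ)

/-- The effect of a search on the memory and the output. -/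
structure Outcome (I : Image) (X : Scope σ) (V' : Finset (ℤ × σ.Vertex))
    (l : List (ℕ × σ.Vertex)) (ms : List (Move σ)) (s s' : St) : Prop where
  agree : Agree (X.Cells s.vb) s.sp s s'
  sp : s'.sp = s.sp
  marks : Marks X I.N s'.mem s.vb V'
  out : s'.out = s.out ++ movesText (ms.map (l.reverse ++ ·))

/-- The state `s'` is the result of a search from `c` in the state `s`. -/
def SearchGoal (I : Image) (B : Inst σ) (X : Scope σ) (S : SemiState σ)
    (V : Finset (ℤ × σ.Vertex)) (l : List (ℕ × σ.Vertex)) (U : ℕ) (c : Stack σ × SemiState σ)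
    (t : ℕ) (s s' : St) : Prop :=
  ∃ V' ms, Searched B X I.N S V V' s.found s'.found ms c ∧ Covered X I.N S V' s'.found c ∧
    Outcome I X V' l ms s s' ∧ s'.time + X.total B U V ≤ s.time + X.total B U V' + t

/-- The search works for at most `u` unvisited nodes, if there are at most `j` modifiers to come,
and at most `K` modifiers in total; it needs at most `r` cells for the nodes that come after modifiers. -/
def VisitSpec (I : Image) (B : Inst σ) (W : ℤ) (X : Scope σ) (K j U : ℕ) (r : ℤ) (u : ℤ) : Prop :=
  ∀ (S : SemiState σ) (V : Finset (ℤ × σ.Vertex)) (l : List (ℕ × σ.Vertex)) (M : ℤ) (s : St)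
    (c : Stack σ × SemiState σ), Ready I X S V l s → S.Bounded B → Budget B c.1 c.2 j →
    Target X I.N S c s → X.len * σ.vertices - V.card ≤ u →
    s.sp + 10 * (X.len * σ.vertices - V.card) + r + 2 * l.length + 4 * I.L + 40 ≤ M → M + 32 ≤ W →
    l.length + j ≤ K →
    Go W M (.call 5) s (SearchGoal I B X S V l U c 100 s)

/-- The state `s'` is the result of a search from the node `z` in the state `s`, in which the node
has been marked already. -/
def NodeGoal (I : Image) (B : Inst σ) (X : Scope σ) (S : SemiState σ)
    (V : Finset (ℤ × σ.Vertex)) (l : List (ℕ × σ.Vertex)) (U : ℕ) (z : Node σ) (v : σ.Vertex)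
    (s s' : St) : Prop :=
  ∃ V' ms, Searched B X I.N S V V' s.found s'.found ms (z.conf S v) ∧ (z.addr, v) ∈ V' ∧
    Outcome I X V' l ms s s' ∧ s'.time + X.total B U V + 200 ≤ s.time + X.total B U V'

/-- The situation in which a node has just been marked. -/
structure AtNode (I : Image) (B : Inst σ) (W : ℤ) (X : Scope σ) (K j : ℕ) (r : ℤ) (u : ℤ)
    (S : SemiState σ) (V : Finset (ℤ × σ.Vertex)) (l : List (ℕ × σ.Vertex)) (M : ℤ) (s : St)
    (z : Node σ) (v : σ.Vertex) : Prop where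
  ready : Ready I X S (insert (z.addr, v) V) l s
  bounded : S.Bounded B
  budget : Budget B z.stack (S.move v) j
  node : X.Node I.N z
  new : (z.addr, v) ∉ V
  p : s.p = z.addr
  pos : s.s = (v : ℕ)
  unvisited : X.len * σ.vertices - (insert (z.addr, v) V).card ≤ u
  room : s.sp + 10 * (X.len * σ.vertices - (insert (z.addr, v) V).card) + r + 2 * l.length +
    4 * I.L + 49 ≤ M
  small : M + 32 ≤ W
  depth : l.length + j ≤ K

section Basic

variable {I : Image} {B : Inst σ} {W : ℤ} {X : Scope σ} {S : SemiState σ}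
  {V V' : Finset (ℤ × σ.Vertex)} {l : List (ℕ × σ.Vertex)} {s s' : St}

theorem Scope.addr_mem {N : ℤ} {z : RBG.Node σ} (hz : X.Node N z) :
    X.addr ≤ z.addr ∧ z.addr + nlen z.expr ≤ X.addr + X.len := by
  have := NodeAt.range hz
  rwa [nlen_number] at this

/-- The cells for the address `a` are those from `a * n` to `(a + 1) * n - 1`. -/
theorem cell_lt {a b n v : ℤ} (h : a < b) (hv : v < n) (h0 : 0 ≤ n) : a * n + v < b * n := by
  nlinarith

theorem le_cell {a b n v : ℤ} (h : b ≤ a) (hv : 0 ≤ v) (h0 : 0 ≤ n) : b * n ≤ a * n + v := by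
  nlinarith

theorem cell_inj {a b n v w : ℤ} (h : a * n + v = b * n + w) (hv : 0 ≤ v) (hv' : v < n)
    (hw : 0 ≤ w) (hw' : w < n) : a = b ∧ v = w := by
  have : a = b := by
    by_contra hab
    rcases lt_or_gt_of_ne hab with h1 | h1
    · have := cell_lt h1 hv' (by omega)
      omega
    · have := cell_lt h1 hw' (by omega)
      omega
  subst this
  exact ⟨rfl, by omega⟩

theorem Scope.cells_of_node {N vb : ℤ} {z : RBG.Node σ} (hz : X.Node N z) (v : σ.Vertex) :
    X.Cells vb (vb + (z.addr * σ.vertices + (v : ℕ))) := by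
  have := Scope.addr_mem hz
  have := one_le_nlen z.expr
  have h1 := le_cell (a := z.addr) (b := X.addr) (n := σ.vertices) (v := (v : ℕ)) (by omega)
    (by omega) (by omega)
  have h2 := cell_lt (a := z.addr) (b := X.addr + X.len) (n := σ.vertices) (v := (v : ℕ)) (by omega)
    (by omega) (by omega)
  constructor <;> omega

/-- The cells of the table lie in the reserved part of the memory. -/
theorem Scope.Ok.cells (hX : X.Ok I B W) {vb a : ℤ} (ha : X.Cells vb a) :
    vb ≤ a ∧ a < vb + I.L * σ.vertices := by
  have h1 : 0 ≤ X.addr * (σ.vertices : ℤ) := mul_nonneg (by have := hX.addr_pos; omega) (by omega)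
  have h2 : (X.addr + X.len) * (σ.vertices : ℤ) ≤ I.L * σ.vertices :=
    mul_le_mul_of_nonneg_right hX.addr_le (by omega)
  obtain ⟨h3, h4⟩ := ha
  constructor <;> omega

/-- A search does not disturb what is needed afterwards. -/
theorem Ready.after (hI : I.Ok B) (h : Ready I X S V l s) {R : ℤ → Prop} {b : ℤ}
    (hs : Agree R b s s') (hb : s.vb + I.L * σ.vertices ≤ b) (hR : ∀ a, R a → s.vb ≤ a)
    (hm : Marks X I.N s'.mem s.vb V')
    (hV : ∀ x ∈ V', ∃ z, X.Node I.N z ∧ z.addr = x.1) (hsp : s.vb + I.L * σ.vertices ≤ s'.sp)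
    (hf : s'.found = 0 ∨ s'.found = 1) : Ready I X S V' l s' := by
  have h1 := h.vb_le
  have h2 : 0 ≤ I.L * (σ.vertices : ℤ) := mul_nonneg hI.L_le.1 (by omega)
  have h3 : ∀ a, 0 ≤ a → a < s.vb → s'.mem a = s.mem a := fun a h0 ha =>
    hs.mem a h0 (by omega) fun h => by have := hR a h; omega
  have h4 := hI.L_le
  have h5 := hI.BD_le
  have h6 := hI.PA_le
  have h7 := hI.VA_le
  exact ⟨hs.n.trans h.n, hs.N.trans h.N, hs.L.trans h.L, hs.PA.trans h.PA, hs.VA.trans h.VA,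
    hs.BD.trans h.BD, h.held.congr hI fun a h0 ha => h3 a h0 (by omega), by rwa [hs.vb], hV,
    by rw [hs.vb, hs.mv]; exact h.chain.congr le_rfl fun a h0 _ ha => h3 a h0 ha, by rw [hs.vb]; exact h1, by rwa [hs.vb], hf⟩

/-- Operations above the stack pointer do not disturb anything. -/
theorem Ready.push (hI : I.Ok B) (hX : X.Ok I B W) (h : Ready I X S V l s) {b : ℤ}
    (hs : Agree (fun _ => False) b s s') (hb : s.vb + I.L * σ.vertices ≤ b)
    (hsp : s.vb + I.L * σ.vertices ≤ s'.sp) (hf : s'.found = 0 ∨ s'.found = 1) :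
    Ready I X S V l s' := by
  refine h.after hI hs hb (fun _ => False.elim) (fun z v hz => ?_) h.nodes hsp hf
  have h1 := hX.cells (Scope.cells_of_node (vb := s.vb) hz v)
  have h2 := h.vb_le
  have h3 := hI.L_le
  have h4 := hI.BD_le
  have h5 := hI.PA_le
  have h6 := hI.VA_le
  rw [hs.mem _ (by omega) (by omega) id]
  exact h.marks z v hz

theorem Searched.nodes {N : ℤ} {f f' : ℤ} {ms : List (Move σ)} {c : Stack σ × SemiState σ}
    (h : Searched B X N S V V' f f' ms c) (hV : ∀ x ∈ V, ∃ z, X.Node N z ∧ z.addr = x.1) :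
    ∀ x ∈ V', ∃ z, X.Node N z ∧ z.addr = x.1 := by
  intro x hx
  by_cases h' : x ∈ V
  · exact hV x h'
  · exact (h.node x hx h').imp fun z hz => ⟨hz.1, hz.2.1⟩

/-- The nodes and their positions are numerous. -/
theorem card_le {N : ℤ} (hV : ∀ x ∈ V, ∃ z, X.Node N z ∧ z.addr = x.1) :
    (V.card : ℤ) ≤ X.len * σ.vertices := by
  have h1 : V ⊆ Finset.Ico X.addr (X.addr + X.len) ×ˢ Finset.univ := by
    intro x hx
    obtain ⟨z, hz, h1⟩ := hV x hx
    have := Scope.addr_mem hz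
    have := one_le_nlen z.expr
    simp only [Finset.mem_product, Finset.mem_Ico, Finset.mem_univ, and_true]
    omega
  have h2 := Finset.card_le_card h1
  have h3 : 0 ≤ X.len := by unfold Scope.len; omega
  rw [Finset.card_product, Int.card_Ico, Finset.card_univ, Fintype.card_fin] at h2
  zify at h2
  rw [show X.addr + X.len - X.addr = X.len by ring, Int.toNat_of_nonneg h3] at h2
  exact h2

theorem Scope.total_insert {U : ℕ} {x : ℤ × σ.Vertex} (hx : x ∉ V) :
    X.total B U (insert x V) = X.weight B U x + X.total B U V := Finset.sum_insert hx

theorem Scope.total_mono {U : ℕ} (h : V ⊆ V') : X.total B U V ≤ X.total B U V' :=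
  Finset.sum_le_sum_of_subset h

theorem Scope.le_weight {N : ℤ} {z : RBG.Node σ} (hz : X.Node N z) (U : ℕ) (v : σ.Vertex) :
    U * (headLen z.expr * ((B.edgesText v).length + 1)) ≤ X.weight B U (z.addr, v) :=
  Nat.mul_le_mul le_rfl (Nat.mul_le_mul (NodeAt.headLen_le hz) le_rfl)

/-- After enlarging `V` to a product, the sum of the weights factors into the tokens of the
expression and the size of the board. -/
theorem Scope.total_le (U : ℕ) : X.total B U V ≤ U * (X.len.toNat * B.size) := by
  have h1 : X.total B U V ≤ X.total B U (V.image Prod.fst ×ˢ Finset.univ) := by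
    refine Scope.total_mono fun x hx => ?_
    simpa using ⟨x.2, hx⟩
  refine h1.trans ?_
  simp only [Scope.total, Scope.weight, ← Finset.mul_sum]
  refine Nat.mul_le_mul le_rfl ?_
  rw [Finset.sum_product]
  simp only [← Finset.mul_sum, ← Finset.sum_mul]
  refine Nat.mul_le_mul ?_ le_rfl
  have := sum_headAt_le (X.rex.number X.first) X.addr (V.image Prod.fst)
  rw [nlen_number] at this
  have h2 : X.len = exprLen X.rex := rfl
  rw [h2]
  omega

end Basic

end RBG

-- Going on behind a node; nodes with one successor

namespace RBG

variable {σ : Sig}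

/-- Shows that continuation cells lie in table 2 or are the given cell, and hence in the part of the
memory that the search never changes. -/
theorem NodeAt.cell_range {N : ℤ} {H : NRegex σ} {p c : ℤ} {k : Stack σ} {z : Node σ}
    (h : NodeAt N H p k c z) : z.cell = c ∨ 2 * N + p ≤ z.cell ∧ z.cell < 2 * N + p + nlen H := by
  induction H generalizing p k c with
  | act x => obtain rfl := h; exact .inl rfl
  | sum E F ihE ihF =>
    have := one_le_nlen E
    have := one_le_nlen F
    simp only [nlen]
    rcases h with rfl | h | h
    · exact .inl rfl
    · have := ihE h; omega
    · have := ihF h; omega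
  | cat E F ihE ihF =>
    have := one_le_nlen E
    have := one_le_nlen F
    simp only [nlen]
    rcases h with rfl | h | h
    · exact .inl rfl
    · have := ihE h; omega
    · have := ihF h; omega
  | star E ih =>
    have := one_le_nlen E
    simp only [nlen]
    rcases h with rfl | h
    · exact .inl rfl
    · have := ih h; omega

section Steps

variable {I : Image} {B : Inst σ} {W M : ℤ} {X : Scope σ} {S : SemiState σ}
  {V V' : Finset (ℤ × σ.Vertex)} {l : List (ℕ × σ.Vertex)} {s s₁ s₂ s' : St} {j K U t : ℕ} {r u : ℤ}
  {z : Node σ} {v : σ.Vertex} {c : Stack σ × SemiState σ}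

theorem Image.not_varying_of_lt (hI : I.Ok B) {a : ℤ} (ha : a < I.PA) : ¬ I.Varying σ a := by
  have h1 := hI.L_le
  have h2 := hI.BD_le
  have h3 := hI.PA_le
  have h4 := hI.VA_le
  rintro (h | h | h) <;> omega

theorem Image.not_varying_of_table (hI : I.Ok B) {a : ℤ} (ha : I.N ≤ a)
    (ha' : a < 6 * I.N ∨ 7 * I.N ≤ a) : ¬ I.Varying σ a := by
  have h1 := hI.L_le
  have h2 := hI.BD_le
  have h3 := hI.PA_le
  have h4 := hI.VA_le
  have h5 := hI.pieces_le
  rintro (h | h | h) <;> omega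

/-- The order of the parts of the memory. -/
theorem Image.Ok.order (hI : I.Ok B) : 0 ≤ I.L ∧ I.L ≤ I.BD ∧
    I.BD + (σ.players + σ.extraVars : ℕ) ≤ I.PA ∧ I.PA + σ.vertices ≤ I.VA ∧
    I.VA + (σ.players + σ.extraVars : ℕ) ≤ I.N ∧ σ.pieces ≤ I.N ∧ 0 ≤ I.L * (σ.vertices : ℤ) :=
  ⟨hI.L_le.1, hI.L_le.2, hI.BD_le, hI.PA_le, hI.VA_le, hI.pieces_le,
    mul_nonneg hI.L_le.1 (by omega)⟩

theorem node_addr_le (hX : X.Ok I B W) (hz : X.Node I.N z) :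
    1 ≤ z.addr ∧ 1 ≤ nlen z.expr ∧ z.addr + nlen z.expr ≤ I.L := by
  have h1 := Scope.addr_mem hz
  have h2 := hX.addr_pos
  have h3 := hX.addr_le
  have h4 := one_le_nlen z.expr
  omega

theorem Ready.card (h : Ready I X S V l s) : (V.card : ℤ) ≤ X.len * σ.vertices := card_le h.nodes

/-- The tables of a node. -/
theorem Ready.cont (hI : I.Ok B) (hX : X.Ok I B W) (h : Ready I X S V l s) (hz : X.Node I.N z) :
    0 ≤ s.mem (I.N + z.addr) ∧ s.mem (I.N + z.addr) ≤ 7 * I.N ∧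
      ∀ v : σ.Vertex, ∀ s' : St, s'.p = s.mem (s.mem (I.N + z.addr)) → s'.s = (v : ℕ) →
        Target X I.N S (z.cont, S.move v) s' := by
  have h1 := hI.order
  have h2 := node_addr_le hX hz
  have h3 := NodeAt.ok hz hX.laid
  have h4 := NodeAt.cell_range hz
  have h5 := hX.addr_le
  have h6 := hX.addr_pos
  rw [nlen_number] at h4
  have h7 : X.len = exprLen X.rex := rfl
  have e1 : s.mem (I.N + z.addr) = z.cell := by
    rw [h.held.base _ (by omega) (by omega) (Image.not_varying_of_table hI (by omega) (by omega)),
      h3.1]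
  have e2 : s.mem z.cell = I.base z.cell := h.held.base _ (by omega) (by omega)
    (Image.not_varying_of_table hI (by omega) (by omega))
  refine ⟨by omega, by omega, fun v s' hp hv => ?_⟩
  rw [e1, e2] at hp
  rcases NodeAt.next hz with ⟨h8, h9⟩ | ⟨z', h8, h9, h10⟩
  · exact .inl ⟨h8, by rw [hp, h9, hI.zero]⟩
  · exact .inr ⟨z', v, h8, by rw [h9]; rfl, by rw [hp, h10 _ fun y hy => NodeAt.ok hy hX.laid], hv⟩

theorem Marks.congr (hX : X.Ok I B W) {mem mem' : ℤ → ℤ} {vb b : ℤ} (h : Marks X I.N mem vb V)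
    (h0 : 0 ≤ vb) (hb : vb + I.L * σ.vertices ≤ b) (hm : ∀ a, 0 ≤ a → a < b → mem' a = mem a) :
    Marks X I.N mem' vb V := fun z v hz => by
  have h1 := hX.cells (Scope.cells_of_node (vb := vb) hz v)
  rw [hm _ (by omega) (by omega)]
  exact h z v hz

/-- A search between operations that do not disturb the memory below the stack pointer. -/
theorem SearchGoal.wrap (hI : I.Ok B) (hX : X.Ok I B W) (h : Ready I X S V l s)
    (hs : SearchGoal I B X S V l U c t s₁ s₂) (h₁ : Agree (X.Cells s.vb) s.sp s s₁)
    (hf : s₁.found = s.found) (ho : s₁.out = s.out) (hsp : s.sp ≤ s₁.sp)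
    (h₂ : Agree (fun _ => False) s.sp s₂ s') (hf' : s'.found = s₂.found) (ho' : s'.out = s₂.out)
    (hsp' : s'.sp = s.sp) {t' : ℕ} (ht : s'.time + s₁.time + t ≤ s₂.time + s.time + t') :
    SearchGoal I B X S V l U c t' s s' := by
  obtain ⟨V', ms, h3, h4, h5, h6⟩ := hs
  rw [hf] at h3
  refine ⟨V', ms, by rwa [hf'], by rwa [hf'], ⟨?_, hsp', ?_, by rw [ho', h5.out, ho]⟩, by omega⟩
  · refine h₁.trans ((h5.agree.mono hsp fun a _ _ h => ?_).trans
      (h₂.mono le_rfl fun _ _ _ => False.elim))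
    rwa [h₁.vb] at h
  · have h7 := hI.order
    have h8 := h.vb_le
    have h9 := h5.marks
    rw [h₁.vb] at h9
    exact h9.congr hX (by omega) h.sp_le fun a h0 ha => h₂.mem a h0 ha id

theorem Agree.refl {R : ℤ → Prop} {b : ℤ} : Agree R b s s := ⟨rfl, rfl, rfl, rfl, rfl, rfl, rfl, rfl,
  fun _ _ _ _ => rfl⟩

/-- Readiness after a search. -/
theorem Ready.search (hI : I.Ok B) (hX : X.Ok I B W) (h : Ready I X S V l s) {ms : List (Move σ)}
    (h₁ : Searched B X I.N S V V' s.found s'.found ms c) (h₂ : Outcome I X V' l ms s s') :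
    Ready I X S V' l s' :=
  h.after hI h₂.agree h.sp_le (fun a ha => (hX.cells ha).1) h₂.marks (h₁.nodes h.nodes)
    (by rw [h₂.sp]; exact h.sp_le) (h₁.bool h.found)

/-- The double indirection leads to the cell behind the node and then to the node whose address it
holds, or to 0 at the end of the expression. -/
theorem go_goOn (hI : I.Ok B) (hX : X.Ok I B W) (hv : VisitSpec I B W X K j U r u)
    (h : Ready I X S V l s) (hS : S.Bounded B) (hz : X.Node I.N z) (hp : s.p = z.addr)
    (hs : s.s = (v : ℕ)) (hb : Budget B z.cont (S.move v) j) (hu : X.len * σ.vertices - V.card ≤ u)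
    (hroom : s.sp + 10 * (X.len * σ.vertices - V.card) + r + 2 * l.length + 4 * I.L + 40 ≤ M)
    (hr : 0 ≤ r) (hW : M + 32 ≤ W) (hl : l.length + j ≤ K) :
    Go W M Code.goOn s (SearchGoal I B X S V l U (z.cont, S.move v) 120 s) := by
  have h1 := hI.order
  have h2 := node_addr_le hX hz
  have h3 := h.card
  have h4 := h.vb_le
  have h5 := h.sp_le
  have h6 := h.cont hI hX hz
  simp only [Code.goOn, run_rules, val_rules, cost_rules, ok_rules, St.set, St.get, St.tick,
    true_and, Code.tab, one_mul, hp, h.N]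
  repeat refine And.intro (by omega) ?_
  refine Run.mono (hv S V l M _ (z.cont, S.move v) ?_ hS hb ?_ hu hroom hW hl) fun s' hs' =>
    SearchGoal.wrap hI hX h hs' ?_ rfl rfl le_rfl Agree.refl rfl rfl ?_ ?_
  · exact h.push hI hX ⟨rfl, h.N.symm, rfl, rfl, rfl, rfl, rfl, rfl, fun _ _ _ _ => rfl⟩ h.sp_le h.sp_le
      h.found
  · exact h6.2.2 v _ (by simp) hs
  · exact ⟨rfl, h.N.symm, rfl, rfl, rfl, rfl, rfl, rfl, fun _ _ _ _ => rfl⟩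
  · obtain ⟨V', ms, _, _, h8, _⟩ := hs'
    exact h8.sp
  · dsimp only; omega

/-- The costs of the visit of a node. -/
theorem AtNode.cost (hU : 1000 ≤ U) (h : AtNode I B W X K j r u S V l M s z v) :
    1000 * headLen z.expr + 1000 * (B.edgesText v).length ≤ X.weight B U (z.addr, v) := by
  have h1 := Scope.le_weight (B := B) h.node U v
  have h2 : 1 ≤ headLen z.expr := by
    cases z.expr <;> simp [headLen, Action.one_le_length_text]
  have h3 : 1 ≤ (B.edgesText v).length := by simp [Inst.edgesText]
  have h4 : 1000 * (headLen z.expr * ((B.edgesText v).length + 1)) ≤ X.weight B U (z.addr, v) :=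
    (Nat.mul_le_mul_right _ hU).trans h1
  have h5 : headLen z.expr + (B.edgesText v).length ≤
      headLen z.expr * ((B.edgesText v).length + 1) := by nlinarith
  omega

/-- A node that is not a modifier and has at most one successor. -/
theorem NodeGoal.one (h : AtNode I B W X K j r u S V l M s z v)
    (hm : ∀ i a, z.expr = .act (i, a) → a.isModifier = false)
    (hc : EStep B (z.conf S v) c) (hc' : ∀ c', EStep B (z.conf S v) c' → c' = c)
    (hs : SearchGoal I B X S (insert (z.addr, v) V) l U c t s s')
    (ht : t + 200 ≤ X.weight B U (z.addr, v)) : NodeGoal I B X S V l U z v s s' := by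
  obtain ⟨V', ms, h1, h2, h3, h4⟩ := hs
  rw [Scope.total_insert h.new] at h4
  refine ⟨V', ms, Searched.enter h.node h.new ?_ (fun c' hc'' => ?_) fun i a k hk => ?_,
    h1.subset (Finset.mem_insert_self _ _), h3, by omega⟩
  · have := (Searched.refl (B := B) (X := X) (N := I.N) (S := S)).trans h1 .refl (.single hc)
    simpa using this
  · rw [hc' c' hc'']; exact h2
  · exact hm i a (List.cons.inj hk).1

/-- A node that is not a modifier and has no successors. -/
theorem NodeGoal.zero (h : AtNode I B W X K j r u S V l M s z v)
    (hm : ∀ i a, z.expr = .act (i, a) → a.isModifier = false)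
    (hc' : ∀ c', ¬ EStep B (z.conf S v) c') (hs : Agree (X.Cells s.vb) s.sp s s')
    (hmarks : Marks X I.N s'.mem s.vb (insert (z.addr, v) V))
    (hsp : s'.sp = s.sp) (ho : s'.out = s.out) (hf : s'.found = s.found)
    (ht : s'.time + 200 ≤ s.time + X.weight B U (z.addr, v)) :
    NodeGoal I B X S V l U z v s s' := by
  refine ⟨insert (z.addr, v) V, [], Searched.enter h.node h.new ?_ (fun c' hc'' => ?_)
    fun i a k hk => ?_, Finset.mem_insert_self _ _, ⟨hs, hsp, hmarks, ?_⟩, ?_⟩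
  · rw [hf]; exact Searched.refl
  · exact absurd hc'' (hc' _)
  · exact hm i a (List.cons.inj hk).1
  · simp [ho, movesText]
  · rw [Scope.total_insert h.new]; omega

/-- A node that is not a modifier and has two successors. -/
theorem NodeGoal.two (hU : 1000 ≤ U) (h : AtNode I B W X K j r u S V l M s z v)
    (hm : ∀ i a, z.expr ≠ .act (i, a)) {c₁ c₂ : Stack σ × SemiState σ}
    (hc₁ : EStep B (z.conf S v) c₁) (hc₂ : EStep B (z.conf S v) c₂)
    (hc' : ∀ c', EStep B (z.conf S v) c' → c' = c₁ ∨ c' = c₂) {ms : List (Move σ)} {t₁ t₂ : ℕ}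
    (hs₁ : Searched B X I.N S (insert (z.addr, v) V) V' s.found s₁.found ms c₁)
    (hcov : Covered X I.N S V' s₁.found c₁) (hO : Outcome I X V' l ms s s₁)
    (htime : s₁.time + X.total B U (insert (z.addr, v) V) ≤ s.time + X.total B U V' + t₁)
    (hs₂ : SearchGoal I B X S V' l U c₂ t₂ s₁ s') (ht : t₁ + t₂ + 200 ≤ 1000) :
    NodeGoal I B X S V l U z v s s' := by
  obtain ⟨V'', ms', h1, h2, h3, h4⟩ := hs₂
  have h5 := h.cost hU
  rw [Scope.total_insert h.new] at htime
  have h6 : 1 ≤ headLen z.expr := by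
    cases z.expr <;> simp [headLen, Action.one_le_length_text]
  refine ⟨V'', ms ++ ms', Searched.enter h.node h.new (hs₁.trans h1 (.single hc₁) (.single hc₂))
    (fun c' hc'' => ?_) fun i a k hk => absurd (List.cons.inj hk).1 (hm i a),
    h1.subset (hs₁.subset (Finset.mem_insert_self _ _)), ⟨?_, h3.sp.trans hO.sp, ?_, ?_⟩, by omega⟩
  · rcases hc' c' hc'' with rfl | rfl
    · exact hcov.mono h1.subset h1.mono
    · exact h2
  · have := h3.agree
    rw [hO.agree.vb, hO.sp] at this
    exact hO.agree.trans this
  · have := h3.marks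
    rwa [hO.agree.vb] at this
  · rw [h3.out, hO.out, List.map_append, movesText, movesText, movesText, List.flatMap_append,
      List.append_assoc]

theorem go_visitCat (hI : I.Ok B) (hX : X.Ok I B W) (hv : VisitSpec I B W X K j U r u)
    (hU : 1000 ≤ U) (hr : 0 ≤ r) (h : AtNode I B W X K j r u S V l M s z v) {E F : NRegex σ}
    (he : z.expr = .cat E F) : Go W M Code.visitCat s (NodeGoal I B X S V l U z v s) := by
  have h1 := hI.order
  have h2 := node_addr_le hX h.node
  have h3 := h.ready.card
  have h4 := h.ready.vb_le
  have h5 := h.ready.sp_le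
  have h6 := h.room
  have h7 := h.small
  have hc : EStep B (z.conf S v) (E :: F :: z.cont, S.move v) := by
    rw [Node.conf, Node.stack, he]; exact .step .cat
  simp only [Code.visitCat, run_rules, val_rules, cost_rules, ok_rules, St.set, St.get, St.tick,
    true_and, Code.tab, one_mul]
  rw [h.p]
  repeat refine And.intro (by omega) ?_
  refine Run.mono (hv S _ l M _ (E :: F :: z.cont, S.move v) ?_ h.bounded ?_ ?_ h.unvisited
    (by dsimp only; omega) h7 h.depth)
    fun s' hs' => NodeGoal.one h (t := 120) ?_ hc ?_ (SearchGoal.wrap hI hX h.ready hs'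
      ?_ rfl rfl le_rfl Agree.refl rfl rfl ?_ ?_) ?_
  · exact h.ready.push hI hX ⟨rfl, rfl, rfl, rfl, rfl, rfl, rfl, rfl, fun _ _ _ _ => rfl⟩ h5 h5
      h.ready.found
  · exact hc.budget h.budget
  · refine .inr ⟨⟨z.addr + 1, E, F :: z.cont, 2 * I.N + z.addr⟩, v, NodeAt.trans h.node ?_, rfl, rfl, h.pos⟩
    rw [he]
    exact .inr (.inl (.root ..))
  · rw [he]; simp
  · intro c' hc'
    rw [Node.conf, Node.stack, he] at hc'
    cases hc' with
    | step hs => cases hs; rfl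
  · exact ⟨rfl, rfl, rfl, rfl, rfl, rfl, rfl, rfl, fun _ _ _ _ => rfl⟩
  · obtain ⟨V', ms, _, _, h8, _⟩ := hs'
    exact h8.sp
  · dsimp only; omega
  · have := h.cost hU
    rw [he, headLen] at this
    · omega
    · simp

end Steps

end RBG

-- Sums, stars, and letters in general

namespace RBG

variable {σ : Sig}

section Branches

variable {I : Image} {B : Inst σ} {W M : ℤ} {X : Scope σ} {S : SemiState σ}
  {V V' : Finset (ℤ × σ.Vertex)} {l : List (ℕ × σ.Vertex)} {s s₁ s₂ s' : St} {j K U t : ℕ} {r u : ℤ}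
  {z : Node σ} {v : σ.Vertex} {c : Stack σ × SemiState σ}

/-- A search does not disturb the stack. -/
theorem Outcome.above (hX : X.Ok I B W) {ms : List (Move σ)} (h : Outcome I X V' l ms s s') {a : ℤ}
    (h0 : 0 ≤ a) (h1 : s.vb + I.L * σ.vertices ≤ a) (h2 : a < s.sp) : s'.mem a = s.mem a :=
  h.agree.mem a h0 h2 fun ha => by have := hX.cells ha; omega

/-- A search does not disturb what lies below the table of the visited nodes. -/
theorem Outcome.below (hX : X.Ok I B W) {ms : List (Move σ)} (h : Outcome I X V' l ms s s') {a : ℤ}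
    (h0 : 0 ≤ a) (h1 : a < s.vb) (h2 : a < s.sp) : s'.mem a = s.mem a :=
  h.agree.mem a h0 h2 fun ha => by have := hX.cells ha; omega

theorem SearchGoal.sp (h : SearchGoal I B X S V l U c t s s') : s'.sp = s.sp := by
  obtain ⟨V', ms, _, _, h8, _⟩ := h
  exact h8.sp

/-- A node with two successors, the first of which begins behind the node. -/
theorem go_twoBranches (hI : I.Ok B) (hX : X.Ok I B W) (hv : VisitSpec I B W X K j U r u)
    (hU : 1000 ≤ U) (hr : 0 ≤ r) (h : AtNode I B W X K j r u S V l M s z v)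
    (hm : ∀ i a, z.expr ≠ .act (i, a)) {z₁ : Node σ} {c₂ : Stack σ × SemiState σ}
    (hz₁ : X.Node I.N z₁) (ha : z₁.addr = z.addr + 1) (hc₁ : EStep B (z.conf S v) (z₁.conf S v))
    (hc₂ : EStep B (z.conf S v) c₂)
    (hc' : ∀ c', EStep B (z.conf S v) c' → c' = z₁.conf S v ∨ c' = c₂) {d : HCmd} {ls : List HCmd}
    (hC : ∀ V₁ s₃, Ready I X S V₁ l s₃ → s₃.p = z.addr → s₃.s = (v : ℕ) →
      X.len * σ.vertices - V₁.card ≤ u →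
      s₃.sp + 10 * (X.len * σ.vertices - V₁.card) + r + 2 * l.length + 4 * I.L + 49 ≤ M →
      Go W M (.block (d :: ls)) s₃ (SearchGoal I B X S V₁ l U c₂ 200 s₃)) :
    Go W M (.block (Code.saveNode :: .set .p (.reg .p + .const 1) :: .call 5 :: Code.restoreNode ::
      d :: ls)) s (NodeGoal I B X S V l U z v s) := by
  have h1 := hI.order
  have h2 := node_addr_le hX h.node
  have h3 := h.ready.card
  have h4 := h.ready.vb_le
  have h5 := h.ready.sp_le
  have h6 := h.room
  have h7 := h.small
  have h8 := h.unvisited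
  have hp := h.p
  have hpos := h.pos
  have hvn := v.isLt
  simp only [Code.saveNode, Code.restoreNode, run_rules, val_rules, cost_rules, ok_rules,
    St.set, St.get, St.tick, true_and, Code.tab, one_mul]
  repeat refine And.intro (by omega) ?_
  refine Run.mono (hv S _ l M _ (z₁.conf S v) (h.ready.push hI hX (b := s.sp)
    ⟨rfl, rfl, rfl, rfl, rfl, rfl, rfl, rfl, fun a _ ha _ => ?_⟩ h5 ?_ h.ready.found) h.bounded
    (hc₁.budget h.budget) (.inr ⟨z₁, v, hz₁, rfl, ?_, h.pos⟩) h.unvisited (by dsimp only; omega) h7 h.depth)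
    fun s₂ hs₂ => ?_
  · dsimp only; rw [upd_of_ne (by omega), upd_of_ne (by omega)]
  · dsimp only; omega
  · dsimp only; omega
  obtain ⟨V₁, ms, g1, g2, g3, g4⟩ := id hs₂
  have e1 : s₂.mem (s.sp + 2 - 2) = s.p := by
    rw [g3.above hX (by omega) (by dsimp only; omega) (by dsimp only; omega)]
    dsimp only
    rw [upd_of_ne (by omega), add_sub_cancel_right, upd_self]
  have e2 : s₂.mem (s.sp + 2 - 2 + 1) = s.s := by
    rw [g3.above hX (by omega) (by dsimp only; omega) (by dsimp only; omega)]
    dsimp only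
    rw [add_sub_cancel_right, upd_self]
  have gsp := g3.sp
  dsimp only at gsp
  have key : ∀ s₃ : St, Agree (fun _ => False) s.sp s₂ s₃ → s₃.sp = s.sp → s₃.p = s.p →
      s₃.s = s.s → s₃.found = s₂.found → s₃.out = s₂.out → s₃.time ≤ s₂.time + 50 →
      Go W M (.block (d :: ls)) s₃ (NodeGoal I B X S V l U z v s) := by
    intro s₃ k1 k2 k3 k4 k5 k6 k7
    obtain ⟨V₁, ms, g1, g2, g3, g4⟩ := SearchGoal.wrap (t' := 300) hI hX h.ready hs₂
      ⟨rfl, rfl, rfl, rfl, rfl, rfl, rfl, rfl, fun a _ ha _ => by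
        dsimp only; rw [upd_of_ne (by omega), upd_of_ne (by omega)]⟩ rfl rfl (by dsimp only; omega) k1
      k5 k6 k2 (by dsimp only; omega)
    have hcard := Finset.card_le_card g1.subset
    exact (hC V₁ s₃ (h.ready.search hI hX g1 g3) (k3.trans hp) (k4.trans hpos) (by omega)
      (by omega)).mono fun s' hs' => NodeGoal.two hU h hm hc₁ hc₂ hc' g1 g2 g3 g4 hs' (by omega)
  simp only [gsp, e1, e2]
  repeat refine And.intro (by omega) ?_
  exact key _ ⟨rfl, rfl, rfl, rfl, rfl, rfl, rfl, rfl, fun _ _ _ _ => rfl⟩ (by dsimp only; omega) rfl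
    rfl rfl rfl (by dsimp only; omega)

theorem go_visitSum (hI : I.Ok B) (hX : X.Ok I B W) (hv : VisitSpec I B W X K j U r u)
    (hU : 1000 ≤ U) (hr : 0 ≤ r) (h : AtNode I B W X K j r u S V l M s z v) {E F : NRegex σ}
    (he : z.expr = .sum E F) : Go W M Code.visitSum s (NodeGoal I B X S V l U z v s) := by
  have hc₂ : EStep B (z.conf S v) (F :: z.cont, S.move v) := by
    rw [Node.conf, Node.stack, he]; exact .step .sumR
  refine go_twoBranches hI hX hv hU hr h (by simp [he]) (z₁ := ⟨z.addr + 1, E, z.cont, z.cell⟩)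
    (NodeAt.trans h.node (by rw [he]; exact .inr (.inl (.root ..)))) rfl
    (by rw [Node.conf, Node.stack, he]; exact .step .sumL) hc₂ (fun c' hc' => ?_)
    fun V₁ s₃ k1 k2 k3 k4 k5 => ?_
  · rw [Node.conf, Node.stack, he] at hc'
    cases hc' with
    | step hs => cases hs <;> simp [Node.conf, Node.stack]
  have h1 := hI.order
  have h2 := node_addr_le hX h.node
  have h3 := k1.card
  have h4 := k1.vb_le
  have h5 := k1.sp_le
  have h7 := h.small
  have hN := k1.N
  have ht := NodeAt.ok h.node hX.laid
  rw [Node.Ok, he] at ht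
  have e1 : s₃.mem (2 * s₃.N + s₃.p) = z.addr + 1 + nlen E := by
    rw [hN, k2, k1.held.base _ (by omega) (by omega)
      (Image.not_varying_of_table hI (by omega) (by omega)), ht.2]
  simp only [run_rules, val_rules, cost_rules, ok_rules, St.set, St.get, St.tick, true_and, Code.tab]
  repeat refine And.intro (by omega) ?_
  refine Run.mono (hv S _ l M _ (F :: z.cont, S.move v) (k1.push hI hX (b := s₃.sp)
    ⟨rfl, rfl, rfl, rfl, rfl, rfl, rfl, rfl, fun a _ ha _ => rfl⟩ h5 h5 k1.found) h.bounded
    (hc₂.budget h.budget) (.inr ⟨⟨z.addr + 1 + nlen E, F, z.cont, z.cell⟩, v,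
      NodeAt.trans h.node (by rw [he]; exact .inr (.inr (.root ..))), rfl, e1, k3⟩) k4
    (by dsimp only; omega) h7 h.depth) fun s₂ hs₂ => SearchGoal.wrap hI hX k1 hs₂
    ⟨rfl, rfl, rfl, rfl, rfl, rfl, rfl, rfl, fun a _ ha _ => rfl⟩ rfl rfl le_rfl Agree.refl rfl rfl
    hs₂.sp (by dsimp only; omega)

/-- The body may match the empty word and lead back to the star at the same position. This does no
harm, since the pair is already marked. -/
theorem go_visitStar (hI : I.Ok B) (hX : X.Ok I B W) (hv : VisitSpec I B W X K j U r u)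
    (hU : 1000 ≤ U) (hr : 0 ≤ r) (h : AtNode I B W X K j r u S V l M s z v) {E : NRegex σ}
    (he : z.expr = .star E) : Go W M Code.visitStar s (NodeGoal I B X S V l U z v s) := by
  have hc₂ : EStep B (z.conf S v) (z.cont, S.move v) := by
    rw [Node.conf, Node.stack, he]; exact .step .starEnd
  refine go_twoBranches hI hX hv hU hr h (by simp [he])
    (z₁ := ⟨z.addr + 1, E, .star E :: z.cont, 2 * I.N + z.addr⟩)
    (NodeAt.trans h.node (by rw [he]; exact .inr (.root ..))) rfl
    (by rw [Node.conf, Node.stack, he]; exact .step .starGo) hc₂ (fun c' hc' => ?_)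
    fun V₁ s₃ k1 k2 k3 k4 k5 => ?_
  · rw [Node.conf, Node.stack, he] at hc'
    cases hc' with
    | step hs => cases hs <;> simp [Node.conf, Node.stack]
  have h7 := h.small
  refine (go_goOn hI hX hv k1 h.bounded h.node k2 k3 (hc₂.budget h.budget) k4 (by omega) hr
    h7 h.depth).mono fun s' ⟨V', ms, g1, g2, g3, g4⟩ => ⟨V', ms, g1, g2, g3, by omega⟩

/-- A letter that is not a modifier. -/
theorem eStep_act_iff {z : Node σ} {i : ℕ} {a : Action σ} (he : z.expr = .act (i, a))
    (ha : a.isModifier = false) {c' : Stack σ × SemiState σ} :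
    EStep B (z.conf S v) c' ↔ B.Valid a (S.move v) ∧ c' = (z.cont, B.apply (S.move v) a) := by
  rw [Node.conf, Node.stack, he]
  constructor
  · intro h
    cases h with
    | step hs => cases hs
    | act _ h => exact ⟨h, rfl⟩
  · rintro ⟨h, rfl⟩
    exact .act ha h

/-- A valid action that is not a modifier, and the search after it. -/
theorem go_letter (hI : I.Ok B) (hX : X.Ok I B W) (hv : VisitSpec I B W X K j U r u)
    (hU : 1000 ≤ U) (hr : 0 ≤ r) (h : AtNode I B W X K j r u S V l M s z v) {i : ℕ} {a : Action σ}
    (he : z.expr = .act (i, a)) (ha : a.isModifier = false) {v' : σ.Vertex}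
    (hval : B.Valid a (S.move v)) (hap : B.apply (S.move v) a = S.move v')
    (hs : Agree (X.Cells s.vb) s.sp s s₁) (hm : Marks X I.N s₁.mem s.vb (insert (z.addr, v) V))
    (hsp : s₁.sp = s.sp) (hf : s₁.found = s.found) (ho : s₁.out = s.out) (hp : s₁.p = s.p)
    (hs' : s₁.s = (v' : ℕ))
    (ht : s₁.time + 320 ≤ s.time + X.weight B U (z.addr, v)) :
    Go W M Code.goOn s₁ (NodeGoal I B X S V l U z v s) := by
  have h6 := h.room
  have h7 := h.small
  have hcost := h.cost hU
  have hlen : 1 ≤ headLen z.expr := by rw [he]; exact Action.one_le_length_text _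
  have hc : EStep B (z.conf S v) (z.cont, S.move v') := (eStep_act_iff he ha).2 ⟨hval, by rw [hap]⟩
  refine (go_goOn hI hX hv (h.ready.after hI hs h.ready.sp_le (fun a ha => (hX.cells ha).1) hm
    h.ready.nodes (by rw [hsp]; exact h.ready.sp_le)
    (by rw [hf]; exact h.ready.found)) h.bounded h.node (hp.trans h.p) hs' (hc.budget h.budget)
    h.unvisited (by omega) hr h7 h.depth).mono fun s' h' => ?_
  refine NodeGoal.one (t := s₁.time + 120 - s.time) h (fun i' a' e => ?_) hc (fun c' hc' => ?_)
    (SearchGoal.wrap hI hX h.ready h' hs hf ho hsp.ge Agree.refl rfl rfl (h'.sp.trans hsp) ?_) ?_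
  · rw [he] at e
    obtain ⟨rfl, rfl⟩ := Prod.mk.inj (Regex.act.inj e)
    exact ha
  · rw [((eStep_act_iff he ha).1 hc').2, hap]
  · omega
  · omega

/-- An action that is not valid and not a modifier. -/
theorem NodeGoal.invalid (h : AtNode I B W X K j r u S V l M s z v) {i : ℕ} {a : Action σ}
    (he : z.expr = .act (i, a)) (ha : a.isModifier = false) (hval : ¬ B.Valid a (S.move v))
    (hs : Agree (X.Cells s.vb) s.sp s s₁) (hm : Marks X I.N s₁.mem s.vb (insert (z.addr, v) V))
    (hsp : s₁.sp = s.sp) (hf : s₁.found = s.found) (ho : s₁.out = s.out)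
    (ht : s₁.time + 200 ≤ s.time + X.weight B U (z.addr, v)) :
    NodeGoal I B X S V l U z v s s₁ := by
  refine NodeGoal.zero h (fun i' a' e => ?_) (fun c' hc' => ?_) hs hm hsp ho hf ht
  · rw [he] at e
    obtain ⟨rfl, rfl⟩ := Prod.mk.inj (Regex.act.inj e)
    exact ha
  · exact hval ((eStep_act_iff he ha).1 hc').1

/-- The node stays marked if the memory below the stack pointer is not changed. -/
theorem AtNode.marks (hI : I.Ok B) (hX : X.Ok I B W) (h : AtNode I B W X K j r u S V l M s z v)
    {mem : ℤ → ℤ} (hm : ∀ a, 0 ≤ a → a < s.sp → mem a = s.mem a) :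
    Marks X I.N mem s.vb (insert (z.addr, v) V) := by
  have h6 := h.ready.vb_le
  have h7 := hI.order
  exact h.ready.marks.congr hX (by omega) h.ready.sp_le hm

end Branches

end RBG

-- Ons and shifts

namespace RBG

variable {σ : Sig}

theorem NodeAt.magnitude_le {B : Inst σ} {N : ℤ} {E : Regex (Action σ)} {n : ℕ} {p c : ℤ}
    {k : Stack σ} {z : Node σ} (h : NodeAt N (E.number n) p k c z) {i : ℕ} {a : Action σ}
    (he : z.expr = .act (i, a)) : a.magnitude B ≤ exprMagnitude B E := by
  induction E generalizing n p k c with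
  | act b =>
    obtain rfl := h
    obtain ⟨rfl, rfl⟩ := Prod.mk.inj (Regex.act.inj he)
    simp [exprMagnitude]
  | sum E F ihE ihF =>
    simp only [exprMagnitude]
    rcases h with rfl | h | h
    · simp at he
    · exact (ihE h).trans (le_max_left _ _)
    · exact (ihF h).trans (le_max_right _ _)
  | cat E F ihE ihF =>
    simp only [exprMagnitude]
    rcases h with rfl | h | h
    · simp at he
    · exact (ihE h).trans (le_max_left _ _)
    · exact (ihF h).trans (le_max_right _ _)
  | star E ih =>
    rcases h with rfl | h
    · simp at he
    · exact ih h

theorem HasText.getElem {mem : ℤ → ℤ} {p : ℤ} {l : List ℤ} (h : HasText mem p l) (x : ℤ)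
    (hx : x ∈ l) : ∃ a, p ≤ a ∧ a < p + l.length ∧ mem a = x := by
  induction l generalizing p with
  | nil => simp at hx
  | cons y l ih =>
    simp only [List.length_cons, Nat.cast_add, Nat.cast_one]
    rcases List.mem_cons.1 hx with rfl | hx
    · exact ⟨p, le_rfl, by omega, h.1⟩
    · obtain ⟨a, h1, h2, h3⟩ := ih h.2 hx
      exact ⟨a, by omega, by omega, h3⟩

/-- The loop that looks for a piece in a list. -/
theorem go_findPiece {W M : ℤ} (L : List ℤ) {s : St} {Q : St → Prop} (ht : HasText s.mem s.e L)
    (hc : s.c = L.length) (h0 : 0 ≤ s.e) (hM : s.e + L.length + 1 ≤ M)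
    (hW : s.e + L.length + 16 ≤ W) (hx : ∀ y ∈ L, |y| + |s.x| + 16 ≤ W)
    (hQ : ∀ e c τ, τ ≤ s.time + 40 * L.length + 10 →
      Q { s with e := e, c := c, y := if s.x ∈ L then 1 else s.y, time := τ }) :
    Go W M Code.findPiece s Q := by
  rw [Code.findPiece, Go]
  induction L generalizing s with
  | nil =>
    have h1 : s.c = 0 := by simpa using hc
    rw [run_loop]
    simp only [val_rules, ok_rules, cost_rules, St.get, St.tick, h1, test_rules, if_false, true_and]
    convert hQ s.e 0 (s.time + (1 + 1)) (by simp) using 2; simp [h1]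
  | cons y L ih =>
    simp only [List.length_cons, Nat.cast_add, Nat.cast_one] at hc hM hW hQ
    have h1 : 0 < s.c := by omega
    have h2 := ht.1
    have h3 := hx y (by simp)
    have h4 := neg_abs_le y
    have h5 := le_abs_self y
    have h6 := neg_abs_le s.x
    have h7 := le_abs_self s.x
    rw [run_loop]
    have h8 : 0 < 1 - (if y < s.x then (1 : ℤ) else 0) - (if s.x < y then 1 else 0) ↔ s.x = y := by
      split_ifs <;> omega
    simp only [run_rules, val_rules, ok_rules, cost_rules, St.get, St.set, St.tick, h1, if_true,
      true_and, h2, h8]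
    have hk : (-W ≤ 1 - if y < s.x then (1 : ℤ) else 0) ∧ (1 - if y < s.x then (1 : ℤ) else 0) ≤ W ∧
        (-W ≤ (1 - if y < s.x then (1 : ℤ) else 0) - if s.x < y then (1 : ℤ) else 0) ∧
        ((1 - if y < s.x then (1 : ℤ) else 0) - if s.x < y then (1 : ℤ) else 0) ≤ W := by
      split_ifs <;> omega
    repeat refine And.intro (by omega) ?_
    have hrec : ∀ (f : ℤ) (τ : ℕ), τ ≤ s.time + 35 → (f = if s.x = y then 1 else s.y) →
        Run Code.procedures W M (.loop (.reg .c) (.block [.ite (Code.eqv (Code.ld (Code.r .e))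
          (Code.r .x)) (.set .y (Code.k 1)) .skip, .set .e (Code.r .e + Code.k 1),
          .set .c (Code.r .c - Code.k 1)]))
          { s with e := s.e + 1, c := s.c - 1, y := f, time := τ } Q := by
      intro f τ hτ hf
      refine ih (s := { s with e := s.e + 1, c := s.c - 1, y := f, time := τ }) ht.2 ?_ ?_ ?_ ?_
        (fun y' h' => hx y' (by simp [h'])) fun e c τ' hτ' => ?_
      iterate 4 dsimp only; omega
      dsimp only at hτ' ⊢
      convert hQ e c τ' (by omega) using 2
      simp only [List.mem_cons]
      by_cases g1 : s.x ∈ L <;> by_cases g2 : s.x = y <;> simp [g1, g2, hf]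
    split_ifs with g
    all_goals
      repeat refine And.intro (by omega) ?_
      exact hrec _ _ (by omega) (by simp [g])

/-- The loop that looks for the last entry of an association list. -/
theorem go_findEdge {W M : ℤ} (L : List (ℤ × ℤ)) {s : St} {Q : St → Prop}
    (ht : HasText s.mem s.e (L.flatMap fun x => [x.1, x.2])) (hc : s.y = L.length) (h0 : 0 ≤ s.e)
    (hM : s.e + 2 * L.length + 1 ≤ M) (hW : s.e + 2 * L.length + 16 ≤ W)
    (hx : ∀ y ∈ L, -W ≤ y.1 - s.t ∧ y.1 - s.t ≤ W)
    (hQ : ∀ e y τ, τ ≤ s.time + 60 * L.length + 10 →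
      Q { s with e := e, y := y, x := L.foldl (fun x y => if y.1 = s.t then y.2 else x) s.x, time := τ }) :
    Go W M Code.findEdge s Q := by
  rw [Code.findEdge, Go]
  induction L generalizing s with
  | nil =>
    have h1 : s.y = 0 := by simpa using hc
    rw [run_loop]
    simp only [val_rules, ok_rules, cost_rules, St.get, St.tick, h1, test_rules, if_false, true_and]
    convert hQ s.e 0 (s.time + (1 + 1)) (by simp) using 2; simp [h1]
  | cons y L ih =>
    simp only [List.length_cons, Nat.cast_add, Nat.cast_one] at hc hM hW hQ
    have h1 : 0 < s.y := by omega
    have h2 : s.mem s.e = y.1 := ht.1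
    have h2' : s.mem (s.e + 1) = y.2 := ht.2.1
    have h3 := hx y (by simp)
    rw [run_loop]
    have h8 : 0 < 1 - (if y.1 < s.t then (1 : ℤ) else 0) - (if s.t < y.1 then 1 else 0) ↔ y.1 = s.t := by
      split_ifs <;> omega
    simp only [run_rules, val_rules, ok_rules, cost_rules, St.get, St.set, St.tick, h1, if_true,
      true_and, h2, h2', h8]
    have hk : (-W ≤ 1 - if y.1 < s.t then (1 : ℤ) else 0) ∧ (1 - if y.1 < s.t then (1 : ℤ) else 0) ≤ W ∧
        (-W ≤ (1 - if y.1 < s.t then (1 : ℤ) else 0) - if s.t < y.1 then (1 : ℤ) else 0) ∧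
        ((1 - if y.1 < s.t then (1 : ℤ) else 0) - if s.t < y.1 then (1 : ℤ) else 0) ≤ W := by
      split_ifs <;> omega
    repeat refine And.intro (by omega) ?_
    have hrec : ∀ (f : ℤ) (τ : ℕ), τ ≤ s.time + 55 → (f = if y.1 = s.t then y.2 else s.x) →
        Run Code.procedures W M (.loop (.reg .y) (.block [.ite (Code.eqv (Code.ld (Code.r .e))
          (Code.r .t)) (.set .x (Code.ld (Code.r .e + Code.k 1))) .skip,
          .set .e (Code.r .e + Code.k 2), .set .y (Code.r .y - Code.k 1)]))
          { s with e := s.e + 2, y := s.y - 1, x := f, time := τ } Q := by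
      intro f τ hτ hf
      refine ih (s := { s with e := s.e + 2, y := s.y - 1, x := f, time := τ }) ?_ ?_ ?_ ?_ ?_
        (fun y' h' => hx y' (by simp [h'])) fun e c τ' hτ' => ?_
      · have := ht.2.2
        rwa [add_assoc] at this
      iterate 4 dsimp only; omega
      dsimp only at hτ' ⊢
      convert hQ e c τ' (by omega) using 2
      simp [hf]
    split_ifs with g
    all_goals
      repeat refine And.intro (by omega) ?_
      exact hrec _ _ (by omega) (by simp [g])

/-- The edges of a vertex. -/
def Inst.edges (B : Inst σ) (v : σ.Vertex) : List (ℤ × ℤ) :=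
  (List.finRange σ.dirs).filterMap fun dir =>
    (B.next v dir).map fun v' : σ.Vertex => (((dir : ℕ) : ℤ), ((v' : ℕ) : ℤ))

theorem Inst.edgesText_eq (B : Inst σ) (v : σ.Vertex) :
    B.edgesText v = ((B.edges v).length : ℤ) :: (B.edges v).flatMap fun x => [x.1, x.2] := by
  have key : ∀ l : List σ.Dir,
      (l.filterMap fun dir => (B.next v dir).map fun v' => [((dir : ℕ) : ℤ), ((v' : ℕ) : ℤ)]) =
      (l.filterMap fun dir => (B.next v dir).map fun v' : σ.Vertex => (((dir : ℕ) : ℤ), ((v' : ℕ) : ℤ))).map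
        fun x => [x.1, x.2] := by
    intro l
    rw [List.map_filterMap]
    congr 1
    funext dir
    cases B.next v dir <;> rfl
  simp only [Inst.edgesText, key, List.length_map, Inst.edges, List.flatMap_def]

/-- The result of the search for an edge. -/
theorem Inst.foldl_edges (B : Inst σ) (v : σ.Vertex) (dir : σ.Dir) :
    (B.edges v).foldl (fun x y => if y.1 = ((dir : ℕ) : ℤ) then y.2 else x) (-1) =
      match B.next v dir with
      | some v' => ((v' : ℕ) : ℤ)
      | none => -1 := by
  -- Generalized over the current result `x`: either the direction is still to come, or `x` is
  -- already the answer; without an edge it remains -1.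
  have key : ∀ (l : List σ.Dir) (x : ℤ), (dir ∉ l → x = match B.next v dir with
      | some v' => ((v' : ℕ) : ℤ)
      | none => -1) → (B.next v dir = none → x = -1) →
      (l.filterMap fun dir => (B.next v dir).map fun v' : σ.Vertex => (((dir : ℕ) : ℤ), ((v' : ℕ) : ℤ))).foldl
        (fun x y => if y.1 = ((dir : ℕ) : ℤ) then y.2 else x) x =
      match B.next v dir with
      | some v' => ((v' : ℕ) : ℤ)
      | none => -1 := by
    intro l
    induction l with
    | nil => intro x hx _; exact hx (by simp)
    | cons d l ih =>
      intro x hx hx'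
      by_cases hd : d = dir
      · subst hd
        cases hn : B.next v d with
        | none =>
          simp only [hn, List.filterMap_cons, Option.map_none] at ih ⊢
          exact ih x (fun _ => hx' hn) fun _ => hx' hn
        | some v' =>
          simp only [hn, List.filterMap_cons, Option.map_some, List.foldl_cons, if_true] at ih ⊢
          exact ih _ (fun _ => by simp) (by simp)
      · have hd' : ¬ ((d : ℕ) : ℤ) = ((dir : ℕ) : ℤ) := fun h => hd (Fin.ext (by omega))
        have hx₂ : dir ∉ l → x = match B.next v dir with
            | some v' => ((v' : ℕ) : ℤ)
            | none => -1 := fun h => hx (by simp [h, Ne.symm hd])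
        cases hn : B.next v d with
        | none =>
          simp only [hn, List.filterMap_cons, Option.map_none]
          exact ih x hx₂ hx'
        | some v' =>
          simp only [hn, List.filterMap_cons, Option.map_some, List.foldl_cons, hd', if_false]
          exact ih x hx₂ hx'
  exact key _ (-1) (fun h => absurd (List.mem_finRange dir) h) fun _ => rfl

section Letters

variable {I : Image} {B : Inst σ} {W M : ℤ} {X : Scope σ} {S : SemiState σ}
  {V V' : Finset (ℤ × σ.Vertex)} {l : List (ℕ × σ.Vertex)} {s s₁ s₂ s' : St} {j K U t : ℕ} {r u : ℤ}
  {z : Node σ} {v : σ.Vertex} {c : Stack σ × SemiState σ}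

/-- The text of an action at a node. -/
theorem Ready.text (hI : I.Ok B) (hX : X.Ok I B W) (h : Ready I X S V l s) (hz : X.Node I.N z)
    {i : ℕ} {a : Action σ} (he : z.expr = .act (i, a)) :
    HasText s.mem z.addr a.text ∧ z.addr + a.text.length ≤ I.L ∧
      (∀ x ∈ a.text, |x| + 32 ≤ W) ∧ a.magnitude B ≤ exprMagnitude B X.rex := by
  have h1 := hI.order
  have h2 := node_addr_le hX hz
  have h4 : HasText I.base z.addr a.text := by
    have := NodeAt.hasText hz (mem := I.base) (by rw [ntext_number]; exact hX.text)
    rwa [he] at this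
  have h5 : z.addr + a.text.length ≤ I.L := by
    have := h2.2.2
    rwa [he] at this
  refine ⟨h4.congr fun b hb hb' => ?_, h5, fun x hx => ?_, NodeAt.magnitude_le hz he⟩
  · exact h.held.base b (by omega) (by omega) (Image.not_varying_of_lt hI (by omega))
  · obtain ⟨b, hb, hb', rfl⟩ := h4.getElem x hx
    exact hX.tokens b (by omega) (by omega)

/-- The scan takes time proportional to the number of listed pieces. This is why a letter pays for
its whole text. -/
theorem go_visitOn (hI : I.Ok B) (hX : X.Ok I B W) (hv : VisitSpec I B W X K j U r u)
    (hU : 1000 ≤ U) (hr : 0 ≤ r) (h : AtNode I B W X K j r u S V l M s z v) {i : ℕ}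
    {Y : Finset σ.Piece} (he : z.expr = .act (i, .on Y)) :
    Go W M Code.visitOn s (NodeGoal I B X S V l U z v s) := by
  have h1 := hI.order
  have h2 := node_addr_le hX h.node
  have h3 := h.ready.card
  have h4 := h.ready.vb_le
  have h5 := h.ready.sp_le
  have h6 := h.room
  have h7 := h.small
  have hcost := h.cost hU
  have hp := h.p
  have hpos := h.pos
  have hvn := v.isLt
  obtain ⟨k1, k2, k3, -⟩ := h.ready.text hI hX h.node he
  have hlen : headLen z.expr = (Action.on Y).text.length := by rw [he]; rfl
  rw [Action.text_on] at k1 k2 k3 hlen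
  have e1 : s.mem (z.addr + 1) = Y.card := k1.2.1
  have e2 : s.mem (s.PA + s.s) = (S.pieceAt v : ℕ) := by
    rw [h.ready.PA, hpos, h.ready.held.piece]
  have hPA := h.ready.PA
  have hyn := (S.pieceAt v).isLt
  simp only [List.length_cons, List.length_map, Finset.length_sort, Nat.cast_add, Nat.cast_one] at k2 hlen
  have hpc : (σ.pieces : ℤ) ≤ I.N := h1.2.2.2.2.2.1
  simp only [Code.visitOn, run_rules, val_rules, cost_rules, ok_rules, St.set, St.get, St.tick,
    true_and, hp, e1, e2]
  repeat refine And.intro (by omega) ?_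
  refine go_findPiece ((Y.sort (· ≤ ·)).map fun x : σ.Piece => ((x : ℕ) : ℤ)) ?_ ?_ ?_ ?_ ?_ ?_
    fun e c τ hτ => ?_
  · have := k1.2.2
    rwa [add_assoc] at this
  · simp
  · dsimp only; omega
  · simp only [List.length_map, Finset.length_sort]; omega
  · simp only [List.length_map, Finset.length_sort]; omega
  · intro y hy
    obtain ⟨y', _, rfl⟩ := List.mem_map.1 hy
    have := y'.isLt
    simp only [Nat.abs_cast]
    omega
  simp only [List.length_map, Finset.length_sort] at hτ
  have hmem : (((S.pieceAt v : ℕ) : ℤ) ∈ (Y.sort (· ≤ ·)).map fun x : σ.Piece => ((x : ℕ) : ℤ)) ↔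
      S.pieceAt v ∈ Y := by
    simp only [List.mem_map, Finset.mem_sort]
    refine ⟨fun ⟨x, hx, e⟩ => ?_, fun h => ⟨_, h, rfl⟩⟩
    obtain rfl : x = S.pieceAt v := Fin.ext (by omega)
    exact hx
  simp only [hmem, zero_lt_ite, run_rules, val_rules, cost_rules, ok_rules, St.set, St.get, St.tick,
    true_and]
  split_ifs with hY
  · refine go_letter hI hX hv hU hr h he rfl (v' := v) hY rfl
      ⟨rfl, rfl, rfl, rfl, rfl, rfl, rfl, rfl, fun _ _ _ _ => rfl⟩ h.ready.marks rfl rfl rfl hp.symm hpos ?_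
    dsimp only; omega
  · refine NodeGoal.invalid h he rfl hY
      ⟨rfl, rfl, rfl, rfl, rfl, rfl, rfl, rfl, fun _ _ _ _ => rfl⟩ h.ready.marks rfl rfl rfl ?_
    dsimp only; omega

/-- The scan takes time proportional to the outgoing edges of the vertex. This is why the weight of
a pair contains the length of `edgesText`. -/
theorem go_visitShift (hI : I.Ok B) (hX : X.Ok I B W) (hv : VisitSpec I B W X K j U r u)
    (hU : 1000 ≤ U) (hr : 0 ≤ r) (h : AtNode I B W X K j r u S V l M s z v) {i : ℕ} {dir : σ.Dir}
    (he : z.expr = .act (i, .shift dir)) (ht : s.t = ((dir : ℕ) : ℤ)) :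
    Go W M Code.visitShift s (NodeGoal I B X S V l U z v s) := by
  have h1 := hI.order
  have h2 := node_addr_le hX h.node
  have h3 := h.ready.card
  have h4 := h.ready.vb_le
  have h5 := h.ready.sp_le
  have h6 := h.room
  have h7 := h.small
  have hcost := h.cost hU
  have hp := h.p
  have hpos := h.pos
  have hN := h.ready.N
  have hvn := v.isLt
  obtain ⟨k1, k2, k3, -⟩ := h.ready.text hI hX h.node he
  obtain ⟨g1, g2, g3⟩ := hI.edges v
  rw [Inst.edgesText_eq] at g2 g3
  have hlen : (B.edgesText v).length = 1 + 2 * (B.edges v).length := by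
    simp [Inst.edgesText_eq]; omega
  have hlen' : ((B.edges v).flatMap fun x => [x.1, x.2]).length = 2 * (B.edges v).length := by
    simp; omega
  rw [List.length_cons, hlen'] at g2
  push_cast at g2
  have e1 : s.mem (5 * s.N + s.s) = I.base (5 * I.N + (v : ℕ)) := by
    rw [hN, hpos]
    exact h.ready.held.base _ (by omega) (by omega)
      (Image.not_varying_of_table hI (by omega) (by omega))
  have g4 : HasText s.mem (I.base (5 * I.N + (v : ℕ))) _ := g3.congr fun a ha ha' => by
    rw [List.length_cons, hlen'] at ha'
    push_cast at ha'
    exact h.ready.held.base _ (by omega) (by omega) (Image.not_varying_of_lt hI (by omega))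
  generalize I.base (5 * I.N + (v : ℕ)) = q at e1 g1 g2 g3 g4
  have e2 := g4.1
  simp only [Code.visitShift, run_rules, val_rules, cost_rules, ok_rules, St.set, St.get, St.tick,
    true_and, Code.tab, e1, e2]
  repeat refine And.intro (by omega) ?_
  refine go_findEdge (B.edges v) g4.2 rfl ?_ ?_ ?_ ?_ fun e y τ hτ => ?_
  iterate 3 dsimp only; omega
  · intro y hy
    have w1 : |s.t| + 32 ≤ W := k3 s.t (by simp [Action.text, ht])
    simp only [Inst.edges, List.mem_filterMap, Option.map_eq_some_iff] at hy
    obtain ⟨d, _, v', _, rfl⟩ := hy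
    have w2 : HasText I.base q _ := g3
    -- Directions are compared by subtraction. Both numbers are tokens of the input, and tokens are
    -- small.
    obtain ⟨b, hb, hb', hb''⟩ := w2.getElem ((d : ℕ) : ℤ) (by
      simp only [List.mem_cons, List.mem_flatMap]
      refine .inr ⟨((d : ℕ), (v' : ℕ)), ?_, by simp⟩
      simp only [Inst.edges, List.mem_filterMap, Option.map_eq_some_iff]
      exact ⟨d, List.mem_finRange d, v', by assumption, rfl⟩)
    have w3 := hX.tokens b (by omega) (by
      rw [List.length_cons, hlen'] at hb'
      push_cast at hb'
      omega)
    rw [hb''] at w3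
    simp only [ht, Nat.abs_cast] at w1 w3 ⊢
    omega
  dsimp only at hτ
  rw [ht, Inst.foldl_edges]
  have ht' : (z.conf S v).2.pos = v := rfl
  cases hn : B.next v dir with
  | none =>
    simp only [run_rules, val_rules, cost_rules, ok_rules, St.set, St.get, St.tick, true_and,
      zero_lt_ite, lt_irrefl, if_false]
    repeat refine And.intro (by omega) ?_
    refine NodeGoal.invalid h he rfl (by simp [Inst.Valid, SemiState.move, hn])
      ⟨rfl, rfl, rfl, rfl, rfl, rfl, rfl, rfl, fun _ _ _ _ => rfl⟩ h.ready.marks rfl rfl rfl ?_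
    dsimp only; omega
  | some v' =>
    have hv' := v'.isLt
    have hpos' : (-1 : ℤ) < (v' : ℕ) := by omega
    simp only [run_rules, val_rules, cost_rules, ok_rules, St.set, St.get, St.tick, true_and,
      zero_lt_ite, hpos', if_true]
    repeat refine And.intro (by omega) ?_
    refine go_letter hI hX hv hU hr h he rfl (v' := v') (by simp [Inst.Valid, SemiState.move, hn])
      (by simp [Inst.apply, SemiState.move, hn])
      ⟨rfl, rfl, rfl, rfl, rfl, rfl, rfl, rfl, fun _ _ _ _ => rfl⟩ h.ready.marks rfl rfl rfl rfl rfl ?_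
    dsimp only; omega

end Letters

end RBG

-- Comparisons and switches

namespace RBG

variable {σ : Sig}

open Classical in
theorem go_relation {W M : ℤ} {s : St} {Q : St → Prop} (o : RelOp) (ht : s.t = o.code)
    (h : |s.x| + |s.v| + 16 ≤ W)
    (hQ : ∀ τ, τ ≤ s.time + 60 → Q { s with y := if o.Holds s.x s.v then 1 else 0, time := τ }) :
    Go W M Code.relation s Q := by
  have h1 := neg_abs_le s.x
  have h2 := le_abs_self s.x
  have h3 := neg_abs_le s.v
  have h4 := le_abs_self s.v
  cases o <;> simp only [RelOp.code] at ht <;>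
    simp only [Code.relation, run_rules, val_rules, cost_rules, ok_rules, St.set, St.get, St.tick,
      true_and, ht, zero_lt_ite, lt_irrefl, if_true, if_false, Int.reduceLT]
  all_goals
    repeat refine And.intro (by (try split_ifs) <;> omega) ?_
    convert hQ _ ?_ using 2
    any_goals omega
    simp only [RelOp.Holds]
    split_ifs <;> omega

section Letters

variable {I : Image} {B : Inst σ} {W M : ℤ} {X : Scope σ} {S : SemiState σ}
  {V V' : Finset (ℤ × σ.Vertex)} {l : List (ℕ × σ.Vertex)} {s s₁ s₂ s' : St} {j K U t : ℕ} {r u : ℤ}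
  {z : Node σ} {v : σ.Vertex} {c : Stack σ × SemiState σ}

theorem go_visitCompare (hI : I.Ok B) (hX : X.Ok I B W) (hv : VisitSpec I B W X K j U r u)
    (hU : 1000 ≤ U) (hr : 0 ≤ r) (h : AtNode I B W X K j r u S V l M s z v) {i : ℕ}
    {o : RelOp} {e f : AExpr σ} (he : z.expr = .act (i, .compare o e f)) :
    Go W M Code.visitCompare s (NodeGoal I B X S V l U z v s) := by
  have h1 := hI.order
  have h2 := node_addr_le hX h.node
  have h3 := h.ready.card
  have h4 := h.ready.vb_le
  have h5 := h.ready.sp_le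
  have h6 := h.room
  have h7 := h.small
  have hcost := h.cost hU
  have hp := h.p
  have hpos := h.pos
  have hvn := v.isLt
  obtain ⟨k1, k2, k3, k4⟩ := h.ready.text hI hX h.node he
  have hlen : headLen z.expr = (Action.compare o e f).text.length := by rw [he]; rfl
  rw [Action.text] at k1 k2 k3 hlen
  simp only [List.length_cons, List.length_append] at k2 hlen
  push_cast at k2
  rw [Action.magnitude] at k4
  have e1 := k1.2.1
  have k5 := hasText_append.1 k1.2.2
  have k6 : z.addr + 1 + 1 = z.addr + 2 := by ring
  rw [k6] at k5
  have hVA := h.ready.VA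
  have hN := h.ready.N
  have hS : SemiState.Bounded B (S.move v) := h.bounded
  have hmag := hX.magnitude
  have m1 := AExpr.abs_total_le hS e
  have m2 := AExpr.abs_total_le hS f
  have m1' := abs_le.1 m1
  have m2' := abs_le.1 m2
  have ho : 0 ≤ o.code ∧ o.code ≤ 5 := by cases o <;> simp [RelOp.code]
  have hvals : ValuesAt s.mem s.VA s.N s.sp (S.move v) := by
    have := h.ready.held.valuesAt hI (a := s.sp) (by omega)
    rw [hVA, hN]
    exact ⟨this.var, this.piece⟩
  have hpc : (σ.pieces : ℤ) ≤ I.N := h1.2.2.2.2.2.1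
  simp only [Code.visitCompare, run_rules, val_rules, cost_rules, ok_rules, St.set, St.get, St.tick,
    true_and, hp]
  repeat refine And.intro (by omega) ?_
  refine go_eval hS e (by dsimp only; omega) k5.1 (by simp only [alen]; omega) hvals
    (by dsimp only; omega) (by dsimp only; omega) (by dsimp only; omega)
    (by simp only [alen]; omega) (by simp only [alen]; omega) (by omega)
    fun t x mem τ hmem hτ => ?_
  dsimp only at hmem hτ ⊢
  repeat refine And.intro (by omega) ?_
  have hm2 : ∀ a, a < s.sp → upd mem s.sp (e.total (S.move v)) a = s.mem a := fun a ha => by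
    rw [upd_of_ne (by omega), hmem a ha]
  refine go_eval hS f ?_ ?_ ?_ ?_ ?_ ?_ ?_ ?_ ?_ ?_ fun t' x' mem' τ' hmem' hτ' => ?_
  · dsimp only; omega
  · exact k5.2.congr fun a ha ha' => hm2 a (by omega)
  · simp only [alen]; omega
  · exact hvals.congr (by dsimp only; omega) (by omega) (by omega) fun a _ ha => hm2 a ha
  iterate 3 dsimp only; omega
  iterate 2 simp only [alen]; omega
  · omega
  dsimp only at hmem' hτ'
  have hm3 : ∀ a, a < s.sp → mem' a = s.mem a := fun a ha => by
    rw [hmem' a (by omega), hm2 a ha]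
  have e2 : mem' (s.sp + 1 - 1) = e.total (S.move v) := by
    rw [hmem' _ (by omega), add_sub_cancel_right, upd_self]
  have e3 : mem' (z.addr + 1) = o.code := by rw [hm3 _ (by omega), e1]
  dsimp only
  simp only [e2, e3]
  repeat refine And.intro (by omega) ?_
  refine go_relation o rfl (by dsimp only; omega) fun τ₂ hτ₂ => ?_
  dsimp only at hτ₂
  simp only [alen] at hτ hτ'
  have hsp : s.sp + 1 - 1 = s.sp := by ring
  by_cases hd : e.IsDef (S.move v) = true ∧ f.IsDef (S.move v) = true
  · simp only [hd.1, hd.2, if_true, test_rules, if_false, zero_lt_ite]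
    by_cases hR : o.Holds (e.total (S.move v)) (f.total (S.move v)) <;>
      simp only [hR, if_true, if_false, test_rules, true_and]
    · refine go_letter hI hX hv hU hr h he rfl (v' := v)
        ⟨e.total (S.move v), f.total (S.move v), by rw [AExpr.eval_eq, if_pos hd.1],
          by rw [AExpr.eval_eq, if_pos hd.2], hR⟩ rfl
        ⟨rfl, rfl, rfl, rfl, rfl, rfl, rfl, rfl, fun a _ ha _ => hm3 a ha⟩
        (h.marks hI hX fun a _ ha => hm3 a ha) hsp rfl rfl hp.symm hpos ?_
      dsimp only; omega
    · refine NodeGoal.invalid h he rfl ?_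
        ⟨rfl, rfl, rfl, rfl, rfl, rfl, rfl, rfl, fun a _ ha _ => hm3 a ha⟩
        (h.marks hI hX fun a _ ha => hm3 a ha) hsp rfl rfl ?_
      · rintro ⟨x, y, hx, hy, hR'⟩
        rw [AExpr.eval_eq, if_pos hd.1] at hx
        rw [AExpr.eval_eq, if_pos hd.2] at hy
        obtain rfl := Option.some.inj hx
        obtain rfl := Option.some.inj hy
        exact hR hR'
      · dsimp only; omega
  · have her : (if f.IsDef (S.move v) = true then (if e.IsDef (S.move v) = true then (0 : ℤ) else 1)
        else 1) = 1 := by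
      split_ifs <;> simp_all
    simp only [her, if_true, test_rules]
    refine NodeGoal.invalid h he rfl ?_
      ⟨rfl, rfl, rfl, rfl, rfl, rfl, rfl, rfl, fun a _ ha _ => hm3 a ha⟩
      (h.marks hI hX fun a _ ha => hm3 a ha) hsp rfl rfl ?_
    · rintro ⟨x, y, hx, hy, hR'⟩
      rw [AExpr.eval_eq] at hx hy
      apply hd
      constructor <;> by_contra h' <;> simp_all
    · dsimp only; omega

/-- The only place where the time depends on the length of the recorded list. That list has at most
`K - j` entries, so by `hl` writing it is paid for by one unit. -/
theorem go_visitSwitch (hI : I.Ok B) (hX : X.Ok I B W) (hU : 1000 ≤ U) (hl : 60 * K ≤ U + 60 * j)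
    (hr : 0 ≤ r) (h : AtNode I B W X K j r u S V l M s z v) {i : ℕ}
    {p : σ.Player} (he : z.expr = .act (i, .switch p)) :
    Go W M Code.visitSwitch s (NodeGoal I B X S V l U z v s) := by
  have h1 := hI.order
  have h2 := node_addr_le hX h.node
  have h3 := h.ready.card
  have h4 := h.ready.vb_le
  have h5 := h.ready.sp_le
  have h6 := h.room
  have h7 := h.small
  have hcost := h.cost hU
  have hp := h.p
  have hpos := h.pos
  have hvn := v.isLt
  have hN := h.ready.N
  have hdep := h.depth
  have hok := NodeAt.ok h.node hX.laid
  rw [Node.Ok, he] at hok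
  have hlen : headLen z.expr = 2 := by rw [he]; rfl
  have hw := Scope.le_weight (B := B) h.node U v
  have hw₂ : U * (2 * 1) ≤ U * (2 * ((B.edgesText v).length + 1)) :=
    Nat.mul_le_mul_left _ (Nat.mul_le_mul_left _ (by omega))
  rw [hlen] at hw
  have e1 : s.mem (3 * I.N + z.addr) = i := by
    rw [h.ready.held.base _ (by omega) (by omega)
      (Image.not_varying_of_table hI (by omega) (by omega)), hok.2.1]
  simp only [Code.visitSwitch, run_rules, val_rules, cost_rules, ok_rules, St.set, St.get, St.tick,
    true_and, Code.tab]
  refine go_print (l := l) (h.ready.chain.congr (by dsimp only; omega) fun _ _ _ _ => rfl)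
    (by dsimp only; omega) (by dsimp only; omega) (by dsimp only; omega) fun x mem τ hmem hτ => ?_
  dsimp only at hmem hτ
  have e2 : mem (3 * s.N + s.p) = i := by rw [hmem _ (by omega), hN, hp, e1]
  simp only [e2]
  repeat refine And.intro (by omega) ?_
  refine ⟨insert (z.addr, v) V, [[(i, v)]], Searched.modifier h.node h.new he rfl ?_ id .inl id
    (by simp) (fun m => ?_), Finset.mem_insert_self _ _,
    ⟨⟨rfl, rfl, rfl, rfl, rfl, rfl, rfl, rfl, fun a _ ha _ => hmem a ha⟩, rfl,
      h.marks hI hX fun a _ ha => hmem a ha, ?_⟩, ?_⟩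
  · rintro ⟨i', a', k, h', -, h'', -⟩
    rw [Node.conf, Node.stack, he] at h'
    obtain ⟨rfl, rfl⟩ := Prod.mk.inj (Regex.act.inj (List.cons.inj h').1)
    exact absurd trivial h''
  · constructor
    · intro hm
      obtain rfl : m = [(i, v)] := by simpa using hm
      exact ⟨i, .switch p, z.cont, [], by rw [Node.conf, Node.stack, he], rfl, trivial, rfl,
        .inl ⟨trivial, rfl⟩⟩
    · rintro ⟨i', a', k, m', h', -, -, rfl, h''⟩
      rw [Node.conf, Node.stack, he] at h'
      obtain ⟨rfl, rfl⟩ := Prod.mk.inj (Regex.act.inj (List.cons.inj h').1)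
      rcases h'' with ⟨-, rfl⟩ | ⟨h'', -⟩
      · simp; rfl
      · exact absurd trivial h''
  · simp [movesText, moveTokens, hpos]
  · rw [Scope.total_insert h.new]
    dsimp only
    omega

end Letters

end RBG

-- The search behind a modifier

namespace RBG

variable {σ : Sig}

section Modifiers

variable {I : Image} {B : Inst σ} {W M : ℤ} {X : Scope σ} {S S₁ : SemiState σ}
  {V V' : Finset (ℤ × σ.Vertex)} {l : List (ℕ × σ.Vertex)} {s s₁ s₂ s' : St} {j K U t i : ℕ}
  {r u : ℤ} {z : Node σ} {v : σ.Vertex} {c : Stack σ × SemiState σ}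

/-- The result of the search after a modifier. -/
structure Descended (B : Inst σ) (X : Scope σ) (l : List (ℕ × σ.Vertex)) (L : ℤ) (U i : ℕ)
    (v : σ.Vertex) (k : Stack σ) (S : SemiState σ) (ms : List (Move σ)) (s s' : St) : Prop where
  nodup : ms.Nodup
  moves : ∀ m, m ∈ ms ↔ MoveFrom B k S m
  found : s'.found = 1 ↔ s.found = 1 ∨ Accepts B k S
  bool : s'.found = 0 ∨ s'.found = 1
  agree : Agree (fun _ => False) s.sp s s'
  sp : s'.sp = s.sp
  out : s'.out = s.out ++ movesText (ms.map (((i, v) :: l).reverse ++ ·))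
  time : (s'.time : ℤ) ≤ s.time + 20 * (L * σ.vertices) + U * (X.len * B.size) + 300

/-- As the new table is empty, the outcome does not depend on earlier searches, and
`Searched.moves_iff` and `Searched.accepts_iff` describe it by moves and acceptance. The old table
lies below the new record and is not touched. -/
theorem go_descend (hI : I.Ok B) (hX : X.Ok I B W) (hv : VisitSpec I B W X K j U r u)
    (h : Ready I X S V l s) (hS : S.Bounded B) (hz : X.Node I.N z) {a : Action σ}
    (he : z.expr = .act (i, a)) (hp : s.p = z.addr) (hs : s.s = (v : ℕ)) (hpos : S.pos = v)
    (hb : Budget B z.cont S j) (hu : X.len * σ.vertices ≤ u)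
    (hroom : s.sp + I.L * σ.vertices + 10 * (X.len * σ.vertices) + r + 2 * l.length + 4 * I.L +
      60 ≤ M) (hr : 0 ≤ r) (hW : M + 32 ≤ W) (hl : l.length + 1 + j ≤ K) :
    Go W M (.call 8) s fun s' => ∃ ms, Descended B X l I.L U i v z.cont S ms s s' := by
  have h1 := hI.order
  have h2 := node_addr_le hX hz
  have h3 := h.card
  have h4 := h.vb_le
  have h5 := h.sp_le
  have hN := h.N
  have hvn := v.isLt
  have hok := NodeAt.ok hz hX.laid
  rw [Node.Ok, he] at hok
  have hLn : s.L * s.n = I.L * σ.vertices := by rw [h.L, h.n]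
  have e1 : s.mem (3 * s.N + s.p) = i := by
    rw [hN, hp, h.held.base _ (by omega) (by omega)
      (Image.not_varying_of_table hI (by omega) (by omega)), hok.2.1]
  have hlen : 0 ≤ X.len * (σ.vertices : ℤ) := mul_nonneg (by unfold Scope.len; omega) (by omega)
  refine Run.call rfl (by omega) ?_
  simp only [Code.descend, run_rules, val_rules, cost_rules, ok_rules, St.set, St.get, St.tick,
    true_and, Code.tab, e1, hLn]
  repeat refine And.intro (by omega) ?_
  refine go_clear (by dsimp only; omega) (by dsimp only; omega) (by dsimp only; omega)
    (by dsimp only; omega) fun τ hτ => ?_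
  dsimp only at hτ
  set mem₁ := upd (upd (upd (upd s.mem s.sp i) (s.sp + 1) s.s) (s.sp + 2) s.mv) (s.sp + 3) s.vb
    with hmem₁
  have f0 : ∀ a, a < s.sp → mem₁ a = s.mem a := fun a ha => by
    rw [hmem₁, upd_of_ne (by omega), upd_of_ne (by omega), upd_of_ne (by omega), upd_of_ne (by omega)]
  have f1 : mem₁ s.sp = i := by
    rw [hmem₁, upd_of_ne (by omega), upd_of_ne (by omega), upd_of_ne (by omega), upd_self]
  have f2 : mem₁ (s.sp + 1) = s.s := by
    rw [hmem₁, upd_of_ne (by omega), upd_of_ne (by omega), upd_self]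
  have f3 : mem₁ (s.sp + 2) = s.mv := by rw [hmem₁, upd_of_ne (by omega), upd_self]
  have f4 : mem₁ (s.sp + 3) = s.vb := by rw [hmem₁, upd_self]
  clear_value mem₁
  set mem₂ := cleared mem₁ (s.sp + 4) (s.sp + 4 + I.L * σ.vertices) with hmem₂
  have g0 : ∀ a, a < s.sp + 4 → mem₂ a = mem₁ a := fun a ha => by
    simp only [hmem₂, cleared]; rw [if_neg (by omega)]
  have g1 : ∀ a, s.sp + 4 ≤ a → a < s.sp + 4 + I.L * σ.vertices → mem₂ a = 0 := fun a ha ha' => by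
    simp only [hmem₂, cleared]; rw [if_pos ⟨ha, ha'⟩]
  clear_value mem₂
  have hready : ∀ s₂ : St, s₂.n = s.n → s₂.N = s.N → s₂.L = s.L → s₂.PA = s.PA → s₂.VA = s.VA →
      s₂.BD = s.BD → s₂.mem = mem₂ → s₂.vb = s.sp + 4 → s₂.mv = s.sp →
      s₂.sp = s.sp + 4 + I.L * σ.vertices → s₂.found = s.found →
      Ready I X S ∅ ((i, v) :: l) s₂ := by
    intro s₂ i1 i2 i3 i4 i5 i6 i7 i8 i9 i10 i11
    refine ⟨i1.trans h.n, i2.trans hN, i3.trans h.L, i4.trans h.PA, i5.trans h.VA, i6.trans h.BD,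
      ?_, fun z' v' hz' => ?_, by simp, ?_, by omega, by omega, by rw [i11]; exact h.found⟩
    · rw [i7]
      exact h.held.congr hI fun a _ ha => by rw [g0 a (by omega), f0 a (by omega)]
    · have := hX.cells (Scope.cells_of_node (vb := s₂.vb) hz' v')
      rw [i7, g1 _ (by omega) (by omega)]
      simp
    · rw [i7, i8, i9]
      refine ⟨by omega, by omega, by omega, by rw [g0 _ (by omega), f1], by rw [g0 _ (by omega), f2, hs], ?_⟩
      rw [g0 _ (by omega), f3]
      exact h.chain.congr (by omega) fun a _ _ ha => by rw [g0 a (by omega), f0 a (by omega)]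
  have hmove : S.move v = S := by rw [← hpos]; rfl
  refine Run.mono (go_goOn hI hX hv (hready _ rfl rfl rfl rfl rfl rfl rfl rfl rfl rfl rfl) hS hz hp hs
    (by rw [hmove]; exact hb) (by simpa using hu) ?_ hr (by omega) (by simpa using hl))
    fun s₃ ⟨V', ms, k1, k2, k3, k4⟩ => ?_
  · simp only [Finset.card_empty, List.length_cons]
    push_cast
    omega
  dsimp only at k1 k4
  rw [hmove] at k1 k2
  have ag := k3.agree
  have e2 : s₃.mv = s.sp := ag.mv
  have e3 : s₃.mem (s.sp + 3) = s.vb := by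
    rw [k3.below hX (by omega) (by dsimp only; omega) (by dsimp only; omega)]
    dsimp only
    rw [g0 _ (by omega), f4]
  have e4 : s₃.mem (s.sp + 2) = s.mv := by
    rw [k3.below hX (by omega) (by dsimp only; omega) (by dsimp only; omega)]
    dsimp only
    rw [g0 _ (by omega), f3]
  simp only [run_rules, val_rules, cost_rules, ok_rules, St.set, St.get, St.tick, true_and, e2, e3, e4]
  repeat refine And.intro (by omega) ?_
  refine ⟨ms, k1.nodup, fun m => (k1.moves_iff k2 m), k1.accepts_iff k2, k1.bool h.found,
    ⟨ag.n, ag.N, ag.L, ag.PA, ag.VA, ag.BD, rfl, rfl, fun a ha ha' _ => ?_⟩, rfl, k3.out, ?_⟩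
  · rw [k3.below hX ha (by dsimp only; omega) (by dsimp only; omega)]
    dsimp only
    rw [g0 _ (by omega), f0 _ ha']
  -- The potential begins at zero and ends at most at the weight of all pairs, which bounds the time
  -- of the whole search.
  · have t1 := Scope.total_le (X := X) (B := B) (V := V') U
    have t2 : X.total B U ∅ = 0 := rfl
    rw [t2] at k4
    zify at k4 t1
    rw [Int.toNat_of_nonneg (by unfold Scope.len; omega)] at t1
    push_cast
    omega

end Modifiers

end RBG

-- Offs and assignments

namespace RBG

variable {σ : Sig}

theorem St.get_update (s : St) (mem : ℤ → ℤ) (t : ℕ) (x : Reg) :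
    ({ s with mem := mem, time := t } : St).get x = s.get x := by cases x <;> rfl

section Modifiers

variable {I : Image} {B : Inst σ} {W M : ℤ} {X : Scope σ} {S S₁ : SemiState σ}
  {V V' : Finset (ℤ × σ.Vertex)} {l : List (ℕ × σ.Vertex)} {s s₁ s₂ s' : St} {j K U t i : ℕ}
  {r u : ℤ} {z : Node σ} {v : σ.Vertex} {c : Stack σ × SemiState σ} {a : Action σ}

theorem go_setPiece {Q : St → Prop} (x y : Reg) {p q : σ.Piece} (hI : I.Ok B)
    (h : I.Held s.mem S) (hx : s.get x = (p : ℕ)) (hy : s.get y = (q : ℕ)) (hs : s.s = (v : ℕ))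
    (hp : S.pieceAt v = p) (hN : s.N = I.N) (hPA : s.PA = I.PA) (hM : 7 * I.N + 2 ≤ M)
    (hW : 7 * I.N + 32 ≤ W)
    (hQ : ∀ mem τ, I.Held mem { S with pieceAt := Function.update S.pieceAt v q } →
      (∀ a, 7 * I.N + 2 ≤ a → mem a = s.mem a) → τ ≤ s.time + 80 →
      Q { s with mem := mem, time := τ }) :
    Go W M (Code.setPiece x y) s Q := by
  have h1 := hI.order
  have hvn := v.isLt
  have hpn := p.isLt
  have hqn := q.isLt
  have hpc : (σ.pieces : ℤ) ≤ I.N := h1.2.2.2.2.2.1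
  have hc : ∀ w : σ.Piece, 0 ≤ s.mem (6 * I.N + (w : ℕ)) ∧ s.mem (6 * I.N + (w : ℕ)) ≤ σ.vertices := by
    intro w
    rw [h.count w]
    have := Finset.card_le_univ (Finset.univ.filter fun v => S.pieceAt v = w)
    rw [Fintype.card_fin] at this
    omega
  have hcp := hc p
  have hcq := hc q
  -- A crude bound for the second counter, which covers the case of equal pieces, where it has just
  -- been decreased.
  have hcq' : -1 ≤ upd s.mem (6 * I.N + (p : ℕ)) (s.mem (6 * I.N + (p : ℕ)) - 1) (6 * I.N + (q : ℕ)) ∧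
      upd s.mem (6 * I.N + (p : ℕ)) (s.mem (6 * I.N + (p : ℕ)) - 1) (6 * I.N + (q : ℕ)) ≤ σ.vertices := by
    rw [upd_apply]
    split_ifs <;> omega
  simp only [Code.setPiece, run_rules, val_rules, cost_rules, ok_rules, true_and, Code.tab,
    St.get_update, hx, hy]
  simp only [St.get, hN, hPA, hs]
  repeat refine And.intro (by omega) ?_
  refine St.transfer (fun τ hτ => hQ _ τ (h.off hI v p q hp rfl) (fun a ha => ?_) hτ) ?_ ?_
  · rw [upd_of_ne (by omega), upd_of_ne (by omega), upd_of_ne (by omega)]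
  · dsimp only; omega
  · simp only [hs, hN, hPA]

/-- A node with a modifier that is valid and not a switch. -/
theorem NodeGoal.modifier (h : AtNode I B W X K j r u S V l M s z v) (he : z.expr = .act (i, a))
    (ha : a.isModifier = true) (hsw : ¬ a.IsSwitch) (hval : B.Valid a (S.move v)) {L : ℤ} {U' : ℕ}
    {ms : List (Move σ)} (hd : Descended B X l L U' i v z.cont (B.apply (S.move v) a) ms s₁ s₂)
    (hf₁ : s₁.found = s.found) (ho₁ : s₁.out = s.out) (hs : Agree (fun _ => False) s.sp s s')
    (hm : Marks X I.N s'.mem s.vb (insert (z.addr, v) V)) (hsp : s'.sp = s.sp)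
    (ho : s'.out = s₂.out) (hf : s'.found = s₂.found)
    (ht : s'.time + 200 ≤ s.time + X.weight B U (z.addr, v)) :
    NodeGoal I B X S V l U z v s s' := by
  have hstack : (z.conf S v).1 = .act (i, a) :: z.cont := by rw [Node.conf, Node.stack, he]
  have hacc : AcceptsAt B (z.conf S v).1 (z.conf S v).2 ↔ Accepts B z.cont (B.apply (S.move v) a) := by
    constructor
    · rintro ⟨i', a', k, h', -, -, -, h''⟩
      rw [hstack] at h'
      obtain ⟨h1, rfl⟩ := List.cons.inj h'
      obtain ⟨rfl, rfl⟩ := Prod.mk.inj (Regex.act.inj h1)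
      exact h''
    · exact fun h' => ⟨i, a, z.cont, hstack, ha, hsw, hval, h'⟩
  have hem : ∀ m, EmitsAt B (z.conf S v).1 (z.conf S v).2 m ↔
      ∃ m', MoveFrom B z.cont (B.apply (S.move v) a) m' ∧ (i, v) :: m' = m := by
    intro m
    constructor
    · rintro ⟨i', a', k, m', h', -, -, rfl, h''⟩
      rw [hstack] at h'
      obtain ⟨h1, rfl⟩ := List.cons.inj h'
      obtain ⟨rfl, rfl⟩ := Prod.mk.inj (Regex.act.inj h1)
      rcases h'' with ⟨h'', -⟩ | ⟨-, h''⟩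
      · exact absurd h'' hsw
      · exact ⟨m', h'', rfl⟩
    · rintro ⟨m', h', rfl⟩
      exact ⟨i, a, z.cont, m', hstack, ha, hval, rfl, .inr ⟨hsw, h'⟩⟩
  have hfound := hd.found
  rw [hf₁] at hfound
  refine ⟨insert (z.addr, v) V, ms.map ((i, v) :: ·), Searched.modifier h.node h.new he ha
    (fun h' => ?_) (fun h' => ?_) (fun h' => ?_) (fun _ => by rw [hf]; exact hd.bool)
    (hd.nodup.map fun _ _ e => (List.cons.inj e).2) (fun m => ?_), Finset.mem_insert_self _ _,
    ⟨hs.mono le_rfl fun _ _ _ => False.elim, hsp, hm, ?_⟩, ?_⟩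
  · rw [hf, hfound, ← hacc]; exact .inr h'
  · rw [hf, hfound]; exact .inl h'
  · rwa [hf, hfound, ← hacc] at h'
  · rw [hem, List.mem_map]
    simp only [hd.moves]
  · rw [ho, hd.out, ho₁, List.map_map]
    congr 2
    refine List.map_congr_left fun m _ => ?_
    simp
  · rw [Scope.total_insert h.new]; omega

/-- A node with a modifier that is not valid. -/
theorem NodeGoal.invalid_modifier (h : AtNode I B W X K j r u S V l M s z v)
    (he : z.expr = .act (i, a)) (ha : a.isModifier = true) (hval : ¬ B.Valid a (S.move v))
    (hs : Agree (fun _ => False) s.sp s s')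
    (hm : Marks X I.N s'.mem s.vb (insert (z.addr, v) V)) (hsp : s'.sp = s.sp)
    (ho : s'.out = s.out) (hf : s'.found = s.found)
    (ht : s'.time + 200 ≤ s.time + X.weight B U (z.addr, v)) :
    NodeGoal I B X S V l U z v s s' := by
  have hstack : (z.conf S v).1 = .act (i, a) :: z.cont := by rw [Node.conf, Node.stack, he]
  refine ⟨insert (z.addr, v) V, [], Searched.modifier h.node h.new he ha ?_ (by rw [hf]; exact id)
    (fun h' => .inl (by rwa [hf] at h')) (by rw [hf]; exact id) .nil (fun m => ⟨by simp, ?_⟩),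
    Finset.mem_insert_self _ _, ⟨hs.mono le_rfl fun _ _ _ => False.elim, hsp, hm, ?_⟩, ?_⟩
  · rintro ⟨i', a', k, h', -, -, h'', -⟩
    rw [hstack] at h'
    obtain ⟨rfl, rfl⟩ := Prod.mk.inj (Regex.act.inj (List.cons.inj h').1)
    exact absurd h'' hval
  · rintro ⟨i', a', k, m', h', -, h'', -⟩
    rw [hstack] at h'
    obtain ⟨rfl, rfl⟩ := Prod.mk.inj (Regex.act.inj (List.cons.inj h').1)
    exact absurd h'' hval
  · simp [ho, movesText]
  · rw [Scope.total_insert h.new]; omega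

/-- The requirements for the search after a modifier. -/
structure Below (I : Image) (B : Inst σ) (W : ℤ) (X : Scope σ) (K j U : ℕ) (r : ℤ) : Prop where
  spec : ∀ j', j = j' + 1 → ∃ (U' : ℕ) (r' : ℤ), VisitSpec I B W X K j' U' r' (X.len * σ.vertices) ∧
    0 ≤ r' ∧ I.L * σ.vertices + 10 * (X.len * σ.vertices) + r' + 20 ≤ r ∧
    20 * (I.L * σ.vertices) + U' * (X.len * B.size) + 1000 ≤ (3 * U : ℕ)

/-- A valid modifier forces `j` to be positive, so `Below` provides the search for one modifier
less. The three cells of slack are those on which the caller saves what it needs for undoing the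
action. -/
theorem AtNode.descend (hI : I.Ok B) (hX : X.Ok I B W) (hB : Below I B W X K j U r)
    (h : AtNode I B W X K j r u S V l M s z v) (he : z.expr = .act (i, a))
    (ha : a.isModifier = true) (hsw : ¬ a.IsSwitch) (hval : B.Valid a (S.move v))
    (h₁ : Ready I X (B.apply (S.move v) a) (insert (z.addr, v) V) l s₁) (hp : s₁.p = z.addr)
    (hs : s₁.s = (v : ℕ)) (hsp : s₁.sp ≤ s.sp + 3) {M' : ℤ} (hM : M ≤ M' + 3) (hM' : M' ≤ M) :
    Go W M' (.call 8) s₁ fun s' => ∃ (L : ℤ) (U' : ℕ) (ms : List (Move σ)), (20 * (L * σ.vertices) + U' * (X.len * B.size) + 1000 ≤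
        (3 * U : ℕ)) ∧ Descended B X l L U' i v z.cont (B.apply (S.move v) a) ms s₁ s' := by
  have hb := h.budget
  rw [Node.stack, he] at hb
  obtain ⟨j', hj, hb'⟩ := hb.modifier ha hsw hval
  obtain ⟨U', r', k1, k2, k3, k4⟩ := hB.spec j' hj
  have h3 := h.ready.card
  have h6 := h.room
  have h7 := h.small
  have h8 := h.depth
  have hpos : (B.apply (S.move v) a).pos = v := by
    cases a <;> first | rfl | simp [Action.isModifier] at ha
  have h9 := hI.order
  have hlen : 0 ≤ X.len * (σ.vertices : ℤ) := mul_nonneg (by unfold Scope.len; omega) (by omega)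
  exact (go_descend hI hX k1 h₁ (SemiState.Bounded.apply (S := S.move v) h.bounded hval) h.node he hp hs hpos hb' le_rfl
    (by omega) k2 (by omega) (by omega)).mono
    fun s' ⟨ms, hd⟩ => ⟨I.L, U', ms, k4, hd⟩

/-- The weight of a node with a modifier. -/
theorem AtNode.le_weight (h : AtNode I B W X K j r u S V l M s z v) :
    2 * U * headLen z.expr ≤ X.weight B U (z.addr, v) := by
  have h1 := Scope.le_weight (B := B) h.node U v
  have h2 : 1 ≤ (B.edgesText v).length := by simp [Inst.edgesText]
  nlinarith [Nat.mul_le_mul_left (U * headLen z.expr) (show 2 ≤ (B.edgesText v).length + 1 by omega)]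

/-- The node weighs at least `4 * U`: two tokens, and a list of edges with at least one token. The
search behind it takes less than `3 * U`, with enough left for the action and its reversal. -/
theorem go_visitOff (hI : I.Ok B) (hX : X.Ok I B W) (hB : Below I B W X K j U r)
    (hr : 0 ≤ r) (h : AtNode I B W X K j r u S V l M s z v) {y : σ.Piece}
    (he : z.expr = .act (i, .off y)) :
    Go W M Code.visitOff s (NodeGoal I B X S V l U z v s) := by
  have h1 := hI.order
  have h2 := node_addr_le hX h.node
  have h3 := h.ready.card
  have h4 := h.ready.vb_le
  have h5 := h.ready.sp_le
  have h6 := h.room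
  have h7 := h.small
  have hcost := h.le_weight (U := U)
  have hlen : headLen z.expr = 2 := by rw [he]; rfl
  rw [hlen] at hcost
  have hp := h.p
  have hpos := h.pos
  have hvn := v.isLt
  have hPA := h.ready.PA
  have hN := h.ready.N
  have hyn := y.isLt
  have hpc : (σ.pieces : ℤ) ≤ I.N := h1.2.2.2.2.2.1
  obtain ⟨k1, k2, k3, -⟩ := h.ready.text hI hX h.node he
  simp only [Action.text, List.length_cons, List.length_nil] at k2
  have e1 : s.mem (s.p + 1) = (y : ℕ) := by rw [hp]; exact k1.2.1
  have e2 : s.mem (s.PA + s.s) = (S.pieceAt v : ℕ) := by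
    rw [hPA, hpos, h.ready.held.piece]
  have hxn := (S.pieceAt v).isLt
  simp only [Code.visitOff, run_rules, val_rules, cost_rules, ok_rules, St.set, St.get, St.tick,
    true_and, e1, e2]
  repeat refine And.intro (by omega) ?_
  set mem₁ := upd (upd (upd s.mem s.sp s.s) (s.sp + 1) (S.pieceAt v : ℕ)) (s.sp + 2) s.p with hmem₁
  have f0 : ∀ a, a < s.sp → mem₁ a = s.mem a := fun a ha => by
    rw [hmem₁, upd_of_ne (by omega), upd_of_ne (by omega), upd_of_ne (by omega)]
  have f1 : mem₁ s.sp = s.s := by rw [hmem₁, upd_of_ne (by omega), upd_of_ne (by omega), upd_self]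
  have f2 : mem₁ (s.sp + 1) = (S.pieceAt v : ℕ) := by rw [hmem₁, upd_of_ne (by omega), upd_self]
  have f3 : mem₁ (s.sp + 2) = s.p := by rw [hmem₁, upd_self]
  clear_value mem₁
  refine go_setPiece .x .y (p := S.pieceAt v) (q := y) (S := S) (v := v) hI
    (h.ready.held.congr hI fun a _ ha => f0 a (by omega)) rfl rfl hpos rfl hN hPA (by omega) (by omega)
    fun mem₂ τ hheld hmem₂ hτ => ?_
  dsimp only at hmem₂ hτ ⊢
  have g0 : ∀ a, 7 * I.N + 2 ≤ a → a < s.sp → mem₂ a = s.mem a := fun a ha ha' => by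
    rw [hmem₂ a ha, f0 a ha']
  refine Run.mono (AtNode.descend hI hX hB h he rfl id trivial ?_ ?_ ?_ ?_ (M' := M) (by omega)
    (by omega)) ?_
  · refine ⟨h.ready.n, hN, h.ready.L, hPA, h.ready.VA, h.ready.BD,
      ⟨hheld.piece, hheld.value, hheld.count, hheld.base⟩, fun z' v' hz' => ?_, h.ready.nodes,
      ?_, h4, by dsimp only; omega, h.ready.found⟩
    · have := hX.cells (Scope.cells_of_node (vb := s.vb) hz' v')
      dsimp only
      rw [g0 _ (by omega) (by omega)]
      exact h.ready.marks z' v' hz'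
    · exact h.ready.chain.congr le_rfl fun a ha ha' ha'' => g0 a ha' (by omega)
  · exact hp
  · exact hpos
  · dsimp only; omega
  rintro s₃ ⟨L, U', ms, hL, hd⟩
  have ag := hd.agree
  have hsp₃ := hd.sp
  dsimp only at ag hsp₃
  have e3 : s₃.mem s.sp = s.s := by
    rw [ag.mem _ (by omega) (by omega) id]; dsimp only; rw [hmem₂ _ (by omega), f1]
  have e4 : s₃.mem (s.sp + 1) = (S.pieceAt v : ℕ) := by
    rw [ag.mem _ (by omega) (by omega) id]; dsimp only; rw [hmem₂ _ (by omega), f2]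
  have e5 : s₃.mem (s.sp + 2) = s.p := by
    rw [ag.mem _ (by omega) (by omega) id]; dsimp only; rw [hmem₂ _ (by omega), f3]
  have hheld₃ : I.Held s₃.mem { S with pieceAt := Function.update S.pieceAt v y } :=
    hheld.congr hI fun a ha ha' => ag.mem _ ha (by omega) id
  have e6 : s₃.mem (s.p + 1) = (y : ℕ) := by
    rw [hheld₃.base _ (by omega) (by omega) (Image.not_varying_of_lt hI (by omega)),
      ← h.ready.held.base _ (by omega) (by omega) (Image.not_varying_of_lt hI (by omega)), e1]
  have e0 : s.sp + 3 - 3 = s.sp := by ring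
  simp only [hsp₃, e0, e3, e4, e5, e6]
  repeat refine And.intro (by omega) ?_
  refine go_setPiece .y .x (p := y) (q := S.pieceAt v) (v := v) hI hheld₃ rfl rfl hpos
    (by simp) (ag.N.trans hN) (ag.PA.trans hPA) (by omega) (by omega)
    fun mem₄ τ₄ hheld₄ hmem₄ hτ₄ => ?_
  dsimp only at hmem₄ hτ₄
  have hheld₅ : I.Held mem₄ S := by
    have : Function.update (Function.update S.pieceAt v y) v (S.pieceAt v) = S.pieceAt := by simp
    dsimp only at hheld₄
    rwa [this] at hheld₄
  -- Below `7 * N + 2` the memory is determined by the restored semi-state; above, neither the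
  -- action nor the search has changed it.
  have hfin : ∀ a, 0 ≤ a → a < s.sp → mem₄ a = s.mem a := fun a ha ha' => by
    by_cases h' : a < 7 * I.N + 2
    · exact h.ready.held.unique hheld₅ a ha h'
    · rw [hmem₄ a (by omega), ag.mem a ha (by omega) id]
      exact g0 a (by omega) ha'
  have htime := hd.time
  dsimp only at htime
  refine NodeGoal.modifier h he rfl id trivial hd rfl rfl
    ⟨ag.n, ag.N, ag.L, ag.PA, ag.VA, ag.BD, ag.vb, ag.mv, fun a ha ha' _ => hfin a ha ha'⟩
    (h.marks hI hX hfin) rfl rfl rfl ?_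
  dsimp only
  push_cast at hL
  omega

theorem go_visitAssign (hI : I.Ok B) (hX : X.Ok I B W) (hB : Below I B W X K j U r)
    (hU : 1000 ≤ U) (hr : 0 ≤ r) (h : AtNode I B W X K j r u S V l M s z v) {y : σ.Var}
    {e : AExpr σ} (he : z.expr = .act (i, .assign y e)) :
    Go W M Code.visitAssign s (NodeGoal I B X S V l U z v s) := by
  have h1 := hI.order
  have h2 := node_addr_le hX h.node
  have h3 := h.ready.card
  have h4 := h.ready.vb_le
  have h5 := h.ready.sp_le
  have h6 := h.room
  have h7 := h.small
  have hcost := h.le_weight (U := U)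
  have hcost' := h.cost hU
  have hp := h.p
  have hpos := h.pos
  have hvn := v.isLt
  have hyn := y.isLt
  have hVA := h.ready.VA
  have hBD := h.ready.BD
  have hN := h.ready.N
  have hpc : (σ.pieces : ℤ) ≤ I.N := h1.2.2.2.2.2.1
  obtain ⟨k1, k2, k3, k4⟩ := h.ready.text hI hX h.node he
  have hlen : headLen z.expr = (Action.assign y e).text.length := by rw [he]; rfl
  rw [Action.text] at k1 k2 k3 hlen
  simp only [List.length_cons] at k2 hlen
  push_cast at k2
  rw [Action.magnitude] at k4
  have e1 := k1.2.1
  have k5 := k1.2.2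
  have k6 : z.addr + 1 + 1 = z.addr + 2 := by ring
  rw [k6] at k5
  have hS : SemiState.Bounded B (S.move v) := h.bounded
  have hmag := hX.magnitude
  have hbd := hX.bound y
  have m1 := abs_le.1 (AExpr.abs_total_le hS e)
  have hle := hS y
  have hvals : ValuesAt s.mem s.VA s.N s.sp (S.move v) := by
    have := h.ready.held.valuesAt hI (a := s.sp) (by omega)
    rw [hVA, hN]
    exact ⟨this.var, this.piece⟩
  simp only [Code.visitAssign, run_rules, val_rules, cost_rules, ok_rules, St.set, St.get, St.tick,
    true_and, hp]
  repeat refine And.intro (by omega) ?_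
  refine go_eval hS e (by dsimp only; omega) k5 (by simp only [alen]; omega) hvals
    (by dsimp only; omega) (by dsimp only; omega) (by dsimp only; omega)
    (by simp only [alen]; omega) (by simp only [alen]; omega) (by omega)
    fun t x mem τ hmem hτ => ?_
  dsimp only at hmem hτ ⊢
  simp only [alen] at hτ
  have e2 : mem (z.addr + 1) = (y : ℕ) := by rw [hmem _ (by omega), e1]
  have e3 : mem (s.BD + (y : ℕ)) = B.bound y := by
    rw [hmem _ (by omega), hBD, h.ready.held.base _ (by omega) (by omega)
      (Image.not_varying_of_lt hI (by omega)), hI.bound]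
  simp only [e2, e3]
  have hinv : ∀ τ' : ℕ, ∀ q t x y' er vv, τ' ≤ τ + 100 → ¬ B.Valid (.assign y e) (S.move v) →
      NodeGoal I B X S V l U z v s { s with q := q, p := z.addr, t := t, x := x, y := y', v := vv, er := er, mem := mem, time := τ' } := by
    intro τ' q t x y' er vv hτ' hval
    refine NodeGoal.invalid_modifier h he rfl hval
      ⟨rfl, rfl, rfl, rfl, rfl, rfl, rfl, rfl, fun a _ ha _ => hmem a ha⟩
      (h.marks hI hX fun a _ ha => hmem a ha) rfl rfl rfl ?_
    dsimp only; omega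
  cases hd : e.IsDef (S.move v) with
  | false =>
    simp only [Bool.false_eq_true, if_false, test_rules, if_true]
    repeat refine And.intro (by omega) ?_
    refine hinv _ _ _ _ _ _ _ (by omega) ?_
    rintro ⟨w, hw, -⟩
    simp [AExpr.eval_eq, hd] at hw
  | true =>
    have heval : e.eval (S.move v) = some (e.total (S.move v)) := by rw [AExpr.eval_eq, if_pos hd]
    simp only [if_true, test_rules, if_false, zero_lt_ite]
    repeat refine And.intro (by omega) ?_
    by_cases hneg : e.total (S.move v) < 0
    · rw [if_pos hneg]
      refine hinv _ _ _ _ _ _ _ (by omega) ?_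
      rintro ⟨w, hw, h0, -⟩
      rw [heval] at hw
      obtain rfl := Option.some.inj hw
      omega
    rw [if_neg hneg]
    repeat refine And.intro (by omega) ?_
    by_cases hbig : (B.bound y : ℤ) < e.total (S.move v)
    · rw [if_pos hbig]
      refine hinv _ _ _ _ _ _ _ (by omega) ?_
      rintro ⟨w, hw, h0, h0'⟩
      rw [heval] at hw
      obtain rfl := Option.some.inj hw
      omega
    rw [if_neg hbig]
    have hval : B.Valid (.assign y e) (S.move v) := ⟨_, heval, by omega, by omega⟩
    have e4 : mem (s.VA + (y : ℕ)) = S.value y := by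
      rw [hmem _ (by omega), hVA, h.ready.held.value]
    have hle' : S.value y ≤ B.bound y := hle
    simp only [Code.doAssign, run_rules, val_rules, cost_rules, ok_rules, St.set, St.get, St.tick,
      true_and, e4]
    repeat refine And.intro (by omega) ?_
    have htot : e.total (S.move v) = (((e.eval (S.move v)).getD 0).toNat : ℕ) := by
      rw [heval, Option.getD_some, Int.toNat_of_nonneg (by omega)]
    set mem₁ := upd (upd mem s.sp (y : ℕ)) (s.sp + 1) (S.value y) with hmem₁
    have f0 : ∀ a, a < s.sp → mem₁ a = s.mem a := fun a ha => by
      rw [hmem₁, upd_of_ne (by omega), upd_of_ne (by omega), hmem a ha]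
    have f1 : mem₁ s.sp = (y : ℕ) := by rw [hmem₁, upd_of_ne (by omega), upd_self]
    have f2 : mem₁ (s.sp + 1) = S.value y := by rw [hmem₁, upd_self]
    clear_value mem₁
    have hheld := (h.ready.held.congr hI fun a _ ha => f0 a (by omega)).assign hI y
      ((e.eval (S.move v)).getD 0).toNat
    rw [← htot, ← hVA] at hheld
    set mem₂ := upd mem₁ (s.VA + (y : ℕ)) (e.total (S.move v)) with hmem₂
    have g0 : ∀ a, 7 * I.N + 2 ≤ a → mem₂ a = mem₁ a := fun a ha => by
      rw [hmem₂, upd_of_ne (by omega)]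
    clear_value mem₂
    refine Run.mono (AtNode.descend hI hX hB h he rfl id hval ?_ ?_ ?_ ?_ (M' := M) (by omega)
      (by omega)) ?_
    · refine ⟨h.ready.n, hN, h.ready.L, h.ready.PA, hVA, hBD,
        ⟨hheld.piece, hheld.value, hheld.count, hheld.base⟩, fun z' v' hz' => ?_, h.ready.nodes,
        ?_, h4, by dsimp only; omega, h.ready.found⟩
      · have := hX.cells (Scope.cells_of_node (vb := s.vb) hz' v')
        dsimp only
        rw [g0 _ (by omega), f0 _ (by omega)]
        exact h.ready.marks z' v' hz'
      · exact h.ready.chain.congr le_rfl fun a _ ha ha' => by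
          dsimp only
          rw [g0 _ ha, f0 _ (by omega)]
    · rfl
    · exact hpos
    · dsimp only; omega
    rintro s₃ ⟨L, U', ms, hL, hd⟩
    have ag := hd.agree
    have hsp₃ := hd.sp
    have htime := hd.time
    dsimp only at ag hsp₃ htime
    have e5 : s₃.mem s.sp = (y : ℕ) := by
      rw [ag.mem _ (by omega) (by omega) id]; dsimp only; rw [g0 _ (by omega), f1]
    have e6 : s₃.mem (s.sp + 1) = S.value y := by
      rw [ag.mem _ (by omega) (by omega) id]; dsimp only; rw [g0 _ (by omega), f2]
    have e0 : s.sp + 2 - 2 = s.sp := by ring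
    have eVA : s₃.VA = I.VA := ag.VA.trans hVA
    simp only [hsp₃, e0, e5, e6, eVA]
    repeat refine And.intro (by omega) ?_
    have hheld₃ : I.Held s₃.mem _ := hheld.congr hI fun a ha ha' => ag.mem _ ha (by omega) id
    have hheld₄ := hheld₃.assign hI y (S.value y)
    have hheld₅ : I.Held (upd s₃.mem (I.VA + (y : ℕ)) (S.value y)) S := by
      simpa using hheld₄
    have hfin : ∀ a, 0 ≤ a → a < s.sp → upd s₃.mem (I.VA + (y : ℕ)) (S.value y) a = s.mem a :=
      fun a ha ha' => by
        by_cases h' : a < 7 * I.N + 2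
        · exact h.ready.held.unique hheld₅ a ha h'
        · rw [upd_of_ne (by omega), ag.mem a ha (by omega) id]
          dsimp only
          rw [g0 a (by omega), f0 a ha']
    -- The first two tokens pay for the search as with an off, and the tokens of the arithmetic
    -- expression pay for its evaluation.
    have hlen' : 3 * U + (U + 2000 * alen e) ≤ X.weight B U (z.addr, v) := by
      have h1 : 2000 * alen e ≤ 2 * U * alen e := Nat.mul_le_mul_right _ (by omega)
      have h2 : 2 * U * headLen z.expr = 4 * U + 2 * U * alen e := by rw [hlen, alen]; ring
      omega
    rw [alen] at hlen'
    refine NodeGoal.modifier h he rfl id hval hd rfl rfl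
      ⟨ag.n, ag.N, ag.L, ag.PA, ag.VA.symm ▸ eVA ▸ rfl, ag.BD, ag.vb, ag.mv,
        fun a ha ha' _ => hfin a ha ha'⟩ (h.marks hI hX hfin) rfl rfl rfl ?_
    dsimp only
    push_cast at hL
    omega

end Modifiers

end RBG

-- Patterns

namespace RBG

variable {σ : Sig}

theorem NodeAt.wf {N : ℤ} {E : Regex (Action σ)} {n : ℕ} {p c : ℤ} {k : Stack σ} {z : Node σ}
    (h : NodeAt N (E.number n) p k c z) {i : ℕ} {a : Action σ} (he : z.expr = .act (i, a))
    {sw : Bool} (hw : exprWF E sw) : a.WF sw := by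
  induction E generalizing n p k c with
  | act b =>
    obtain rfl := h
    obtain ⟨rfl, rfl⟩ := Prod.mk.inj (Regex.act.inj he)
    exact hw
  | sum E F ihE ihF =>
    rcases h with rfl | h | h
    · simp at he
    · exact ihE h hw.1
    · exact ihF h hw.2
  | cat E F ihE ihF =>
    rcases h with rfl | h | h
    · simp at he
    · exact ihE h hw.1
    · exact ihF h hw.2
  | star E ih =>
    rcases h with rfl | h
    · simp at he
    · exact ih h hw

section Patterns

variable {I : Image} {B : Inst σ} {W M : ℤ} {X : Scope σ} {S : SemiState σ}
  {V V' : Finset (ℤ × σ.Vertex)} {l : List (ℕ × σ.Vertex)} {s s₁ s₂ s' : St} {j K U U' t i : ℕ}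
  {r r' u : ℤ} {z : RBG.Node σ} {v : σ.Vertex} {c : Stack σ × SemiState σ} {a : Action σ}
  {P : Regex (Action σ)}

/-- What the memory contains at a pattern. -/
theorem Scope.Ok.pattern (hX : X.Ok I B W) (hz : X.Node I.N z) (he : z.expr = .act (i, a))
    (ha : a = .check P ∨ a = .checkNot P) : (⟨P, i, z.addr + 1⟩ : Scope σ).Ok I B W ∧
      exprWF P false ∧ nlen z.expr = 1 + (exprText P).length ∧
      I.base (2 * I.N + z.addr) = z.addr + 1 + (exprText P).length := by
  have h1 := NodeAt.hasText hz (mem := I.base) (by rw [ntext_number]; exact hX.text)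
  have h2 := node_addr_le hX hz
  have h3 := NodeAt.ok hz hX.laid
  obtain ⟨sw, hw⟩ := hX.wf
  have h4 := NodeAt.wf hz he hw
  have h5 := NodeAt.magnitude_le (B := B) hz he
  have h6 := hX.magnitude
  have h7 := hX.bound
  rw [Node.Ok] at h3
  rw [he] at h1 h2 h3 ⊢
  have h8 : a.text.length = 1 + (exprText P).length := by
    rcases ha with rfl | rfl <;> simp [Action.text, Nat.add_comm]
  have h9 : nlen (Regex.act (i, a)) = 1 + (exprText P).length := by
    rw [nlen, h8]; push_cast; rfl
  have h10 : HasText I.base (z.addr + 1) (exprText P) := by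
    rcases ha with rfl | rfl <;> exact h1.2
  have h11 : a.Laid I.base I.N z.addr i := h3.2.2
  have h12 : exprWF P false := by rcases ha with rfl | rfl <;> exact h4
  have h13 : exprMagnitude B P ≤ exprMagnitude B X.rex := by
    rcases ha with rfl | rfl <;> simpa only [Action.magnitude] using h5
  have h14 : I.base (2 * I.N + z.addr) = z.addr + 1 + (exprText P).length ∧
      exprLaid I.base I.N P (z.addr + 1) (7 * I.N) i := by
    rcases ha with rfl | rfl <;> exact h11
  refine ⟨⟨?_, ?_, h10, h14.2, ⟨false, h12⟩, ?_, fun v => ?_, hX.tokens⟩, h12, h9, h14.1⟩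
  · dsimp only; omega
  · simp only [Scope.len]; omega
  · dsimp only; omega
  · have := h7 v; dsimp only; omega

/-- The visited nodes lie outside a pattern. -/
theorem card_add_le (hV : ∀ x ∈ V, ∃ z, X.Node I.N z ∧ z.addr = x.1) (hz : X.Node I.N z)
    (he : z.expr = .act (i, a)) {b : ℤ} (hb : 0 ≤ b) (hl : nlen z.expr = 1 + b) :
    (V.card : ℤ) + b * σ.vertices ≤ X.len * σ.vertices := by
  have h1 := Scope.addr_mem hz
  have h2 : V ⊆ (Finset.Ico X.addr (X.addr + X.len) \ Finset.Ico (z.addr + 1) (z.addr + 1 + b)) ×ˢ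
      Finset.univ := by
    intro x hx
    obtain ⟨z', hz', h3⟩ := hV x hx
    have h4 := Scope.addr_mem hz'
    have h5 := one_le_nlen z'.expr
    have h6 := NodeAt.not_inside hz he hz'
    simp only [Finset.mem_product, Finset.mem_sdiff, Finset.mem_Ico, Finset.mem_univ, and_true]
    omega
  have h3 := Finset.card_le_card h2
  rw [Finset.card_product, Finset.card_sdiff_of_subset, Int.card_Ico, Int.card_Ico,
    Finset.card_univ, Fintype.card_fin] at h3
  · have h4 : 0 ≤ X.len := by unfold Scope.len; omega
    have h5 : ((X.addr + X.len - X.addr).toNat - (z.addr + 1 + b - (z.addr + 1)).toNat : ℕ) =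
        X.len - b := by omega
    zify at h3
    rw [h5] at h3
    linarith
  · intro x hx
    rw [Finset.mem_Ico] at hx ⊢
    omega

/-- The search in a pattern runs on its part of the current table, with an empty set of visited
pairs and its own flag `found`. It has at least the room of the surrounding search: by `card_add_le`
the pairs of the pattern are no more than the unvisited pairs outside. -/
theorem go_match {Q : St → Prop} (hI : I.Ok B) (hX : X.Ok I B W)
    (h : AtNode I B W X K j r u S V l M s z v) (he : z.expr = .act (i, a))
    (ha : a = .check P ∨ a = .checkNot P)
    (hv : VisitSpec I B W ⟨P, i, z.addr + 1⟩ K j U' r' ((exprText P).length * σ.vertices))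
    (hr : r' ≤ r) (hr' : 0 ≤ r')
    (hQ : ∀ s₁, Agree (X.Cells s.vb) s.sp s s₁ → Marks X I.N s₁.mem s.vb (insert (z.addr, v) V) →
      s₁.sp = s.sp → s₁.found = s.found → s₁.out = s.out → s₁.p = s.p → s₁.s = s.s →
      (0 < s₁.x ↔ Accepts B [P.number i] (S.move v)) →
      s₁.time ≤ s.time + 20 * ((exprText P).length * σ.vertices) +
        U' * ((exprText P).length * B.size) + 400 → Q s₁) :
    Go W M Code.match_ s Q := by
  have h1 := hI.order
  have h2 := node_addr_le hX h.node
  have h4 := h.ready.vb_le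
  have h5 := h.ready.sp_le
  have h6 := h.room
  have h7 := h.small
  have hp := h.p
  have hpos := h.pos
  have hN := h.ready.N
  have hn := h.ready.n
  obtain ⟨hY, hwf, hlen, hsnd⟩ := hX.pattern h.node he ha
  have h3 := card_add_le h.ready.nodes h.node he (by omega) hlen
  set m : ℤ := ((exprText P).length : ℤ) with hm
  have hm0 : 0 ≤ m := by omega
  have p1 : 0 ≤ (z.addr + 1) * (σ.vertices : ℤ) := mul_nonneg (by omega) (by omega)
  have p2 : (z.addr + 1 + m) * (σ.vertices : ℤ) = (z.addr + 1) * σ.vertices + m * σ.vertices := by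
    ring
  have p3 : (z.addr + 1 + m) * (σ.vertices : ℤ) ≤ I.L * σ.vertices :=
    mul_le_mul_of_nonneg_right (by omega) (by omega)
  have p4 : 0 ≤ m * (σ.vertices : ℤ) := mul_nonneg hm0 (by omega)
  have hb : Budget B [P.number i] (S.move v) j := by
    have := h.budget
    rw [Node.stack, he] at this
    exact this.pattern ha i
  have e1 : s.mem (2 * I.N + z.addr) = z.addr + 1 + m := by
    rw [h.ready.held.base _ (by omega) (by omega)
      (Image.not_varying_of_table hI (by omega) (by omega)), hsnd]
  simp only [Code.match_, run_rules, val_rules, cost_rules, ok_rules, St.set, St.get, St.tick,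
    true_and, Code.tab, hp, hN, hn]
  set mem₁ := upd (upd (upd s.mem s.sp z.addr) (s.sp + 1) s.s) (s.sp + 2) s.found with hmem₁
  have f0 : ∀ a, a < s.sp → mem₁ a = s.mem a := fun a ha => by
    rw [hmem₁, upd_of_ne (by omega), upd_of_ne (by omega), upd_of_ne (by omega)]
  have f1 : mem₁ s.sp = z.addr := by
    rw [hmem₁, upd_of_ne (by omega), upd_of_ne (by omega), upd_self]
  have f2 : mem₁ (s.sp + 1) = s.s := by rw [hmem₁, upd_of_ne (by omega), upd_self]
  have f3 : mem₁ (s.sp + 2) = s.found := by rw [hmem₁, upd_self]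
  clear_value mem₁
  have e2 : mem₁ (2 * I.N + z.addr) = z.addr + 1 + m := by rw [f0 _ (by omega), e1]
  simp only [e2, p2]
  repeat refine And.intro (by omega) ?_
  refine go_clear (by dsimp only; omega) (by dsimp only; omega) (by dsimp only; omega)
    (by dsimp only; omega) fun τ hτ => ?_
  dsimp only at hτ ⊢
  set mem₂ := cleared mem₁ (s.vb + (z.addr + 1) * σ.vertices)
    (s.vb + ((z.addr + 1) * σ.vertices + m * σ.vertices)) with hmem₂
  have g0 : ∀ a, ¬ (s.vb + (z.addr + 1) * σ.vertices ≤ a ∧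
      a < s.vb + ((z.addr + 1) * σ.vertices + m * σ.vertices)) → mem₂ a = mem₁ a := fun a ha => by
    simp only [hmem₂, cleared]; rw [if_neg ha]
  have g1 : ∀ a, s.vb + (z.addr + 1) * σ.vertices ≤ a →
      a < s.vb + ((z.addr + 1) * σ.vertices + m * σ.vertices) → mem₂ a = 0 := fun a ha ha' => by
    simp only [hmem₂, cleared]; rw [if_pos ⟨ha, ha'⟩]
  clear_value mem₂
  have hcells : ∀ a, s.vb + (z.addr + 1) * σ.vertices ≤ a →
      a < s.vb + ((z.addr + 1) * σ.vertices + m * σ.vertices) → X.Cells s.vb a := by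
    intro a h8 h9
    have h10 := Scope.addr_mem h.node
    have h11 : X.addr * (σ.vertices : ℤ) ≤ (z.addr + 1) * σ.vertices :=
      mul_le_mul_of_nonneg_right (by omega) (by omega)
    have h12 : (z.addr + 1 + m) * (σ.vertices : ℤ) ≤ (X.addr + X.len) * σ.vertices :=
      mul_le_mul_of_nonneg_right (by omega) (by omega)
    exact ⟨by omega, by omega⟩
  -- The text of a letter contains no other node of the surrounding expression, so clearing these
  -- cells removes none of its marks.
  have houtside : ∀ z' (v' : σ.Vertex), X.Node I.N z' →
      ¬ (s.vb + (z.addr + 1) * σ.vertices ≤ s.vb + (z'.addr * σ.vertices + (v' : ℕ)) ∧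
      s.vb + (z'.addr * σ.vertices + (v' : ℕ)) <
        s.vb + ((z.addr + 1) * σ.vertices + m * σ.vertices)) := by
    rintro z' v' hz' ⟨h8, h9⟩
    rcases NodeAt.not_inside h.node he hz' with h10 | h10
    · have := cell_lt (a := z'.addr) (b := z.addr + 1) (n := σ.vertices) (v := (v' : ℕ)) (by omega)
        (by omega) (by omega)
      omega
    · have := le_cell (a := z'.addr) (b := z.addr + 1 + m) (n := σ.vertices) (v := (v' : ℕ))
        (by omega) (by omega) (by omega)
      omega
  repeat refine And.intro (by omega) ?_
  refine Run.mono (hv S ∅ l M _ ([P.number i], S.move v) ?_ h.bounded hb ?_ ?_ ?_ h7 h.depth)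
    fun s₃ ⟨V', ms, q1, q2, q3, q4⟩ => ?_
  · refine ⟨hn.symm ▸ rfl, hN.symm ▸ rfl, h.ready.L, h.ready.PA, h.ready.VA, h.ready.BD, ?_,
      fun z' v' hz' => ?_, by simp, ?_, h4, by dsimp only; omega, .inl rfl⟩
    · exact h.ready.held.congr hI fun a _ ha => by
        dsimp only; rw [g0 _ (by omega), f0 _ (by omega)]
    · have := Scope.cells_of_node (vb := s.vb) hz' v'
      simp only [Scope.Cells, Scope.len, ← hm, p2] at this
      dsimp only
      rw [g1 _ this.1 this.2]
      simp
    · exact h.ready.chain.congr le_rfl fun a _ _ ha => by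
        dsimp only; rw [g0 _ (by omega), f0 _ (by omega)]
  · exact .inr ⟨⟨z.addr + 1, P.number i, [], 7 * I.N⟩, v, .root .., rfl, rfl, hpos⟩
  · simp [Scope.len, hm]
  · simp only [Scope.len, ← hm, Finset.card_empty]
    push_cast
    omega
  dsimp only at q1 q2 q4
  have ag := q3.agree
  have hsp₃ := q3.sp
  have hout := q3.out
  dsimp only at hsp₃ hout
  have k0 : ∀ a, 0 ≤ a → a < s.sp + 3 → ¬ (s.vb + (z.addr + 1) * σ.vertices ≤ a ∧
      a < s.vb + ((z.addr + 1) * σ.vertices + m * σ.vertices)) → s₃.mem a = mem₁ a := by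
    intro a h8 h9 h10
    rw [ag.mem a h8 h9]
    · exact g0 a h10
    · simpa only [Scope.Cells, Scope.len, ← hm, p2] using h10
  have e3 : s₃.mem s.sp = z.addr := by rw [k0 _ (by omega) (by omega) (by omega), f1]
  have e4 : s₃.mem (s.sp + 1) = s.s := by rw [k0 _ (by omega) (by omega) (by omega), f2]
  have e5 : s₃.mem (s.sp + 2) = s.found := by rw [k0 _ (by omega) (by omega) (by omega), f3]
  have e0 : s.sp + 3 - 3 = s.sp := by ring
  simp only [hsp₃, e0, e3, e4, e5]
  repeat refine And.intro (by omega) ?_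
  -- A pattern contains no switches, so the search in it writes nothing.
  have hms : ms = [] := List.eq_nil_iff_forall_not_mem.2 fun m' hm' =>
    not_moveFrom_of_switchFree hwf ((q1.moves_iff q2 m').1 hm')
  have hbool := q1.bool (.inl rfl)
  have hacc := q1.accepts_iff q2
  have hout' : s₃.out = s.out := by rw [hout, hms]; simp [movesText]
  have t1 := Scope.total_le (X := ⟨P, i, z.addr + 1⟩) (B := B) (V := V') U'
  have t2 : (⟨P, i, z.addr + 1⟩ : Scope σ).total B U' ∅ = 0 := rfl
  have t3 : (⟨P, i, z.addr + 1⟩ : Scope σ).len.toNat = (exprText P).length := by simp [Scope.len]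
  rw [t2] at q4
  rw [t3] at t1
  refine hQ _ ⟨ag.n.trans hn.symm, ag.N.trans hN.symm, ag.L, ag.PA, ag.VA, ag.BD, ag.vb, ag.mv, fun a h8 h9 h10 => ?_⟩
    (fun z' v' hz' => ?_) rfl rfl hout' hp.symm rfl ?_ ?_
  · dsimp only
    rw [k0 a h8 (by omega) fun h' => h10 (hcells a h'.1 h'.2), f0 _ h9]
  · have := hX.cells (Scope.cells_of_node (vb := s.vb) hz' v')
    dsimp only
    rw [k0 _ (by omega) (by omega) (houtside z' v' hz'), f0 _ (by omega)]
    exact h.ready.marks z' v' hz'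
  · dsimp only
    simp only [zero_ne_one, false_or] at hacc
    rw [← hacc]
    omega
  · dsimp only
    zify at q4 t1 ⊢
    rw [← hm] at t1 ⊢
    omega

theorem go_visitCheck (hI : I.Ok B) (hX : X.Ok I B W) (hv : VisitSpec I B W X K j U r u)
    (hU : 1000 ≤ U) (hr : 0 ≤ r) (h : AtNode I B W X K j r u S V l M s z v)
    (he : z.expr = .act (i, .check P))
    (hv' : VisitSpec I B W ⟨P, i, z.addr + 1⟩ K j U' r ((exprText P).length * σ.vertices))
    (ht : 20 * ((exprText P).length * σ.vertices) + U' * ((exprText P).length * B.size) + 1000 ≤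
      2 * U * headLen z.expr) : Go W M Code.visitCheck s (NodeGoal I B X S V l U z v s) := by
  have hw := h.le_weight (U := U)
  have hwf := (hX.pattern h.node he (.inl rfl)).2.1
  simp only [Code.visitCheck, run_rules, val_rules, cost_rules, ok_rules, St.set, St.get, St.tick,
    true_and]
  refine go_match hI hX h he (.inl rfl) hv' le_rfl hr fun s₁ k1 k2 k3 k4 k5 k6 k7 k8 k9 => ?_
  have hval := valid_check_iff_accepts (B := B) i hwf (S := S.move v)
  rw [← k8] at hval
  split_ifs with hx
  · refine go_letter hI hX hv hU hr h he rfl (v' := v) (hval.2 hx) rfl ?_ k2 k3 k4 k5 k6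
      (k7.trans h.pos) ?_
    · exact ⟨k1.n, k1.N, k1.L, k1.PA, k1.VA, k1.BD, k1.vb, k1.mv, k1.mem⟩
    · dsimp only; omega
  · refine NodeGoal.invalid h he rfl (fun h' => hx (hval.1 h')) ?_ k2 k3 k4 k5 ?_
    · exact ⟨k1.n, k1.N, k1.L, k1.PA, k1.VA, k1.BD, k1.vb, k1.mv, k1.mem⟩
    · dsimp only; omega

theorem go_visitCheckNot (hI : I.Ok B) (hX : X.Ok I B W) (hv : VisitSpec I B W X K j U r u)
    (hU : 1000 ≤ U) (hr : 0 ≤ r) (h : AtNode I B W X K j r u S V l M s z v)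
    (he : z.expr = .act (i, .checkNot P))
    (hv' : VisitSpec I B W ⟨P, i, z.addr + 1⟩ K j U' r ((exprText P).length * σ.vertices))
    (ht : 20 * ((exprText P).length * σ.vertices) + U' * ((exprText P).length * B.size) + 1000 ≤
      2 * U * headLen z.expr) : Go W M Code.visitCheckNot s (NodeGoal I B X S V l U z v s) := by
  have hw := h.le_weight (U := U)
  have hwf := (hX.pattern h.node he (.inr rfl)).2.1
  simp only [Code.visitCheckNot, run_rules, val_rules, cost_rules, ok_rules, St.set, St.get, St.tick,
    true_and]
  refine go_match hI hX h he (.inr rfl) hv' le_rfl hr fun s₁ k1 k2 k3 k4 k5 k6 k7 k8 k9 => ?_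
  have hval := valid_checkNot_iff_accepts (B := B) i hwf (S := S.move v)
  rw [← k8] at hval
  split_ifs with hx
  · refine NodeGoal.invalid h he rfl (fun h' => hval.1 h' hx) ?_ k2 k3 k4 k5 ?_
    · exact ⟨k1.n, k1.N, k1.L, k1.PA, k1.VA, k1.BD, k1.vb, k1.mv, k1.mem⟩
    · dsimp only; omega
  · refine go_letter hI hX hv hU hr h he rfl (v' := v) (hval.2 hx) rfl ?_ k2 k3 k4 k5 k6
      (k7.trans h.pos) ?_
    · exact ⟨k1.n, k1.N, k1.L, k1.PA, k1.VA, k1.BD, k1.vb, k1.mv, k1.mem⟩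
    · dsimp only; omega

end Patterns

end RBG

-- The visit of one node, and induction on the unvisited pairs

namespace RBG

variable {σ : Sig}

section Visits

variable {I : Image} {B : Inst σ} {W M : ℤ} {X : Scope σ} {S : SemiState σ}
  {V V' : Finset (ℤ × σ.Vertex)} {l : List (ℕ × σ.Vertex)} {s s₁ s₂ s' : St} {j K U U' t i : ℕ}
  {r r' u : ℤ} {z : Node σ} {v : σ.Vertex} {c : Stack σ × SemiState σ} {a : Action σ}
  {P : Regex (Action σ)}

theorem AtNode.tick (h : AtNode I B W X K j r u S V l M s z v) (τ : ℕ) :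
    AtNode I B W X K j r u S V l M (s.tick τ) z v :=
  ⟨⟨h.ready.n, h.ready.N, h.ready.L, h.ready.PA, h.ready.VA, h.ready.BD, h.ready.held,
    h.ready.marks, h.ready.nodes, h.ready.chain, h.ready.vb_le, h.ready.sp_le, h.ready.found⟩,
    h.bounded, h.budget, h.node, h.new, h.p, h.pos, h.unvisited, h.room, h.small, h.depth⟩

/-- The requirements for the search in patterns. -/
def Inner (I : Image) (B : Inst σ) (W : ℤ) (X : Scope σ) (K j U : ℕ) (r : ℤ) : Prop :=
  ∀ z i a P, X.Node I.N z → z.expr = .act (i, a) → a = .check P ∨ a = .checkNot P →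
    ∃ U', VisitSpec I B W ⟨P, i, z.addr + 1⟩ K j U' r ((exprText P).length * σ.vertices) ∧
      20 * ((exprText P).length * σ.vertices) + U' * ((exprText P).length * B.size) + 1000 ≤
        2 * U * headLen z.expr

theorem go_dispatch (hI : I.Ok B) (hX : X.Ok I B W) (hv : VisitSpec I B W X K j U r u)
    (hB : Below I B W X K j U r) (hP : Inner I B W X K j U r) (hU : 1000 ≤ U)
    (hl : 60 * K ≤ U + 60 * j) (hr : 0 ≤ r) (h : AtNode I B W X K j r u S V l M s z v)
    {L : List ℤ} (ht : ntext z.expr = s.t :: L) (hW : |s.t| + 32 ≤ W) :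
    Go W M (Code.cases (-1) [Code.visitShift, Code.visitSum, Code.visitCat, Code.visitStar,
      Code.visitOn, Code.visitOff, Code.visitAssign, Code.visitCompare, Code.visitSwitch,
      Code.visitCheck] Code.visitCheckNot) s
      fun s' => ∃ τ ≤ 120, NodeGoal I B X S V l U z v (s.tick τ) s' := by
  have ha1 := neg_abs_le s.t
  have ha2 := le_abs_self s.t
  simp only [Code.cases, run_rules, val_rules, cost_rules, ok_rules, St.set, St.get, St.tick,
    zero_lt_ite, true_and]
  have key : ∀ (d : HCmd) (τ : ℕ), τ ≤ 120 →
      Go W M d (s.tick τ) (NodeGoal I B X S V l U z v (s.tick τ)) →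
      Go W M d { s with time := s.time + τ } fun s' => ∃ τ ≤ 120, NodeGoal I B X S V l U z v { s with time := s.time + τ } s' :=
    fun d τ hτ h => Run.mono h fun s' hs' => ⟨τ, hτ, hs'⟩
  simp only [add_assoc]
  cases he : z.expr with
  | sum E F =>
    rw [he, ntext] at ht
    have ht' := (List.cons.inj ht).1
    repeat
      refine And.intro (by omega) ?_
      first | rw [if_pos (by omega)] | rw [if_neg (by omega)]
    try refine And.intro (by omega) ?_
    exact key _ _ (by omega) (go_visitSum hI hX hv hU hr (h.tick _) he)
  | cat E F =>
    rw [he, ntext] at ht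
    have ht' := (List.cons.inj ht).1
    repeat
      refine And.intro (by omega) ?_
      first | rw [if_pos (by omega)] | rw [if_neg (by omega)]
    try refine And.intro (by omega) ?_
    exact key _ _ (by omega) (go_visitCat hI hX hv hU hr (h.tick _) he)
  | star E =>
    rw [he, ntext] at ht
    have ht' := (List.cons.inj ht).1
    repeat
      refine And.intro (by omega) ?_
      first | rw [if_pos (by omega)] | rw [if_neg (by omega)]
    try refine And.intro (by omega) ?_
    exact key _ _ (by omega) (go_visitStar hI hX hv hU hr (h.tick _) he)
  | act x =>
    obtain ⟨i, a⟩ := x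
    rw [he, ntext] at ht
    cases a with
    | shift dir =>
      rw [Action.text] at ht
      have ht' := (List.cons.inj ht).1
      rw [if_pos (by omega)]
      repeat refine And.intro (by omega) ?_
      exact key _ _ (by omega) (go_visitShift hI hX hv hU hr (h.tick _) he ht'.symm)
    | on Y =>
      rw [Action.text] at ht
      have ht' := (List.cons.inj ht).1
      repeat
        refine And.intro (by omega) ?_
        first | rw [if_pos (by omega)] | rw [if_neg (by omega)]
      try refine And.intro (by omega) ?_
      exact key _ _ (by omega) (go_visitOn hI hX hv hU hr (h.tick _) he)
    | off y =>
      rw [Action.text] at ht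
      have ht' := (List.cons.inj ht).1
      repeat
        refine And.intro (by omega) ?_
        first | rw [if_pos (by omega)] | rw [if_neg (by omega)]
      try refine And.intro (by omega) ?_
      exact key _ _ (by omega) (go_visitOff hI hX hB hr (h.tick _) he)
    | assign y e =>
      rw [Action.text] at ht
      have ht' := (List.cons.inj ht).1
      repeat
        refine And.intro (by omega) ?_
        first | rw [if_pos (by omega)] | rw [if_neg (by omega)]
      try refine And.intro (by omega) ?_
      exact key _ _ (by omega) (go_visitAssign hI hX hB hU hr (h.tick _) he)
    | compare o e f =>
      rw [Action.text] at ht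
      have ht' := (List.cons.inj ht).1
      repeat
        refine And.intro (by omega) ?_
        first | rw [if_pos (by omega)] | rw [if_neg (by omega)]
      try refine And.intro (by omega) ?_
      exact key _ _ (by omega) (go_visitCompare hI hX hv hU hr (h.tick _) he)
    | switch p =>
      rw [Action.text] at ht
      have ht' := (List.cons.inj ht).1
      repeat
        refine And.intro (by omega) ?_
        first | rw [if_pos (by omega)] | rw [if_neg (by omega)]
      try refine And.intro (by omega) ?_
      exact key _ _ (by omega) (go_visitSwitch hI hX hU hl hr (h.tick _) he)
    | check P =>
      obtain ⟨U', k1, k2⟩ := hP z i _ P h.node he (.inl rfl)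
      rw [Action.text] at ht
      have ht' := (List.cons.inj ht).1
      repeat
        refine And.intro (by omega) ?_
        first | rw [if_pos (by omega)] | rw [if_neg (by omega)]
      try refine And.intro (by omega) ?_
      exact key _ _ (by omega) (go_visitCheck hI hX hv hU hr (h.tick _) he k1 k2)
    | checkNot P =>
      obtain ⟨U', k1, k2⟩ := hP z i _ P h.node he (.inr rfl)
      rw [Action.text] at ht
      have ht' := (List.cons.inj ht).1
      repeat
        refine And.intro (by omega) ?_
        first | rw [if_pos (by omega)] | rw [if_neg (by omega)]
      try refine And.intro (by omega) ?_
      exact key _ _ (by omega) (go_visitCheckNot hI hX hv hU hr (h.tick _) he k1 k2)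

/-- Marking and dispatching take at most 300 steps: 200 are the surplus in `NodeGoal`, the other 100
are charged to the caller of the visit. -/
theorem NodeGoal.searchGoal (h : NodeGoal I B X S V l U z v s₁ s') (hz : X.Node I.N z)
    (hs : Agree (X.Cells s.vb) s.sp s s₁) (hsp : s₁.sp = s.sp) (hf : s₁.found = s.found)
    (ho : s₁.out = s.out) (ht : s₁.time ≤ s.time + 300) :
    SearchGoal I B X S V l U (z.conf S v) 100 s s' := by
  obtain ⟨V', ms, h1, h2, h3, h4⟩ := h
  rw [hf] at h1
  refine ⟨V', ms, h1, .inr ⟨z, v, hz, rfl, h2⟩, ⟨hs.trans ?_, h3.sp.trans hsp, ?_, by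
    rw [h3.out, ho]⟩, by omega⟩
  · have := h3.agree
    rwa [hs.vb, hsp] at this
  · have := h3.marks
    rwa [hs.vb] at this

/-- The visit of a further node. -/
theorem VisitSpec.succ (hI : I.Ok B) (hX : X.Ok I B W) (hv : VisitSpec I B W X K j U r u)
    (hB : Below I B W X K j U r) (hP : Inner I B W X K j U r) (hU : 1000 ≤ U)
    (hl : 60 * K ≤ U + 60 * j) (hr : 0 ≤ r) : VisitSpec I B W X K j U r (u + 1) := by
  intro S V l M s c hR hS hb hT hu hroom hW hdep
  have h1 := hI.order
  have h3 := hR.card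
  have h4 := hR.vb_le
  have h5 := hR.sp_le
  -- A pair that gets marked releases ten cells of room. The pending call takes one of them, and the
  -- other nine raise the constant 40 to the 49 in `AtNode`.
  refine Run.call rfl (by omega) ?_
  simp only [Code.visit, run_rules, val_rules, cost_rules, ok_rules, St.set, St.get, St.tick,
    true_and]
  rcases hT with ⟨hc, hp⟩ | ⟨z, v, hz, rfl, hp, hpos⟩
  · rw [if_neg (by omega)]
    refine ⟨by omega, V, [], ⟨subset_rfl, fun x h h' => absurd h h', fun z v _ h h' => absurd h h',
      fun z v _ h h' => absurd h h', fun _ => rfl, fun _ => .inr ?_, fun _ => .inr rfl, .nil,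
      fun m => ⟨by simp, fun ⟨z, v, _, h, h', _⟩ => absurd h h'⟩⟩, .inl ⟨hc, rfl⟩,
      ⟨⟨rfl, rfl, rfl, rfl, rfl, rfl, rfl, rfl, fun _ _ _ _ => rfl⟩, rfl, hR.marks, by
        simp [movesText]⟩, by dsimp only; omega⟩
    exact ⟨[], by rw [hc]; exact .refl, by simp, trivial⟩
  have h2 := node_addr_le hX hz
  have hvn := v.isLt
  have hn := hR.n
  have hcell := hX.cells (Scope.cells_of_node (vb := s.vb) hz v)
  have hmark := hR.marks z v hz
  have p1 : z.addr * (σ.vertices : ℤ) ≤ I.L * σ.vertices :=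
    mul_le_mul_of_nonneg_right (by omega) (by omega)
  have p2 : 0 ≤ z.addr * (σ.vertices : ℤ) := mul_nonneg (by omega) (by omega)
  rw [if_pos (by omega)]
  simp only [hp, hn, hpos, hmark, zero_lt_ite]
  repeat refine And.intro (by omega) ?_
  split_ifs with hV
  · exact ⟨V, [], Searched.refl, .inr ⟨z, v, hz, rfl, hV⟩,
      ⟨⟨hn.symm, rfl, rfl, rfl, rfl, rfl, rfl, rfl, fun _ _ _ _ => rfl⟩, rfl, hR.marks, by
        simp [movesText]⟩, by dsimp only; omega⟩
  simp only [Code.visitNode, run_rules, val_rules, cost_rules, ok_rules, St.set, St.get, St.tick,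
    true_and, hp]
  set mem₁ := upd s.mem (s.vb + (z.addr * σ.vertices + (v : ℕ))) 1 with hmem₁
  have f0 : ∀ a, a ≠ s.vb + (z.addr * σ.vertices + (v : ℕ)) → mem₁ a = s.mem a := fun a ha => by
    rw [hmem₁, upd_of_ne ha]
  have f1 : mem₁ (s.vb + (z.addr * σ.vertices + (v : ℕ))) = 1 := by rw [hmem₁, upd_self]
  clear_value mem₁
  have htext := NodeAt.hasText hz (mem := I.base) (by rw [ntext_number]; exact hX.text)
  obtain ⟨x, L, hxL⟩ : ∃ x L, ntext z.expr = x :: L := by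
    cases h' : ntext z.expr with
    | nil => have := length_ntext z.expr; rw [h'] at this; simp at this; omega
    | cons x L => exact ⟨x, L, rfl⟩
  rw [hxL] at htext
  have e1 : mem₁ z.addr = x := by
    rw [f0 _ (by omega), hR.held.base _ (by omega) (by omega)
      (Image.not_varying_of_lt hI (by omega)), htext.1]
  have hx := hX.tokens z.addr (by omega) (by omega)
  rw [htext.1] at hx
  have hcard : ((insert (z.addr, v) V).card : ℤ) = V.card + 1 := by
    rw [Finset.card_insert_of_notMem hV]; push_cast; ring
  simp only [e1]
  repeat refine And.intro (by omega) ?_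
  refine Run.mono (go_dispatch (z := z) (v := v) (S := S) (V := V) (l := l) (L := L) hI hX hv hB hP
    hU hl hr ?_ hxL hx) fun s' ⟨τ, hτ, hs'⟩ => hs'.searchGoal hz ?_ rfl rfl rfl ?_
  · refine ⟨⟨rfl, hR.N, hR.L, hR.PA, hR.VA, hR.BD, ?_, fun z' v' hz' => ?_, fun y hy => ?_, ?_, h4,
      h5, hR.found⟩, hS, hb, hz, hV, rfl, rfl, by omega, by dsimp only; omega, by omega, hdep⟩
    · exact hR.held.congr hI fun a _ ha => f0 a (by omega)
    · dsimp only
      by_cases h' : (z'.addr, v') = (z.addr, v)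
      · obtain ⟨h6, rfl⟩ := Prod.mk.inj h'
        rw [h6, f1, if_pos (Finset.mem_insert_self _ _)]
      · rw [f0 _ fun h'' => h' ?_, hR.marks z' v' hz']
        · simp only [Finset.mem_insert, h', false_or]
        · obtain ⟨h6, h7⟩ := cell_inj (a := z'.addr) (b := z.addr) (n := σ.vertices)
            (v := ((v' : ℕ) : ℤ)) (w := ((v : ℕ) : ℤ)) (by omega) (by omega) (by omega) (by omega)
            (by omega)
          rw [h6, Fin.ext (a := v') (b := v) (by omega)]
    · rcases Finset.mem_insert.1 hy with rfl | hy
      · exact ⟨z, hz, rfl⟩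
      · exact hR.nodes y hy
    · exact hR.chain.congr le_rfl fun a _ _ ha => f0 a (by omega)
  · refine ⟨hn.symm, rfl, rfl, rfl, rfl, rfl, rfl, rfl, fun a _ _ ha => f0 a fun h' => ha ?_⟩
    rw [h']
    exact Scope.cells_of_node hz v
  · dsimp only [St.tick]; omega

/-- Vacuous, as there are never more visited pairs than cells. It is the start of the induction on
the unvisited pairs. -/
theorem VisitSpec.neg (hu : u < 0) : VisitSpec I B W X K j U r u := by
  intro S V l M s c hR hS hb hT hu'
  have := hR.card
  omega

/-- The recursion of the search within one table terminates because a visit that does not return at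
once marks a new pair. -/
theorem VisitSpec.of_requirements (hI : I.Ok B) (hX : X.Ok I B W) (hB : Below I B W X K j U r)
    (hP : Inner I B W X K j U r) (hU : 1000 ≤ U) (hl : 60 * K ≤ U + 60 * j) (hr : 0 ≤ r) (u : ℤ) :
    VisitSpec I B W X K j U r u := by
  by_cases hu : u < 0
  · exact .neg hu
  · obtain ⟨n, rfl⟩ := Int.eq_ofNat_of_zero_le (not_lt.1 hu)
    clear hu
    induction n with
    | zero => exact VisitSpec.succ hI hX (VisitSpec.neg (u := -1) (by omega)) hB hP hU hl hr
    | succ n ih => exact_mod_cast VisitSpec.succ hI hX ih hB hP hU hl hr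

end Visits

end RBG

-- Induction on the modifiers to come and on the pattern depth

namespace RBG

variable {σ : Sig}

theorem NodeAt.depth_le {N : ℤ} {E : Regex (Action σ)} {n : ℕ} {p c : ℤ}
    {k : Stack σ} {z : Node σ} (h : NodeAt N (E.number n) p k c z) {i : ℕ} {a : Action σ}
    (he : z.expr = .act (i, a)) : a.depth ≤ exprDepth E := by
  induction E generalizing n p k c with
  | act b =>
    obtain rfl := h
    obtain ⟨rfl, rfl⟩ := Prod.mk.inj (Regex.act.inj he)
    simp [exprDepth]
  | sum E F ihE ihF =>
    simp only [exprDepth]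
    rcases h with rfl | h | h
    · simp at he
    · exact (ihE h).trans (le_max_left _ _)
    · exact (ihF h).trans (le_max_right _ _)
  | cat E F ihE ihF =>
    simp only [exprDepth]
    rcases h with rfl | h | h
    · simp at he
    · exact (ihE h).trans (le_max_left _ _)
    · exact (ihF h).trans (le_max_right _ _)
  | star E ih =>
    rcases h with rfl | h
    · simp at he
    · exact ih h

/-- The time that is available for a token and an edge, if there are `j` modifiers to come, at most
`K` modifiers in total, and patterns of depth at most `d`. -/
def allowance (Q D K j d : ℕ) : ℕ := 2000 * (2 ^ (K - j) * Q ^ j * D ^ d)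

theorem two_pow_le_mul {a b : ℕ} (h : a ≤ b + 1) : 2 ^ a ≤ 2 * 2 ^ b := by
  rw [mul_comm, ← pow_succ]
  exact Nat.pow_le_pow_right (by omega) h

theorem two_thousand_le_allowance {Q D : ℕ} (hQ : 1 ≤ Q) (hD : 1 ≤ D) (K j d : ℕ) :
    2000 * 2 ^ (K - j) ≤ allowance Q D K j d := by
  refine Nat.mul_le_mul_left _ ?_
  rw [mul_assoc]
  exact Nat.le_mul_of_pos_right _ (Nat.mul_pos (Nat.pow_pos hQ) (Nat.pow_pos hD))

theorem Inst.vertices_le_size (B : Inst σ) : σ.vertices ≤ B.size := by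
  have : ∑ _v : σ.Vertex, 1 ≤ B.size := Finset.sum_le_sum fun v _ => by omega
  simpa using this

/-- Induction on the number of modifiers to come. Each of them adds a table (`L` times the number of
vertices), room for the pairs of one search (ten times as much at most) and a few cells for records.
-/
theorem VisitSpec.of_inner {I : Image} {B : Inst σ} {W : ℤ} (hI : I.Ok B) {Q D K : ℕ}
    (hQ : I.L * B.size ≤ Q) (hQ1 : 1 ≤ Q) (hD1 : 1 ≤ D) {d : ℕ} {X : Scope σ}
    (hX : X.Ok I B W) (hP : ∀ j : ℕ, Inner I B W X K j (allowance Q D K j d)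
      (j * (11 * (I.L * σ.vertices) + 20))) (j : ℕ) (u : ℤ) :
    VisitSpec I B W X K j (allowance Q D K j d) (j * (11 * (I.L * σ.vertices) + 20)) u := by
  have h1 := hI.order
  have h2 : X.len ≤ I.L := by have := hX.addr_pos; have := hX.addr_le; omega
  have h3 : I.L * (σ.vertices : ℤ) ≤ Q :=
    (mul_le_mul_of_nonneg_left (by exact_mod_cast B.vertices_le_size) h1.1).trans hQ
  have h4 : X.len * (σ.vertices : ℤ) ≤ I.L * σ.vertices :=
    mul_le_mul_of_nonneg_right h2 (by omega)
  have h5 : X.len * (B.size : ℤ) ≤ Q := (mul_le_mul_of_nonneg_right h2 (by omega)).trans hQ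
  -- The power of two exceeds `K - j`, so one unit pays for writing all modifiers recorded so far.
  have h6 : ∀ j, 1000 ≤ allowance Q D K j d ∧ 60 * K ≤ allowance Q D K j d + 60 * j := by
    intro j
    have h7 := two_thousand_le_allowance hQ1 hD1 K j d
    have h8 := Nat.lt_two_pow_self (n := K - j)
    omega
  have hr : ∀ j : ℕ, 0 ≤ (j : ℤ) * (11 * (I.L * σ.vertices) + 20) := fun j =>
    mul_nonneg (by omega) (by omega)
  induction j generalizing u with
  | zero =>
    -- Without budget no modifier can be valid, and `Below` is vacuous.
    exact VisitSpec.of_requirements hI hX ⟨fun j' hj => by omega⟩ (hP 0) (h6 0).1 (h6 0).2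
      (by simp) u
  | succ j ih =>
    refine VisitSpec.of_requirements hI hX ⟨fun j' hj => ?_⟩ (hP _) (h6 _).1 (h6 _).2
      (hr _) u
    obtain rfl : j = j' := by omega
    refine ⟨_, _, ih _, hr _, by push_cast; linarith, ?_⟩
    -- One modifier more trades a factor two for a factor `Q`. Of the three units granted in
    -- `Below`, two pay for the next search and the third, by `h10`, for clearing its table and for
    -- the fixed costs.
    have h9 : allowance Q D K j d * Q ≤ 2 * allowance Q D K (j + 1) d := by
      have := two_pow_le_mul (a := K - j) (b := K - (j + 1)) (by omega)
      simp only [allowance]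
      calc 2000 * (2 ^ (K - j) * Q ^ j * D ^ d) * Q = 2 ^ (K - j) * (2000 * Q ^ (j + 1) * D ^ d) := by
            ring
        _ ≤ 2 * 2 ^ (K - (j + 1)) * (2000 * Q ^ (j + 1) * D ^ d) := Nat.mul_le_mul_right _ this
        _ = _ := by ring
    have h10 : 2000 * Q ≤ allowance Q D K (j + 1) d := by
      simp only [allowance]
      refine Nat.mul_le_mul_left _ ?_
      calc Q = 1 * Q ^ 1 * 1 := by ring
        _ ≤ _ := Nat.mul_le_mul (Nat.mul_le_mul Nat.one_le_two_pow
          (Nat.pow_le_pow_right hQ1 (by omega))) (Nat.pow_pos hD1)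
    have h11 : (allowance Q D K j d : ℤ) * (X.len * B.size) ≤ allowance Q D K j d * Q :=
      mul_le_mul_of_nonneg_left h5 (by omega)
    zify at h9 h10 hQ1
    push_cast
    linarith

/-- The search is correct and efficient. -/
theorem visitSpec {I : Image} {B : Inst σ} {W : ℤ} (hI : I.Ok B) {Q D K : ℕ}
    (hQ : I.L * B.size ≤ Q) (hQ1 : 1 ≤ Q) (hD : B.size ≤ D) (hD1 : 1 ≤ D) (d j : ℕ) (X : Scope σ)
    (hX : X.Ok I B W) (hd : exprDepth X.rex ≤ d) (u : ℤ) :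
    VisitSpec I B W X K j (allowance Q D K j d) (j * (11 * (I.L * σ.vertices) + 20)) u := by
  induction d generalizing j X u with
  | zero =>
    refine VisitSpec.of_inner hI hQ hQ1 hD1 hX (fun j z i a P hz he ha => ?_) j u
    have h1 := NodeAt.depth_le hz he
    rcases ha with rfl | rfl <;> simp only [Action.depth] at h1 <;> omega
  | succ d ih =>
    refine VisitSpec.of_inner hI hQ hQ1 hD1 hX (fun j z i a P hz he ha => ?_) j u
    have h1 := NodeAt.depth_le hz he
    have h2 : exprDepth P ≤ d := by
      rcases ha with rfl | rfl <;> simp only [Action.depth] at h1 <;> omega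
    have h3 := hX.pattern hz he ha
    refine ⟨_, ih j _ h3.1 h2 _, ?_⟩
    have h4 : headLen z.expr = 1 + (exprText P).length := by
      have := h3.2.2.1
      rw [he, nlen] at this
      rw [he, headLen]
      omega
    have h5 : allowance Q D K j (d + 1) = allowance Q D K j d * D := by
      simp only [allowance]; ring
    have h6 : 2000 ≤ allowance Q D K j d :=
      le_trans (by have := Nat.one_le_two_pow (n := K - j); omega)
        (two_thousand_le_allowance hQ1 hD1 K j d)
    rw [h4, h5]
    set m := (exprText P).length
    set U := allowance Q D K j d
    -- The outer unit is `U * D`, so the `m` tokens of the pattern pay for a search over `m` tokens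
    -- and the whole board, and once more for clearing the cells.
    have h7 : U * (m * B.size) ≤ U * (m * D) := Nat.mul_le_mul_left _ (Nat.mul_le_mul_left _ hD)
    have h8 : 20 * (m * σ.vertices) ≤ U * (m * D) :=
      Nat.mul_le_mul (by omega) (Nat.mul_le_mul_left _ (B.vertices_le_size.trans hD))
    have h9 : 2000 * 1 ≤ U * D := Nat.mul_le_mul h6 hD1
    calc 20 * (m * σ.vertices) + U * (m * B.size) + 1000
        ≤ U * (m * D) + U * (m * D) + 2 * (U * D) := by omega
      _ = 2 * (U * D) * (1 + m) := by ring

end RBG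

-- The loops that read the board and count the pieces

namespace RBG

variable {σ : Sig}

/-- The texts of the edges of the given vertices. -/
def Inst.edgesTexts (B : Inst σ) (l : List σ.Vertex) : List ℤ := l.flatMap B.edgesText

theorem Inst.edgesTexts_cons (B : Inst σ) (v : σ.Vertex) (l : List σ.Vertex) :
    B.edgesTexts (v :: l) = B.edgesText v ++ B.edgesTexts l := rfl

theorem Inst.length_edgesText (B : Inst σ) (v : σ.Vertex) :
    (B.edgesText v).length = 1 + 2 * (B.edges v).length := by
  simp [Inst.edgesText_eq]; omega

theorem go_skipEdges {W M : ℤ} (B : Inst σ) (l : List σ.Vertex) {s : St} {Q : St → Prop}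
    (ht : HasText s.mem s.q (B.edgesTexts l)) (hx : s.x = l.length) (h0 : 0 ≤ s.q)
    (hM : s.q + (B.edgesTexts l).length + 1 ≤ M)
    (hW : s.q + (B.edgesTexts l).length + l.length + 16 ≤ W)
    (hQ : ∀ τ, τ ≤ s.time + 20 * l.length + 10 →
      Q { s with q := s.q + (B.edgesTexts l).length, x := 0, time := τ }) :
    Go W M Code.skipEdges s Q := by
  rw [Code.skipEdges, Go]
  induction l generalizing s with
  | nil =>
    have h1 : s.x = 0 := by simpa using hx
    rw [run_loop]
    simp only [val_rules, ok_rules, cost_rules, St.get, St.tick, h1, test_rules, if_false, true_and]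
    convert hQ (s.time + (1 + 1)) (by simp) using 2; simp [h1, Inst.edgesTexts]
  | cons v l ih =>
    have hlen := B.length_edgesText v
    rw [B.edgesTexts_cons, hasText_append] at ht
    rw [B.edgesTexts_cons] at hM hW hQ
    simp only [List.length_cons, List.length_append, Nat.cast_add, Nat.cast_one] at hx hM hW hQ
    have h1 : 0 < s.x := by omega
    have h2 : s.mem s.q = (B.edges v).length := by
      have := ht.1
      rw [Inst.edgesText_eq] at this
      exact this.1
    rw [run_loop]
    simp only [run_rules, val_rules, ok_rules, cost_rules, St.get, St.set, St.tick, h1, if_true,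
      true_and, h2]
    repeat refine And.intro (by omega) ?_
    have hq : s.q + 1 + 2 * (B.edges v).length = s.q + (B.edgesText v).length := by
      rw [hlen]; push_cast; ring
    rw [hq]
    refine ih ht.2 (by dsimp only; omega) (by dsimp only; omega) (by dsimp only; omega)
      (by dsimp only; omega) fun τ hτ => ?_
    dsimp only at hτ ⊢
    rw [add_assoc]
    exact hQ τ (by omega)

/-- The table of the edges is filled for the given vertices. -/
theorem go_tableEdges {W M : ℤ} (B : Inst σ) (m : ℕ) {s : St} {Q : St → Prop} {k : ℕ}
    (hk : k + m = σ.vertices) (hx : s.x = k) (hn : s.n = σ.vertices)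
    (ht : HasText s.mem s.q (B.edgesTexts ((List.finRange σ.vertices).drop k)))
    (h0 : 0 ≤ s.q) (hN : s.q + (B.edgesTexts ((List.finRange σ.vertices).drop k)).length ≤ s.N)
    (hnN : σ.vertices ≤ s.N) (hM : 6 * s.N + 1 ≤ M) (hW : 6 * s.N + 32 ≤ W)
    (hQ : ∀ q mem τ, (∀ a, a < 5 * s.N + k ∨ 5 * s.N + σ.vertices ≤ a → mem a = s.mem a) →
      (∀ v : σ.Vertex, k ≤ (v : ℕ) → s.q ≤ mem (5 * s.N + (v : ℕ)) ∧
        mem (5 * s.N + (v : ℕ)) + (B.edgesText v).length ≤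
          s.q + (B.edgesTexts ((List.finRange σ.vertices).drop k)).length ∧
        HasText mem (mem (5 * s.N + (v : ℕ))) (B.edgesText v)) →
      τ ≤ s.time + 40 * m + 10 →
      Q { s with q := q, x := σ.vertices, mem := mem, time := τ }) :
    Go W M Code.tableEdges s Q := by
  rw [Code.tableEdges, Go]
  induction m generalizing s k Q with
  | zero =>
    have h1 : ¬ s.x < s.n := by omega
    rw [run_loop]
    simp only [val_rules, ok_rules, cost_rules, St.get, St.tick, h1, zero_lt_ite, if_false, true_and]
    refine ⟨by omega, ?_⟩
    refine St.transfer (fun τ hτ => hQ s.q s.mem τ (fun _ _ => rfl) (fun v hv => ?_) hτ) ?_ ?_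
    · have := v.isLt; omega
    · dsimp only; omega
    · dsimp only
      have : s.x = σ.vertices := by omega
      rw [this]
  | succ m ih =>
    have hkn : k < σ.vertices := by omega
    have hdrop : (List.finRange σ.vertices).drop k =
        (⟨k, hkn⟩ : σ.Vertex) :: (List.finRange σ.vertices).drop (k + 1) := by
      rw [List.drop_eq_getElem_cons (by simpa using hkn)]
      simp
    rw [hdrop, B.edgesTexts_cons] at ht hN hQ
    rw [hasText_append] at ht
    simp only [List.length_append, Nat.cast_add] at hN hQ
    have hlen := B.length_edgesText ⟨k, hkn⟩
    have h1 : s.x < s.n := by omega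
    have h2 : s.mem s.q = (B.edges ⟨k, hkn⟩).length := by
      have := ht.1
      rw [Inst.edgesText_eq] at this
      exact this.1
    rw [run_loop]
    simp only [run_rules, val_rules, ok_rules, cost_rules, St.get, St.set, St.tick, h1, if_true,
      true_and, Code.tab, zero_lt_ite]
    set mem₁ := upd s.mem (5 * s.N + s.x) s.q with hmem₁
    have f0 : ∀ a, a ≠ 5 * s.N + s.x → mem₁ a = s.mem a := fun a ha => by
      rw [hmem₁, upd_of_ne ha]
    have f1 : mem₁ (5 * s.N + s.x) = s.q := by rw [hmem₁, upd_self]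
    clear_value mem₁
    have e1 : mem₁ s.q = (B.edges ⟨k, hkn⟩).length := by rw [f0 _ (by omega), h2]
    simp only [e1]
    repeat refine And.intro (by omega) ?_
    have hq : s.q + 1 + 2 * (B.edges ⟨k, hkn⟩).length = s.q + (B.edgesText ⟨k, hkn⟩).length := by
      rw [hlen]; push_cast; ring
    rw [hq]
    refine ih (k := k + 1) (by omega) (by dsimp only; push_cast; omega) hn (ht.2.congr fun a ha ha' => ?_)
      (by dsimp only; omega) (by dsimp only; omega) hnN (by dsimp only; omega) (by dsimp only; omega)
      fun q mem τ k1 k2 k3 => ?_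
    · exact f0 a (by omega)
    dsimp only at k1 k2 k3 ⊢
    push_cast at k1
    refine hQ q mem τ (fun a ha => ?_) (fun v hv => ?_) (by omega)
    · rw [k1 a (by omega), f0 a (by omega)]
    · by_cases hvk : (v : ℕ) = k
      · obtain rfl : v = ⟨k, hkn⟩ := Fin.ext hvk
        have e2 : mem (5 * s.N + (k : ℕ)) = s.q := by rw [k1 _ (by omega), ← hx, f1]
        dsimp only
        rw [e2]
        refine ⟨by omega, by omega, ht.1.congr fun a ha ha' => ?_⟩
        rw [k1 _ (by omega), f0 _ (by omega)]
      · obtain ⟨g1, g2, g3⟩ := k2 v (by omega)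
        exact ⟨by omega, by omega, g3⟩

/-- The invariant counts the pieces on the first `k` vertices. For `k = 0` it says that the counters
are zero, as the memory behind the input is. -/
theorem go_countPieces {W M : ℤ} (S : SemiState σ) (m : ℕ) {s : St} {Q : St → Prop} {k : ℕ}
    (hk : k + m = σ.vertices) (hx : s.x = k) (hn : s.n = σ.vertices)
    (hp : ∀ v : σ.Vertex, s.mem (s.PA + (v : ℕ)) = (S.pieceAt v : ℕ))
    (hc : ∀ w : σ.Piece, s.mem (6 * s.N + (w : ℕ)) =
      ((Finset.univ.filter fun v : σ.Vertex => (v : ℕ) < k ∧ S.pieceAt v = w).card : ℕ))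
    (h0 : 0 ≤ s.PA) (hPA : s.PA + σ.vertices ≤ s.N) (hpN : σ.pieces ≤ s.N) (hM : 7 * s.N + 1 ≤ M)
    (hW : 7 * s.N + 32 ≤ W)
    (hQ : ∀ y mem τ, (∀ a, a < 6 * s.N ∨ 6 * s.N + σ.pieces ≤ a → mem a = s.mem a) →
      (∀ w : σ.Piece, mem (6 * s.N + (w : ℕ)) =
        ((Finset.univ.filter fun v : σ.Vertex => S.pieceAt v = w).card : ℤ)) → τ ≤ s.time + 40 * m + 10 →
      Q { s with y := y, x := σ.vertices, mem := mem, time := τ }) :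
    Go W M Code.countPieces s Q := by
  rw [Code.countPieces, Go]
  induction m generalizing s k Q with
  | zero =>
    have h1 : ¬ s.x < s.n := by omega
    rw [run_loop]
    simp only [val_rules, ok_rules, cost_rules, St.get, St.tick, h1, zero_lt_ite, if_false, true_and]
    refine ⟨by omega, ?_⟩
    refine St.transfer (fun τ hτ => hQ s.y s.mem τ (fun _ _ => rfl) (fun w => ?_) hτ) ?_ ?_
    · rw [hc w]
      congr 2
      ext v
      have := v.isLt
      simp only [Finset.mem_filter, Finset.mem_univ, true_and, and_iff_right_iff_imp]
      omega
    · dsimp only; omega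
    · dsimp only
      have : s.x = σ.vertices := by omega
      rw [this]
  | succ m ih =>
    have hkn : k < σ.vertices := by omega
    have h1 : s.x < s.n := by omega
    have h2 : s.mem (s.PA + s.x) = (S.pieceAt ⟨k, hkn⟩ : ℕ) := by rw [hx]; exact hp ⟨k, hkn⟩
    have h3 := (S.pieceAt ⟨k, hkn⟩).isLt
    have h4 := hc (S.pieceAt ⟨k, hkn⟩)
    have h5 := Finset.card_le_univ
      (Finset.univ.filter fun v : σ.Vertex => (v : ℕ) < k ∧ S.pieceAt v = S.pieceAt ⟨k, hkn⟩)
    rw [Fintype.card_fin] at h5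
    rw [run_loop]
    simp only [run_rules, val_rules, ok_rules, cost_rules, St.get, St.set, St.tick, h1, if_true,
      true_and, Code.tab, zero_lt_ite, h2]
    repeat refine And.intro (by omega) ?_
    refine ih (k := k + 1) (by omega) (by dsimp only; push_cast; omega) hn (fun v => ?_)
      (fun w => ?_) h0 hPA hpN hM hW fun y mem τ k1 k2 k3 => ?_
    · have := v.isLt
      dsimp only
      rw [upd_of_ne (by omega), hp]
    · have hw := w.isLt
      dsimp only
      have e : (Finset.univ.filter fun v : σ.Vertex => (v : ℕ) < k + 1 ∧ S.pieceAt v = w).card =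
          (Finset.univ.filter fun v : σ.Vertex => (v : ℕ) < k ∧ S.pieceAt v = w).card +
            (if S.pieceAt ⟨k, hkn⟩ = w then 1 else 0) := by
        simp only [Finset.card_filter]
        rw [← Finset.add_sum_erase _ _ (Finset.mem_univ (⟨k, hkn⟩ : σ.Vertex)),
          ← Finset.add_sum_erase Finset.univ
            (fun v : σ.Vertex => if (v : ℕ) < k ∧ S.pieceAt v = w then 1 else 0)
            (Finset.mem_univ (⟨k, hkn⟩ : σ.Vertex)),
          Finset.sum_congr rfl (g := fun v : σ.Vertex =>
            if (v : ℕ) < k ∧ S.pieceAt v = w then 1 else 0)]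
        · simp; ring
        · intro v hv
          have : (v : ℕ) ≠ k := fun h => Finset.ne_of_mem_erase hv (Fin.ext h)
          have h' : (v : ℕ) < k + 1 ↔ (v : ℕ) < k := by omega
          simp only [h']
      rw [e]
      by_cases hw' : S.pieceAt ⟨k, hkn⟩ = w
      · subst hw'
        rw [upd_self, h4]
        simp
      · rw [upd_of_ne, hc w]
        · simp [hw']
        · intro h
          exact hw' (Fin.ext (by omega))
    · dsimp only at k1 k2 k3 ⊢
      refine hQ y mem τ (fun a ha => ?_) k2 (by omega)
      rw [k1 a ha, upd_of_ne (by omega)]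

end RBG

namespace RBG

variable {σ : Sig}

/-! ## The input -/

theorem tableText_eq {n : ℕ} (f : Fin n → ℕ) : tableText f = List.ofFn fun v => (f v : ℤ) := by
  have : ∀ l : List ℕ, (l.flatMap fun x : ℕ => [(x : ℤ)]) = l.map fun x : ℕ => (x : ℤ) := by
    intro l; induction l <;> simp_all
  simp only [tableText, bind, pure, List.map_id', this, List.map_ofFn]
  rfl

theorem length_tableText {n : ℕ} (f : Fin n → ℕ) : (tableText f).length = n := by
  simp [tableText_eq]

theorem HasText.table {mem : ℤ → ℤ} {q : ℤ} {n : ℕ} {f : Fin n → ℕ}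
    (h : HasText mem q (tableText f)) (v : Fin n) : mem (q + (v : ℕ)) = f v := by
  induction n generalizing q with
  | zero => exact v.elim0
  | succ n ih =>
    rw [tableText_eq, List.ofFn_succ] at h
    refine Fin.cases ?_ (fun w => ?_) v
    · simpa using h.1
    · have := ih (f := fun i => f i.succ) (by rw [tableText_eq]; exact h.2) w
      rw [← this]
      congr 1
      simp; ring

/-- The number of variables. -/
abbrev Sig.vars (σ : Sig) : ℕ := σ.players + σ.extraVars

/-- The address of the rules in the input. -/
def Sig.start (σ : Sig) : ℕ := σ.players + σ.extraVars + σ.pieces + 4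

/-- The number of tokens of the edges. -/
def Inst.edgesLen (B : Inst σ) : ℕ := (B.edgesTexts (List.finRange σ.vertices)).length

theorem GenRules.length_eq (R : GenRules σ) : R.length = σ.start + (exprText R.rules).length := by
  simp only [GenRules.length, GenRules.text, List.length_append, List.length_cons, List.length_nil,
    length_tableText, Sig.start]
  omega

theorem SemiState.length_text (S : SemiState σ) : S.text.length = 2 + σ.vertices + σ.vars := by
  simp only [SemiState.text, List.length_append, List.length_cons, length_tableText, Sig.vars]
  omega

theorem Inst.length_eq (B : Inst σ) : B.length = B.edgesLen + 2 * σ.vars + σ.vertices + 3 := by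
  simp only [Inst.length, Inst.text, List.length_append, List.length_cons, length_tableText,
    SemiState.length_text, Inst.edgesLen, Inst.edgesTexts, Sig.vars]
  omega

theorem length_inputText (R : GenRules σ) (B : Inst σ) (g : GameState σ) :
    (inputText R B g).length = R.length + B.length + σ.vertices + σ.vars + 3 := by
  simp only [inputText, GameState.text, List.length_append, List.length_cons,
    SemiState.length_text, GenRules.length, Inst.length]
  omega

theorem Inst.size_eq (B : Inst σ) : B.size = B.edgesLen + σ.vertices := by
  simp only [Inst.size, Inst.edgesLen, Inst.edgesTexts, List.length_flatMap, Finset.sum_add_distrib,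
    Finset.sum_const, Finset.card_univ, Fintype.card_fin, smul_eq_mul, mul_one, Nat.add_right_cancel_iff]
  rw [← List.ofFn_eq_map, List.sum_ofFn]

/-- The address of the bounds in the input. -/
def bounds (R : GenRules σ) (B : Inst σ) : ℕ := R.length + 1 + B.edgesLen

/-- The address of the pieces of the game state in the input. -/
def pieces (R : GenRules σ) (B : Inst σ) : ℕ := bounds R B + 2 * σ.vars + σ.vertices + 5

/-- The memory contains the input. -/
structure Loaded (R : GenRules σ) (B : Inst σ) (g : GameState σ) (mem : ℤ → ℤ) : Prop where
  players : mem 0 = σ.players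
  extraVars : mem (σ.players + 2 : ℕ) = σ.extraVars
  pieceCount : mem (σ.vars + 3 : ℕ) = σ.pieces
  rules : HasText mem σ.start (exprText R.rules)
  vertices : mem R.length = σ.vertices
  edges : HasText mem (R.length + 1 : ℕ) (B.edgesTexts (List.finRange σ.vertices))
  bound : ∀ v : σ.Var, mem (bounds R B + (v : ℕ) : ℕ) = B.bound v
  index : mem (pieces R B - 3 : ℤ) = g.index
  pos : mem (pieces R B - 1 : ℤ) = (g.semi.pos : ℕ)
  piece : ∀ v : σ.Vertex, mem (pieces R B + (v : ℕ) : ℕ) = (g.semi.pieceAt v : ℕ)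
  value : ∀ v : σ.Var, mem (pieces R B + σ.vertices + (v : ℕ) : ℕ) = g.semi.value v

theorem HasText.loaded {R : GenRules σ} {B : Inst σ} {g : GameState σ} {mem : ℤ → ℤ}
    (h : HasText mem 0 (inputText R B g)) : Loaded R B g mem := by
  have h' := h
  have hR := R.length_eq
  have hB := B.length_eq
  -- Nested to the right, the text can be taken apart at once, and the address of each part is the
  -- sum of the lengths before it.
  have e1 : inputText R B g = ((σ.players : ℤ) :: tableText (fun p : σ.Player => (p : ℕ))) ++
      (((R.keeper : ℕ) : ℤ) :: (σ.extraVars : ℤ) ::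
      (tableText (fun v : Fin σ.extraVars => σ.players + (v : ℕ)) ++
      ((σ.pieces : ℤ) :: (tableText (fun x : σ.Piece => (x : ℕ)) ++
      (exprText R.rules ++ ((σ.vertices : ℤ) :: (B.edgesTexts (List.finRange σ.vertices) ++
      (tableText B.bound ++ (B.init.text ++ ((g.index : ℤ) :: ((g.semi.player : ℕ) : ℤ) ::
      ((g.semi.pos : ℕ) : ℤ) :: (tableText (fun v => (g.semi.pieceAt v : ℕ)) ++
      tableText g.semi.value))))))))))) := by
    simp [inputText, GenRules.text, Inst.text, GameState.text, SemiState.text, Inst.edgesTexts]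
  rw [e1] at h
  simp only [hasText_append, HasText, length_tableText, List.length_cons, SemiState.length_text] at h
  obtain ⟨⟨k1, -⟩, -, k2, -, k3, -, k4, k5, k6, k7, -, k8, -, k9, k10, k11⟩ := h
  have key : ∀ {a b x : ℤ}, mem a = x → a = b → mem b = x := fun h h' => h' ▸ h
  have key' : ∀ {a b : ℤ} {L : List ℤ}, HasText mem a L → a = b → HasText mem b L :=
    fun h h' => h' ▸ h
  have hE : (B.edgesTexts (List.finRange σ.vertices)).length = B.edgesLen := rfl
  rw [hE] at k7 k8 k9 k10 k11
  have hp : pieces R B = R.length + 1 + B.edgesLen + 2 * σ.vars + σ.vertices + 5 := rfl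
  have hb : bounds R B = R.length + 1 + B.edgesLen := rfl
  have hs : σ.start = σ.players + σ.extraVars + σ.pieces + 4 := rfl
  have hv : σ.vars = σ.players + σ.extraVars := rfl
  exact ⟨k1, key k2 (by push_cast; ring), key k3 (by push_cast; ring),
    key' k4 (by push_cast [hs]; ring), key k5 (by push_cast [hR, hs]; ring),
    key' k6 (by push_cast [hR, hs]; ring),
    fun v => key (k7.table v) (by push_cast [hb, hR, hs]; ring),
    key k8 (by push_cast [hp, hb, hR, hs, hv]; ring), key k9 (by push_cast [hp, hb, hR, hs, hv]; ring),
    fun v => key (k10.table v) (by push_cast [hp, hb, hR, hs, hv]; ring),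
    fun v => key (k11.table v) (by push_cast [hp, hb, hR, hs, hv]; ring)⟩

/-- The memory at the beginning. -/
def inputMem (l : List ℤ) (a : ℤ) : ℤ := if 0 ≤ a then l.getD a.toNat 0 else 0

theorem hasText_inputMem (l : List ℤ) : HasText (inputMem l) 0 l := by
  have key : ∀ (l' : List ℤ) (mem : ℤ → ℤ) (q : ℕ), (∀ i : ℕ, i < l'.length → mem (q + i : ℕ) = l'.getD i 0) →
      HasText mem q l' := by
    intro l'
    induction l' with
    | nil => intros; trivial
    | cons x l' ih =>
      intro mem q h
      refine ⟨by simpa using h 0 (by simp), ?_⟩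
      have := ih mem (q + 1) fun i hi => by
        have := h (i + 1) (by simpa using hi)
        rw [List.getD_cons_succ] at this
        rw [← this]
        congr 2
        omega
      exact_mod_cast this
  exact key l _ 0 fun i _ => by simp [inputMem]

theorem inputMem_of_le {l : List ℤ} {a : ℤ} (h : l.length ≤ a) : inputMem l a = 0 := by
  rw [inputMem, if_pos (by omega), List.getD_eq_default]
  omega

theorem le_maxAbs {l : List ℤ} {x : ℤ} (h : x ∈ l) : |x| ≤ maxAbs l := by
  induction l with
  | nil => simp at h
  | cons y l ih =>
    simp only [maxAbs, List.map_cons, List.foldr_cons] at ih ⊢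
    rcases List.mem_cons.1 h with rfl | h
    · have := le_max_left x.natAbs ((l.map Int.natAbs).foldr max 0)
      rw [Int.abs_eq_natAbs]
      omega
    · have := le_max_right y.natAbs ((l.map Int.natAbs).foldr max 0)
      have := ih h
      omega

theorem abs_inputMem_le (l : List ℤ) (a : ℤ) : |inputMem l a| ≤ maxAbs l := by
  rw [inputMem]
  split_ifs with h
  · by_cases h' : a.toNat < l.length
    · rw [List.getD_eq_getElem _ _ h']
      exact le_maxAbs (List.getElem_mem h')
    · rw [List.getD_eq_default _ _ (by omega)]
      simp
  · simp

end RBG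

-- Execution of the preprocessing

namespace RBG

variable {σ : Sig} {R : GenRules σ} {B : Inst σ} {g : GameState σ}

/-- The length of the input. -/
def inputLen (R : GenRules σ) (B : Inst σ) : ℕ := pieces R B + σ.vertices + σ.vars

theorem inputLen_eq : (inputText R B g).length = inputLen R B := by
  have h1 := B.length_eq
  have h2 : pieces R B = bounds R B + 2 * σ.vars + σ.vertices + 5 := rfl
  have h3 : bounds R B = R.length + 1 + B.edgesLen := rfl
  rw [length_inputText, inputLen]
  omega

theorem layout (R : GenRules σ) (B : Inst σ) :
    inputLen R B = pieces R B + σ.vertices + σ.vars ∧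
    pieces R B = bounds R B + 2 * σ.vars + σ.vertices + 5 ∧
    bounds R B = R.length + 1 + B.edgesLen ∧ R.length = σ.start + (exprText R.rules).length ∧
    σ.start = σ.players + σ.extraVars + σ.pieces + 4 ∧ σ.vars = σ.players + σ.extraVars ∧
    B.edgesLen = (B.edgesTexts (List.finRange σ.vertices)).length :=
  ⟨rfl, rfl, rfl, R.length_eq, rfl, rfl, rfl⟩

theorem go_readHeader {W M : ℤ} {s : St} {Q : St → Prop} (h : Loaded R B g s.mem)
    (hM : 7 * inputLen R B + 2 ≤ M) (hW : 7 * inputLen R B + 32 ≤ W)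
    (hA : ∀ x ∈ exprText R.rules, x + 16 ≤ W)
    (hQ : ∀ t τ, τ ≤ s.time + 100 * inputLen R B + 100 →
      Q { s with q := bounds R B, y := σ.vars, x := 0, t := t, b := σ.start, L := R.length,
                 n := σ.vertices, BD := bounds R B, PA := pieces R B,
                 VA := (pieces R B + σ.vertices : ℕ), N := inputLen R B, time := τ }) :
    Go W M Code.readHeader s Q := by
  obtain ⟨l1, l2, l3, l4, l5, l6, l7⟩ := layout R B
  have e1 := h.players
  have e2 : s.mem ((σ.players : ℤ) + 2) = σ.extraVars := by exact_mod_cast h.extraVars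
  have e3 : s.mem ((σ.players : ℤ) + 2 + σ.extraVars + 1) = σ.pieces := by
    rw [← h.pieceCount]; congr 1; push_cast [l6]; ring
  have e4 : (σ.players : ℤ) + 2 + σ.extraVars + 1 + σ.pieces + 1 = σ.start := by
    push_cast [l5]; ring
  simp only [Code.readHeader, run_rules, val_rules, cost_rules, ok_rules, St.set, St.get, St.tick,
    true_and, e1, e2, e3, e4]
  repeat refine And.intro (by omega) ?_
  refine go_skipRegex _ R.rules le_rfl (by dsimp only; omega) h.rules (by dsimp only; omega)
    (by dsimp only; omega) hA fun t τ hτ => ?_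
  dsimp only at hτ ⊢
  have e5 : (σ.start : ℤ) + (exprText R.rules).length = R.length := by push_cast [l4]; ring
  have e6 := h.vertices
  simp only [e5, e6]
  repeat refine And.intro (by omega) ?_
  refine go_skipEdges B (List.finRange σ.vertices) ?_ ?_ ?_ ?_ ?_ fun τ' hτ' => ?_
  · have := h.edges
    push_cast at this
    exact this
  · simp
  · dsimp only; omega
  · dsimp only; omega
  · dsimp only; simp only [List.length_finRange]; omega
  dsimp only at hτ' ⊢
  simp only [List.length_finRange] at hτ'
  repeat refine And.intro (by omega) ?_
  refine St.transfer (fun τ'' h'' => hQ t τ'' h'') ?_ ?_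
  · dsimp only; omega
  · have a1 : (R.length : ℤ) + 1 + (B.edgesTexts (List.finRange σ.vertices)).length = bounds R B := by
      push_cast [l3, l7]; ring
    have a2 : (σ.players : ℤ) + σ.extraVars = σ.vars := by push_cast [l6]; ring
    have a3 : (bounds R B : ℤ) + σ.vars + σ.vars + σ.vertices + 5 = pieces R B := by
      push_cast [l2]; ring
    have a4 : (pieces R B : ℤ) + σ.vertices + σ.vars = inputLen R B := by push_cast [l1]; ring
    have a5 : ((pieces R B + σ.vertices : ℕ) : ℤ) = (pieces R B : ℤ) + σ.vertices := Nat.cast_add ..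
    rw [a1, a2, a3, a4, a5]

/-- The tables have been filled. -/
structure Filled (R : GenRules σ) (B : Inst σ) (g : GameState σ) (N : ℤ) (mem mem' : ℤ → ℤ) :
    Prop where
  frame : ∀ a, a < N → mem' a = mem a
  laid : exprLaid mem' N R.rules σ.start (7 * N) 0
  jump : ∀ k z x, NodeAt N R.rules.hat σ.start k (7 * N) z → z.expr = .act x →
    mem' (4 * N + x.1) = z.cell
  edges : ∀ v : σ.Vertex, 0 ≤ mem' (5 * N + (v : ℕ)) ∧
    mem' (5 * N + (v : ℕ)) + (B.edgesText v).length ≤ bounds R B ∧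
    HasText mem' (mem' (5 * N + (v : ℕ))) (B.edgesText v)
  count : ∀ w : σ.Piece, mem' (6 * N + (w : ℕ)) =
    ((Finset.univ.filter fun v : σ.Vertex => g.semi.pieceAt v = w).card : ℤ)
  zero : mem' (7 * N) = 0
  root : mem' (7 * N + 1) = σ.start
  start : mem' (4 * N) = 7 * N + 1

/-- Each table has `N` cells, and `N` exceeds the address of every token of the rules and the
numbers of letters, vertices and pieces; so the tables do not overlap. -/
theorem go_fillTables {W M : ℤ} {s : St} {Q : St → Prop} (h : Loaded R B g s.mem)
    (h0 : ∀ a : ℤ, inputLen R B ≤ a → s.mem a = 0) (hL : s.L = R.length) (hn : s.n = σ.vertices)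
    (hPA : s.PA = pieces R B) (hN : s.N = inputLen R B) (hb : s.b = σ.start) (hi : s.i = 0)
    (hM : 11 * inputLen R B + 20 ≤ M) (hW : 11 * inputLen R B + 40 ≤ W)
    (hA : ∀ x ∈ exprText R.rules, x + 16 ≤ W)
    (hQ : ∀ q x y i t p c mem τ, Filled R B g (inputLen R B) s.mem mem →
      τ ≤ s.time + 300 * inputLen R B + 200 →
      Q { s with q := q, x := x, y := y, sp := 7 * (inputLen R B : ℤ) + 2, i := i, t := t, p := p, c := c,
                 mem := mem, time := τ }) :
    Go W M Code.fillTables s Q := by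
  obtain ⟨l1, l2, l3, l4, l5, l6, l7⟩ := layout R B
  have hE := exprText_ne_nil R.rules
  simp only [Code.fillTables, run_rules, val_rules, cost_rules, ok_rules, St.set, St.get, St.tick,
    true_and, hL]
  repeat refine And.intro (by omega) ?_
  refine go_tableEdges B σ.vertices (k := 0) (by omega) (by simp) hn ?_ ?_ ?_ ?_ ?_ ?_
    fun q mem₁ τ k1 k2 k3 => ?_
  · have := h.edges
    push_cast at this
    exact this
  iterate 5 dsimp only [List.drop]; omega
  dsimp only [List.drop] at k1 k2 k3 ⊢
  rw [hN] at k1 k2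
  simp only [Nat.cast_zero, add_zero] at k1
  refine ⟨by omega, ?_⟩
  refine go_countPieces g.semi σ.vertices (k := 0) (by omega) (by simp) hn (fun v => ?_)
    (fun w => ?_) ?_ ?_ ?_ ?_ ?_ fun y mem₂ τ₂ k4 k5 k6 => ?_
  · dsimp only
    have := v.isLt
    rw [k1 _ (by omega), hPA]
    exact_mod_cast h.piece v
  · dsimp only
    rw [k1 _ (by omega), h0 _ (by omega)]
    simp
  iterate 5 dsimp only; omega
  dsimp only at k4 k5 k6 ⊢
  simp only [hN, hb, Code.tab] at k4 k5 ⊢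
  set N := (inputLen R B : ℤ) with hNdef
  set mem₃ := upd (upd mem₂ (7 * N + 1) σ.start) (4 * N) (7 * N + 1) with hmem₃
  have f0 : ∀ a, a ≠ 7 * N + 1 → a ≠ 4 * N → mem₃ a = mem₂ a := fun a ha ha' => by
    rw [hmem₃, upd_of_ne ha', upd_of_ne ha]
  have f1 : mem₃ (7 * N + 1) = σ.start := by rw [hmem₃, upd_of_ne (by omega), upd_self]
  have f2 : mem₃ (4 * N) = 7 * N + 1 := by rw [hmem₃, upd_self]
  clear_value mem₃
  have f3 : ∀ a, a < N → mem₃ a = s.mem a := fun a ha => by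
    rw [f0 a (by omega) (by omega), k4 a (by omega), k1 a (by omega)]
  repeat refine And.intro (by omega) ?_
  refine go_parse (n := 0) _ R.rules le_rfl ?_ ?_ ?_ ?_ ?_ ?_ ?_ ?_ hA
    fun t p c mem₄ τ₄ k7 k8 => ?_
  · dsimp only; omega
  · exact h.rules.congr fun a ha ha' => f3 a (by omega)
  · dsimp only; omega
  · exact hi
  iterate 4 dsimp only; omega
  dsimp only at k7 k8 ⊢
  -- Parsing writes to tables 1 to 4 only, and in table 4 only behind entry 0, which belongs to the
  -- rules index 0.
  have hf : ∀ a, a < 7 * N + 2 → a < N ∨ 4 * N + (exprText R.rules).length < a ∨ a = 4 * N →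
      mem₄ a = mem₃ a := fun a ha ha' => k7.frame a ha (by rw [InTables]; push_cast; omega)
  refine St.transfer (fun τ' hτ' => hQ (σ.start + (exprText R.rules).length) σ.vertices y
    (s.i + R.rules.count) t p c mem₄ τ' ⟨fun a ha => ?_, k7.laid, k7.jump,
    fun v => ?_, fun w => ?_, ?_, ?_, ?_⟩ hτ') ?_ (by simp only [hb, hN, hL, hNdef])
  · rw [hf a (by omega) (.inl ha), f3 a ha]
  · have hv := v.isLt
    obtain ⟨g1, g2, g3⟩ := k2 v (by omega)
    have e : mem₄ (5 * N + (v : ℕ)) = mem₁ (5 * N + (v : ℕ)) := by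
      rw [hf _ (by omega) (by omega), f0 _ (by omega) (by omega), k4 _ (by omega)]
    rw [e]
    refine ⟨by omega, by omega, g3.congr fun a ha ha' => ?_⟩
    rw [hf a (by omega) (by omega), f3 a (by omega), k1 a (by omega)]
  · have hw := w.isLt
    rw [hf _ (by omega) (by omega), f0 _ (by omega) (by omega), k5]
  · rw [hf _ (by omega) (by omega), f0 _ (by omega) (by omega), k4 _ (by omega), k1 _ (by omega),
      h0 _ (by omega)]
  · rw [hf _ (by omega) (by omega), f1]
  · rw [hf _ (by omega) (by omega), f2]
  · dsimp only; omega

end RBG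

-- From the filled tables to the search

namespace RBG

variable {σ : Sig} {R : GenRules σ} {B : Inst σ} {g : GameState σ}

/-- The places of the data, after the tables have been filled. -/
def image (R : GenRules σ) (B : Inst σ) (mem : ℤ → ℤ) : Image where
  N := inputLen R B
  L := R.length
  PA := pieces R B
  VA := (pieces R B + σ.vertices : ℕ)
  BD := bounds R B
  base := mem

/-- The whole expression of the rules. -/
def GenRules.scope (R : GenRules σ) : Scope σ := ⟨R.rules, 0, σ.start⟩

theorem GenRules.scope_end (R : GenRules σ) : R.scope.addr + R.scope.len = R.length := by
  have := R.length_eq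
  simp only [GenRules.scope, Scope.len]
  omega

theorem Filled.image_ok {mem mem' : ℤ → ℤ} (h : Loaded R B g mem)
    (h' : Filled R B g (inputLen R B) mem mem') : (image R B mem').Ok B := by
  obtain ⟨l1, l2, l3, l4, l5, l6, l7⟩ := layout R B
  refine ⟨?_, ?_, ?_, ?_, ?_, h'.edges, fun v => ?_, h'.zero⟩
  iterate 5 dsimp only [image]; omega
  have := v.isLt
  dsimp only [image]
  rw [h'.frame _ (by omega)]
  exact_mod_cast h.bound v

theorem Filled.held {mem mem' : ℤ → ℤ} (h : Loaded R B g mem)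
    (h' : Filled R B g (inputLen R B) mem mem') : (image R B mem').Held mem' g.semi := by
  obtain ⟨l1, l2, l3, l4, l5, l6, l7⟩ := layout R B
  refine ⟨fun v => ?_, fun v => ?_, fun w => ?_, fun _ _ _ _ => rfl⟩
  · have := v.isLt
    dsimp only [image]
    rw [h'.frame _ (by omega)]
    exact_mod_cast h.piece v
  · have := v.isLt
    dsimp only [image]
    rw [h'.frame _ (by omega)]
    exact_mod_cast h.value v
  · exact h'.count w

theorem Filled.scope_ok {W : ℤ} {mem mem' : ℤ → ℤ} (h : Loaded R B g mem)
    (h' : Filled R B g (inputLen R B) mem mem') (ht : ∀ a, |mem a| + 32 ≤ W)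
    (hm : 2 * (exprMagnitude B R.rules : ℤ) + 32 ≤ W)
    (hb : ∀ v, exprMagnitude B R.rules + (B.bound v : ℤ) + 32 ≤ W) :
    R.scope.Ok (image R B mem') B W := by
  obtain ⟨l1, l2, l3, l4, l5, l6, l7⟩ := layout R B
  refine ⟨?_, (R.scope_end).le, ?_, h'.laid, ⟨true, R.wf⟩, hm, hb, fun a _ ha => ?_⟩
  · dsimp only [GenRules.scope]; omega
  · exact h.rules.congr fun a _ ha => h'.frame a (by omega)
  · dsimp only [image] at ha ⊢
    rw [h'.frame a (by omega)]
    exact ht a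

/-- A positive rules index finds its continuation cell in table 4, the index 0 the cell with the
address of the rules. If nothing follows, the cell contains 0. -/
theorem Filled.target {W : ℤ} {mem mem' : ℤ → ℤ} (h' : Filled R B g (inputLen R B) mem mem')
    (hX : R.scope.Ok (image R B mem') B W) {k : Stack σ} {c : ℤ}
    (hk : After (inputLen R B) R.rules σ.start g.index k c) :
    mem' (4 * inputLen R B + g.index) = c ∧ 0 ≤ c ∧ c ≤ 7 * inputLen R B + 1 ∧
      ∀ s' : St, s'.p = mem' c → s'.s = (g.semi.pos : ℕ) →
        Target R.scope (inputLen R B) g.semi (k, g.semi) s' := by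
  obtain ⟨l1, l2, l3, l4, l5, l6, l7⟩ := layout R B
  rcases hk with ⟨h0, rfl, rfl⟩ | ⟨z, a, hz, he, rfl, rfl⟩
  · refine ⟨by rw [h0, Nat.cast_zero, add_zero, h'.start], by omega, by omega, fun s' hp hs => ?_⟩
    exact .inr ⟨_, g.semi.pos, NodeAt.root .., rfl, hp.trans h'.root, hs⟩
  · have h4 := NodeAt.cell_range hz
    rw [Regex.hat, nlen_number] at h4
    have h7 : (exprText R.rules).length = exprLen R.rules := rfl
    refine ⟨h'.jump _ z _ hz he, by omega, by omega, fun s' hp hs => ?_⟩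
    rcases NodeAt.next hz with ⟨h8, h9⟩ | ⟨z', h8, h9, h10⟩
    · exact .inl ⟨h8, by rw [hp, h9, h'.zero]⟩
    · exact .inr ⟨z', g.semi.pos, h8, by rw [h9]; rfl,
        hp.trans (h10 _ fun y hy => NodeAt.ok hy hX.laid), hs⟩

theorem After.index_le {N : ℤ} {E : Regex (Action σ)} {p c : ℤ} {r : ℕ} {k : Stack σ}
    (h : After N E p r k c) : r ≤ (exprText E).length := by
  rcases h with ⟨rfl, _⟩ | ⟨z, a, hz, he, _⟩
  · omega
  · have := hz.index_range he
    have := E.count_le_length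
    omega

/-- The main search is an instance of `visitSpec` with an empty table, no recorded modifiers, and
`K` and `j` both equal to `k`. The game state is reachable, so straightness provides the budget. -/
theorem go_search {W M : ℤ} {s : St} {mem : ℤ → ℤ} {k d : ℕ} (h : Loaded R B g mem)
    (h' : Filled R B g (inputLen R B) mem s.mem) (hL : s.L = R.length) (hn : s.n = σ.vertices)
    (hPA : s.PA = pieces R B) (hVA : s.VA = (pieces R B + σ.vertices : ℕ))
    (hBD : s.BD = bounds R B) (hN : s.N = inputLen R B) (hsp : s.sp = 7 * (inputLen R B : ℤ) + 2)
    (hmv : s.mv = 0) (hfound : s.found = 0) (hg : Reachable R B g) (hk : IsStraight R B k)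
    (hd : exprDepth R.rules ≤ d) (ht : ∀ a, |mem a| + 32 ≤ W)
    (hm : 2 * (exprMagnitude B R.rules : ℤ) + 32 ≤ W)
    (hb : ∀ v, exprMagnitude B R.rules + (B.bound v : ℤ) + 32 ≤ W)
    (hM : 7 * (inputLen R B : ℤ) + 11 * (R.length * σ.vertices) +
      k * (11 * (R.length * σ.vertices) + 20) + 4 * R.length + 60 ≤ M) (hW : M + 32 ≤ W) :
    Go W M Code.search s fun s' => ∃ ms : List (Move σ), ms.Nodup ∧
      (∀ m, m ∈ ms ↔ LegalMove R B g m) ∧ s'.out = s.out ++ movesText ms ∧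
      s'.time ≤ s.time + 20 * (R.length * σ.vertices) + 300 +
        allowance (R.length * B.length) B.length k k d * (R.length * B.length) := by
  obtain ⟨l1, l2, l3, l4, l5, l6, l7⟩ := layout R B
  have hI := h'.image_ok h
  have hH := h'.held h
  have hX := h'.scope_ok h ht hm hb
  obtain ⟨κ, c, a1, a2, a3⟩ := hg.after (N := inputLen R B) (p := σ.start) hk
  obtain ⟨b1, b2, b3, b4⟩ := h'.target hX a1
  have b5 := a1.index_le
  have hp0 : 0 ≤ (R.length : ℤ) * σ.vertices := by positivity
  have hk0 : 0 ≤ (k : ℤ) * (11 * (R.length * σ.vertices) + 20) := by positivity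
  have e1 : s.mem (pieces R B - 3) = g.index := by rw [h'.frame _ (by omega), h.index]
  have e2 : s.mem (pieces R B - 1) = (g.semi.pos : ℕ) := by rw [h'.frame _ (by omega), h.pos]
  simp only [Code.search, run_rules, val_rules, cost_rules, ok_rules, St.set, St.get, St.tick,
    true_and, Code.tab, hL, hn, hPA, hN, hsp, e1, e2, b1]
  repeat refine And.intro (by omega) ?_
  refine go_clear (by dsimp only; omega) (by dsimp only; omega) (by dsimp only; omega)
    (by dsimp only; omega) fun τ hτ => ?_
  dsimp only at hτ ⊢
  set mem₁ := cleared s.mem (7 * (inputLen R B : ℤ) + 2)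
    (7 * (inputLen R B : ℤ) + 2 + R.length * σ.vertices) with hmem₁
  have f1 : ∀ a, a < 7 * (inputLen R B : ℤ) + 2 → mem₁ a = s.mem a := fun a ha => by
    rw [hmem₁, cleared, if_neg (by omega)]
  have f2 : ∀ a, 7 * (inputLen R B : ℤ) + 2 ≤ a →
      a < 7 * (inputLen R B : ℤ) + 2 + R.length * σ.vertices → mem₁ a = 0 := fun a ha ha' => by
    rw [hmem₁, cleared, if_pos ⟨ha, ha'⟩]
  clear_value mem₁
  have hB := B.length_eq
  have hsize := B.size_eq
  have hQ : (image R B s.mem).L * B.size ≤ (R.length * B.length : ℕ) := by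
    dsimp only [image]
    exact_mod_cast Nat.mul_le_mul_left _ (by omega)
  have hQ1 : 1 ≤ R.length * B.length := Nat.mul_pos (by omega) (by omega)
  have hlen : R.scope.len ≤ R.length := by
    have := R.scope_end
    have := hX.addr_pos
    omega
  have hlen' : R.scope.len * σ.vertices ≤ (R.length : ℤ) * σ.vertices :=
    mul_le_mul_of_nonneg_right hlen (by omega)
  refine Run.mono (visitSpec (K := k) hI hQ hQ1 (by omega : B.size ≤ B.length) (by omega) d k R.scope hX hd
    (R.scope.len * σ.vertices) g.semi ∅ [] M _ (κ, g.semi) ?_ a3 a2 (b4 _ ?_ rfl) ?_ ?_ hW ?_) ?_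
  · refine ⟨rfl, rfl, rfl, rfl, hVA, hBD, hH.congr hI fun a _ ha => f1 a ha, fun z v hz => ?_, by simp,
      hmv, le_rfl, le_rfl, .inl hfound⟩
    have := hX.cells (Scope.cells_of_node (vb := 7 * (inputLen R B : ℤ) + 2) hz v)
    dsimp only [image] at this ⊢
    simp only [Finset.notMem_empty, if_false]
    exact f2 _ this.1 this.2
  · rfl
  · simp
  · dsimp only [image]
    simp only [Finset.card_empty, List.length_nil]
    push_cast
    omega
  · simp
  rintro s' ⟨V', ms, h1, h2, h3, h4⟩
  refine ⟨ms, h1.nodup, fun m => ?_, ?_, ?_⟩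
  · rw [a1.legalMove_iff]
    exact h1.moves_iff h2 m
  · rw [h3.out]
    simp
  · have h5 := Scope.total_le (X := R.scope) (B := B) (V := V')
      (allowance (R.length * B.length) B.length k k d)
    have h6 : R.scope.len.toNat * B.size ≤ R.length * B.length :=
      Nat.mul_le_mul (by omega) (by omega)
    have h7 := Nat.mul_le_mul_left (allowance (R.length * B.length) B.length k k d) h6
    dsimp only at h4
    zify at *
    omega

end RBG

-- The whole program

namespace RBG

variable {σ : Sig} {R : GenRules σ} {B : Inst σ} {g : GameState σ}

/-- The initial state. -/
def St.initial (l : List ℤ) : St :=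
  { q := 0, c := 0, i := 0, p := 0, s := 0, found := 0, vb := 0, mv := 0, sp := 0, t := 0, a := 0,
    b := 0, x := 0, y := 0, e := 0, er := 0, v := 0, n := 0, N := 0, L := 0, PA := 0, VA := 0,
    BD := 0, mem := inputMem l, out := [], time := 0 }

theorem represents_initial (l : List ℤ) {W : ℤ} (h : (maxAbs l : ℤ) ≤ W) :
    Represents W (St.initial l) (initStore l) where
  reg r := by cases r <;> rfl
  zero := rfl
  mem a := by simp [initStore, St.initial, inputMem]
  out := rfl
  reg_le r := by cases r <;> simp only [St.get, St.initial, abs_zero] <;> omega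
  mem_le a := (abs_inputMem_le l a).trans h

theorem mem_inputText_bound (R : GenRules σ) (B : Inst σ) (g : GameState σ) (v : σ.Var) :
    (B.bound v : ℤ) ∈ inputText R B g := by
  have h : (B.bound v : ℤ) ∈ tableText B.bound := by
    rw [tableText_eq]
    exact List.mem_ofFn.2 ⟨v, rfl⟩
  simp only [inputText, Inst.text, List.mem_append]
  exact .inl (.inr (.inl (.inr h)))

theorem mem_inputText_rules (R : GenRules σ) (B : Inst σ) (g : GameState σ) {x : ℤ}
    (hx : x ∈ exprText R.rules) : x ∈ inputText R B g := by
  simp only [inputText, GenRules.text, List.mem_append]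
  exact .inl (.inl (.inr hx))

theorem go_main {W M : ℤ} {k d : ℕ} (hg : Reachable R B g) (hk : IsStraight R B k)
    (hd : exprDepth R.rules ≤ d) (ht : (maxAbs (inputText R B g) : ℤ) + 32 ≤ W)
    (hm : 2 * (exprMagnitude B R.rules : ℤ) + 32 ≤ W)
    (hb : exprMagnitude B R.rules + (maxAbs (inputText R B g) : ℤ) + 32 ≤ W)
    (hM : 7 * (inputLen R B : ℤ) + 11 * (R.length * σ.vertices) +
      k * (11 * (R.length * σ.vertices) + 20) + 4 * R.length + 61 ≤ M)
    (hM' : 11 * (inputLen R B : ℤ) + 21 ≤ M) (hW : M + 32 ≤ W) :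
    Go W M (.call 0) (St.initial (inputText R B g)) fun s' => ∃ ms : List (Move σ), ms.Nodup ∧
      (∀ m, m ∈ ms ↔ LegalMove R B g m) ∧ s'.out = movesText ms ∧
      s'.time ≤ 400 * inputLen R B + 20 * (R.length * σ.vertices) + 601 +
        allowance (R.length * B.length) B.length k k d * (R.length * B.length) := by
  have hl : Loaded R B g (inputMem (inputText R B g)) := (hasText_inputMem _).loaded
  have hA : ∀ x ∈ exprText R.rules, x + 16 ≤ W := fun x hx => by
    have := (abs_le.1 (le_maxAbs (mem_inputText_rules R B g hx))).2
    omega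
  refine Run.call rfl (by omega) ?_
  simp only [Code.main, run_rules]
  refine go_readHeader hl (by omega) (by omega) hA fun t τ hτ => ?_
  refine go_fillTables hl ?_ rfl rfl rfl rfl rfl rfl (by omega) (by omega) hA
    fun q x y i t p c mem τ' hf hτ' => ?_
  · exact fun a ha => inputMem_of_le (by rw [inputLen_eq]; exact ha)
  refine Run.mono (go_search hl hf rfl rfl rfl rfl rfl rfl rfl rfl rfl hg hk hd
    (fun a => ?_) hm (fun v => ?_) (by omega) (by omega)) ?_
  · have := abs_inputMem_le (inputText R B g) a
    omega
  · have := (abs_le.1 (le_maxAbs (mem_inputText_bound R B g v))).2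
    omega
  · rintro s' ⟨ms, h1, h2, h3, h4⟩
    refine ⟨ms, h1, h2, h3, ?_⟩
    dsimp only [St.initial, St.tick] at h4 hτ' hτ
    omega

end RBG

theorem mainTheorem6 :
    ∃ (P : RBG.Program) (C : ℕ),
      ∀ (σ : RBG.Sig) (R : RBG.GenRules σ) (S : RBG.Inst σ) (k d : ℕ), 1 ≤ k →
        RBG.IsStraight R S k → RBG.exprDepth R.rules ≤ d →
        ∀ g : RBG.GameState σ, RBG.Reachable R S g →
          ∃ (moves : List (RBG.Move σ)) (time space : ℕ),
            moves.Nodup ∧ (∀ m, m ∈ moves ↔ RBG.LegalMove R S g m) ∧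
            RBG.Computes P
              (C * (k * (R.length * S.length) + RBG.maxAbs (RBG.inputText R S g) +
                RBG.exprMagnitude S R.rules))
              (RBG.inputText R S g) (RBG.movesText moves) time space ∧
            time ≤ C * ((R.length * S.length) ^ (k + 1) * S.length ^ d) ∧
            space ≤ C * (k * (R.length * S.length)) := by
  refine ⟨RBG.Code.procedures.map RBG.HCmd.compile, 4000, fun σ R S k d hk hs hd g hg => ?_⟩
  set A := RBG.maxAbs (RBG.inputText R S g)
  set q := R.length * S.length with hq
  have hR := R.length_eq
  have hS := S.length_eq
  obtain ⟨l1, l2, l3, l4, l5, l6, l7⟩ := RBG.layout R S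
  have hRq : R.length ≤ q := Nat.le_mul_of_pos_right _ (by omega)
  have hSq : S.length ≤ q := Nat.le_mul_of_pos_left _ (by omega)
  have hn : R.length * σ.vertices ≤ q := Nat.mul_le_mul_left _ (by omega)
  have hkq : q ≤ k * q := Nat.le_mul_of_pos_left _ hk
  have hkn : k * (11 * (R.length * σ.vertices) + 20) ≤ k * (31 * q) :=
    Nat.mul_le_mul_left _ (by omega)
  have hkn' : k * (31 * q) = 31 * (k * q) := by ring
  -- The input has at most `3 * q` tokens, so the required number of cells is at most `128 * (k *
  -- q)`; 200 is a generous choice.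
  have hM : 7 * (RBG.inputLen R S : ℤ) + 11 * (R.length * σ.vertices) +
      k * (11 * (R.length * σ.vertices) + 20) + 4 * R.length + 61 ≤ ((200 * (k * q) : ℕ) : ℤ) := by
    norm_cast
    omega
  obtain ⟨s', h1, ms, h2, h3, h4, h5⟩ := RBG.go_main
    (W := ((4000 * (k * q + A + RBG.exprMagnitude S R.rules) : ℕ) : ℤ)) hg hs hd (by omega)
    (by omega) (by omega) hM (by omega) (by omega)
  obtain ⟨t, m, st, e1, e2, e3, e4⟩ := h1.exec (by omega) _
    (RBG.represents_initial (RBG.inputText R S g) (by omega)) (by omega)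
  refine ⟨ms, t, m, h2, h3, ⟨st, e1, e2.out.trans h4⟩, ?_, by omega⟩
  have e5 : s'.time = t := by rw [e4]; simp [RBG.St.initial]
  have h6 : 1 ≤ q ^ k * S.length ^ d := Nat.mul_pos (Nat.pow_pos (by omega)) (Nat.pow_pos (by omega))
  -- At the top no modifier has been recorded, so the power of two is 1. Preprocessing and clearing
  -- the first table add at most `1821 * q` steps, whence the constant 4000.
  have h7 : RBG.allowance q S.length k k d * q = 2000 * (q ^ (k + 1) * S.length ^ d) := by
    simp only [RBG.allowance, Nat.sub_self]
    ring
  have h8 : q ≤ q ^ (k + 1) * S.length ^ d := by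
    calc q = 1 * q := (one_mul q).symm
      _ ≤ q ^ k * S.length ^ d * q := Nat.mul_le_mul_right _ h6
      _ = q ^ (k + 1) * S.length ^ d := by ring
  rw [← hq, h7] at h5
  omega
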